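/- **Setting.** Fix real $x,t$. For $\mu>0$ let $T=T(\mu)=\sqrt{\mu^2/4-1}$ ($T\ge 0$ if $\mu\ge 2$, $T\in i(0,\infty)$ if $0<\mu<2$), and for $\Im z\ge 0$ let $$f(z,\mu)=\Big(\tfrac{\mu}{2}-z\Big)\Big[\tfrac{\pi i}{2}+\ln\Big(\tfrac{\mu}{2}-z\Big)\Big]+\tfrac{z+T}{2}\ln(z+T)+\tfrac{z-T}{2}\ln(z-T)-T\tanh^{-1}\tfrac{T}{\mu/2}-xz-2tz^2+\tfrac{\mu}{2}\ln 2 ,$$ where in the closed upper half plane $\ln(\frac\mu2-z)$ has imaginary part in $[-\pi,0]$, $\ln(z+T)$ has imaginary part in $[0,\pi]$, and $\ln(z-T)$ has a branch cut from $T$ to $0$ if $0<\mu<2$ and has imaginary part in $[0,\pi]$ for $\Im z\ge\Im T$; for $\Im z<0$ put $f(z,\mu)=\overline{f(\overline z,\mu)}$. Then $f(\cdot,\mu)$ is analytic in $\mathcal D_\mu=\{z:\Im z\ne 0,\ z\notin[-T,T]\}$. Write $f'=\partial f/\partial z$ and $f_\mu=\partial f/\partial\mu$. For $\Im\alpha>0$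 let $\Gamma(\alpha,\mu)$ be the set of non-selfintersecting arcs $\gamma$ of finite length from $\overline\alpha$ to $\alpha$ that are symmetric in the real axis, pass through $\mu/2$, and satisfy $\gamma\setminus\{\mu/2\}\subset\mathcal D_\mu$. Given $\gamma$, let $R(z,\alpha)=\sqrt{(z-\alpha)(z-\overline\alpha)}$ be the branch with branch cut $\gamma$ and $R(z,\alpha)/z\to-1$ as $z\to\infty$. Let $\hat\Gamma(\gamma,\mu)$ be the set of symmetric, clockwise, piecewise regular $C^1$ loops $\hat\gamma$ around $\gamma$ in $\mathcal D_\mu\cup\{\mu/2\}$, consisting of a loop from $\mu/2$ to $\mu/2$ in the upper half plane, simple and disjoint from $\gamma$ except at $\mu/2$, with winding number $-1$ about the points of $\gamma$ in the upper half plane, and of its mirror image in the real axis. Put $$K(\alpha,\mu)=\frac1{2\pi i}\oint_{\hat\gamma}\frac{f(\zeta,\mu)\,d\zeta}{(\zeta-\alpha)R(\zeta,\alpha)} .$$ A function $h$ on $\mathcal D_\mu\setminus\gamma$ solves $RHP(\gamma,\alpha,\mu)$ if it has boundary values $h_\pm$ on the two sides of $\gamma\setminus\{\alpha,\overline\alpha\}$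 with $h_++h_-=0$, is bounded near $\alpha$ and $\overline\alpha$, and $h+f$ extends analytically to $(\mathbb C\cup\{\infty\})\setminus\gamma$. **Theorem ($\mu$-perturbation in genus $0$).** Let $\mu_0>0$, $\Im\alpha_0^{(0)}>0$, $\gamma_0\in\Gamma(\alpha_0^{(0)},\mu_0)$ and $\hat\gamma_0\in\hat\Gamma(\gamma_0,\mu_0)$, and suppose that $K(\alpha_0^{(0)},\mu_0)=0$. Let $h$ solve $RHP(\gamma_0,\alpha_0^{(0)},\mu_0)$ and suppose that $h'/R\neq0$ on $\gamma_0$, i.e. $h'(z)/R(z,\alpha_0^{(0)})$ does not tend to $0$ as $z\to w$, $z\in\mathcal D_{\mu_0}\setminus\gamma_0$, for any $w\in\gamma_0$. Then there are open neighbourhoods $I\subset(0,\infty)$ of $\mu_0$ and $U$ of $\alpha_0^{(0)}$ and contours $\gamma(\alpha,\mu)\in\Gamma(\alpha,\mu)$ for $\alpha\in U$, $\mu\in I$, with $\gamma(\alpha_0^{(0)},\mu_0)=\gamma_0$ and $\hat\Gamma(\gamma(\alpha,\mu),\mu)\neq\emptyset$, such that: 1. $K(\alpha,\mu)$, computed with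 $\gamma(\alpha,\mu)$, does not depend on the choice of $\hat\gamma\in\hat\Gamma(\gamma(\alpha,\mu),\mu)$; for each $\mu\in I$ the equation $K(\alpha,\mu)=0$ has exactly one solution $\alpha=\alpha_0(\mu)$ in $U$; $\alpha_0(\mu_0)=\alpha_0^{(0)}$; and $\alpha_0(\mu)$ is $C^1$ on $I$. 2. Write $\gamma(\mu)=\gamma(\alpha_0(\mu),\mu)$. For each $\mu\in I$ the problem $RHP(\gamma(\mu),\alpha_0(\mu),\mu)$ has exactly one solution $h(\cdot,\mu)$ on $\mathcal D_\mu\setminus\gamma(\mu)$; the set of all $(z,\mu)$ with $\mu\in I$, $z\in\mathcal D_\mu\setminus\gamma(\mu)$ is open, and for fixed $z$ the function $h(z,\mu)$ is $C^1$ in $\mu$ there. 3. For all $\mu\in I$ and $\hat\gamma(\mu)\in\hat\Gamma(\gamma(\mu),\mu)$, with absolutely convergent integrals and nonzero denominator, $$\frac{\partial\alpha_0}{\partial\mu}(\mu)=-\frac{2\pi i\,\frac{\partial K}{\partial\mu}(\alpha_0(\mu),\mu)}{\oint_{\hat\gamma(\mu)}\frac{f'(\zeta,\mu)}{(\zeta-\alpha_0(\mu))R(\zeta,\alpha_0(\mu))}d\zeta},\qquad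 \frac{\partial K}{\partial\mu}(\alpha_0(\mu),\mu)=\frac1{2\pi i}\oint_{\hat\gamma(\mu)}\frac{f_\mu(\zeta,\mu)\,d\zeta}{(\zeta-\alpha_0(\mu))R(\zeta,\alpha_0(\mu))},$$ and for all $z$ inside $\hat\gamma(\mu)$ (winding number $-1$), $z\notin\gamma(\mu)$, $$\frac{\partial h}{\partial\mu}(z,\mu)=\frac{R(z,\alpha_0(\mu))}{2\pi i}\oint_{\hat\gamma(\mu)}\frac{f_\mu(\zeta,\mu)}{(\zeta-z)R(\zeta,\alpha_0(\mu))}d\zeta .$$ -/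

import Mathlib

open Set Filter Topology

noncomputable section

namespace GenusZero

/-! ### The function `f` -/

/-- `T(μ) = √(μ²/4 - 1)`, with `T ≥ 0` for `μ ≥ 2` and `T ∈ i(0, ∞)` for `0 < μ < 2`
(principal square root). -/
def branchT (μ : ℝ) : ℂ := ((μ ^ 2 / 4 - 1 : ℝ) : ℂ) ^ (1 / 2 : ℂ)

/-- The logarithm with branch cut along the negative imaginary axis,
`-π/2 < arg w ≤ 3π/2`. -/
def logDown (w : ℂ) : ℂ := Complex.log (-Complex.I * w) + Real.pi * Complex.I / 2

/-- The logarithm with branch cut along the positive imaginary axis,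
`-3π/2 < arg w ≤ π/2`. -/
def logUp (w : ℂ) : ℂ := Complex.log (Complex.I * w) - Real.pi * Complex.I / 2

/-- The principal inverse hyperbolic tangent. -/
def artanhC (w : ℂ) : ℂ := (Complex.log (1 + w) - Complex.log (1 - w)) / 2

/-- The formula for `f(z, μ, x, t)` in the closed upper half plane.  There
`ln (μ/2 - z)` has argument in `[-π, 0]` (cut from `μ/2` to `+∞`), `ln (z - T)` has its cut from
`T` down to `0` (when `0 < μ < 2`) and then along the real axis, with argument in `[0, π]` when
`Im z ≥ Im T`, and `ln (z + T)` has argument in `[0, π]`. -/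
def fUpper (x t μ : ℝ) (z : ℂ) : ℂ :=
  ((μ : ℂ) / 2 - z) * (Real.pi * Complex.I / 2 + logUp ((μ : ℂ) / 2 - z))
    + (z + branchT μ) / 2 * logDown (z + branchT μ)
    + (z - branchT μ) / 2 * logDown (z - branchT μ)
    - branchT μ * artanhC (branchT μ / ((μ : ℂ) / 2))
    - x * z - 2 * t * z ^ 2 + (μ : ℂ) / 2 * Real.log 2

/-- The function `f(z, μ, x, t)`: `fUpper` for `Im z ≥ 0`, extended by Schwarz reflection. -/
def f (x t μ : ℝ) (z : ℂ) : ℂ :=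
  if 0 ≤ z.im then fUpper x t μ z else starRingEnd ℂ (fUpper x t μ (starRingEnd ℂ z))

/-- `f'`, the derivative of `f` with respect to `z`. -/
def fPrime (x t μ : ℝ) (z : ℂ) : ℂ := deriv (fun w : ℂ => f x t μ w) z

/-- `∂f/∂μ`. -/
def fMu (x t μ : ℝ) (z : ℂ) : ℂ := deriv (fun m : ℝ => f x t m z) μ

/-- The domain of analyticity of `f(·, μ)`: the nonreal numbers off the segment `[-T, T]`. -/
def Dom (μ : ℝ) : Set ℂ := {z : ℂ | z.im ≠ 0 ∧ z ∉ segment ℝ (-branchT μ) (branchT μ)}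

/-! ### The arc `γ` and the radical -/

/-- `γ ∈ Γ(α, μ)` in genus zero: `γ` is a non-selfintersecting arc of finite length (that is, the
image of `[0, 1]` under an injective Lipschitz map) from `ᾱ` in the lower to `α` in the upper half
plane, symmetric with respect to the real axis, passing through `μ/2`, and contained, except for
the point `μ/2`, in the domain of analyticity of `f(·, μ)`. -/
def IsContour (α : ℂ) (μ : ℝ) (γ : Set ℂ) : Prop :=
  0 < α.im ∧
  (∃ c : ℝ → ℂ, (∃ L : NNReal, LipschitzOnWith L c (Icc 0 1)) ∧ InjOn c (Icc 0 1) ∧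
    c 0 = starRingEnd ℂ α ∧ c 1 = α ∧ c '' Icc 0 1 = γ) ∧
  (∀ z ∈ γ, starRingEnd ℂ z ∈ γ) ∧
  ((μ : ℂ) / 2) ∈ γ ∧
  (∀ z ∈ γ, z ≠ (μ : ℂ) / 2 → z ∈ Dom μ)

/-- `R` is the branch of `√((z - α)(z - ᾱ))` with branch cut `γ` and `R(z) ~ -z` at infinity. -/
def IsRadical (γ : Set ℂ) (α : ℂ) (R : ℂ → ℂ) : Prop :=
  DifferentiableOn ℂ R γᶜ ∧
  (∀ z ∈ γᶜ, R z ^ 2 = (z - α) * (z - starRingEnd ℂ α)) ∧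
  Tendsto (fun z => R z / z) (cocompact ℂ) (𝓝 (-1))

/-- The radical `R(z, α)` with branch cut `γ`; the conditions in `IsRadical` determine it off
`γ`, and its values on `γ` are irrelevant. -/
def radical (γ : Set ℂ) (α : ℂ) : ℂ → ℂ := Classical.epsilon (IsRadical γ α)

/-! ### The loop `γ̂` -/

/-- `σ` restricted to `[0, 1]` is a piecewise regular `C¹` curve. -/
def IsPiecewiseRegular (σ : ℝ → ℂ) : Prop :=
  ∃ (n : ℕ) (p : ℕ → ℝ), p 0 = 0 ∧ p n = 1 ∧ ∀ i < n, p i < p (i + 1) ∧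
    ContDiffOn ℝ 1 σ (Icc (p i) (p (i + 1))) ∧
    ∀ s ∈ Icc (p i) (p (i + 1)), derivWithin σ (Icc (p i) (p (i + 1))) s ≠ 0

/-- The contour integral `∫_σ g(ζ) dζ` over `σ : [0, 1] → ℂ`. -/
def curveInt (σ : ℝ → ℂ) (g : ℂ → ℂ) : ℂ := ∫ s in (0 : ℝ)..1, g (σ s) * deriv σ s

/-- The integral over `σ` converges absolutely. -/
def CurveIntegrable (σ : ℝ → ℂ) (g : ℂ → ℂ) : Prop :=
  IntervalIntegrable (fun s => g (σ s) * deriv σ s) MeasureTheory.volume 0 1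

/-- The mirror image of `σ` in the real axis, traversed backwards (so that the mirror image of a
clockwise loop is again a clockwise loop). -/
def mirror (σ : ℝ → ℂ) : ℝ → ℂ := fun s => starRingEnd ℂ (σ (1 - s))

/-- `γ̂ ∈ Γ̂(γ, α, μ)`.  A closed curve around `γ` which meets the real axis only at `μ/2` (the
only point of the real axis that it may contain, `f` being nonanalytic at the others) consists of a
closed curve `σ` from `μ/2` through the upper half plane back to `μ/2` and one in the lower half
plane; by the symmetry the latter is `mirror σ`.  So `γ̂` is represented by its upper half `σ`,
which is a non-selfintersecting loop in the domain of analyticity of `f` (except for `μ/2`),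
disjoint from `γ` (except for `μ/2`), and surrounds the part of `γ` in the upper half plane once,
in the clockwise direction. -/
def IsLoop (γ : Set ℂ) (μ : ℝ) (σ : ℝ → ℂ) : Prop :=
  IsPiecewiseRegular σ ∧ σ 0 = (μ : ℂ) / 2 ∧ σ 1 = (μ : ℂ) / 2 ∧
  InjOn σ (Ioo 0 1) ∧
  (∀ s ∈ Ioo (0 : ℝ) 1, 0 < (σ s).im ∧ σ s ∈ Dom μ ∧ σ s ∉ γ) ∧
  (∀ z ∈ γ, 0 < z.im →
    (2 * Real.pi * Complex.I)⁻¹ * curveInt σ (fun ζ => (ζ - z)⁻¹) = -1)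

/-- The integral `∮_γ̂ g(ζ) dζ` over the whole loop `γ̂` with upper half `σ`. -/
def loopInt (σ : ℝ → ℂ) (g : ℂ → ℂ) : ℂ := curveInt σ g + curveInt (mirror σ) g

/-- The integral over `γ̂` converges absolutely. -/
def LoopIntegrable (σ : ℝ → ℂ) (g : ℂ → ℂ) : Prop :=
  CurveIntegrable σ g ∧ CurveIntegrable (mirror σ) g

/-- The inside of `γ̂`: the points off `γ̂` with winding number `-1`. -/
def inside (σ : ℝ → ℂ) : Set ℂ :=
  {z : ℂ | z ∉ σ '' Icc 0 1 ∧ z ∉ mirror σ '' Icc 0 1 ∧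
    (2 * Real.pi * Complex.I)⁻¹ * loopInt σ (fun ζ => (ζ - z)⁻¹) = -1}

/-- `K(α, μ) = (1/2πi) ∮_γ̂ f(ζ, μ) / ((ζ - α) R(ζ, α)) dζ`. -/
def modK (x t μ : ℝ) (γ : Set ℂ) (α : ℂ) (σ : ℝ → ℂ) : ℂ :=
  (2 * Real.pi * Complex.I)⁻¹ *
    loopInt σ (fun ζ => f x t μ ζ / ((ζ - α) * radical γ α ζ))

/-! ### The scalar Riemann-Hilbert problem -/

/-- `hp` and `hm` are the boundary values on the two sides of the arc `γ` (without its end points)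
of the function `h`, which is considered on `D` minus `γ`.  The two sides are the images of the two sides of the segment `[-1, 1]` under a
homeomorphism of the plane that maps `[-1, 1]` onto `γ`; by the Schoenflies theorem there is one for
every arc.  The condition `h₊ + h₋ = 0` does not depend on which side is called `+`. -/
def HasBoundaryValues (γ D : Set ℂ) (h hp hm : ℂ → ℂ) : Prop :=
  ∃ Φ : ℂ ≃ₜ ℂ, Φ '' ((fun s : ℝ => (s : ℂ)) '' Icc (-1) 1) = γ ∧
    ∀ s ∈ Ioo (-1 : ℝ) 1,
      Tendsto (fun z => h (Φ z)) (𝓝[{z : ℂ | 0 < z.im ∧ Φ z ∈ D}] (s : ℂ)) (𝓝 (hp (Φ s))) ∧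
      Tendsto (fun z => h (Φ z)) (𝓝[{z : ℂ | z.im < 0 ∧ Φ z ∈ D}] (s : ℂ)) (𝓝 (hm (Φ s)))

/-- `h` solves the scalar Riemann-Hilbert problem on `γ` with end points `ᾱ`, `α`:
`h₊ + h₋ = 0` on `γ`, `h + f` is analytic in `ℂ ∪ {∞}` minus `γ`, and `h` is bounded near the
end points of `γ`.  Here `h` is considered on the domain of analyticity of `f` minus `γ`, and
`h + f` is required to extend from there to an analytic function `G` off `γ`; analyticity at
infinity is expressed by the existence of a finite limit. -/
def SolvesRHP (x t μ : ℝ) (γ : Set ℂ) (α : ℂ) (h : ℂ → ℂ) : Prop :=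
  (∃ hp hm : ℂ → ℂ, HasBoundaryValues γ (Dom μ) h hp hm ∧
    ∀ w ∈ γ, w ≠ α → w ≠ starRingEnd ℂ α → hp w + hm w = 0) ∧
  (∃ G : ℂ → ℂ, DifferentiableOn ℂ G γᶜ ∧ (∃ l : ℂ, Tendsto G (cocompact ℂ) (𝓝 l)) ∧
    ∀ z ∈ Dom μ \ γ, G z = h z + f x t μ z) ∧
  (∃ C : ℝ, (∀ᶠ z in 𝓝[Dom μ \ γ] α, ‖h z‖ ≤ C) ∧
    ∀ᶠ z in 𝓝[Dom μ \ γ] (starRingEnd ℂ α), ‖h z‖ ≤ C)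

end GenusZero

end

/-!
The contours `γ(α, μ)` are images of `γ₀` under deformations of the plane that move the end points
and are translations near `μ/2`; they are the family `BaseContour.fam`. Loops around one of them,
moved with `μ/2`, are loops around its neighbours, so all integrals are taken in the coordinate
`z - μ/2`. There the logarithmic singularities at `μ/2` cancel in the derivatives of `f`
(`BaseContour.Adm.relE_contDiffAt`).

With the Cauchy integral `E(z) = (2πi)⁻¹ ∮ f(ζ) / ((ζ - z) R(ζ)) dζ`, the solution of the
Riemann-Hilbert problem is `R E` near the contour and `R E - f` outside the loop
(`IsLoop.solvesRHP`). The loop passes through `μ/2`, where `E` is estimated by the potential of the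
length measure (`exists_tendsto_of_le_potential`). The difference of two solutions, divided by `R`,
is continuous across the contour, which is removable by Painlevé's theorem
(`differentiableOn_of_continuousOn_off_curve`); so it is constant, namely `0`
(`SolvesRHP.unique`). Hence `h` does not depend on the loop, nor does `K = E(α)`, the limit of
`h / R` at `α` (`IsLoop.modK_eq`).

If `K = 0`, integration by parts gives `∂K/∂α = (2πi)⁻¹ ∮ f' / ((ζ - α) R) dζ` and `∂K/∂ᾱ = 0`
(`IsLoop.loopInt_fPrime`, `IsLoop.loopInt_dens_end`). This number is `3/2 E'(α)`, the limit of
`h' / R` at `α` (`BaseContour.tendsto_deriv_div_radical`), hence nonzero by hypothesis, and the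
implicit function theorem (`exists_implicit`) gives `α₀(μ)`. In `∂h/∂μ` the terms from the motion of
the end points cancel, since `E(α) = 0` (`IsLoop.loopInt_dens_off`,
`BaseContour.sol_contDiffAt`). A loop through the given point is first pushed off it
(`IsLoop.exists_not_mem_loopTrace`).
-/

noncomputable section

open Complex MeasureTheory Metric
open scoped ComplexConjugate Real

variable {α z w y b : ℂ} {γ : Set ℂ} {μ m s : ℝ} {σ c : ℝ → ℂ} {g : ℂ → ℂ}

namespace GenusZero

/-! ### Curves and integrals along them -/

/-- The regularity of a parametrized curve used for contour integration: Lipschitz on `[0, 1]` and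
differentiable off a countable set. -/
structure NiceCurve (c : ℝ → ℂ) : Prop where
  lip : ∃ L : NNReal, LipschitzOnWith L c (Icc 0 1)
  diff : ∃ S : Set ℝ, S.Countable ∧ ∀ s ∈ Ioo 0 1 \ S, DifferentiableAt ℝ c s

lemma NiceCurve.continuousOn (h : NiceCurve c) : ContinuousOn c (Icc 0 1) := by
  obtain ⟨L, hL⟩ := h.lip
  exact hL.continuousOn

lemma exists_deriv_bound (h : ∃ L : NNReal, LipschitzOnWith L c (Icc 0 1)) :
    ∃ L : ℝ, 0 ≤ L ∧ ∀ s ∈ Ioo 0 1, ‖deriv c s‖ ≤ L := by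
  obtain ⟨L, hL⟩ := h
  refine ⟨L, L.2, fun s hs => ?_⟩
  exact norm_deriv_le_of_lipschitzOn (Icc_mem_nhds hs.1 hs.2) hL

lemma lipschitzOnWith_Icc_glue {a b d : ℝ} {L M : NNReal} (h₁ : LipschitzOnWith L c (Icc a b))
    (h₂ : LipschitzOnWith M c (Icc b d)) : LipschitzOnWith (max L M) c (Icc a d) := by
  rcases le_total a b with hab | hab
  swap
  · exact (h₂.mono (Icc_subset_Icc_left hab)).weaken (le_max_right _ _)
  rcases le_total b d with hbd | hbd
  swap
  · exact (h₁.mono (Icc_subset_Icc_right hbd)).weaken (le_max_left _ _)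
  have h₁' := h₁.weaken (le_max_left L M)
  have h₂' := h₂.weaken (le_max_right L M)
  have key : ∀ x ∈ Icc a d, ∀ y ∈ Icc a d, x ≤ y →
      dist (c x) (c y) ≤ (max L M : NNReal) * dist x y := by
    intro x hx y hy hxy
    rcases le_total y b with hyb | hyb
    · exact h₁'.dist_le_mul x ⟨hx.1, hxy.trans hyb⟩ y ⟨hy.1, hyb⟩
    rcases le_total b x with hbx | hbx
    · exact h₂'.dist_le_mul x ⟨hbx, hx.2⟩ y ⟨hyb, hy.2⟩
    have e1 := h₁'.dist_le_mul x ⟨hx.1, hbx⟩ b ⟨hab, le_rfl⟩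
    have e2 := h₂'.dist_le_mul b ⟨le_rfl, hbd⟩ y ⟨hyb, hy.2⟩
    have e3 := dist_triangle (c x) (c b) (c y)
    have e4 : dist x y = dist x b + dist b y := by
      rw [Real.dist_eq, Real.dist_eq, Real.dist_eq, abs_of_nonpos (by linarith),
        abs_of_nonpos (by linarith), abs_of_nonpos (by linarith)]
      ring
    rw [e4, mul_add]
    linarith
  refine LipschitzOnWith.of_dist_le_mul fun x hx y hy => ?_
  rcases le_total x y with hxy | hxy
  · simp_all
  · rw [dist_comm (c x), dist_comm x]
    exact key y hy x hx hxy

lemma ContDiffOn.exists_lipschitzOnWith_Icc {a b : ℝ} (hab : a < b)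
    (h : ContDiffOn ℝ 1 c (Icc a b)) : ∃ L : NNReal, LipschitzOnWith L c (Icc a b) := by
  have hc : ContinuousOn (derivWithin c (Icc a b)) (Icc a b) :=
    h.continuousOn_derivWithin (uniqueDiffOn_Icc hab) le_rfl
  obtain ⟨C, hC⟩ := isCompact_Icc.exists_bound_of_continuousOn hc
  refine ⟨⟨max C 0, le_max_right _ _⟩, ?_⟩
  refine (convex_Icc a b).lipschitzOnWith_of_nnnorm_derivWithin_le
    (h.differentiableOn one_ne_zero) fun x hx => ?_
  exact_mod_cast (hC x hx).trans (le_max_left _ _)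

/-- A point of `[p 0, p n)` off the partition points lies in one of the open pieces. -/
lemma exists_mem_Ioo_partition {n : ℕ} {p : ℕ → ℝ} (h0 : p 0 < s) (hn : s < p n)
    (hne : ∀ i, s ≠ p i) : ∃ i < n, s ∈ Ioo (p i) (p (i + 1)) := by
  classical
  have hex : ∃ i, s < p i := ⟨n, hn⟩
  have hpos : Nat.find hex ≠ 0 := by
    intro h
    have := Nat.find_spec hex
    rw [h] at this
    linarith
  obtain ⟨k, hk⟩ := Nat.exists_eq_succ_of_ne_zero hpos
  refine ⟨k, ?_, ?_, ?_⟩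
  · have := Nat.find_min' hex hn
    omega
  · have := Nat.find_min hex (m := k) (by omega)
    exact lt_of_le_of_ne (not_lt.1 this) (hne k).symm
  · have := Nat.find_spec hex
    rwa [hk] at this

lemma IsPiecewiseRegular.niceCurve (h : IsPiecewiseRegular σ) : NiceCurve σ := by
  obtain ⟨n, p, h0, h1, hp⟩ := h
  constructor
  · have key : ∀ k ≤ n, ∃ L : NNReal, LipschitzOnWith L σ (Icc (p 0) (p k)) := by
      intro k
      induction k with
      | zero =>
        intro _
        refine ⟨0, LipschitzOnWith.of_dist_le_mul fun x hx y hy => ?_⟩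
        have : x = y := by simp_all
        simp [this]
      | succ k ih =>
        intro hk
        obtain ⟨L, hL⟩ := ih (by omega)
        obtain ⟨hlt, hcd, -⟩ := hp k (by omega)
        obtain ⟨M, hM⟩ := ContDiffOn.exists_lipschitzOnWith_Icc hlt hcd
        exact ⟨_, lipschitzOnWith_Icc_glue hL hM⟩
    have := key n le_rfl
    rwa [h0, h1] at this
  · refine ⟨range p, countable_range p, fun s hs => ?_⟩
    obtain ⟨i, hi, hsi⟩ := exists_mem_Ioo_partition (n := n) (p := p) (s := s)
      (by rw [h0]; exact hs.1.1) (by rw [h1]; exact hs.1.2) (fun i hi => hs.2 ⟨i, hi.symm⟩)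
    obtain ⟨-, hcd, -⟩ := hp i hi
    exact ((hcd.differentiableOn one_ne_zero) s (Ioo_subset_Icc_self hsi)).differentiableAt
      (Icc_mem_nhds hsi.1 hsi.2)

lemma NiceCurve.mirror (h : NiceCurve c) : NiceCurve (mirror c) := by
  constructor
  · obtain ⟨L, hL⟩ := h.lip
    refine ⟨L, LipschitzOnWith.of_dist_le_mul fun x hx y hy => ?_⟩
    have := hL.dist_le_mul (1 - x) ⟨by linarith [hx.2], by linarith [hx.1]⟩ (1 - y)
      ⟨by linarith [hy.2], by linarith [hy.1]⟩
    simp only [GenusZero.mirror, dist_conj_conj]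
    refine this.trans_eq ?_
    congr 1
    rw [dist_sub_left]
  · obtain ⟨S, hS, hd⟩ := h.diff
    refine ⟨(fun s => 1 - s) '' S, hS.image _, fun s hs => ?_⟩
    have h1 : DifferentiableAt ℝ c (1 - s) := by
      refine hd _ ⟨⟨by linarith [hs.1.2], by linarith [hs.1.1]⟩, fun h => hs.2 ⟨1 - s, h, by simp⟩⟩
    have h2 : DifferentiableAt ℝ (fun s => c (1 - s)) s := by fun_prop
    exact h2.star

lemma deriv_mirror (c : ℝ → ℂ) (s : ℝ) : deriv (mirror c) s = -conj (deriv c (1 - s)) := by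
  have h1 : deriv (mirror c) s = star (deriv (fun s => c (1 - s)) s) := deriv.star
  rw [h1, deriv_comp_const_sub]
  simp

lemma curveInt_mirror (c : ℝ → ℂ) (g : ℂ → ℂ) :
    curveInt (mirror c) g = -conj (curveInt c (fun z => conj (g (conj z)))) := by
  unfold curveInt
  have h1 : (fun s => g (mirror c s) * deriv (mirror c) s) = fun s =>
      (fun s => -conj (conj (g (conj (c s))) * deriv c s)) (1 - s) := by
    funext s
    simp [deriv_mirror, mirror]
  rw [h1, intervalIntegral.integral_comp_sub_left (fun s =>
    -conj (conj (g (conj (c s))) * deriv c s)) 1]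
  simp only [sub_self, sub_zero]
  rw [intervalIntegral.integral_neg]
  congr 1
  rw [intervalIntegral.integral_of_le zero_le_one, intervalIntegral.integral_of_le zero_le_one]
  exact integral_conj

lemma curveIntegrable_mirror (h : CurveIntegrable c (fun z => conj (g (conj z)))) :
    CurveIntegrable (mirror c) g := by
  unfold CurveIntegrable at *
  have h1 : (fun s => g (mirror c s) * deriv (mirror c) s) = fun s =>
      (fun s => -conj (conj (g (conj (c s))) * deriv c s)) (1 - s) := by
    funext s
    simp [deriv_mirror, mirror]
  rw [h1]
  have h2 : IntervalIntegrable
      (fun s => -conj (conj (g (conj (c s))) * deriv c s))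
      volume 0 1 := by
    refine IntervalIntegrable.neg ?_
    rw [intervalIntegrable_iff] at h ⊢
    exact (conjCLE.toContinuousLinearMap.integrable_comp h)
  have := (h2.comp_sub_left 1).symm
  simpa using this

lemma restrict_Ioc_eq_Ioo : (volume : Measure ℝ).restrict (Ioc 0 1) = volume.restrict (Ioo 0 1) :=
  Measure.restrict_congr_set Ioo_ae_eq_Ioc.symm

lemma ae_mem_Ioo : ∀ᵐ s ∂((volume : Measure ℝ).restrict (Ioc 0 1)), s ∈ Ioo 0 1 := by
  rw [restrict_Ioc_eq_Ioo]
  exact ae_restrict_mem measurableSet_Ioo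

/-- A bounded function that is continuous along the open curve can be integrated along the
curve. -/
lemma NiceCurve.curveIntegrable (hc : NiceCurve c)
    (hg : ContinuousOn (fun s => g (c s)) (Ioo 0 1)) (hb : ∃ C, ∀ s ∈ Ioo 0 1, ‖g (c s)‖ ≤ C) :
    CurveIntegrable c g := by
  obtain ⟨C, hC⟩ := hb
  obtain ⟨L, hL0, hL⟩ := exists_deriv_bound hc.lip
  unfold CurveIntegrable
  rw [intervalIntegrable_iff_integrableOn_Ioc_of_le zero_le_one]
  refine Integrable.of_bound (C := C * L) ?_ ?_
  · refine AEStronglyMeasurable.mul ?_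
      (measurable_deriv c).stronglyMeasurable.aestronglyMeasurable
    rw [restrict_Ioc_eq_Ioo]
    exact hg.aestronglyMeasurable measurableSet_Ioo
  · filter_upwards [ae_mem_Ioo] with s hs
    rw [norm_mul]
    exact mul_le_mul (hC s hs) (hL s hs) (norm_nonneg _) ((norm_nonneg _).trans (hC s hs))

/-- The fundamental theorem of calculus along a curve. -/
lemma NiceCurve.curveInt_eq_sub (hc : NiceCurve c) {P g : ℂ → ℂ}
    (hP : ContinuousOn (fun s => P (c s)) (Icc 0 1))
    (hd : ∀ s ∈ Ioo 0 1, HasDerivAt P (g (c s)) (c s)) (hi : CurveIntegrable c g) :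
    curveInt c g = P (c 1) - P (c 0) := by
  obtain ⟨S, hS, hcd⟩ := hc.diff
  unfold curveInt
  refine integral_eq_of_hasDerivAt_off_countable (fun s => P (c s)) _ hS ?_ ?_ hi
  · simp_all
  · intro s hs
    rw [min_eq_left zero_le_one, max_eq_right zero_le_one] at hs
    have h1 := (hcd s hs).hasDerivAt
    have h2 := hd s hs.1
    exact h2.comp_of_eq s h1 rfl

/-! ### Analytic dependence of integrals on a parameter -/

/-- The integral of a locally uniformly bounded family of analytic functions is analytic. -/
lemma differentiableOn_integral_of_bounded {φ : ℝ → ℂ} {F : ℝ → ℂ → ℂ} {O : Set ℂ}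
    (hφm : AEStronglyMeasurable φ (volume.restrict (Ioc 0 1))) (hφb : ∃ L, ∀ s ∈ Ioo 0 1, ‖φ s‖ ≤ L)
    (hF : ∀ s ∈ Ioo 0 1, DifferentiableOn ℂ (F s) O) (hm : ∀ w ∈ O, AEStronglyMeasurable (fun s => F
    s w) (volume.restrict (Ioc 0 1))) (hb : ∀ w₀ ∈ O, ∃ r > 0, ∃ C, ball w₀ r ⊆ O ∧ ∀ s ∈ Ioo 0 1, ∀
    w ∈ ball w₀ r, ‖F s w‖ ≤ C) :
    DifferentiableOn ℂ (fun w => ∫ s in (0 : ℝ)..1, F s w * φ s) O := by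
  intro w₀ hw₀
  obtain ⟨r, hr, C, hrO, hC⟩ := hb w₀ hw₀
  obtain ⟨L, hL⟩ := hφb
  have hI : uIoc (0 : ℝ) 1 = Ioc 0 1 := by simp
  have hdiff : ∀ s ∈ Ioo 0 1, ∀ w ∈ ball w₀ r, HasDerivAt (F s) (deriv (F s) w) w := by
    intro s hs w hw
    exact ((hF s hs).differentiableAt
      (mem_of_superset (isOpen_ball.mem_nhds hw) hrO)).hasDerivAt
  have hmeas : ∀ w ∈ ball w₀ r,
      AEStronglyMeasurable (fun s => F s w * φ s) (volume.restrict (Ioc 0 1)) :=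
    fun w hw => (hm w (hrO hw)).mul hφm
  have hint : ∀ w ∈ ball w₀ r, IntervalIntegrable (fun s => F s w * φ s) volume 0 1 := by
    intro w hw
    rw [intervalIntegrable_iff_integrableOn_Ioc_of_le zero_le_one]
    refine Integrable.of_bound (C := C * L) (hmeas w hw) ?_
    filter_upwards [ae_mem_Ioo] with s hs
    rw [norm_mul]
    exact mul_le_mul (hC s hs w hw) (hL s hs) (norm_nonneg _) ((norm_nonneg _).trans (hC s hs w hw))
  have hw₀r : w₀ ∈ ball w₀ r := mem_ball_self hr
  have hderm : AEStronglyMeasurable (fun s => deriv (F s) w₀) (volume.restrict (Ioc 0 1)) := by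
    -- the derivative is a limit of difference quotients
    set ε : ℕ → ℂ := fun n => (((r / 2) / ((n : ℝ) + 1) : ℝ) : ℂ) with hε
    have hεpos : ∀ n : ℕ, 0 < (r / 2) / ((n : ℝ) + 1) := fun n => by positivity
    have hεlt : ∀ n : ℕ, (r / 2) / ((n : ℝ) + 1) ≤ r / 2 := fun n =>
      div_le_self (by positivity) (by linarith [(Nat.cast_nonneg n : (0 : ℝ) ≤ n)])
    have hball : ∀ n, w₀ + ε n ∈ ball w₀ r := by
      intro n
      rw [mem_ball, dist_eq_norm, add_sub_cancel_left, hε, Complex.norm_real,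
        Real.norm_of_nonneg (hεpos n).le]
      linarith [hεlt n]
    have hε0 : Tendsto ε atTop (𝓝 0) := by
      have h0 : Tendsto (fun n : ℕ => (r / 2) / ((n : ℝ) + 1)) atTop (𝓝 0) :=
        tendsto_const_nhds.div_atTop (tendsto_atTop_add_const_right _ _ tendsto_natCast_atTop_atTop)
      simpa [hε, Function.comp_def] using (continuous_ofReal.tendsto 0).comp h0
    refine aestronglyMeasurable_of_tendsto_ae atTop
      (f := fun n s => (ε n)⁻¹ • (F s (w₀ + ε n) - F s w₀)) (fun n => ?_) ?_
    · exact ((hm _ (hrO (hball n))).sub (hm _ hw₀)).const_smul (ε n)⁻¹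
    · filter_upwards [ae_mem_Ioo] with s hs
      have h1 := (hasDerivAt_iff_tendsto_slope_zero.1 (hdiff s hs w₀ hw₀r))
      refine h1.comp (tendsto_nhdsWithin_iff.2 ⟨hε0, Eventually.of_forall fun n => ?_⟩)
      simpa only [hε, mem_compl_iff, mem_singleton_iff, ofReal_eq_zero] using (hεpos n).ne'
  have hsub : ball w₀ (r / 2) ⊆ ball w₀ r := ball_subset_ball (by linarith)
  have key := intervalIntegral.hasDerivAt_integral_of_dominated_loc_of_deriv_le (𝕜 := ℂ)
    (μ := volume) (a := 0) (b := 1)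
    (F := fun w s => F s w * φ s) (F' := fun w s => deriv (F s) w * φ s) (x₀ := w₀)
    (s := ball w₀ (r / 2)) (bound := fun _ => C / (r / 2) * L)
    (ball_mem_nhds _ (by positivity)) ?_ (hint w₀ hw₀r) ?_ ?_ (by simp) ?_
  · exact key.2.differentiableAt.differentiableWithinAt
  · rw [hI]
    filter_upwards [ball_mem_nhds w₀ hr] with w hw using hmeas w hw
  · rw [hI]
    exact hderm.mul hφm
  · have h0 := ae_mem_Ioo
    rw [ae_restrict_iff' measurableSet_Ioc] at h0
    rw [hI]
    filter_upwards [h0] with s hs hs' w hw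
    have hs := hs hs'
    rw [norm_mul]
    have hcl : closedBall w (r / 2) ⊆ ball w₀ r := by
      intro y hy
      have h1 := mem_closedBall.1 hy
      have h2 := mem_ball.1 hw
      exact mem_ball.2 ((dist_triangle y w w₀).trans_lt (by linarith))
    have h3 : ‖deriv (F s) w‖ ≤ C / (r / 2) := by
      refine norm_deriv_le_of_forall_mem_sphere_norm_le (by positivity) ?_ ?_
      · refine DifferentiableOn.diffContOnCl ?_
        rw [closure_ball _ (by positivity)]
        exact (hF s hs).mono (hcl.trans hrO)
      · intro y hy
        exact hC s hs y (hcl (sphere_subset_closedBall hy))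
    exact mul_le_mul h3 (hL s hs) (norm_nonneg _) ((norm_nonneg _).trans h3)
  · have h0 := ae_mem_Ioo
    rw [ae_restrict_iff' measurableSet_Ioc] at h0
    rw [hI]
    filter_upwards [h0] with s hs hs' w hw
    exact (hdiff s (hs hs') w (hsub hw)).mul_const _

lemma dslope_symm (g : ℂ → ℂ) (a b : ℂ) : dslope g a b = dslope g b a := by
  rcases eq_or_ne a b with h | h
  · rw [h]
  · rw [dslope_of_ne _ h.symm, dslope_of_ne _ h, slope_comm]

/-- The first step of Dixon's proof of Cauchy's theorem: the integral of the difference quotients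
of an analytic function is analytic across the curve.  The curve may end at boundary points of the
domain, as long as the function is bounded along the curve. -/
lemma differentiableOn_integral_dslope (hc : NiceCurve c) {O : Set ℂ} (hO : IsOpen O)
    (hcO : ∀ s ∈ Ioo 0 1, c s ∈ O) (hg : DifferentiableOn ℂ g O)
    (hb : ∃ C, ∀ s ∈ Ioo 0 1, ‖g (c s)‖ ≤ C) :
    DifferentiableOn ℂ (fun w => ∫ s in (0 : ℝ)..1, dslope g w (c s) * deriv c s) O := by
  obtain ⟨C, hC⟩ := hb
  obtain ⟨L, hL0, hL⟩ := exists_deriv_bound hc.lip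
  have hds : ∀ w ∈ O, DifferentiableOn ℂ (dslope g w) O := fun w hw =>
    (differentiableOn_dslope (hO.mem_nhds hw)).2 hg
  refine differentiableOn_integral_of_bounded (F := fun s w => dslope g w (c s))
    (measurable_deriv c).stronglyMeasurable.aestronglyMeasurable ⟨L, hL⟩ ?_ ?_ ?_
  · intro s hs
    simp_rw [dslope_symm g _ (c s)]
    exact hds _ (hcO s hs)
  · intro w hw
    rw [restrict_Ioc_eq_Ioo]
    refine ContinuousOn.aestronglyMeasurable ?_ measurableSet_Ioo
    exact (hds w hw).continuousOn.comp (hc.continuousOn.mono Ioo_subset_Icc_self) hcO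
  · intro w₀ hw₀
    obtain ⟨r, hr, hrO⟩ := nhds_basis_closedBall.mem_iff.1 (hO.mem_nhds hw₀)
    have hK : IsCompact (closedBall w₀ r) := isCompact_closedBall _ _
    obtain ⟨M, hM⟩ := hK.exists_bound_of_continuousOn
      ((hg.deriv hO).continuousOn.mono hrO)
    obtain ⟨N, hN⟩ := hK.exists_bound_of_continuousOn (hg.continuousOn.mono hrO)
    refine ⟨r / 2, by positivity, max M ((C + N) / (r / 2)), ?_, ?_⟩
    · exact (ball_subset_closedBall.trans
        (closedBall_subset_closedBall (by linarith))).trans hrO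
    · intro s hs w hw
      have hw' : w ∈ closedBall w₀ r :=
        closedBall_subset_closedBall (by linarith) (ball_subset_closedBall hw)
      have hCs := hC s hs
      by_cases hcs : c s ∈ closedBall w₀ r
      · refine le_trans ?_ (le_max_left _ _)
        rcases eq_or_ne (c s) w with h | h
        · simp_all
        · rw [dslope_of_ne _ h, slope_def_field, norm_div,
            div_le_iff₀ (norm_pos_iff.2 (sub_ne_zero.2 h))]
          exact (convex_closedBall w₀ r).norm_image_sub_le_of_norm_deriv_le
            (fun x hx => hg.differentiableAt (hO.mem_nhds (hrO hx))) hM hw' hcs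
      · refine le_trans ?_ (le_max_right _ _)
        have hd : r / 2 ≤ ‖c s - w‖ := by
          have h1 : r < dist (c s) w₀ := by simpa using hcs
          have h2 := mem_ball.1 hw
          have h3 := dist_triangle (c s) w w₀
          rw [← dist_eq_norm]
          linarith
        have h : c s ≠ w := by
          intro h
          rw [h] at hd
          simp at hd
          linarith
        rw [dslope_of_ne _ h, slope_def_field, norm_div]
        gcongr
        · exact (norm_nonneg _).trans (le_trans (norm_sub_le _ _) (add_le_add hCs (hN w hw')))
        · exact (norm_sub_le _ _).trans (add_le_add hCs (hN w hw'))

/-- The Cauchy-type integral along a curve is analytic off the curve. -/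
lemma differentiableOn_cauchyInt (hc : ∃ L : NNReal, LipschitzOnWith L c (Icc 0 1))
    (hg : ContinuousOn (fun s => g (c s)) (Ioo 0 1)) (hb : ∃ C, ∀ s ∈ Ioo 0 1, ‖g (c s)‖ ≤ C) :
    DifferentiableOn ℂ (fun w => curveInt c (fun z => g z / (z - w))) (c '' Icc 0 1)ᶜ := by
  obtain ⟨C, hC⟩ := hb
  obtain ⟨L, hL0, hL⟩ := exists_deriv_bound hc
  have hcc : ContinuousOn c (Icc 0 1) := hc.elim fun _ h => h.continuousOn
  have hcl : IsClosed (c '' Icc 0 1) := (isCompact_Icc.image_of_continuousOn hcc).isClosed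
  have hne : ∀ s ∈ Ioo 0 1, ∀ w ∈ (c '' Icc 0 1)ᶜ, c s - w ≠ 0 := fun s hs w hw h =>
    hw ⟨s, Ioo_subset_Icc_self hs, sub_eq_zero.1 h⟩
  refine differentiableOn_integral_of_bounded (F := fun s w => g (c s) / (c s - w))
    (measurable_deriv c).stronglyMeasurable.aestronglyMeasurable ⟨L, hL⟩ ?_ ?_ ?_
  · intro s hs w hw
    exact ((differentiableAt_const _).div ((differentiableAt_const _).sub differentiableAt_id)
      (hne s hs w hw)).differentiableWithinAt
  · intro w hw
    rw [restrict_Ioc_eq_Ioo]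
    exact (hg.div ((hcc.mono Ioo_subset_Icc_self).sub continuousOn_const)
      fun s hs => hne s hs w hw).aestronglyMeasurable measurableSet_Ioo
  · intro w₀ hw₀
    obtain ⟨r, hr, hrO⟩ := nhds_basis_ball.mem_iff.1 (hcl.isOpen_compl.mem_nhds hw₀)
    refine ⟨r / 2, by positivity, C / (r / 2), ?_, ?_⟩
    · exact (ball_subset_ball (by linarith)).trans hrO
    · intro s hs w hw
      rw [norm_div]
      have hd : r / 2 ≤ ‖c s - w‖ := by
        have h1 : r ≤ dist (c s) w₀ := by
          by_contra h
          exact hrO (mem_ball.2 (not_le.1 h)) ⟨s, Ioo_subset_Icc_self hs, rfl⟩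
        have h2 := mem_ball.1 hw
        have h3 := dist_triangle (c s) w w₀
        rw [← dist_eq_norm]
        linarith
      have := hC s hs
      gcongr
      exact (norm_nonneg _).trans this

/-- The Cauchy-type integral along a curve vanishes at infinity. -/
lemma tendsto_cauchyInt_cocompact (hc : ∃ L : NNReal, LipschitzOnWith L c (Icc 0 1))
    (hb : ∃ C, ∀ s ∈ Ioo 0 1, ‖g (c s)‖ ≤ C) :
    Tendsto (fun w => curveInt c (fun z => g z / (z - w))) (cocompact ℂ) (𝓝 0) := by
  obtain ⟨C, hC⟩ := hb
  obtain ⟨L, hL0, hL⟩ := exists_deriv_bound hc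
  have hcc : ContinuousOn c (Icc 0 1) := hc.elim fun _ h => h.continuousOn
  obtain ⟨ρ, hρ⟩ := (isCompact_Icc.image_of_continuousOn hcc).isBounded.exists_norm_le
  have hC0 : 0 ≤ C := (norm_nonneg _).trans (hC (1 / 2) (by norm_num))
  have hup : Tendsto (fun w : ℂ => C * L / (‖w‖ - ρ)) (cocompact ℂ) (𝓝 0) :=
    tendsto_const_nhds.div_atTop
      (tendsto_atTop_add_const_right _ (-ρ) (tendsto_norm_cocompact_atTop (E := ℂ)))
  refine squeeze_zero_norm' ?_ hup
  filter_upwards [(tendsto_norm_cocompact_atTop (E := ℂ)).eventually_gt_atTop ρ] with w hw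
  have hw' : 0 < ‖w‖ - ρ := sub_pos.2 hw
  unfold curveInt
  have h1 := intervalIntegral.norm_integral_le_of_norm_le_const_ae (a := (0 : ℝ)) (b := 1)
    (f := fun s => g (c s) / (c s - w) * deriv c s) (C := C * L / (‖w‖ - ρ)) ?_
  · simp_all
  have h0 := ae_mem_Ioo
  rw [ae_restrict_iff' measurableSet_Ioc] at h0
  filter_upwards [h0] with s hs hs'
  rw [uIoc_of_le zero_le_one] at hs'
  have hs := hs hs'
  have h2 : ‖w‖ - ρ ≤ ‖c s - w‖ := by
    have := hρ (c s) ⟨s, Ioo_subset_Icc_self hs, rfl⟩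
    have h3 := norm_sub_norm_le w (c s)
    rw [norm_sub_rev] at h3
    linarith
  rw [norm_mul, norm_div, div_mul_eq_mul_div]
  exact div_le_div₀ (mul_nonneg hC0 hL0)
    (mul_le_mul (hC s hs) (hL s hs) (norm_nonneg _) hC0) hw' h2

/-! ### Removability of rectifiable curves for continuous functions -/

/-- The integral of `u` over the boundary of the rectangle `[x₁, x₂] × [y₁, y₂]`. -/
def rectInt (u : ℂ → ℂ) (x₁ x₂ y₁ y₂ : ℝ) : ℂ :=
  (∫ x in x₁..x₂, u (x + y₁ * I)) - (∫ x in x₁..x₂, u (x + y₂ * I))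
    + I • (∫ y in y₁..y₂, u (x₂ + y * I))
    - I • (∫ y in y₁..y₂, u (x₁ + y * I))

lemma sum_rectInt_horizontal {u : ℂ → ℂ} {x : ℕ → ℝ} {y₁ y₂ : ℝ} {N : ℕ} (h₁ : ∀ i < N,
    IntervalIntegrable (fun t : ℝ => u (t + y₁ * I)) volume (x i) (x (i + 1))) (h₂ : ∀ i < N,
    IntervalIntegrable (fun t : ℝ => u (t + y₂ * I)) volume (x i) (x (i + 1))) :
    ∑ i ∈ Finset.range N, rectInt u (x i) (x (i + 1)) y₁ y₂ = rectInt u (x 0) (x N) y₁ y₂ := by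
  unfold rectInt
  have e (i : ℕ) : (∫ t in x i..x (i + 1), u (t + y₁ * I))
      - (∫ t in x i..x (i + 1), u (t + y₂ * I))
      + I • (∫ y in y₁..y₂, u (x (i + 1) + y * I))
      - I • (∫ y in y₁..y₂, u (x i + y * I))
      = ((∫ t in x i..x (i + 1), u (t + y₁ * I))
      - (∫ t in x i..x (i + 1), u (t + y₂ * I)))
      + (I • (∫ y in y₁..y₂, u (x (i + 1) + y * I))
      - I • (∫ y in y₁..y₂, u (x i + y * I))) := by ring
  simp_rw [e]
  rw [Finset.sum_add_distrib, Finset.sum_sub_distrib,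
    intervalIntegral.sum_integral_adjacent_intervals h₁,
    intervalIntegral.sum_integral_adjacent_intervals h₂,
    Finset.sum_range_sub (fun i => I • (∫ y in y₁..y₂, u (x i + y * I)))]
  ring

lemma sum_rectInt_vertical {u : ℂ → ℂ} {y : ℕ → ℝ} {x₁ x₂ : ℝ} {N : ℕ} (h₁ : ∀ i < N,
    IntervalIntegrable (fun t : ℝ => u (x₁ + t * I)) volume (y i) (y (i + 1))) (h₂ : ∀ i < N,
    IntervalIntegrable (fun t : ℝ => u (x₂ + t * I)) volume (y i) (y (i + 1))) :
    ∑ i ∈ Finset.range N, rectInt u x₁ x₂ (y i) (y (i + 1)) = rectInt u x₁ x₂ (y 0) (y N) := by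
  unfold rectInt
  have e (i : ℕ) : (∫ t in x₁..x₂, u (t + y i * I))
      - (∫ t in x₁..x₂, u (t + y (i + 1) * I))
      + I • (∫ t in y i..y (i + 1), u (x₂ + t * I))
      - I • (∫ t in y i..y (i + 1), u (x₁ + t * I))
      = -((∫ t in x₁..x₂, u (t + y (i + 1) * I))
      - (∫ t in x₁..x₂, u (t + y i * I)))
      + (I • (∫ t in y i..y (i + 1), u (x₂ + t * I))
      - I • (∫ t in y i..y (i + 1), u (x₁ + t * I))) := by ring
  simp_rw [e]
  rw [Finset.sum_add_distrib, Finset.sum_sub_distrib, Finset.sum_neg_distrib,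
    ← Finset.smul_sum, ← Finset.smul_sum,
    intervalIntegral.sum_integral_adjacent_intervals h₁,
    intervalIntegral.sum_integral_adjacent_intervals h₂,
    Finset.sum_range_sub (fun i => (∫ t in x₁..x₂, u (t + y i * I)))]
  ring

/-- If `u` is within `ε` of a constant on a rectangle, its boundary integral is at most `ε` times
the perimeter. -/
lemma norm_rectInt_le {u : ℂ → ℂ} {x₁ x₂ y₁ y₂ ε : ℝ} {k : ℂ}
    (hu : ContinuousOn u ((uIcc x₁ x₂) ×ℂ (uIcc y₁ y₂)))
    (h : ∀ z ∈ (uIcc x₁ x₂) ×ℂ (uIcc y₁ y₂), ‖u z - k‖ ≤ ε) :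
    ‖rectInt u x₁ x₂ y₁ y₂‖ ≤ 2 * ε * (|x₂ - x₁| + |y₂ - y₁|) := by
  have hH : ∀ y ∈ (uIcc y₁ y₂), IntervalIntegrable (fun t : ℝ => u (t + y * I))
      volume x₁ x₂ := fun y hy =>
    (hu.comp (by fun_prop) fun t ht => by simp [mem_reProdIm, ht, hy]).intervalIntegrable
  have hV : ∀ x ∈ (uIcc x₁ x₂), IntervalIntegrable (fun t : ℝ => u (x + t * I))
      volume y₁ y₂ := fun x hx =>
    (hu.comp (by fun_prop) fun t ht => by simp [mem_reProdIm, ht, hx]).intervalIntegrable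
  have hc (a b : ℝ) : IntervalIntegrable (fun _ : ℝ => k) volume a b := by simp
  have e : rectInt u x₁ x₂ y₁ y₂ = (∫ x in x₁..x₂, (u (x + y₁ * I) - k))
      - (∫ x in x₁..x₂, (u (x + y₂ * I) - k))
    + I • (∫ y in y₁..y₂, (u (x₂ + y * I) - k))
    - I • (∫ y in y₁..y₂, (u (x₁ + y * I) - k)) := by
    rw [intervalIntegral.integral_sub (hH _ left_mem_uIcc) (hc _ _),
      intervalIntegral.integral_sub (hH _ right_mem_uIcc) (hc _ _),
      intervalIntegral.integral_sub (hV _ left_mem_uIcc) (hc _ _),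
      intervalIntegral.integral_sub (hV _ right_mem_uIcc) (hc _ _)]
    unfold rectInt
    simp only [smul_sub]
    ring
  have bH : ∀ y ∈ (uIcc y₁ y₂), ‖∫ x in x₁..x₂, (u (x + y * I) - k)‖ ≤ ε * |x₂ - x₁| :=
    fun y hy => intervalIntegral.norm_integral_le_of_norm_le_const fun t ht =>
      h _ (by simp [mem_reProdIm, uIoc_subset_uIcc ht, hy])
  have bV : ∀ x ∈ (uIcc x₁ x₂), ‖I • ∫ y in y₁..y₂, (u (x + y * I) - k)‖
      ≤ ε * |y₂ - y₁| := by
    intro x hx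
    rw [norm_smul, norm_I, one_mul]
    exact intervalIntegral.norm_integral_le_of_norm_le_const fun t ht =>
      h _ (by simp [mem_reProdIm, uIoc_subset_uIcc ht, hx])
  rw [e]
  refine (norm_sub_le _ _).trans ?_
  refine (add_le_add_left (norm_add_le _ _) _).trans ?_
  refine (add_le_add_left (add_le_add_left (norm_sub_le _ _) _) _).trans ?_
  have := bH _ left_mem_uIcc
  have := bH _ right_mem_uIcc
  have := bV _ left_mem_uIcc
  have := bV _ right_mem_uIcc
  linarith

/-- At most `C N` cells of an `N × N` grid meet a given Lipschitz curve. -/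
lemma exists_card_cells_le {L : NNReal} (hc : LipschitzOnWith L c (Icc 0 1)) (a b : ℝ) {p q : ℝ}
    (hp : p ≠ 0) (hq : q ≠ 0) :
    ∃ C : ℝ, ∀ N : ℕ, 0 < N → ∃ S : Finset (ℕ × ℕ), (S.card : ℝ) ≤ C * N ∧
      ∀ i j : ℕ, (∃ t ∈ Icc 0 1, ∃ θ ∈ Icc (i : ℝ) (i + 1), ∃ η ∈ Icc (j : ℝ) (j + 1),
        (c t).re = a + θ * (p / N) ∧ (c t).im = b + η * (q / N)) → (i, j) ∈ S := by
  set δ := min |p| |q| with hδ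
  have hδ0 : 0 < δ := by simp_all
  refine ⟨((L : ℝ) / δ + 3) * 16, fun N hN => ?_⟩
  have hN' : (0 : ℝ) < N := by simp_all
  have hN1 : (1 : ℝ) ≤ N := by exact_mod_cast hN
  set M : ℕ := ⌈(L : ℝ) * N / δ⌉₊ + 1 with hM
  have hM0 : (0 : ℝ) < M := by positivity
  have hM1 : (L : ℝ) * N / δ ≤ M := by
    rw [hM]; push_cast
    linarith [Nat.le_ceil ((L : ℝ) * N / δ)]
  have hM2 : (M : ℝ) ≤ L * N / δ + 2 := by
    rw [hM]; push_cast
    linarith [(Nat.ceil_lt_add_one (by positivity : (0 : ℝ) ≤ (L : ℝ) * N / δ)).le]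
  let A : ℕ → ℕ := fun k => ⌈((c (k / M)).re - a) / (p / N) - 2⌉₊
  let B : ℕ → ℕ := fun k => ⌈((c (k / M)).im - b) / (q / N) - 2⌉₊
  refine ⟨(Finset.range (M + 1)).biUnion fun k =>
    Finset.Icc (A k) (A k + 3) ×ˢ Finset.Icc (B k) (B k + 3), ?_, ?_⟩
  · have h1 : ((Finset.range (M + 1)).biUnion fun k =>
      Finset.Icc (A k) (A k + 3) ×ˢ Finset.Icc (B k) (B k + 3)).card ≤ (M + 1) * 16 := by
      refine (Finset.card_biUnion_le_card_mul _ _ 16 fun k _ => ?_).trans (by simp)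
      rw [Finset.card_product, Nat.card_Icc, Nat.card_Icc]
      have e1 : A k + 3 + 1 - A k = 4 := by omega
      have e2 : B k + 3 + 1 - B k = 4 := by omega
      rw [e1, e2]
    have h2 : (((M + 1) * 16 : ℕ) : ℝ) ≤ ((L : ℝ) / δ + 3) * 16 * N := by
      push_cast
      have : (L : ℝ) * N / δ = L / δ * N := by ring
      nlinarith
    exact le_trans (by exact_mod_cast h1) h2
  · rintro i j ⟨t, ht, θ, hθ, η, hη, hre, him⟩
    rw [Finset.mem_biUnion]
    refine ⟨⌊t * M⌋₊, ?_, ?_⟩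
    · rw [Finset.mem_range, Nat.lt_succ_iff]
      refine Nat.floor_le_of_le ?_
      nlinarith [ht.2]
    set k := ⌊t * M⌋₊ with hk
    have hk1 : (k : ℝ) ≤ t * M := Nat.floor_le (mul_nonneg ht.1 hM0.le)
    have hk2 : t * M < k + 1 := Nat.lt_floor_add_one _
    have hkt : |t - k / M| ≤ 1 / M := by
      rw [abs_of_nonneg]
      · rw [sub_le_iff_le_add, ← add_div, le_div_iff₀ hM0]; linarith
      · rw [sub_nonneg, div_le_iff₀ hM0]; exact hk1
    have hkM : (k : ℝ) / M ∈ Icc 0 1 := by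
      refine ⟨by positivity, ?_⟩
      rw [div_le_one hM0]
      nlinarith [ht.2]
    have hdist : ‖c t - c (k / M)‖ ≤ δ / N := by
      have h1 := hc.dist_le_mul t ht _ hkM
      rw [dist_eq_norm, Real.dist_eq] at h1
      refine h1.trans ((mul_le_mul_of_nonneg_left hkt L.2).trans ?_)
      rw [div_le_iff₀ hδ0] at hM1
      rw [mul_one_div, div_le_div_iff₀ hM0 hN', mul_comm δ]
      exact hM1
    -- one coordinate at a time, in units of the mesh
    have coord : ∀ (X Y a p θ : ℝ) (i : ℕ), p ≠ 0 → δ ≤ |p| → θ ∈ Icc (i : ℝ) (i + 1) →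
        X = a + θ * (p / N) → |X - Y| ≤ δ / N →
        i ∈ Finset.Icc ⌈(Y - a) / (p / N) - 2⌉₊ (⌈(Y - a) / (p / N) - 2⌉₊ + 3) := by
      intro X Y a p θ i hp hδp hθ hX hXY
      have hpN : p / N ≠ 0 := by positivity
      have h1 : |θ - (Y - a) / (p / N)| ≤ 1 := by
        have : θ - (Y - a) / (p / N) = (X - Y) / (p / N) := by rw [hX]; field_simp; ring
        rw [this, abs_div, abs_div, abs_of_pos hN', div_le_one (by positivity)]
        exact hXY.trans (by gcongr)
      rw [abs_le] at h1
      rw [Finset.mem_Icc]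
      constructor
      · refine Nat.ceil_le.2 ?_
        linarith [hθ.2]
      · have h2 := Nat.le_ceil ((Y - a) / (p / N) - 2)
        have h3 : (i : ℝ) ≤ ((⌈(Y - a) / (p / N) - 2⌉₊ + 3 : ℕ) : ℝ) := by
          push_cast
          linarith [hθ.1]
        exact_mod_cast h3
    rw [Finset.mem_product]
    refine ⟨coord _ _ a p θ i hp (min_le_left _ _) hθ hre ?_,
      coord _ _ b q η j hq (min_le_right _ _) hη him ?_⟩
    · exact le_trans (by simpa using abs_re_le_norm (c t - c (k / M))) hdist
    · exact le_trans (by simpa using abs_im_le_norm (c t - c (k / M))) hdist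

lemma mem_uIcc_affine {a p θ s t : ℝ} (h : s ≤ θ ∧ θ ≤ t) :
    a + θ * p ∈ (uIcc (a + s * p) (a + t * p)) := by
  rw [mem_uIcc]
  rcases le_total 0 p with hp | hp
  · left; constructor <;> nlinarith [h.1, h.2]
  · right; constructor <;> nlinarith [h.1, h.2]

lemma exists_of_mem_uIcc_affine {a p x s t : ℝ} (hst : s ≤ t)
    (h : x ∈ (uIcc (a + s * p) (a + t * p))) : ∃ θ ∈ Icc s t, x = a + θ * p := by
  have h1 : (uIcc (a + s * p) (a + t * p)) = (fun θ => a + θ * p) '' Icc s t := by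
    rw [← uIcc_of_le hst]
    have := (Set.image_const_add_uIcc a (s * p) (t * p))
    rw [← this, ← Set.image_mul_const_uIcc p s t, image_image]
  rw [h1] at h
  obtain ⟨θ, hθ, rfl⟩ := h
  exact ⟨θ, hθ, rfl⟩

/-- The integral over the boundary of a rectangle vanishes for a continuous function that is
analytic off a rectifiable curve. -/
lemma rectInt_eq_zero {u : ℂ → ℂ} {L : NNReal} (hc : LipschitzOnWith L c (Icc 0 1))
    {x₁ x₂ y₁ y₂ : ℝ} (hu : ContinuousOn u ((uIcc x₁ x₂) ×ℂ (uIcc y₁ y₂))) (hd : DifferentiableOn ℂ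
    u (((uIcc x₁ x₂) ×ℂ (uIcc y₁ y₂)) \ c '' Icc 0 1)) : rectInt u x₁ x₂ y₁ y₂ = 0 := by
  rcases eq_or_ne (x₂ - x₁) 0 with hp | hp
  · simp [rectInt, sub_eq_zero.1 hp]
  rcases eq_or_ne (y₂ - y₁) 0 with hq | hq
  · simp [rectInt, sub_eq_zero.1 hq]
  set p := x₂ - x₁ with hpdef
  set q := y₂ - y₁ with hqdef
  obtain ⟨C, hC⟩ := exists_card_cells_le hc x₁ y₁ hp hq
  have hK : IsCompact ((uIcc x₁ x₂) ×ℂ (uIcc y₁ y₂)) := isCompact_uIcc.reProdIm isCompact_uIcc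
  have huc := hK.uniformContinuousOn_of_continuous hu
  rw [uniformContinuousOn_iff_le] at huc
  have main : ∀ ε > 0, ‖rectInt u x₁ x₂ y₁ y₂‖ ≤ ε * (2 * max C 0 * (|p| + |q|)) := by
    intro ε hε
    obtain ⟨δ, hδ, hδu⟩ := huc ε hε
    obtain ⟨N, hN⟩ := exists_nat_gt ((|p| + |q|) / δ)
    have hN' : (0 : ℝ) < N := lt_of_le_of_lt (by positivity) hN
    have hN0 : 0 < N := by simp_all
    obtain ⟨S, hS, hmem⟩ := hC N hN0
    set x : ℕ → ℝ := fun i => x₁ + i * (p / N) with hx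
    set y : ℕ → ℝ := fun i => y₁ + i * (q / N) with hy
    have hx0 : x 0 = x₁ := by simp [hx]
    have hxN : x N = x₂ := by simp only [hx, hpdef]; field_simp; ring
    have hy0 : y 0 = y₁ := by simp [hy]
    have hyN : y N = y₂ := by simp only [hy, hqdef]; field_simp; ring
    have hxmem : ∀ i ≤ N, x i ∈ (uIcc x₁ x₂) := by
      intro i hi
      rw [← hx0, ← hxN]
      simp only [hx]
      exact mem_uIcc_affine ⟨by simp, by exact_mod_cast hi⟩
    have hymem : ∀ i ≤ N, y i ∈ (uIcc y₁ y₂) := by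
      intro i hi
      rw [← hy0, ← hyN]
      simp only [hy]
      exact mem_uIcc_affine ⟨by simp, by exact_mod_cast hi⟩
    have hsub : ∀ i < N, ∀ j < N,
        (uIcc (x i) (x (i + 1))) ×ℂ (uIcc (y j) (y (j + 1))) ⊆ (uIcc x₁ x₂) ×ℂ (uIcc y₁ y₂) := by
      intro i hi j hj z hz
      rw [mem_reProdIm] at hz ⊢
      exact ⟨uIcc_subset_uIcc (hxmem i hi.le) (hxmem (i + 1) hi) hz.1,
        uIcc_subset_uIcc (hymem j hj.le) (hymem (j + 1) hj) hz.2⟩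
    have hsum : ∑ j ∈ Finset.range N, ∑ i ∈ Finset.range N,
        rectInt u (x i) (x (i + 1)) (y j) (y (j + 1)) = rectInt u x₁ x₂ y₁ y₂ := by
      have h1 : ∀ j ∈ Finset.range N, ∑ i ∈ Finset.range N,
          rectInt u (x i) (x (i + 1)) (y j) (y (j + 1)) = rectInt u x₁ x₂ (y j) (y (j + 1)) := by
        intro j hj
        rw [Finset.mem_range] at hj
        rw [sum_rectInt_horizontal, hx0, hxN]
        · intro i hi
          refine (hu.comp (by fun_prop) fun t ht => ?_).intervalIntegrable
          refine hsub i hi j hj ?_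
          simp [mem_reProdIm, ht]
        · intro i hi
          refine (hu.comp (by fun_prop) fun t ht => ?_).intervalIntegrable
          refine hsub i hi j hj ?_
          simp [mem_reProdIm, ht]
      rw [Finset.sum_congr rfl h1, sum_rectInt_vertical, hy0, hyN]
      · intro j hj
        refine (hu.comp (by fun_prop) fun t ht => ?_).intervalIntegrable
        simpa [mem_reProdIm] using
          uIcc_subset_uIcc (hymem j hj.le) (hymem (j + 1) hj) ht
      · intro j hj
        refine (hu.comp (by fun_prop) fun t ht => ?_).intervalIntegrable
        simpa [mem_reProdIm] using
          uIcc_subset_uIcc (hymem j hj.le) (hymem (j + 1) hj) ht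
    have hdx : ∀ i, x (i + 1) - x i = p / N := fun i => by simp only [hx]; push_cast; ring
    have hdy : ∀ i, y (i + 1) - y i = q / N := fun i => by simp only [hy]; push_cast; ring
    have hcell : ∀ i < N, ∀ j < N, ‖rectInt u (x i) (x (i + 1)) (y j) (y (j + 1))‖
        ≤ if (i, j) ∈ S then 2 * ε * ((|p| + |q|) / N) else 0 := by
      intro i hi j hj
      split_ifs with hij
      · have h1 := norm_rectInt_le (ε := ε) (k := u (x i + y j * I))
          (hu.mono (hsub i hi j hj)) ?_
        · rw [hdx, hdy, abs_div, abs_div, abs_of_pos hN', ← add_div] at h1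
          exact h1
        · intro z hz
          rw [← dist_eq_norm]
          refine hδu z (hsub i hi j hj hz) _ (hsub i hi j hj ?_) ?_
          · simp [mem_reProdIm]
          · rw [mem_reProdIm] at hz
            have h1 := abs_sub_left_of_mem_uIcc hz.1
            have h2 := abs_sub_left_of_mem_uIcc hz.2
            rw [hdx, abs_div, abs_of_pos hN'] at h1
            rw [hdy, abs_div, abs_of_pos hN'] at h2
            rw [dist_eq_norm]
            refine (norm_le_abs_re_add_abs_im _).trans ?_
            have e1 : (z - (x i + y j * I)).re = z.re - x i := by simp
            have e2 : (z - (x i + y j * I)).im = z.im - y j := by simp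
            rw [e1, e2]
            refine (add_le_add h1 h2).trans ?_
            rw [← add_div, div_le_iff₀ hN']
            rw [div_lt_iff₀ hδ] at hN
            linarith
      · have h1 : rectInt u (x i) (x (i + 1)) (y j) (y (j + 1)) = 0 := by
          have h2 := integral_boundary_rect_eq_zero_of_differentiableOn u
            (x i + y j * I) (x (i + 1) + y (j + 1) * I) (hd.mono ?_)
          · simpa [rectInt] using h2
          · intro z hz
            have hz' : z ∈ (uIcc (x i) (x (i + 1))) ×ℂ (uIcc (y j) (y (j + 1))) := by simpa using hz
            refine ⟨hsub i hi j hj hz', ?_⟩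
            rintro ⟨t, ht, rfl⟩
            refine hij (hmem i j ⟨t, ht, ?_⟩)
            rw [mem_reProdIm] at hz'
            simp only [hx, hy] at hz'
            obtain ⟨θ, hθ, e1⟩ := exists_of_mem_uIcc_affine (by push_cast; linarith) hz'.1
            obtain ⟨η, hη, e2⟩ := exists_of_mem_uIcc_affine (by push_cast; linarith) hz'.2
            exact ⟨θ, by simpa using hθ, η, by simpa using hη, e1, e2⟩
        rw [h1, norm_zero]
    rw [← hsum]
    calc ‖∑ j ∈ Finset.range N, ∑ i ∈ Finset.range N, rectInt u (x i) (x (i + 1)) (y j) (y (j + 1))‖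
        ≤ ∑ j ∈ Finset.range N, ∑ i ∈ Finset.range N,
          (if (i, j) ∈ S then 2 * ε * ((|p| + |q|) / N) else 0) := by
          refine norm_sum_le_of_le _ fun j hj => norm_sum_le_of_le _ fun i hi => ?_
          exact hcell i (Finset.mem_range.1 hi) j (Finset.mem_range.1 hj)
      _ = ∑ z ∈ (Finset.range N ×ˢ Finset.range N).filter (· ∈ S), 2 * ε * ((|p| + |q|) / N) := by
          rw [Finset.sum_comm, ← Finset.sum_product', Finset.sum_filter]
      _ ≤ S.card * (2 * ε * ((|p| + |q|) / N)) := by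
          rw [Finset.sum_const, nsmul_eq_mul]
          gcongr
          exact fun z hz => (Finset.mem_filter.1 hz).2
      _ ≤ (max C 0 * N) * (2 * ε * ((|p| + |q|) / N)) := by
          gcongr
          exact hS.trans (by gcongr; exact le_max_left _ _)
      _ = ε * (2 * max C 0 * (|p| + |q|)) := by field_simp
  have h0 : ‖rectInt u x₁ x₂ y₁ y₂‖ ≤ 0 := by
    refine le_of_forall_pos_le_add fun η hη => ?_
    set D := 2 * max C 0 * (|p| + |q|)
    have hD : 0 ≤ D := by positivity
    have := main (η / (D + 1)) (by positivity)
    refine this.trans ?_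
    rw [zero_add, div_mul_eq_mul_div, div_le_iff₀ (by positivity)]
    nlinarith
  exact norm_le_zero_iff.1 h0

/-- Painlevé's theorem: rectifiable curves are removable for continuous functions. -/
lemma differentiableOn_of_continuousOn_off_curve {u : ℂ → ℂ} {O : Set ℂ} (hO : IsOpen O)
    {L : NNReal} (hc : LipschitzOnWith L c (Icc 0 1)) (hu : ContinuousOn u O)
    (hd : DifferentiableOn ℂ u (O \ c '' Icc 0 1)) : DifferentiableOn ℂ u O := by
  intro z hz
  obtain ⟨r, hr, hrO⟩ := isOpen_iff.1 hO z hz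
  have hcons : IsConservativeOn u (ball z r) := by
    intro a b hab
    rw [← add_eq_zero_iff_eq_neg, wedgeIntegral_add_wedgeIntegral_eq]
    exact rectInt_eq_zero hc (hu.mono (hab.trans hrO))
      (hd.mono (sdiff_subset_sdiff_left (hab.trans hrO)))
  have hex : IsExactOn u (ball z r) :=
    ⟨_, fun w hw => hcons.hasDerivAt_wedgeIntegral (hu.mono hrO) hw⟩
  exact ((hex.differentiableOn isOpen_ball).differentiableAt
    (ball_mem_nhds z hr)).differentiableWithinAt

/-! ### A removability criterion in terms of area integrals -/

open ENNReal in
lemma lintegral_ball_zero_polar {g : ℂ → ℝ≥0∞} {ρ : ℝ} (hg : AEMeasurable (fun q : ℝ × ℝ => g (q.1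
    * (Real.cos q.2 + Real.sin q.2 * I))) ((volume.restrict (Ioo 0 ρ)).prod (volume.restrict (Ioo
    (-π) π)))) :
    ∫⁻ w in ball 0 ρ, g w = ∫⁻ r in Ioo 0 ρ, ∫⁻ θ in Ioo (-π) π,
      ENNReal.ofReal r * g (r * (Real.cos θ + Real.sin θ * I)) := by
  have hball : MeasurableSet (ball (0 : ℂ) ρ) := measurableSet_ball
  rw [← lintegral_indicator hball, ← Complex.lintegral_comp_polarCoord_symm]
  have e1 : ∀ q : ℝ × ℝ, q ∈ _root_.polarCoord.target →
      ENNReal.ofReal q.1 • (ball (0 : ℂ) ρ).indicator g (Complex.polarCoord.symm q)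
        = (Ioo (0 : ℝ) ρ ×ˢ Ioo (-π) π).indicator (fun q => ENNReal.ofReal q.1 *
          g (q.1 * (Real.cos q.2 + Real.sin q.2 * I))) q := by
    intro q hq
    rw [_root_.polarCoord_target, mem_prod] at hq
    have hq1 : 0 < q.1 := hq.1
    have hn : ‖Complex.polarCoord.symm q‖ = q.1 := by rw [norm_polarCoord_symm, abs_of_pos hq1]
    by_cases h : q.1 < ρ
    · rw [indicator_of_mem, indicator_of_mem, Complex.polarCoord_symm_apply, smul_eq_mul]
      · exact ⟨⟨hq1, h⟩, hq.2⟩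
      · rwa [mem_ball_zero_iff, hn]
    · rw [indicator_of_notMem, indicator_of_notMem, smul_zero]
      · exact fun h' => h h'.1.2
      · rwa [mem_ball_zero_iff, hn]
  rw [setLIntegral_congr_fun _root_.polarCoord.open_target.measurableSet e1,
    setLIntegral_indicator (measurableSet_Ioo.prod measurableSet_Ioo)]
  have e2 : (Ioo (0 : ℝ) ρ ×ˢ Ioo (-π) π) ∩ _root_.polarCoord.target
      = Ioo (0 : ℝ) ρ ×ˢ Ioo (-π) π := by
    rw [inter_eq_left, _root_.polarCoord_target]
    exact prod_mono (fun x hx => hx.1) le_rfl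
  rw [e2, Measure.volume_eq_prod, ← Measure.prod_restrict, lintegral_prod]
  exact (by fun_prop : AEMeasurable (fun q : ℝ × ℝ => ENNReal.ofReal q.1) _).mul hg

open ENNReal in
/-- An analytic function is bounded by its mean over a disc. -/
lemma enorm_mul_volume_ball_le {m : ℂ → ℂ} {w₀ : ℂ} {ρ : ℝ}
    (hm : DifferentiableOn ℂ m (ball w₀ ρ)) :
    ‖m w₀‖ₑ * volume (ball w₀ ρ) ≤ ∫⁻ w in ball w₀ ρ, ‖m w‖ₑ := by
  have htr : ∀ g : ℂ → ℝ≥0∞, ∫⁻ w in ball w₀ ρ, g w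
      = ∫⁻ w in ball 0 ρ, g (w₀ + w) := by
    intro g
    rw [← lintegral_indicator measurableSet_ball, ← lintegral_indicator measurableSet_ball,
      ← lintegral_add_left_eq_self _ w₀]
    refine lintegral_congr fun w => ?_
    simp [indicator]
  rw [← setLIntegral_const, htr, htr, lintegral_ball_zero_polar (by fun_prop),
    lintegral_ball_zero_polar]
  · refine setLIntegral_mono' measurableSet_Ioo fun r hr => ?_
    rw [lintegral_const_mul' _ _ ofReal_ne_top, lintegral_const_mul' _ _ ofReal_ne_top]
    gcongr ENNReal.ofReal r * ?_
    have hcl : closedBall w₀ |r| ⊆ ball w₀ ρ := by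
      rw [abs_of_pos hr.1]
      exact closedBall_subset_ball hr.2
    have hav : Real.circleAverage m w₀ r = m w₀ := by
      refine circleAverage_of_differentiable_on_off_countable countable_empty
        (hm.continuousOn.mono hcl) fun z hz => ?_
      exact hm.differentiableAt (isOpen_ball.mem_nhds
        (hcl (ball_subset_closedBall hz.1)))
    have hcm : ∀ θ : ℝ, w₀ + r * (Real.cos θ + Real.sin θ * I) = circleMap w₀ r θ := by
      intro θ
      rw [circleMap, exp_mul_I, ofReal_cos, ofReal_sin]
    have hint : ∫ θ in (-π)..Real.pi, m (circleMap w₀ r θ)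
        = (2 * π : ℝ) • m w₀ := by
      have hper : Function.Periodic (fun θ => m (circleMap w₀ r θ)) (2 * π) :=
        (periodic_circleMap w₀ r).comp m
      have h1 := hper.intervalIntegral_add_eq (-π) 0
      rw [show -π + 2 * π = π by ring, zero_add] at h1
      rw [h1, ← hav, Real.circleAverage, smul_smul, mul_inv_cancel₀ Real.two_pi_pos.ne', one_smul]
    calc ∫⁻ _ in Ioo (-π) π, ‖m w₀‖ₑ
        = ‖(2 * π : ℝ) • m w₀‖ₑ := by
          rw [setLIntegral_const, Real.volume_Ioo, enorm_smul, Real.enorm_eq_ofReal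
            Real.two_pi_pos.le, mul_comm]
          congr 2
          ring
      _ ≤ ∫⁻ θ in Ioc (-π) π, ‖m (circleMap w₀ r θ)‖ₑ := by
          rw [← hint, intervalIntegral.integral_of_le (by linarith [Real.pi_pos])]
          exact enorm_integral_le_lintegral_enorm _
      _ = _ := by
          rw [setLIntegral_congr Ioo_ae_eq_Ioc.symm]
          simp_rw [hcm]
  · rw [Measure.prod_restrict]
    refine AEStronglyMeasurable.enorm (f := fun q : ℝ × ℝ =>
      m (w₀ + q.1 * (Real.cos q.2 + Real.sin q.2 * I))) ?_
    refine ContinuousOn.aestronglyMeasurable ?_ (measurableSet_Ioo.prod measurableSet_Ioo)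
    refine hm.continuousOn.comp (by fun_prop) fun q hq => ?_
    rw [mem_ball_iff_norm, add_sub_cancel_left, norm_mul, Complex.norm_real,
      Real.norm_of_nonneg hq.1.1.le]
    have : ‖(Real.cos q.2 : ℂ) + Real.sin q.2 * I‖ = 1 := by simpa using norm_cos_add_sin_mul_I q.2
    rw [this, mul_one]
    exact hq.1.2

open ENNReal in
lemma lintegral_inv_enorm_ball_le {ρ : ℝ} :
    ∫⁻ w in ball (0 : ℂ) ρ, ‖w‖ₑ⁻¹ ≤ ENNReal.ofReal (2 * π * ρ) := by
  rw [lintegral_ball_zero_polar]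
  · have h1 : ∀ r ∈ Ioo (0 : ℝ) ρ, (∫⁻ θ in Ioo (-π) π,
        ENNReal.ofReal r * ‖(r * (Real.cos θ + Real.sin θ * I) : ℂ)‖ₑ⁻¹)
        = ENNReal.ofReal (2 * π) := by
      intro r hr
      have h2 : ∀ θ : ℝ, ENNReal.ofReal r * ‖(r * (Real.cos θ + Real.sin θ * I) : ℂ)‖ₑ⁻¹ = 1 := by
        intro θ
        have h3 : ‖(r * (Real.cos θ + Real.sin θ * I) : ℂ)‖ = r := by
          have : ‖(Real.cos θ : ℂ) + Real.sin θ * I‖ = 1 := by simpa using norm_cos_add_sin_mul_I θ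
          rw [norm_mul, this, mul_one, Complex.norm_real, Real.norm_of_nonneg hr.1.le]
        rw [← ofReal_norm, h3]
        exact ENNReal.mul_inv_cancel (by simpa using hr.1) ofReal_ne_top
      simp_rw [h2]
      rw [setLIntegral_const, Real.volume_Ioo, one_mul]
      congr 1
      ring
    rw [setLIntegral_congr_fun measurableSet_Ioo h1, setLIntegral_const, Real.volume_Ioo, sub_zero]
    rcases le_total 0 ρ with h | h
    · rw [← ENNReal.ofReal_mul Real.two_pi_pos.le]
    · simp [ENNReal.ofReal_of_nonpos h]
  · fun_prop

open ENNReal in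
/-- The Newtonian-type kernel `1 / |z - w|` has integral `O(ρ)` over discs of radius `ρ`,
uniformly in `z`. -/
lemma lintegral_inv_enorm_sub_ball_le (z w₀ : ℂ) {ρ : ℝ} (hρ : 0 < ρ) :
    ∫⁻ w in ball w₀ ρ, ‖z - w‖ₑ⁻¹ ≤ ENNReal.ofReal (3 * π * ρ) := by
  have hsub : ball w₀ ρ ⊆ ball z ρ ∪ (ball w₀ ρ \ ball z ρ) := by
    intro x hx
    by_cases h : x ∈ ball z ρ
    · exact Or.inl h
    · exact Or.inr ⟨hx, h⟩
  refine (lintegral_mono_set hsub).trans ((lintegral_union_le _ _ _).trans ?_)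
  have h1 : ∫⁻ w in ball z ρ, ‖z - w‖ₑ⁻¹ ≤ ENNReal.ofReal (2 * π * ρ) := by
    refine le_trans (le_of_eq ?_) lintegral_inv_enorm_ball_le
    rw [← lintegral_indicator measurableSet_ball, ← lintegral_indicator measurableSet_ball,
      ← lintegral_add_left_eq_self _ z]
    refine lintegral_congr fun w => ?_
    simp [indicator]
  have h2 : ∫⁻ w in ball w₀ ρ \ ball z ρ, ‖z - w‖ₑ⁻¹
      ≤ ENNReal.ofReal (π * ρ) := by
    calc ∫⁻ w in ball w₀ ρ \ ball z ρ, ‖z - w‖ₑ⁻¹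
        ≤ ∫⁻ _ in ball w₀ ρ \ ball z ρ, (ENNReal.ofReal ρ)⁻¹ := by
          refine setLIntegral_mono' (measurableSet_ball.diff measurableSet_ball) fun w hw => ?_
          have h3 : ρ ≤ ‖z - w‖ := by
            have := hw.2
            rw [mem_ball, not_lt, dist_comm, dist_eq_norm] at this
            exact this
          rw [← ofReal_norm]
          gcongr
      _ ≤ (ENNReal.ofReal ρ)⁻¹ * volume (ball w₀ ρ) := by
          rw [setLIntegral_const]
          gcongr
          exact sdiff_subset
      _ = ENNReal.ofReal (π * ρ) := by
          rw [volume_ball, sq, mul_assoc, ← mul_assoc (ENNReal.ofReal ρ)⁻¹,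
            ENNReal.inv_mul_cancel (by simpa using hρ) ofReal_ne_top, one_mul,
            ← ENNReal.ofReal_coe_nnreal, ← ENNReal.ofReal_mul hρ.le, mul_comm]
          rfl
  refine (add_le_add h1 h2).trans (le_of_eq ?_)
  rw [← ENNReal.ofReal_add (by positivity) (by positivity)]
  congr 1
  ring

open ENNReal in
/-- An isolated singularity `p` is removable if near `p` the function is bounded, almost everywhere
in the sense of area, by the potential `∫ |z - w|⁻¹ dν(z)` of a finite measure without an atom at
`p`.  By the mean value property `|m(w)| |w - p|` is bounded by the mean of the potential over a
disc of radius comparable to `|w - p|`, times this radius, and this tends to `0`. -/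
lemma exists_tendsto_of_le_potential {m : ℂ → ℂ} {p : ℂ} {ε : ℝ} (hε : 0 < ε)
    (hm : DifferentiableOn ℂ m (ball p ε \ {p})) (ν : Measure ℂ) [IsFiniteMeasure ν]
    (hν : ν {p} = 0) (C : ℝ) (hb : ∀ᵐ w, w ∈ ball p ε → ‖m w‖ₑ ≤ ENNReal.ofReal C * (1 + ∫⁻ z, ‖z -
    w‖ₑ⁻¹ ∂ν)) : ∃ l, Tendsto m (𝓝[≠] p) (𝓝 l) := by
  -- the normalized potential of the disc of radius `ρ w = |w - p| / 2` around `w`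
  set ρ : ℂ → ℝ := fun w => dist w p / 2 with hρ
  have hρpos : ∀ w ≠ p, 0 < ρ w := fun w hw => half_pos (dist_pos.2 hw)
  set Θ : ℂ → ℂ → ℝ≥0∞ := fun w z =>
    (ENNReal.ofReal (ρ w))⁻¹ * ∫⁻ y in ball w (ρ w), ‖z - y‖ₑ⁻¹ with hΘ
  have hΘmeas : ∀ w, Measurable (Θ w) := by
    intro w
    refine Measurable.const_mul ?_ _
    exact Measurable.lintegral_prod_right' (f := fun q : ℂ × ℂ => ‖q.1 - q.2‖ₑ⁻¹) (by fun_prop)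
  have hΘb : ∀ w ≠ p, ∀ z, Θ w z ≤ ENNReal.ofReal (3 * π) := by
    intro w hw z
    calc Θ w z ≤ (ENNReal.ofReal (ρ w))⁻¹ * ENNReal.ofReal (3 * π * ρ w) := by
          simp only [hΘ]; gcongr; exact lintegral_inv_enorm_sub_ball_le z w (hρpos w hw)
      _ = ENNReal.ofReal (3 * π) := by
          rw [ENNReal.ofReal_mul (by positivity), mul_comm, mul_assoc,
            ENNReal.mul_inv_cancel (by simpa using hρpos w hw) ofReal_ne_top, mul_one]
  have hρ0 : Tendsto ρ (𝓝[≠] p) (𝓝 0) := by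
    have : Continuous ρ := by simp only [hρ]; fun_prop
    have h := this.tendsto p
    simp only [hρ, dist_self, zero_div] at h
    exact h.mono_left nhdsWithin_le_nhds
  have hvol : ∀ w ≠ p, (ENNReal.ofReal (ρ w))⁻¹ * volume (ball w (ρ w))
      = ENNReal.ofReal (π * ρ w) := by
    intro w hw
    have h0 := hρpos w hw
    rw [volume_ball, sq, mul_assoc, ← mul_assoc (ENNReal.ofReal (ρ w))⁻¹,
      ENNReal.inv_mul_cancel (by simpa using h0) ofReal_ne_top, one_mul,
      ← ENNReal.ofReal_coe_nnreal, ← ENNReal.ofReal_mul h0.le, mul_comm]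
    rfl
  have hΘlim : ∀ z ≠ p, Tendsto (fun w => Θ w z) (𝓝[≠] p) (𝓝 0) := by
    intro z hz
    set d := dist z p with hd
    have hd0 : 0 < d := dist_pos.2 hz
    have hup : Tendsto (fun w => (ENNReal.ofReal (d / 2))⁻¹ * ENNReal.ofReal (π * ρ w))
        (𝓝[≠] p) (𝓝 0) := by
      have h1 : Tendsto (fun w => ENNReal.ofReal (π * ρ w)) (𝓝[≠] p) (𝓝 0) := by
        have := ENNReal.tendsto_ofReal (hρ0.const_mul π)
        simpa using this
      have h2 := ENNReal.Tendsto.const_mul (a := (ENNReal.ofReal (d / 2))⁻¹) h1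
        (Or.inr (ENNReal.inv_ne_top.2 (by simpa using hd0)))
      simpa using h2
    refine tendsto_of_tendsto_of_tendsto_of_le_of_le' tendsto_const_nhds hup
      (Eventually.of_forall fun _ => zero_le) ?_
    have hev : ∀ᶠ w in 𝓝[≠] p, dist w p < d / 3 :=
      nhdsWithin_le_nhds (ball_mem_nhds p (by positivity))
    filter_upwards [hev, self_mem_nhdsWithin] with w hw hwp
    rw [← hvol w hwp, ← mul_assoc, mul_comm (ENNReal.ofReal (d / 2))⁻¹, mul_assoc]
    simp only [hΘ]
    gcongr
    rw [← setLIntegral_const]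
    refine setLIntegral_mono' measurableSet_ball fun y hy => ?_
    have h3 : d / 2 ≤ ‖z - y‖ := by
      have h4 := dist_triangle4 z y w p
      have h5 := mem_ball.1 hy
      simp only [hρ] at h5
      rw [dist_eq_norm z y] at h4
      linarith
    rw [← ofReal_norm]
    gcongr
  have hlim : Tendsto (fun w => ∫⁻ z, Θ w z ∂ν) (𝓝[≠] p) (𝓝 0) := by
    have h1 := tendsto_lintegral_filter_of_dominated_convergence (μ := ν) (l := 𝓝[≠] p)
      (F := Θ) (f := fun _ => 0) (fun _ => ENNReal.ofReal (3 * π))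
      (Eventually.of_forall hΘmeas) ?_ ?_ ?_
    · simpa using h1
    · filter_upwards [self_mem_nhdsWithin] with w hw
      exact Eventually.of_forall fun z => hΘb w hw z
    · rw [lintegral_const]
      exact ENNReal.mul_ne_top ofReal_ne_top (measure_ne_top _ _)
    · have : ∀ᵐ z ∂ν, z ≠ p := by
        rw [ae_iff]
        simpa using hν
      filter_upwards [this] with z hz using hΘlim z hz
  -- the mean value estimate
  have hmv : ∀ᶠ w in 𝓝[≠] p, ‖m w‖ₑ * ENNReal.ofReal (π * ρ w)
      ≤ ENNReal.ofReal C * (ENNReal.ofReal (π * ρ w) + ∫⁻ z, Θ w z ∂ν) := by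
    have hev : ∀ᶠ w in 𝓝[≠] p, dist w p < ε / 2 :=
      nhdsWithin_le_nhds (ball_mem_nhds p (by positivity))
    filter_upwards [hev, self_mem_nhdsWithin] with w hw hwp
    have hsub : ball w (ρ w) ⊆ ball p ε \ {p} := by
      intro y hy
      have h5 := mem_ball.1 hy
      simp only [hρ] at h5
      have h6 : 0 < dist w p := dist_pos.2 hwp
      refine ⟨mem_ball.2 ?_, ?_⟩
      · linarith [dist_triangle y w p]
      · rintro rfl
        rw [dist_comm] at h5
        linarith
    have h1 := enorm_mul_volume_ball_le (hm.mono hsub)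
    have h2 : ∫⁻ y in ball w (ρ w), ‖m y‖ₑ ≤ ∫⁻ y in ball w (ρ w),
        ENNReal.ofReal C * (1 + ∫⁻ z, ‖z - y‖ₑ⁻¹ ∂ν) := by
      refine lintegral_mono_ae ?_
      rw [ae_restrict_iff' measurableSet_ball]
      filter_upwards [hb] with y hy hy'
      exact hy (hsub hy').1
    have h3 : ∫⁻ y in ball w (ρ w), ENNReal.ofReal C * (1 + ∫⁻ z, ‖z - y‖ₑ⁻¹ ∂ν)
        = ENNReal.ofReal C * (volume (ball w (ρ w))
          + ∫⁻ z, (∫⁻ y in ball w (ρ w), ‖z - y‖ₑ⁻¹) ∂ν) := by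
      rw [lintegral_const_mul' _ _ ofReal_ne_top, lintegral_add_left measurable_const,
        setLIntegral_one, lintegral_lintegral_swap]
      exact (by fun_prop : Measurable (fun q : ℂ × ℂ => ‖q.2 - q.1‖ₑ⁻¹)).aemeasurable
    have h4 := h1.trans (h2.trans h3.le)
    calc ‖m w‖ₑ * ENNReal.ofReal (π * ρ w)
        = (ENNReal.ofReal (ρ w))⁻¹ * (‖m w‖ₑ * volume (ball w (ρ w))) := by rw [← hvol w hwp]; ring
      _ ≤ (ENNReal.ofReal (ρ w))⁻¹ * (ENNReal.ofReal C * (volume (ball w (ρ w))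
          + ∫⁻ z, (∫⁻ y in ball w (ρ w), ‖z - y‖ₑ⁻¹) ∂ν)) := by gcongr
      _ = ENNReal.ofReal C * ((ENNReal.ofReal (ρ w))⁻¹ * volume (ball w (ρ w))
          + (ENNReal.ofReal (ρ w))⁻¹ * ∫⁻ z, (∫⁻ y in ball w (ρ w), ‖z - y‖ₑ⁻¹) ∂ν) := by
          ring
      _ = _ := by
          rw [hvol w hwp, ← lintegral_const_mul']
          exact ENNReal.inv_ne_top.2 (by simpa using hρpos w hwp)
  have hz : Tendsto (fun w => ‖m w‖ₑ * ENNReal.ofReal (π * ρ w)) (𝓝[≠] p) (𝓝 0) := by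
    have h1 : Tendsto (fun w => ENNReal.ofReal (π * ρ w)) (𝓝[≠] p) (𝓝 0) := by
      have := ENNReal.tendsto_ofReal (hρ0.const_mul π)
      simpa using this
    have h2 := ENNReal.Tendsto.const_mul (a := ENNReal.ofReal C) (h1.add hlim)
      (Or.inr ofReal_ne_top)
    rw [add_zero, mul_zero] at h2
    exact tendsto_of_tendsto_of_tendsto_of_le_of_le' tendsto_const_nhds h2
      (Eventually.of_forall fun _ => zero_le) hmv
  have hlo : m =o[𝓝[≠] p] fun w => (w - p)⁻¹ := by
    refine (Asymptotics.isLittleO_iff_tendsto' ?_).2 ?_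
    · filter_upwards [self_mem_nhdsWithin] with w hw h
      exact absurd (inv_eq_zero.1 h) (sub_ne_zero.2 hw)
    · rw [tendsto_zero_iff_norm_tendsto_zero]
      have h1 := (ENNReal.tendsto_toReal zero_ne_top).comp hz
      have h2 := h1.const_mul (2 / π)
      simp only [ENNReal.toReal_zero, mul_zero] at h2
      refine h2.congr' ?_
      filter_upwards [self_mem_nhdsWithin] with w hw
      have h0 := hρpos w hw
      simp only [Function.comp, ENNReal.toReal_mul, toReal_enorm]
      rw [ENNReal.toReal_ofReal (by positivity)]
      simp only [hρ, dist_eq_norm, div_inv_eq_mul]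
      rw [norm_mul]
      field_simp
  have hd : ∀ᶠ z in 𝓝[≠] p, DifferentiableAt ℂ m z := by
    have ho : IsOpen (ball p ε \ {p}) := isOpen_ball.sdiff isClosed_singleton
    have : ball p ε \ {p} ∈ 𝓝[≠] p :=
      inter_mem (nhdsWithin_le_nhds (ball_mem_nhds p hε)) self_mem_nhdsWithin
    filter_upwards [this] with z hz using hm.differentiableAt (ho.mem_nhds hz)
  refine ⟨_, tendsto_limUnder_of_differentiable_on_punctured_nhds_of_isLittleO hd ?_⟩
  -- a constant is negligible against the pole
  refine hlo.sub ?_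
  refine (Asymptotics.isLittleO_iff_tendsto' ?_).2 ?_
  · filter_upwards [self_mem_nhdsWithin] with w hw h
    exact absurd (inv_eq_zero.1 h) (sub_ne_zero.2 hw)
  · have : Continuous fun w : ℂ => m p * (w - p) := by fun_prop
    have h := (this.tendsto p).mono_left (nhdsWithin_le_nhds (s := {p}ᶜ))
    simpa [div_inv_eq_mul] using h

/-! ### Contours and the radical -/

/-- A contour that is moreover the image of the segment `[-1, 1]` under a homeomorphism of the
plane. -/
structure IsTameContour (α : ℂ) (μ : ℝ) (γ : Set ℂ) : Prop where
  contour : IsContour α μ γ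
  homeo : ∃ Φ : ℂ ≃ₜ ℂ, Φ '' ((fun s : ℝ => (s : ℂ)) '' Icc (-1) 1) = γ

/-- The square root given by the principal logarithm. -/
def csqrt (w : ℂ) : ℂ := Complex.exp (log w / 2)

lemma csqrt_sq (hw : w ≠ 0) : csqrt w ^ 2 = w := by
  rw [csqrt, ← exp_nat_mul]
  push_cast
  rw [mul_div_cancel₀ _ two_ne_zero, exp_log hw]

lemma csqrt_ne_zero (w : ℂ) : csqrt w ≠ 0 := exp_ne_zero _

@[simp] theorem csqrt_one : csqrt 1 = 1 := by simp [csqrt]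

lemma differentiableAt_csqrt (hw : w ∈ slitPlane) : DifferentiableAt ℂ csqrt w :=
  ((differentiableAt_id.clog hw).div_const 2).cexp

lemma hasDerivAt_csqrt (hw : w ∈ slitPlane) : HasDerivAt csqrt (1 / (2 * csqrt w)) w := by
  have h1 := ((hasDerivAt_log hw).div_const 2).cexp
  refine h1.congr_deriv ?_
  have h0 : w ≠ 0 := slitPlane_ne_zero hw
  have h2 := csqrt_sq h0
  have h3 := csqrt_ne_zero w
  change csqrt w * (w⁻¹ / 2) = _
  field_simp
  rw [h2]

lemma csqrt_conj (hw : w ∈ slitPlane) : csqrt (conj w) = conj (csqrt w) := by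
  rw [csqrt, csqrt, log_conj _ (slitPlane_arg_ne_pi hw), ← exp_conj, map_div₀, conj_ofNat]

lemma IsContour.isCompact (h : IsContour α μ γ) : IsCompact γ := by
  obtain ⟨-, ⟨c, ⟨L, hL⟩, -, -, -, hc⟩, -⟩ := h
  rw [← hc]
  exact isCompact_Icc.image_of_continuousOn hL.continuousOn

lemma IsContour.left_mem (h : IsContour α μ γ) : α ∈ γ := by
  obtain ⟨-, ⟨c, -, -, -, h1, hc⟩, -⟩ := h
  rw [← hc, ← h1]
  exact mem_image_of_mem _ (by simp)

lemma IsContour.conj_mem (h : IsContour α μ γ) : conj z ∈ γ ↔ z ∈ γ :=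
  ⟨fun hz => by simpa using h.2.2.1 _ hz, h.2.2.1 z⟩

lemma IsContour.ne_conj (h : IsContour α μ γ) : α ≠ conj α := by
  intro h'
  have h1 := h.1
  have := congrArg Complex.im h'
  simp only [conj_im] at this
  linarith

lemma IsContour.eq_of_im_eq_zero (h : IsContour α μ γ) (hz : z ∈ γ) (him : z.im = 0) :
    z = (μ : ℂ) / 2 := by
  by_contra hne
  exact (h.2.2.2.2 z hz hne).1 him

lemma AbsolutelyContinuousOnInterval.const {k : ℂ} {u : ℝ → ℂ}
    (hu : AbsolutelyContinuousOnInterval u 0 1) (hd : ∀ᵐ x, x ∈ uIcc (0 : ℝ) 1 → HasDerivAt u 0 x)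
    (h0 : u 0 = k) : u 1 = k := by
  obtain ⟨C, hC⟩ := hu.const_of_ae_hasDerivAt_zero hd
  rw [hC 1 right_mem_uIcc, ← h0, hC 0 left_mem_uIcc]

/-- The continuous logarithm along a Lipschitz curve `c` from `c 0` to `c 1`, as a function of the
point `z` off the curve: `exp (∫_c dζ / (ζ - z)) = (z - c 1) / (z - c 0)`. -/
lemma exp_curveInt_inv {L : NNReal} (hc : LipschitzOnWith L c (Icc 0 1)) (hz : z ∉ c '' Icc 0 1) :
    Complex.exp (curveInt c (fun ζ => 1 / (ζ - z))) = (z - c 1) / (z - c 0) := by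
  have hne : ∀ s ∈ Icc 0 1, c s - z ≠ 0 := fun s hs h =>
    hz ⟨s, hs, sub_eq_zero.1 h⟩
  have hcc := hc.continuousOn
  obtain ⟨C, hC⟩ := isCompact_Icc.exists_bound_of_continuousOn
    (((hcc.sub continuousOn_const).inv₀ hne) : ContinuousOn (fun s => (c s - z)⁻¹) (Icc 0 1))
  obtain ⟨K, hK0, hK⟩ := exists_deriv_bound ⟨L, hc⟩
  have hC0 : 0 ≤ C := (norm_nonneg _).trans (hC 0 (by simp))
  set g : ℝ → ℂ := fun s => 1 / (c s - z) * deriv c s with hg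
  have hgb : ∀ s ∈ Ioo 0 1, ‖g s‖ ≤ C * K := by
    intro s hs
    rw [hg, norm_mul, one_div]
    exact mul_le_mul (hC s (Ioo_subset_Icc_self hs)) (hK s hs) (norm_nonneg _) hC0
  have hgi : IntervalIntegrable g volume 0 1 := by
    rw [intervalIntegrable_iff_integrableOn_Ioc_of_le zero_le_one]
    refine Integrable.of_bound (C := C * K) ?_ ?_
    · refine AEStronglyMeasurable.mul ?_
        (measurable_deriv c).stronglyMeasurable.aestronglyMeasurable
      rw [restrict_Ioc_eq_Ioo]
      refine ContinuousOn.aestronglyMeasurable ?_ measurableSet_Ioo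
      exact continuousOn_const.div ((hcc.mono Ioo_subset_Icc_self).sub continuousOn_const)
        fun s hs => hne s (Ioo_subset_Icc_self hs)
    · filter_upwards [ae_mem_Ioo] with s hs using hgb s hs
  have hgi' : ∀ a ∈ Icc 0 1, ∀ b ∈ Icc 0 1, IntervalIntegrable g volume a b := by
    intro a ha b hb
    refine hgi.mono_set ?_
    rw [uIcc_of_le zero_le_one]
    exact ordConnected_Icc.uIcc_subset ha hb
  set ℓ : ℝ → ℂ := fun t => ∫ s in (0 : ℝ)..t, g s with hℓ
  have hae : ∀ a ∈ Icc 0 1, ∀ b ∈ Icc 0 1, ‖∫ s in a..b, g s‖ ≤ C * K * |b - a| := by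
    intro a ha b hb
    refine intervalIntegral.norm_integral_le_of_norm_le_const_ae ?_
    have h0 := ae_mem_Ioo
    rw [ae_restrict_iff' measurableSet_Ioc] at h0
    filter_upwards [h0] with s hs hs'
    refine hgb s (hs ?_)
    have h1 := hs'
    rw [mem_uIoc] at h1
    rcases h1 with h1 | h1
    · exact ⟨ha.1.trans_lt h1.1, h1.2.trans hb.2⟩
    · exact ⟨hb.1.trans_lt h1.1, h1.2.trans ha.2⟩
  have hℓlip : LipschitzOnWith ⟨C * K, mul_nonneg hC0 hK0⟩ ℓ (Icc 0 1) := by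
    refine LipschitzOnWith.of_dist_le_mul fun a ha b hb => ?_
    rw [dist_eq_norm, hℓ, intervalIntegral.integral_interval_sub_left (hgi' _ (by simp) _ ha)
      (hgi' _ (by simp) _ hb)]
    refine (hae b hb a ha).trans ?_
    rw [Real.dist_eq]
    rfl
  have hexplip : ∃ M : NNReal, LipschitzOnWith M (fun t => Complex.exp (-ℓ t)) (Icc 0 1) := by
    have h1 : LipschitzOnWith ⟨Real.exp (C * K), (Real.exp_pos _).le⟩ Complex.exp
        (closedBall 0 (C * K)) := by
      refine (convex_closedBall 0 _).lipschitzOnWith_of_nnnorm_deriv_le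
        (fun x _ => differentiableAt_exp) fun x hx => ?_
      show ‖deriv Complex.exp x‖ ≤ Real.exp (C * K)
      rw [Complex.deriv_exp, norm_exp]
      refine Real.exp_le_exp.2 ((re_le_norm x).trans ?_)
      simpa using hx
    refine ⟨_, h1.comp (g := Complex.exp) (f := fun t => -ℓ t) (K := ⟨C * K, mul_nonneg hC0 hK0⟩)
      (LipschitzOnWith.of_dist_le_mul fun a ha b hb => ?_) fun t ht => ?_⟩
    · rw [dist_neg_neg]
      exact hℓlip.dist_le_mul a ha b hb
    · rw [mem_closedBall_zero_iff, norm_neg]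
      refine (hae 0 (by simp) t ht).trans ?_
      rw [sub_zero, abs_of_nonneg ht.1]
      nlinarith [ht.2, mul_nonneg hC0 hK0]
  obtain ⟨M, hM⟩ := hexplip
  have hu1 : AbsolutelyContinuousOnInterval (fun t => Complex.exp (-ℓ t)) 0 1 := by
    refine LipschitzOnWith.absolutelyContinuousOnInterval (K := M) ?_
    rwa [uIcc_of_le zero_le_one]
  have hu2 : AbsolutelyContinuousOnInterval (fun t => c t - z) 0 1 := by
    refine LipschitzOnWith.absolutelyContinuousOnInterval (K := L) ?_
    rw [uIcc_of_le zero_le_one]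
    refine LipschitzOnWith.of_dist_le_mul fun a ha b hb => ?_
    rw [dist_sub_right]
    exact hc.dist_le_mul a ha b hb
  have hu := hu1.smul hu2
  have hder : ∀ᵐ x, x ∈ uIcc (0 : ℝ) 1 →
      HasDerivAt ((fun t => Complex.exp (-ℓ t)) • (fun t => c t - z)) 0 x := by
    have h0 := ae_mem_Ioo
    rw [restrict_Ioc_eq_Ioo] at h0
    have hb : ∀ᵐ x : ℝ, x ≠ 0 ∧ x ≠ 1 := by
      have h1 : ∀ᵐ x : ℝ, x ≠ 0 := by simp [ae_iff]
      have h2 : ∀ᵐ x : ℝ, x ≠ 1 := by simp [ae_iff]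
      exact h1.and h2
    filter_upwards [hgi.ae_hasDerivAt_integral, hc.ae_differentiableWithinAt_of_mem_real, hb]
      with x h1 h2 h3 hx
    have hx' : x ∈ Icc 0 1 := by rwa [uIcc_of_le zero_le_one] at hx
    have hx1 : Icc (0 : ℝ) 1 ∈ 𝓝 x := Icc_mem_nhds (lt_of_le_of_ne hx'.1 h3.1.symm)
      (lt_of_le_of_ne hx'.2 h3.2)
    have hd1 : HasDerivAt ℓ (g x) x := h1 hx 0 left_mem_uIcc
    have hd2 : HasDerivAt c (deriv c x) x := ((h2 hx').differentiableAt hx1).hasDerivAt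
    have hd3 := hd1.neg.cexp.smul (hd2.sub_const z)
    refine hd3.congr_deriv ?_
    simp only [smul_eq_mul, hg, Pi.neg_apply]
    have := hne x hx'
    field_simp
    ring
  have hfin := AbsolutelyContinuousOnInterval.const hu hder rfl
  simp only [Pi.smul_apply', smul_eq_mul] at hfin
  have h00 : ℓ 0 = 0 := by simp [hℓ]
  rw [h00, neg_zero, exp_zero, one_mul] at hfin
  have h1 : curveInt c (fun ζ => 1 / (ζ - z)) = ℓ 1 := rfl
  rw [h1, eq_div_iff (by rw [← neg_sub]; exact neg_ne_zero.2 (hne 0 (by simp))), ← neg_sub, ← hfin,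
    exp_neg]
  have := exp_ne_zero (ℓ 1)
  field_simp
  ring

/-- The radical is `-(z - ᾱ) exp (½ ∫_γ dζ/(ζ - z))`. -/
lemma IsContour.exists_isRadical (h : IsContour α μ γ) : ∃ R, IsRadical γ α R := by
  obtain ⟨-, ⟨c, ⟨L, hL⟩, -, h0, h1, hc⟩, -⟩ := id h
  set ℓ : ℂ → ℂ := fun z => curveInt c (fun ζ => 1 / (ζ - z)) with hℓ
  have hℓd : DifferentiableOn ℂ ℓ γᶜ := by
    have := differentiableOn_cauchyInt (c := c) ⟨L, hL⟩ (g := fun _ => 1) continuousOn_const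
      ⟨1, by simp⟩
    rwa [hc] at this
  have hℓ0 : Tendsto ℓ (cocompact ℂ) (𝓝 0) :=
    tendsto_cauchyInt_cocompact (c := c) ⟨L, hL⟩ (g := fun _ => 1) ⟨1, by simp⟩
  have hα : conj α ∈ γ := h.conj_mem.2 h.left_mem
  refine ⟨fun z => -(z - conj α) * Complex.exp (ℓ z / 2), ?_, ?_, ?_⟩
  · exact DifferentiableOn.mul (by fun_prop) (hℓd.div_const 2).cexp
  · intro z hz
    have h2 := exp_curveInt_inv hL (z := z) (by rw [hc]; exact hz)
    have h3 : z - conj α ≠ 0 := sub_ne_zero.2 fun h => hz (h ▸ hα)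
    rw [mul_pow, ← exp_nat_mul]
    push_cast
    rw [mul_div_cancel₀ _ two_ne_zero, hℓ]
    simp only
    rw [h2, h0, h1]
    field_simp
  · have h2 : Tendsto (fun z : ℂ => 1 - conj α * z⁻¹) (cocompact ℂ) (𝓝 1) := by
      simpa using tendsto_const_nhds.sub ((tendsto_inv₀_cobounded (α := ℂ)).const_mul _ |>.mono_left
        (cobounded_eq_cocompact (α := ℂ)).ge)
    have h3 : Tendsto (fun z => Complex.exp (ℓ z / 2)) (cocompact ℂ) (𝓝 1) := by
      have := (continuous_exp.tendsto (0 / 2)).comp (hℓ0.div_const 2)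
      simpa [Function.comp_def] using this
    have h4 := (h2.mul h3).neg
    rw [one_mul] at h4
    refine h4.congr' ?_
    have h5 : ∀ᶠ z : ℂ in cocompact ℂ, z ≠ 0 := by
      have := (isCompact_singleton (x := (0 : ℂ))).compl_mem_cocompact
      filter_upwards [this] with z hz using hz
    filter_upwards [h5] with z hz
    field_simp

lemma IsContour.isRadical (h : IsContour α μ γ) : IsRadical γ α (radical γ α) :=
  Classical.epsilon_spec h.exists_isRadical

lemma isPreconnected_compl_segment : IsPreconnected ((fun s : ℝ => (s : ℂ)) '' Icc (-1) 1)ᶜ := by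
  have e : ((fun s : ℝ => (s : ℂ)) '' Icc (-1) 1)ᶜ
      = (({z : ℂ | 0 < z.im} ∪ {z : ℂ | 1 < z.re}) ∪ {z : ℂ | z.im < 0}) ∪ {z : ℂ | z.re < -1} := by
    ext z
    simp only [mem_compl_iff, mem_image, mem_Icc, mem_union, mem_ofPred_eq, not_exists, not_and]
    constructor
    · intro h
      by_contra hcon
      push Not at hcon
      refine h z.re ⟨by linarith, by linarith⟩ (Complex.ext rfl ?_)
      rw [ofReal_im]
      linarith
    · rintro h s hs rfl
      simp only [ofReal_im, ofReal_re, lt_irrefl, false_or, or_false] at h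
      rcases h with h | h <;> linarith [hs.1, hs.2]
  rw [e]
  refine IsPreconnected.union (-2 - I) ?_ ?_ (IsPreconnected.union (2 - I) ?_ ?_
    (IsPreconnected.union (2 + I) ?_ ?_ ?_ ?_) ?_) ?_
  · right; simp
  · simp
  · right; simp
  · simp
  · simp
  · simp
  · exact (convex_halfSpace_im_gt 0).isPreconnected
  · exact (convex_halfSpace_re_gt 1).isPreconnected
  · exact (convex_halfSpace_im_lt 0).isPreconnected
  · exact (convex_halfSpace_re_lt (-1)).isPreconnected

lemma IsTameContour.isPreconnected_compl (h : IsTameContour α μ γ) : IsPreconnected γᶜ := by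
  obtain ⟨Φ, hΦ⟩ := h.homeo
  rw [← hΦ, ← Φ.image_compl]
  exact isPreconnected_compl_segment.image _ Φ.continuous.continuousOn

lemma IsRadical.ne_zero (h : IsContour α μ γ) {R : ℂ → ℂ} (hR : IsRadical γ α R) (hz : z ∉ γ) :
    R z ≠ 0 := by
  intro h0
  have h1 := hR.2.1 z hz
  rw [h0, zero_pow two_ne_zero] at h1
  rcases mul_eq_zero.1 h1.symm with h2 | h2
  · exact hz (sub_eq_zero.1 h2 ▸ h.left_mem)
  · exact hz (sub_eq_zero.1 h2 ▸ h.conj_mem.2 h.left_mem)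

/-- The radical is unique since the contour does not separate the plane. -/
lemma IsTameContour.isRadical_unique (h : IsTameContour α μ γ) {R₁ R₂ : ℂ → ℂ}
    (h₁ : IsRadical γ α R₁) (h₂ : IsRadical γ α R₂) : EqOn R₁ R₂ γᶜ := by
  have hne : ∀ {z}, z ∈ γᶜ → R₂ z ≠ 0 := fun hz => h₂.ne_zero h.contour hz
  rcases h.isPreconnected_compl.eq_or_eq_neg_of_sq_eq h₁.1.continuousOn h₂.1.continuousOn
    (fun z hz => by simp [h₁.2.1 z hz, h₂.2.1 z hz]) hne with h3 | h3
  · exact h3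
  · exfalso
    have h4 : Tendsto (fun z => R₁ z / z) (cocompact ℂ) (𝓝 1) := by
      have := h₂.2.2.neg
      rw [neg_neg] at this
      refine this.congr' ?_
      filter_upwards [h.contour.isCompact.compl_mem_cocompact] with z hz
      rw [h3 hz, Pi.neg_apply, neg_div]
    have h5 := tendsto_nhds_unique h4 h₁.2.2
    norm_num at h5

lemma IsTameContour.radical_eq (h : IsTameContour α μ γ) {R : ℂ → ℂ} (hR : IsRadical γ α R)
    (hz : z ∉ γ) : radical γ α z = R z :=
  h.isRadical_unique h.contour.isRadical hR hz

lemma tendsto_conj_cocompact : Tendsto (fun z : ℂ => conj z) (cocompact ℂ) (cocompact ℂ) :=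
  conjCLE.toHomeomorph.isClosedEmbedding.tendsto_cocompact

lemma IsTameContour.radical_conj (h : IsTameContour α μ γ) (hz : z ∉ γ) :
    radical γ α (conj z) = conj (radical γ α z) := by
  have hR := h.contour.isRadical
  have hz' : conj z ∉ γ := fun h' => hz (h.contour.conj_mem.1 h')
  have : IsRadical γ α (fun w => conj (radical γ α (conj w))) := by
    refine ⟨?_, ?_, ?_⟩
    · intro w hw
      have hw' : conj w ∈ γᶜ := fun h' => hw (h.contour.conj_mem.1 h')
      have h1 := hR.1.differentiableAt (h.contour.isCompact.isClosed.isOpen_compl.mem_nhds hw')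
      exact (differentiableAt_conj_conj_iff.2 h1).differentiableWithinAt
    · intro w hw
      have hw' : conj w ∈ γᶜ := fun h' => hw (h.contour.conj_mem.1 h')
      have h1 := congrArg (conj) (hR.2.1 _ hw')
      simp only [map_pow, map_mul, map_sub, conj_conj] at h1
      rw [h1, mul_comm]
    · have h1 := (continuous_conj.tendsto (-1)).comp (hR.2.2.comp tendsto_conj_cocompact)
      simpa [Function.comp_def] using h1
  have h2 := h.radical_eq this hz'
  simpa using h2

/-! ### The two sides of a contour -/

variable {Φ : ℂ ≃ₜ ℂ}

/-- The segment `[-1, 1]` of the real axis. -/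
local notation "𝕀" => ((fun s : ℝ => (s : ℂ)) '' Icc (-1) 1)

/-- The open upper half plane. -/
local notation "ℍ₊" => (Set.ofPred fun z : ℂ => 0 < z.im)

/-- The open lower half plane. -/
local notation "ℍ₋" => (Set.ofPred fun z : ℂ => z.im < 0)

/-- A homeomorphism that straightens a contour maps end points to end points. -/
lemma IsContour.homeo_endpoints (h : IsContour α μ γ)
    (hΦ : Φ '' 𝕀 = γ) :
    (Φ ((-1 : ℝ) : ℂ) = conj α ∧ Φ ((1 : ℝ) : ℂ) = α) ∨
      (Φ ((-1 : ℝ) : ℂ) = α ∧ Φ ((1 : ℝ) : ℂ) = conj α) := by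
  obtain ⟨-, ⟨c, ⟨L, hL⟩, hinj, h0, h1, hc⟩, -⟩ := h
  have key : ∀ t ∈ Icc 0 1, ∃ s ∈ Icc (-1 : ℝ) 1, Φ.symm (c t) = (s : ℂ) := by
    intro t ht
    have : c t ∈ γ := hc ▸ mem_image_of_mem c ht
    rw [← hΦ] at this
    obtain ⟨_, ⟨s, hs, rfl⟩, h⟩ := this
    exact ⟨s, hs, by rw [← h, Φ.symm_apply_apply]⟩
  set g : ℝ → ℝ := fun t => (Φ.symm (c t)).re with hg
  have hΦg : ∀ t ∈ Icc 0 1, Φ (g t : ℂ) = c t := by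
    intro t ht
    obtain ⟨s, -, h⟩ := key t ht
    simp only [hg]
    rw [h, ofReal_re, ← h, Φ.apply_symm_apply]
  have hmem : ∀ t ∈ Icc 0 1, g t ∈ Icc (-1 : ℝ) 1 := by
    intro t ht
    obtain ⟨s, hs, h⟩ := key t ht
    simp only [hg]
    rwa [h, ofReal_re]
  have hsurj : ∀ s ∈ Icc (-1 : ℝ) 1, ∃ t ∈ Icc 0 1, g t = s := by
    intro s hs
    have : Φ s ∈ γ := hΦ ▸ mem_image_of_mem Φ (mem_image_of_mem _ hs)
    rw [← hc] at this
    obtain ⟨t, ht, h⟩ := this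
    exact ⟨t, ht, by simp only [hg]; rw [h, Φ.symm_apply_apply, ofReal_re]⟩
  have hgc : ContinuousOn g (Icc 0 1) :=
    continuous_re.comp_continuousOn (Φ.symm.continuous.comp_continuousOn hL.continuousOn)
  have hgi : InjOn g (Icc 0 1) := by
    intro a ha b hb hab
    apply hinj ha hb
    rw [← hΦg a ha, ← hΦg b hb, hab]
  obtain ⟨t₁, ht₁, e₁⟩ := hsurj (-1) (by simp)
  obtain ⟨t₂, ht₂, e₂⟩ := hsurj 1 (by simp)
  have m0 := hmem 0 (by simp)
  have m1 := hmem 1 (by simp)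
  have E0 := hΦg 0 (by simp)
  have E1 := hΦg 1 (by simp)
  rw [h0] at E0
  rw [h1] at E1
  rcases ContinuousOn.strictMonoOn_of_injOn_Icc' zero_le_one hgc hgi with hm | hm
  · left
    have a1 := hm.monotoneOn (by simp) ht₁ ht₁.1
    have a2 := hm.monotoneOn ht₂ (by simp) ht₂.2
    rw [show g 0 = -1 by linarith [m0.1]] at E0
    rw [show g 1 = 1 by linarith [m1.2]] at E1
    exact ⟨E0, E1⟩
  · right
    have a1 := hm.antitoneOn ht₁ (by simp) ht₁.2
    have a2 := hm.antitoneOn (by simp) ht₂ ht₂.1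
    rw [show g 0 = 1 by linarith [m0.2]] at E0
    rw [show g 1 = -1 by linarith [m1.1]] at E1
    exact ⟨E1, E0⟩

lemma IsContour.homeo_ne (h : IsContour α μ γ)
    (hΦ : Φ '' 𝕀 = γ) (hs : s ∈ Ioo (-1 : ℝ) 1) :
    Φ s ≠ α ∧ Φ s ≠ conj α := by
  have h1 : Φ s ≠ Φ ((1 : ℝ) : ℂ) := fun e => hs.2.ne (ofReal_injective (Φ.injective e))
  have h2 : Φ s ≠ Φ ((-1 : ℝ) : ℂ) := fun e => hs.1.ne' (ofReal_injective (Φ.injective e))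
  rcases h.homeo_endpoints hΦ with ⟨e1, e2⟩ | ⟨e1, e2⟩
  · rw [e2] at h1
    rw [e1] at h2
    exact ⟨h1, h2⟩
  · rw [e2] at h1
    rw [e1] at h2
    exact ⟨h2, h1⟩

lemma IsContour.exists_homeo_eq (h : IsContour α μ γ)
    (hΦ : Φ '' 𝕀 = γ) (hw : w ∈ γ) (h1 : w ≠ α)
    (h2 : w ≠ conj α) : ∃ s ∈ Ioo (-1 : ℝ) 1, Φ s = w := by
  have := hw
  rw [← hΦ] at this
  obtain ⟨_, ⟨s, hs, rfl⟩, e⟩ := this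
  simp only at e
  refine ⟨s, ⟨lt_of_le_of_ne hs.1 ?_, lt_of_le_of_ne hs.2 ?_⟩, e⟩
  · rintro rfl
    rcases h.homeo_endpoints hΦ with ⟨e1, e2⟩ | ⟨e1, e2⟩
    · exact h2 (e.symm.trans e1)
    · exact h1 (e.symm.trans e1)
  · rintro rfl
    rcases h.homeo_endpoints hΦ with ⟨e1, e2⟩ | ⟨e1, e2⟩
    · exact h1 (e.symm.trans e2)
    · exact h2 (e.symm.trans e2)

/-- A limit from both sides of an arc is a limit in the complement of the arc. -/
lemma tendsto_of_sides {γ D : Set ℂ}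
    (hΦ : Φ '' 𝕀 = γ) {u : ℂ → ℂ} (hs : s ∈ Ioo (-1 : ℝ) 1)
    {F : Filter ℂ} (h1 : Tendsto (fun z => u (Φ z)) (𝓝[{z : ℂ | 0 < z.im ∧ Φ z ∈ D}] (s : ℂ)) F) (h2
    : Tendsto (fun z => u (Φ z)) (𝓝[{z : ℂ | z.im < 0 ∧ Φ z ∈ D}] (s : ℂ)) F) :
    Tendsto u (𝓝[D \ γ] (Φ s)) F := by
  have h3 : Tendsto (fun z => u (Φ z)) (𝓝[Φ ⁻¹' (D \ γ)] (s : ℂ)) F := by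
    have h12 := h1.sup h2
    rw [← nhdsWithin_union] at h12
    refine h12.mono_left ?_
    have hO : {z : ℂ | z.re ∈ Ioo (-1 : ℝ) 1} ∈ 𝓝 (s : ℂ) :=
      (isOpen_Ioo.preimage continuous_re).mem_nhds (by simpa using hs)
    rw [← nhdsWithin_inter_of_mem' (mem_nhdsWithin_of_mem_nhds hO)]
    refine nhdsWithin_mono _ ?_
    rintro z ⟨⟨hD, hγ⟩, hz⟩
    have him : z.im ≠ 0 := by
      intro h0
      apply hγ
      rw [← hΦ]
      exact mem_image_of_mem _ ⟨z.re, Ioo_subset_Icc_self hz, Complex.ext rfl (by simp [h0])⟩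
    rcases him.lt_or_gt with h | h
    · exact Or.inr ⟨h, hD⟩
    · exact Or.inl ⟨h, hD⟩
  have h4 : Tendsto Φ.symm (𝓝[D \ γ] (Φ s)) (𝓝[Φ ⁻¹' (D \ γ)] (s : ℂ)) := by
    refine tendsto_nhdsWithin_iff.2 ⟨?_, ?_⟩
    · have := (Φ.symm.continuous.tendsto (Φ s)).mono_left (nhdsWithin_le_nhds (s := D \ γ))
      rwa [Φ.symm_apply_apply] at this
    · filter_upwards [self_mem_nhdsWithin] with z hz
      rwa [mem_preimage, Φ.apply_symm_apply]
  have h5 := h3.comp h4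
  simpa [Function.comp_def] using h5

lemma mem_closure_compl_of_homeo
    (hΦ : Φ '' 𝕀 = γ) (w : ℂ) : w ∈ closure γᶜ := by
  have h1 : Dense 𝕀ᶜ := by
    have h2 : ({z : ℂ | z.im = 0}ᶜ) ⊆ 𝕀ᶜ := by
      intro z hz h
      obtain ⟨s, -, rfl⟩ := h
      exact hz (by simp)
    refine Dense.mono h2 ?_
    have h3 : ({z : ℂ | z.im = 0}ᶜ) = Complex.im ⁻¹' {0}ᶜ := rfl
    rw [h3]
    exact (dense_compl_singleton (0 : ℝ)).preimage isOpenMap_im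
  have h2 := Φ.surjective.denseRange.dense_image Φ.continuous h1
  rw [Φ.image_compl, hΦ] at h2
  exact h2 w

lemma neBot_nhdsWithin_im_pos (s : ℝ) : (𝓝[ℍ₊] (s : ℂ)).NeBot := by
  rw [← mem_closure_iff_nhdsWithin_neBot, closure_setOfPred_lt_im]
  simp

lemma neBot_nhdsWithin_im_neg (s : ℝ) : (𝓝[ℍ₋] (s : ℂ)).NeBot := by
  rw [← mem_closure_iff_nhdsWithin_neBot, closure_setOfPred_im_lt]
  simp

lemma nhdsWithin_im_pos_inter_ball {ε : ℝ} {s' : ℝ} (hs : (s' : ℂ) ∈ ball (s : ℂ) ε) :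
    ball (s : ℂ) ε ∩ ℍ₊ ∈ 𝓝[ℍ₊] (s' : ℂ) :=
  inter_mem (mem_nhdsWithin_of_mem_nhds (isOpen_ball.mem_nhds hs)) self_mem_nhdsWithin

lemma nhdsWithin_im_neg_inter_ball {ε : ℝ} {s' : ℝ} (hs : (s' : ℂ) ∈ ball (s : ℂ) ε) :
    ball (s : ℂ) ε ∩ ℍ₋ ∈ 𝓝[ℍ₋] (s' : ℂ) :=
  inter_mem (mem_nhdsWithin_of_mem_nhds (isOpen_ball.mem_nhds hs)) self_mem_nhdsWithin

/-- Near an interior point of a contour, the radical is, on each side, one of the two continuous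
branches of the square root. -/
lemma IsContour.radical_local (h : IsContour α μ γ)
    (hΦ : Φ '' 𝕀 = γ) (hs : s ∈ Ioo (-1 : ℝ) 1) :
    ∃ ε > 0, ∃ ψ : ℂ → ℂ, ContinuousOn ψ (ball (s : ℂ) ε) ∧ (∀ z ∈ ball (s : ℂ) ε, ψ z ≠ 0) ∧
      EqOn (fun z => radical γ α (Φ z)) ψ (ball (s : ℂ) ε ∩ ℍ₊) ∧
      (EqOn (fun z => radical γ α (Φ z)) ψ (ball (s : ℂ) ε ∩ ℍ₋) ∨
        EqOn (fun z => radical γ α (Φ z)) (-ψ) (ball (s : ℂ) ε ∩ ℍ₋)) := by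
  have hR := h.isRadical
  set q : ℂ → ℂ := fun z => (z - α) * (z - conj α) with hq
  obtain ⟨n1, n2⟩ := h.homeo_ne hΦ hs
  have hq0 : q (Φ s) ≠ 0 := mul_ne_zero (sub_ne_zero.2 n1) (sub_ne_zero.2 n2)
  have hqc : Continuous fun z => q (Φ z) / q (Φ s) := by
    have := Φ.continuous
    simp only [hq]
    fun_prop
  have hO : IsOpen ((fun z => q (Φ z) / q (Φ s)) ⁻¹' slitPlane) := isOpen_slitPlane.preimage hqc
  obtain ⟨ε, hε, hb⟩ := isOpen_iff.1 hO s (by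
    rw [mem_preimage, div_self hq0]
    exact one_mem_slitPlane)
  set ψ : ℂ → ℂ := fun z => csqrt (q (Φ s)) * csqrt (q (Φ z) / q (Φ s)) with hψ
  have hψc : ContinuousOn ψ (ball (s : ℂ) ε) := by
    refine continuousOn_const.mul fun z hz => ?_
    have h1 := (differentiableAt_csqrt (hb hz)).continuousAt
    exact (ContinuousAt.comp (f := fun z => q (Φ z) / q (Φ s)) h1
      hqc.continuousAt).continuousWithinAt
  have hψ0 : ∀ z, ψ z ≠ 0 := fun z => mul_ne_zero (csqrt_ne_zero _) (csqrt_ne_zero _)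
  have hψq : ∀ z ∈ ball (s : ℂ) ε, ψ z ^ 2 = q (Φ z) := by
    intro z hz
    rw [hψ, mul_pow, csqrt_sq hq0, csqrt_sq (slitPlane_ne_zero (hb hz)), mul_div_cancel₀ _ hq0]
  have hγ : ∀ z : ℂ, z.im ≠ 0 → Φ z ∈ γᶜ := by
    intro z hz hc
    rw [← hΦ] at hc
    obtain ⟨_, ⟨t, -, rfl⟩, e⟩ := hc
    have := Φ.injective e
    rw [← this] at hz
    simp at hz
  have main : ∀ P : Set ℂ, IsPreconnected P → P ⊆ ball (s : ℂ) ε → (∀ z ∈ P, z.im ≠ 0) →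
      EqOn (fun z => radical γ α (Φ z)) ψ P ∨ EqOn (fun z => radical γ α (Φ z)) (-ψ) P := by
    intro P hP hPb hPi
    refine hP.eq_or_eq_neg_of_sq_eq ?_ (hψc.mono hPb) ?_ fun _ => hψ0 _
    · exact hR.1.continuousOn.comp Φ.continuous.continuousOn fun z hz => hγ z (hPi z hz)
    · intro z hz
      simp only [Pi.pow_apply]
      rw [hR.2.1 _ (hγ z (hPi z hz)), hψq z (hPb hz)]
  have hup := main (ball (s : ℂ) ε ∩ ℍ₊)
    ((convex_ball _ _).inter (convex_halfSpace_im_gt 0)).isPreconnected inter_subset_left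
    fun z hz => ne_of_gt hz.2
  have hdn := main (ball (s : ℂ) ε ∩ ℍ₋)
    ((convex_ball _ _).inter (convex_halfSpace_im_lt 0)).isPreconnected inter_subset_left
    fun z hz => ne_of_lt hz.2
  rcases hup with hup | hup
  · exact ⟨ε, hε, ψ, hψc, fun z _ => hψ0 z, hup, hdn⟩
  · refine ⟨ε, hε, -ψ, hψc.neg, fun z _ => neg_ne_zero.2 (hψ0 z), hup, ?_⟩
    rw [neg_neg]
    exact hdn.symm

/-- The radical cannot be continuous across the whole contour: its square has a simple zero at an
end point. -/
lemma IsContour.not_forall_radical_continuous (h : IsContour α μ γ)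
    (hΦ : Φ '' 𝕀 = γ) :
    ¬ ∀ s ∈ Ioo (-1 : ℝ) 1, ∃ l, Tendsto (radical γ α) (𝓝[γᶜ] (Φ s)) (𝓝 l) := by
  intro hall
  have hR := h.isRadical
  have hop : IsOpen γᶜ := h.isCompact.isClosed.isOpen_compl
  set E : Set ℂ := {α, conj α}ᶜ with hE
  set u := extendFrom γᶜ (radical γ α) with hu
  have hlim : ∀ w ∈ E, ∃ l, Tendsto (radical γ α) (𝓝[γᶜ] w) (𝓝 l) := by
    intro w hw
    simp only [hE, mem_compl_iff, mem_insert_iff, mem_singleton_iff, not_or] at hw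
    by_cases hwγ : w ∈ γ
    · obtain ⟨s, hs, rfl⟩ := h.exists_homeo_eq hΦ hwγ hw.1 hw.2
      exact hall s hs
    · exact ⟨_, hR.1.continuousOn w hwγ⟩
  have huc : ContinuousOn u E :=
    continuousOn_extendFrom (fun w _ => mem_closure_compl_of_homeo hΦ w) hlim
  have hO : IsOpen E := (Set.toFinite _).isClosed.isOpen_compl
  have hueq : EqOn u (radical γ α) γᶜ := fun w hw =>
    extendFrom_eq (mem_closure_compl_of_homeo hΦ w) (hR.1.continuousOn w hw)
  obtain ⟨-, ⟨c, ⟨L, hL⟩, -, -, -, hc⟩, -⟩ := id h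
  have hud : DifferentiableOn ℂ u E := by
    refine differentiableOn_of_continuousOn_off_curve hO hL huc ?_
    rw [hc]
    exact (hR.1.congr hueq).mono fun z hz => hz.2
  have hsq : ∀ w ∈ E, u w ^ 2 = (w - α) * (w - conj α) := by
    intro w hw
    have : (𝓝[γᶜ] w).NeBot := mem_closure_iff_nhdsWithin_neBot.1 (mem_closure_compl_of_homeo hΦ w)
    have h1 : Tendsto (fun z => u z ^ 2) (𝓝[γᶜ] w) (𝓝 (u w ^ 2)) :=
      ((huc.continuousAt (hO.mem_nhds hw)).tendsto.pow 2).mono_left nhdsWithin_le_nhds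
    have h2 : Tendsto (fun z : ℂ => (z - α) * (z - conj α)) (𝓝[γᶜ] w)
        (𝓝 ((w - α) * (w - conj α))) :=
      (Continuous.tendsto (by fun_prop) w).mono_left nhdsWithin_le_nhds
    refine tendsto_nhds_unique (h1.congr' ?_) h2
    filter_upwards [self_mem_nhdsWithin] with z hz
    rw [hueq hz, hR.2.1 z hz]
  have hne := h.ne_conj
  set v := Function.update u α 0 with hv
  have hO' : IsOpen ({conj α}ᶜ : Set ℂ) := isOpen_compl_singleton
  have hv_sq : ∀ w ∈ ({conj α}ᶜ : Set ℂ), v w ^ 2 = (w - α) * (w - conj α) := by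
    intro w hw
    by_cases hwa : w = α
    · subst hwa
      simp [hv]
    · rw [hv, Function.update_of_ne hwa]
      exact hsq w (by simpa [hE, hwa] using hw)
  have hvc : ContinuousAt v α := by
    rw [continuousAt_iff']
    intro ε hε
    have h1 : Tendsto (fun w : ℂ => ‖(w - α) * (w - conj α)‖) (𝓝 α) (𝓝 0) := by
      have := (Continuous.tendsto (f := fun w : ℂ => ‖(w - α) * (w - conj α)‖)
        (by fun_prop) α)
      simpa using this
    filter_upwards [h1.eventually (gt_mem_nhds (show 0 < ε ^ 2 by positivity)),
      hO'.mem_nhds (show α ∈ ({conj α}ᶜ : Set ℂ) by simpa using hne)] with w hw hw'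
    rw [← hv_sq w hw', norm_pow] at hw
    rw [show v α = 0 by simp [hv], dist_zero_right]
    exact lt_of_pow_lt_pow_left₀ 2 hε.le hw
  have hvd : DifferentiableAt ℂ v α := by
    have := (differentiableOn_compl_singleton_and_continuousAt_iff (f := v) (c := α)
      (hO'.mem_nhds (show α ∈ ({conj α}ᶜ : Set ℂ) by simpa using hne))).1 ⟨?_, hvc⟩
    · exact this.differentiableAt (hO'.mem_nhds (by simpa using hne))
    · have h3 : ({conj α}ᶜ : Set ℂ) \ {α} ⊆ E := by
        rintro z ⟨h1, h2⟩
        simp only [mem_compl_iff, mem_singleton_iff] at h1 h2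
        simp [hE, h1, h2]
      refine (hud.mono h3).congr fun z hz => ?_
      rw [hv, Function.update_of_ne hz.2]
  have hd1 := hvd.hasDerivAt.pow 2
  have hd2 : HasDerivAt (fun w : ℂ => (w - α) * (w - conj α)) (α - conj α) α := by
    refine (((hasDerivAt_id α).sub_const α).mul
      ((hasDerivAt_id α).sub_const (conj α))).congr_deriv ?_
    simp
  have hd3 : HasDerivAt (v ^ 2) (α - conj α) α := by
    refine hd2.congr_of_eventuallyEq ?_
    filter_upwards [hO'.mem_nhds (show α ∈ ({conj α}ᶜ : Set ℂ) by simpa using hne)]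
      with w hw using hv_sq w hw
  have := hd1.unique hd3
  rw [show v α = 0 by simp [hv]] at this
  simp at this
  exact hne (sub_eq_zero.1 this.symm)

/-- The radical has opposite nonzero boundary values on the two sides of the contour. -/
lemma IsContour.radical_sides (h : IsContour α μ γ)
    (hΦ : Φ '' 𝕀 = γ) (hs : s ∈ Ioo (-1 : ℝ) 1) :
    ∃ r : ℂ, r ≠ 0 ∧ Tendsto (fun z => radical γ α (Φ z)) (𝓝[ℍ₊] (s : ℂ)) (𝓝 r) ∧
      Tendsto (fun z => radical γ α (Φ z)) (𝓝[ℍ₋] (s : ℂ)) (𝓝 (-r)) := by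
  set A : Set ℝ := {s | s ∈ Ioo (-1 : ℝ) 1 ∧ ∃ r : ℂ, r ≠ 0 ∧
    Tendsto (fun z => radical γ α (Φ z)) (𝓝[ℍ₊] (s : ℂ)) (𝓝 r) ∧
    Tendsto (fun z => radical γ α (Φ z)) (𝓝[ℍ₋] (s : ℂ)) (𝓝 r)} with hA
  set B : Set ℝ := {s | s ∈ Ioo (-1 : ℝ) 1 ∧ ∃ r : ℂ, r ≠ 0 ∧
    Tendsto (fun z => radical γ α (Φ z)) (𝓝[ℍ₊] (s : ℂ)) (𝓝 r) ∧
    Tendsto (fun z => radical γ α (Φ z)) (𝓝[ℍ₋] (s : ℂ)) (𝓝 (-r))} with hB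
  have hdis : ∀ s, s ∈ A → s ∈ B → False := by
    rintro s ⟨-, r, hr, h1, h2⟩ ⟨-, r', hr', h1', h2'⟩
    have := neBot_nhdsWithin_im_pos s
    have := neBot_nhdsWithin_im_neg s
    have e1 := tendsto_nhds_unique h1 h1'
    have e2 := tendsto_nhds_unique h2 h2'
    rw [e1] at e2
    exact hr' (self_eq_neg.1 e2)
  have hloc : ∀ s ∈ Ioo (-1 : ℝ) 1, ∃ N ∈ 𝓝 s, N ⊆ A ∨ N ⊆ B := by
    intro s hs
    obtain ⟨ε, hε, ψ, hψc, hψ0, hup, hdn⟩ := h.radical_local hΦ hs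
    refine ⟨((fun x : ℝ => (x : ℂ)) ⁻¹' ball (s : ℂ) ε) ∩ Ioo (-1) 1, ?_, ?_⟩
    · exact inter_mem ((isOpen_ball.preimage continuous_ofReal).mem_nhds
        (by simpa using hε)) (isOpen_Ioo.mem_nhds hs)
    · have hψt : ∀ x : ℝ, (x : ℂ) ∈ ball (s : ℂ) ε → ∀ S,
          Tendsto ψ (𝓝[S] (x : ℂ)) (𝓝 (ψ x)) := fun x hx S =>
        (hψc.continuousAt (isOpen_ball.mem_nhds hx)).tendsto.mono_left nhdsWithin_le_nhds
      have hu : ∀ x : ℝ, (x : ℂ) ∈ ball (s : ℂ) ε →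
          Tendsto (fun z => radical γ α (Φ z)) (𝓝[ℍ₊] (x : ℂ)) (𝓝 (ψ x)) := by
        intro x hx
        refine (hψt x hx _).congr' ?_
        filter_upwards [nhdsWithin_im_pos_inter_ball hx] with z hz using (hup hz).symm
      rcases hdn with hdn | hdn
      · left
        rintro x ⟨hx, hx'⟩
        refine ⟨hx', ψ x, hψ0 x hx, hu x hx, (hψt x hx _).congr' ?_⟩
        filter_upwards [nhdsWithin_im_neg_inter_ball hx] with z hz using (hdn hz).symm
      · right
        rintro x ⟨hx, hx'⟩
        refine ⟨hx', ψ x, hψ0 x hx, hu x hx, (hψt x hx _).neg.congr' ?_⟩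
        filter_upwards [nhdsWithin_im_neg_inter_ball hx] with z hz using (hdn hz).symm
  have hAo : IsOpen A := by
    rw [isOpen_iff_mem_nhds]
    intro s hs
    obtain ⟨N, hN, h1 | h1⟩ := hloc s hs.1
    · exact mem_of_superset hN h1
    · exact (hdis s hs (h1 (mem_of_mem_nhds hN))).elim
  have hBo : IsOpen B := by
    rw [isOpen_iff_mem_nhds]
    intro s hs
    obtain ⟨N, hN, h1 | h1⟩ := hloc s hs.1
    · exact (hdis s (h1 (mem_of_mem_nhds hN)) hs).elim
    · exact mem_of_superset hN h1
  have hcov : Ioo (-1 : ℝ) 1 ⊆ A ∪ B := by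
    intro s hs
    obtain ⟨N, hN, h1 | h1⟩ := hloc s hs
    · exact Or.inl (h1 (mem_of_mem_nhds hN))
    · exact Or.inr (h1 (mem_of_mem_nhds hN))
  rcases isPreconnected_Ioo.subset_or_subset hAo hBo
    (Set.disjoint_left.2 fun s h1 h2 => hdis s h1 h2) hcov with h1 | h1
  · exfalso
    refine h.not_forall_radical_continuous hΦ fun s hs => ?_
    obtain ⟨-, r, -, h2, h3⟩ := h1 hs
    refine ⟨r, ?_⟩
    have := tendsto_of_sides (D := univ) (F := 𝓝 r) (u := radical γ α) hΦ hs (by simpa using h2)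
      (by simpa using h3)
    rwa [← compl_eq_univ_sdiff] at this
  · exact (h1 hs).2

/-- The radical is positive on the real axis to the left of the contour and negative to the right
of it. -/
lemma IsContour.radical_real (h : IsContour α μ γ) :
    (∀ x : ℝ, x < μ / 2 → radical γ α x = ((‖(x : ℂ) - α‖ : ℝ) : ℂ)) ∧
      ∀ x : ℝ, μ / 2 < x → radical γ α x = -((‖(x : ℂ) - α‖ : ℝ) : ℂ) := by
  have hR := h.isRadical
  have hγ : ∀ x : ℝ, x ≠ μ / 2 → (x : ℂ) ∈ γᶜ := by
    intro x hx hc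
    have := h.eq_of_im_eq_zero hc (by simp)
    apply hx
    have h2 := congrArg Complex.re this
    simpa using h2
  have hne : ∀ x : ℝ, (((‖(x : ℂ) - α‖ : ℝ) : ℂ)) ≠ 0 := by
    intro x h0
    rw [ofReal_eq_zero, norm_eq_zero, sub_eq_zero] at h0
    have := h.1
    rw [← h0] at this
    simp at this
  have hnc : Continuous fun x : ℝ => ((‖(x : ℂ) - α‖ : ℝ) : ℂ) := by fun_prop
  have hsq : ∀ x : ℝ, x ≠ μ / 2 → radical γ α x ^ 2 = ((‖(x : ℂ) - α‖ : ℝ) : ℂ) ^ 2 := by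
    intro x hx
    rw [hR.2.1 _ (hγ x hx), ← ofReal_pow, ← normSq_eq_norm_sq, ← mul_conj]
    simp
  have main : ∀ P : Set ℝ, IsPreconnected P → (∀ x ∈ P, x ≠ μ / 2) →
      EqOn (fun x : ℝ => radical γ α x) (fun x : ℝ => ((‖(x : ℂ) - α‖ : ℝ) : ℂ)) P ∨
      EqOn (fun x : ℝ => radical γ α x) (-fun x : ℝ => ((‖(x : ℂ) - α‖ : ℝ) : ℂ)) P := by
    intro P hP hPx
    refine hP.eq_or_eq_neg_of_sq_eq ?_ hnc.continuousOn (fun x hx => hsq x (hPx x hx))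
      fun _ => hne _
    exact hR.1.continuousOn.comp continuous_ofReal.continuousOn fun x hx => hγ x (hPx x hx)
  have hnorm : ∀ F : Filter ℝ, Tendsto (fun x : ℝ => (x : ℂ)) F (cocompact ℂ) →
      Tendsto (fun x : ℝ => radical γ α x / x) F (𝓝 (-1)) := fun F hF => hR.2.2.comp hF
  have hbot : Tendsto (fun x : ℝ => (x : ℂ)) atBot (cocompact ℂ) := by
    refine tendsto_cocompact_of_tendsto_dist_comp_atTop (0 : ℂ) ?_
    simpa [Complex.dist_eq] using tendsto_abs_atBot_atTop (G := ℝ)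
  have htop : Tendsto (fun x : ℝ => (x : ℂ)) atTop (cocompact ℂ) := by
    refine tendsto_cocompact_of_tendsto_dist_comp_atTop (0 : ℂ) ?_
    simpa [Complex.dist_eq] using tendsto_abs_atTop_atTop (G := ℝ)
  constructor
  · rcases main (Iio (μ / 2)) isPreconnected_Iio fun x hx => ne_of_lt hx with h1 | h1
    · exact fun x hx => h1 hx
    · exfalso
      have h2 := (continuous_re.tendsto _).comp (hnorm _ hbot)
      have h3 : ∀ᶠ x : ℝ in atBot, 0 ≤ (Complex.re ∘ fun x : ℝ => radical γ α x / x) x := by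
        filter_upwards [Iio_mem_atBot (μ / 2), Iio_mem_atBot 0] with x hx hx0
        have h4 : radical γ α x = ((-‖(x : ℂ) - α‖ : ℝ) : ℂ) := by rw [ofReal_neg]; exact h1 hx
        rw [Function.comp_apply, h4, ← ofReal_div, ofReal_re]
        exact div_nonneg_of_nonpos (neg_nonpos.2 (norm_nonneg _)) (le_of_lt hx0)
      have := ge_of_tendsto h2 h3
      norm_num at this
  · rcases main (Ioi (μ / 2)) isPreconnected_Ioi fun x hx => ne_of_gt hx with h1 | h1
    · exfalso
      have h2 := (continuous_re.tendsto _).comp (hnorm _ htop)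
      have h3 : ∀ᶠ x : ℝ in atTop, 0 ≤ (Complex.re ∘ fun x : ℝ => radical γ α x / x) x := by
        filter_upwards [Ioi_mem_atTop (μ / 2), Ioi_mem_atTop 0] with x hx hx0
        have h4 : radical γ α x = ((‖(x : ℂ) - α‖ : ℝ) : ℂ) := h1 hx
        rw [Function.comp_apply, h4, ← ofReal_div, ofReal_re]
        exact div_nonneg (norm_nonneg _) (le_of_lt hx0)
      have := ge_of_tendsto h2 h3
      norm_num at this
    · exact fun x hx => h1 hx

/-! ### The function `f` -/

/-- `T(μ)²`. -/
def tau (m : ℝ) : ℝ := m ^ 2 / 4 - 1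

lemma continuous_tau : Continuous tau := by unfold tau; fun_prop

lemma half_sq_sub_tau (m : ℝ) : (m / 2) ^ 2 - tau m = 1 := by unfold tau; ring

lemma branchT_eq (m : ℝ) : branchT m = ((√(tau m) : ℝ) : ℂ) + ((√(-tau m) : ℝ) : ℂ) * I := by
  unfold branchT
  change ((tau m : ℝ) : ℂ) ^ (1 / 2 : ℂ) = _
  rcases le_or_gt 0 (tau m) with h | h
  · rw [Real.sqrt_eq_zero_of_nonpos (by linarith : -tau m ≤ 0), Real.sqrt_eq_rpow, ofReal_cpow h]
    simp
  · rw [Real.sqrt_eq_zero_of_nonpos h.le, ofReal_cpow_of_nonpos h.le, Real.sqrt_eq_rpow,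
      ofReal_cpow (by linarith)]
    have : Complex.exp (π * I * (1 / 2)) = I := by
      rw [show (π : ℂ) * I * (1 / 2) = π / 2 * I by ring, exp_pi_div_two_mul_I]
    rw [this]
    simp

lemma branchT_re (m : ℝ) : (branchT m).re = √(tau m) := by simp [branchT_eq]

lemma branchT_im (m : ℝ) : (branchT m).im = √(-tau m) := by simp [branchT_eq]

lemma branchT_sq (m : ℝ) : branchT m ^ 2 = (tau m : ℂ) := by
  unfold branchT
  change (((tau m : ℝ) : ℂ) ^ (1 / 2 : ℂ)) ^ 2 = _
  rw [← cpow_nat_mul]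
  simp

lemma continuous_branchT : Continuous branchT := by
  have : branchT = fun m => ((√(tau m) : ℝ) : ℂ) + ((√(-tau m) : ℝ) : ℂ) * I := funext branchT_eq
  rw [this]
  have := continuous_tau
  fun_prop

lemma branchT_ne_zero (h : tau m ≠ 0) : branchT m ≠ 0 := by
  intro h0
  have := branchT_sq m
  rw [h0] at this
  apply h
  simpa using this.symm

lemma hasDerivAt_branchT (h : tau m ≠ 0) : HasDerivAt branchT (m / (4 * branchT m)) m := by
  have hτ : HasDerivAt tau (m / 2) m := by
    unfold tau
    refine (((hasDerivAt_pow 2 m).div_const 4).sub_const 1).congr_deriv ?_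
    norm_num
    ring
  have hT : branchT = fun m => ((√(tau m) : ℝ) : ℂ) + ((√(-tau m) : ℝ) : ℂ) * I := funext branchT_eq
  have h1 := (hτ.sqrt h).ofReal_comp.add
    ((hτ.neg.sqrt (neg_ne_zero.2 h)).ofReal_comp.mul_const I)
  have h2 : HasDerivAt branchT ((((m / 2 / (2 * √(tau m)) : ℝ)) : ℂ) +
      ((-(m / 2) / (2 * √(-tau m)) : ℝ) : ℂ) * I) m := by
    rw [hT]; exact h1
  refine h2.congr_deriv ?_
  have hsq := branchT_sq m
  rcases h.lt_or_gt with h' | h'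
  · have e0 : √(tau m) = 0 := Real.sqrt_eq_zero_of_nonpos h'.le
    have e1 : ((√(-tau m) : ℝ) : ℂ) ≠ 0 := by
      exact_mod_cast (Real.sqrt_pos.2 (by linarith : 0 < -tau m)).ne'
    rw [branchT_eq, e0]
    have hI := I_ne_zero
    simp only [mul_zero, div_zero, ofReal_zero, zero_add]
    push_cast
    field_simp
    rw [I_sq]
    ring
  · have e0 : √(-tau m) = 0 := Real.sqrt_eq_zero_of_nonpos (by linarith)
    have e1 : ((√(tau m) : ℝ) : ℂ) ≠ 0 := by exact_mod_cast (Real.sqrt_pos.2 h').ne'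
    rw [branchT_eq, e0]
    simp only [mul_zero, div_zero, ofReal_zero, zero_mul, add_zero]
    push_cast
    field_simp
    norm_num

/-- The segment `[-T, T]`, described without choosing a square root. -/
lemma mem_segment_branchT :
    z ∈ segment ℝ (-branchT m) (branchT m) ↔ ∃ u ∈ Icc (0 : ℝ) 1, z ^ 2 = tau m * (u : ℂ) ^ 2 := by
  constructor
  · rintro ⟨a, b, ha, hb, hab, rfl⟩
    refine ⟨|b - a|, ⟨abs_nonneg _, abs_le.2 ⟨by linarith, by linarith⟩⟩, ?_⟩
    rw [← branchT_sq, ← ofReal_pow, sq_abs]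
    simp only [real_smul]
    push_cast
    ring
  · rintro ⟨u, hu, h⟩
    rw [← branchT_sq, ← mul_pow] at h
    rcases sq_eq_sq_iff_eq_or_eq_neg.1 h with h | h
    · refine ⟨(1 - u) / 2, (1 + u) / 2, by linarith [hu.2], by linarith [hu.1], by ring, ?_⟩
      rw [h]
      simp only [real_smul]
      push_cast
      ring
    · refine ⟨(1 + u) / 2, (1 - u) / 2, by linarith [hu.1], by linarith [hu.2], by ring, ?_⟩
      rw [h]
      simp only [real_smul]
      push_cast
      ring

lemma isOpen_setOf_not_mem_segment :
    IsOpen {q : ℂ × ℝ | q.1 ∉ segment ℝ (-branchT q.2) (branchT q.2)} := by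
  have hc : Continuous fun r : (ℂ × ℝ) × ℝ => r.1.1 ^ 2 - tau r.1.2 * (r.2 : ℂ) ^ 2 := by
    have := continuous_tau
    fun_prop
  rw [isOpen_iff_mem_nhds]
  intro q hq
  have h1 : ∀ u ∈ Icc (0 : ℝ) 1, ∀ᶠ r : (ℂ × ℝ) × ℝ in 𝓝 (q, u),
      r.1.1 ^ 2 - tau r.1.2 * (r.2 : ℂ) ^ 2 ≠ 0 := by
    intro u hu
    refine (hc.tendsto (q, u)).eventually_ne ?_
    intro h0
    exact hq (mem_segment_branchT.2 ⟨u, hu, sub_eq_zero.1 h0⟩)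
  have h2 := isCompact_Icc.eventually_forall_of_forall_eventually
    (P := fun (r : ℂ × ℝ) (u : ℝ) => r.1 ^ 2 - tau r.2 * (u : ℂ) ^ 2 ≠ 0) h1
  filter_upwards [h2] with r hr hr'
  obtain ⟨u, hu, e⟩ := mem_segment_branchT.1 hr'
  exact hr u hu (sub_eq_zero.2 e)

lemma isOpen_setOf_mem_Dom : IsOpen {q : ℂ × ℝ | q.1 ∈ Dom q.2} := by
  have : {q : ℂ × ℝ | q.1 ∈ Dom q.2} = {q : ℂ × ℝ | q.1.im ≠ 0} ∩
    {q : ℂ × ℝ | q.1 ∉ segment ℝ (-branchT q.2) (branchT q.2)} := rfl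
  rw [this]
  refine IsOpen.inter ?_ isOpen_setOf_not_mem_segment
  exact isOpen_ne_fun (by fun_prop) continuous_const

lemma isOpen_Dom (μ : ℝ) : IsOpen (Dom μ) :=
  isOpen_setOf_mem_Dom.preimage (f := fun z : ℂ => (z, μ)) (by fun_prop)

lemma conj_mem_segment :
    conj z ∈ segment ℝ (-branchT m) (branchT m) ↔ z ∈ segment ℝ (-branchT m) (branchT m) := by
  rw [mem_segment_branchT, mem_segment_branchT]
  refine exists_congr fun u => and_congr_right fun _ => ?_
  rw [← map_pow, ← (conj).injective.eq_iff]
  simp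

lemma conj_mem_Dom : conj z ∈ Dom m ↔ z ∈ Dom m := by
  unfold Dom
  simp only [mem_ofPred_eq, conj_mem_segment, conj_im, ne_eq, neg_eq_zero]

lemma half_not_mem_segment (hm : 0 < m) : (m : ℂ) / 2 ∉ segment ℝ (-branchT m) (branchT m) := by
  rw [mem_segment_branchT]
  rintro ⟨u, hu, h⟩
  have h1 : (m / 2) ^ 2 = tau m * u ^ 2 := by exact_mod_cast h
  have h2 := half_sq_sub_tau m
  rcases le_or_gt 0 (tau m) with h3 | h3
  · nlinarith [mul_le_mul_of_nonneg_left (show u ^ 2 ≤ 1 by nlinarith [hu.1, hu.2]) h3]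
  · nlinarith [sq_nonneg u, hu.1, hu.2]

lemma sqrt_tau_lt (hm : 0 < m) : √(tau m) < m / 2 := by
  rw [Real.sqrt_lt' (by linarith)]
  have := half_sq_sub_tau m
  linarith

/-- The points of the open upper half plane off `[-T, T]`, and the point `μ/2`. -/
def UpperReg (m : ℝ) (z : ℂ) : Prop :=
  z ∉ segment ℝ (-branchT m) (branchT m) ∧ (0 < z.im ∨ z = m / 2)

lemma neg_I_mul_mem_slitPlane (h : 0 < w.im ∨ w.re ≠ 0) : -I * w ∈ slitPlane := by
  rw [mem_slitPlane_iff]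
  simpa using h

/-- The points `z ± uT` avoid the cut of `logDown`, whether `T` is real or imaginary. -/
lemma UpperReg.mem_slitPlane (hm : 0 < m) (h : UpperReg m z) {u : ℝ} (hu : u ∈ Icc (-1 : ℝ) 1) :
    -I * (z + u * branchT m) ∈ slitPlane := by
  apply neg_I_mul_mem_slitPlane
  have hre : (z + u * branchT m).re = z.re + u * √(tau m) := by simp [branchT_re]
  have him : (z + u * branchT m).im = z.im + u * √(-tau m) := by simp [branchT_im]
  rw [hre, him]
  rcases h.2 with h2 | h2
  · by_contra hcon
    push Not at hcon
    obtain ⟨h3, h4⟩ := hcon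
    rcases le_or_gt 0 (tau m) with ht | ht
    · rw [Real.sqrt_eq_zero_of_nonpos (by linarith : -tau m ≤ 0)] at h3
      linarith
    · rw [Real.sqrt_eq_zero_of_nonpos ht.le] at h4
      have hs : 0 < √(-tau m) := Real.sqrt_pos.2 (by linarith)
      apply h.1
      rw [mem_segment_branchT]
      refine ⟨z.im / √(-tau m), ⟨by positivity, ?_⟩, ?_⟩
      · rw [div_le_one hs]
        nlinarith [hu.1, hu.2]
      · have e1 : (tau m : ℝ) = -(√(-tau m) ^ 2) := by
          rw [Real.sq_sqrt (by linarith)]; ring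
        have e2 : z = (z.im : ℂ) * I := Complex.ext (by simp; linarith) (by simp)
        have e3 : ((√(-tau m) : ℝ) : ℂ) ≠ 0 := by exact_mod_cast hs.ne'
        have e4 : (tau m : ℂ) = -(((√(-tau m) : ℝ) : ℂ) ^ 2) := by exact_mod_cast e1
        rw [e4]
        conv_lhs => rw [e2]
        push_cast
        field_simp
        rw [I_sq]
        ring
  · right
    have e : z.re = m / 2 := by rw [h2]; simp
    have h3 := sqrt_tau_lt hm
    have h4 := Real.sqrt_nonneg (tau m)
    rw [e]
    intro h5
    nlinarith [hu.1, hu.2]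

lemma UpperReg.mem_slitPlane_add (hm : 0 < m) (h : UpperReg m z) :
    -I * (z + branchT m) ∈ slitPlane := by
  simpa using h.mem_slitPlane hm (u := 1) (by simp)

lemma UpperReg.mem_slitPlane_sub (hm : 0 < m) (h : UpperReg m z) :
    -I * (z - branchT m) ∈ slitPlane := by
  simpa [sub_eq_add_neg] using h.mem_slitPlane hm (u := -1) (by simp)

lemma hasDerivAt_logDown (h : -I * w ∈ slitPlane) : HasDerivAt logDown w⁻¹ w := by
  have h1 : HasDerivAt (fun w : ℂ => -I * w) (-I) w := by
    simpa using (hasDerivAt_id w).const_mul (-I)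
  refine ((h1.clog h).add_const (π * I / 2)).congr_deriv ?_
  have : w ≠ 0 := by
    rintro rfl
    simp at h
  field_simp

lemma continuousAt_logDown (h : -I * w ∈ slitPlane) :
    ContinuousAt logDown w := (hasDerivAt_logDown h).continuousAt

/-- `logDown` is the principal logarithm in the right half plane. -/
lemma logDown_eq_log (hw : 0 < w.re) : logDown w = log w := by
  have hw0 : w ≠ 0 := by rintro rfl; simp at hw
  have h1 := abs_arg_lt_pi_div_two_iff.2 (Or.inl hw)
  rw [abs_lt] at h1
  have hI : Complex.arg (-I) = -(π / 2) := arg_neg_I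
  unfold logDown
  rw [log_mul_eq_add_log_iff (by simp) hw0 |>.2, log_neg_I]
  · ring
  · rw [hI]
    constructor <;> linarith [Real.pi_pos]

lemma one_add_sub_mem_slitPlane (hm : 0 < m) :
    1 + branchT m / (m / 2) ∈ slitPlane ∧ 1 - branchT m / (m / 2) ∈ slitPlane := by
  have h1 := sqrt_tau_lt hm
  have h2 : √(tau m) / (m / 2) < 1 := by rw [div_lt_one (by linarith)]; exact h1
  have h3 : 0 ≤ √(tau m) / (m / 2) := by positivity
  have e : (branchT m / (m / 2)).re = √(tau m) / (m / 2) := by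
    rw [show (m : ℂ) / 2 = ((m / 2 : ℝ) : ℂ) by push_cast; rfl, div_ofReal_re, branchT_re]
  simp only [mem_slitPlane_iff, add_re, sub_re, one_re, e]
  exact ⟨Or.inl (by linarith), Or.inl (by linarith)⟩

lemma hasDerivAt_artanhC (h1 : 1 + w ∈ slitPlane) (h2 : 1 - w ∈ slitPlane) :
    HasDerivAt artanhC (1 / (1 - w ^ 2)) w := by
  have d1 : HasDerivAt (fun w : ℂ => 1 + w) 1 w := by simpa using (hasDerivAt_id w).const_add 1
  have d2 : HasDerivAt (fun w : ℂ => 1 - w) (-1) w := by simpa using (hasDerivAt_id w).const_sub 1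
  refine (((d1.clog h1).sub (d2.clog h2)).div_const 2).congr_deriv ?_
  have e1 := slitPlane_ne_zero h1
  have e2 := slitPlane_ne_zero h2
  have e3 : 1 - w ^ 2 ≠ 0 := by
    rw [show 1 - w ^ 2 = (1 + w) * (1 - w) by ring]
    exact mul_ne_zero e1 e2
  field_simp
  ring

lemma hasDerivAt_artanhC_branchT (hm : 0 < m) :
    HasDerivAt artanhC (1 / (1 - (branchT m / (m / 2)) ^ 2)) (branchT m / (m / 2)) :=
  hasDerivAt_artanhC (one_add_sub_mem_slitPlane hm).1 (one_add_sub_mem_slitPlane hm).2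

/-- `(ln (z + T) - ln (z - T)) / (2 T) - artanh (T / (μ/2)) / T`, written as an integral that is
regular at `T = 0`. -/
def wInt (z : ℂ) (m : ℝ) : ℂ :=
  ∫ u in (0 : ℝ)..1, (z / (z ^ 2 - tau m * (u : ℂ) ^ 2)
    - ((m : ℂ) / 2) / (((m : ℂ) / 2) ^ 2 - tau m * (u : ℂ) ^ 2))

/-- The integral `wInt` carries the dependence on `T` in a form that is regular at `T = 0`. -/
lemma branchT_mul_wInt (hm : 0 < m) (h : UpperReg m z) :
    branchT m * wInt z m = (logDown (z + branchT m) - logDown (z - branchT m)) / 2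
      - artanhC (branchT m / (m / 2)) := by
  have hm1 : (m : ℂ) ≠ 0 := by exact_mod_cast hm.ne'
  have hp : UpperReg m ((m : ℂ) / 2) := ⟨half_not_mem_segment hm, Or.inr rfl⟩
  have ne : ∀ {y : ℂ}, UpperReg m y → ∀ u ∈ uIcc (0 : ℝ) 1, y ^ 2 - tau m * (u : ℂ) ^ 2 ≠ 0 := by
    intro y hy u hu h0
    rw [uIcc_of_le zero_le_one] at hu
    exact hy.1 (mem_segment_branchT.2 ⟨u, hu, sub_eq_zero.1 h0⟩)
  have cont : ∀ {y : ℂ}, UpperReg m y →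
      ContinuousOn (fun u : ℝ => y / (y ^ 2 - tau m * (u : ℂ) ^ 2)) (uIcc 0 1) := by
    intro y hy
    exact continuousOn_const.div (Continuous.continuousOn (by fun_prop)) (ne hy)
  have key : ∀ {y : ℂ}, UpperReg m y →
      branchT m * (∫ u in (0 : ℝ)..1, y / (y ^ 2 - tau m * (u : ℂ) ^ 2)) =
        (logDown (y + branchT m) - logDown (y - branchT m)) / 2 := by
    intro y hy
    have hd : ∀ u ∈ uIcc (0 : ℝ) 1, HasDerivAt
        (fun u : ℝ => (logDown (y + u * branchT m) - logDown (y - u * branchT m)) / 2)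
        (branchT m * (y / (y ^ 2 - tau m * (u : ℂ) ^ 2))) u := by
      intro u hu
      have hne := ne hy u hu
      rw [uIcc_of_le zero_le_one] at hu
      have s1 := hy.mem_slitPlane hm (u := u) ⟨by linarith [hu.1], hu.2⟩
      have s2 := hy.mem_slitPlane hm (u := -u) ⟨by linarith [hu.2], by linarith [hu.1]⟩
      have s2' : -I * (y - u * branchT m) ∈ slitPlane := by simpa [sub_eq_add_neg] using s2
      have d0 : HasDerivAt (fun u : ℝ => (u : ℂ) * branchT m) (branchT m) u := by
        simpa using (ofRealCLM.hasDerivAt (x := u)).mul_const (branchT m)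
      have d1 := (hasDerivAt_logDown s1).comp u (d0.const_add y)
      have d2 := (hasDerivAt_logDown s2').comp u (d0.const_sub y)
      refine ((d1.sub d2).div_const 2).congr_deriv ?_
      have e1 : y + u * branchT m ≠ 0 := by intro e; rw [e] at s1; simp at s1
      have e2 : y - u * branchT m ≠ 0 := by intro e; rw [e] at s2'; simp at s2'
      rw [← branchT_sq] at hne ⊢
      have e3 : y ^ 2 - branchT m ^ 2 * (u : ℂ) ^ 2 =
        (y + u * branchT m) * (y - u * branchT m) := by ring
      rw [e3]
      field_simp
      ring
    rw [← intervalIntegral.integral_const_mul, intervalIntegral.integral_eq_sub_of_hasDerivAt hd]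
    · simp
    · exact (continuousOn_const.mul (cont hy)).intervalIntegrable
  unfold wInt
  rw [intervalIntegral.integral_sub (cont h).intervalIntegrable (cont hp).intervalIntegrable,
    mul_sub, key h, key hp]
  congr 1
  have q1 : 0 < (m / 2 + branchT m).re := by
    rw [Complex.add_re, branchT_re]
    have := Real.sqrt_nonneg (tau m)
    simp
    linarith
  have q2 : 0 < (m / 2 - branchT m).re := by
    rw [Complex.sub_re, branchT_re]
    have := sqrt_tau_lt hm
    simp
    linarith
  rw [logDown_eq_log q1, logDown_eq_log q2]
  unfold artanhC
  have p1 : m / 2 + branchT m = ((m / 2 : ℝ) : ℂ) * (1 + branchT m / (m / 2)) := by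
    push_cast
    field_simp
  have p2 : m / 2 - branchT m = ((m / 2 : ℝ) : ℂ) * (1 - branchT m / (m / 2)) := by
    push_cast
    field_simp
  obtain ⟨n1, n2⟩ := one_add_sub_mem_slitPlane hm
  rw [p1, p2, log_ofReal_mul (by linarith) (slitPlane_ne_zero n1),
    log_ofReal_mul (by linarith) (slitPlane_ne_zero n2)]
  ring

lemma continuousOn_wInt : ContinuousOn (fun q : ℂ × ℝ => wInt q.1 q.2)
    {q | 0 < q.2 ∧ q.1 ∉ segment ℝ (-branchT q.2) (branchT q.2)} := by
  rw [continuousOn_iff_continuous_domRestrict]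
  set S : Set (ℂ × ℝ) := {q | 0 < q.2 ∧ q.1 ∉ segment ℝ (-branchT q.2) (branchT q.2)} with hS
  -- clamping `u` to `[0, 1]` makes the integrand continuous for all real `u`
  set κ : ℝ → ℝ := fun u => max 0 (min u 1) with hκ
  have hκ1 : ∀ u, κ u ∈ Icc (0 : ℝ) 1 := fun u => by simp [hκ]
  have hκc : Continuous κ := by fun_prop
  have hc : Continuous (Function.uncurry fun (q : S) (u : ℝ) =>
      (q.1.1 / (q.1.1 ^ 2 - tau q.1.2 * (κ u : ℂ) ^ 2)
        - ((q.1.2 : ℂ) / 2) / (((q.1.2 : ℂ) / 2) ^ 2 - tau q.1.2 * (κ u : ℂ) ^ 2))) := by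
    have := continuous_tau
    refine Continuous.sub (Continuous.div (by fun_prop) (by fun_prop) ?_)
      (Continuous.div (by fun_prop) (by fun_prop) ?_)
    · rintro ⟨q, u⟩ h0
      exact q.2.2 (mem_segment_branchT.2 ⟨κ u, hκ1 u, sub_eq_zero.1 h0⟩)
    · rintro ⟨q, u⟩ h0
      exact half_not_mem_segment q.2.1 (mem_segment_branchT.2 ⟨κ u, hκ1 u, sub_eq_zero.1 h0⟩)
  have h1 := intervalIntegral.continuous_parametric_intervalIntegral_of_continuous' (μ :=
    volume) hc 0 1
  refine h1.congr fun q => ?_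
  simp only [domRestrict_apply, wInt]
  refine intervalIntegral.integral_congr fun u hu => ?_
  rw [uIcc_of_le zero_le_one] at hu
  have : κ u = u := by simp [hκ, hu.1, hu.2]
  simp only [this]

/-- The part of `f` in the upper half plane that is analytic at `μ/2`. -/
def fReg (x t m : ℝ) (z : ℂ) : ℂ :=
  (z + branchT m) / 2 * logDown (z + branchT m) + (z - branchT m) / 2 * logDown (z - branchT m)
    - branchT m * artanhC (branchT m / (m / 2)) - x * z - 2 * t * z ^ 2
    + m / 2 * Real.log 2

/-- The part of `f'` in the upper half plane that is analytic at `μ/2`. -/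
def fPrimeReg (x t m : ℝ) (z : ℂ) : ℂ :=
  (logDown (z + branchT m) + logDown (z - branchT m)) / 2 - x - 4 * t * z

/-- The part of `∂f/∂μ` in the upper half plane that is analytic at `μ/2`. -/
def fMuReg (m : ℝ) (z : ℂ) : ℂ := (Real.log 2 : ℂ) / 2 + m / 4 * wInt z m

lemma fUpper_eq (x t m : ℝ) (z : ℂ) :
    fUpper x t m z = (m / 2 - z) * log (I * (m / 2 - z)) + fReg x t m z := by
  unfold fUpper fReg logUp
  ring

lemma I_mul_mem_slitPlane (hz : 0 < z.im) : I * (m / 2 - z) ∈ slitPlane := by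
  rw [mem_slitPlane_iff]
  left
  simpa using hz

lemma hasDerivAt_wLog (hz : 0 < z.im) :
    HasDerivAt (fun w : ℂ => w * log (I * w)) (log (I * (m / 2 - z)) + 1) (m / 2 - z) := by
  set w := m / 2 - z with hw
  have hs : I * w ∈ slitPlane := I_mul_mem_slitPlane hz
  have h1 : HasDerivAt (fun w : ℂ => I * w) I w := by simpa using (hasDerivAt_id w).const_mul I
  have hw0 : w ≠ 0 := by intro h; rw [h] at hs; simp at hs
  refine ((hasDerivAt_id w).mul (h1.clog hs)).congr_deriv ?_
  simp only [id_eq, one_mul]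
  field_simp

lemma hasDerivAt_half_mul_logDown (h : -I * w ∈ slitPlane) :
    HasDerivAt (fun w => w / 2 * logDown w) ((logDown w + 1) / 2) w := by
  have hw0 : w ≠ 0 := by intro h0; rw [h0] at h; simp at h
  refine (((hasDerivAt_id w).div_const 2).mul (hasDerivAt_logDown h)).congr_deriv ?_
  simp only [id_eq]
  field_simp

lemma hasDerivAt_fReg (x t : ℝ) (hm : 0 < m) (h : UpperReg m z) :
    HasDerivAt (fReg x t m) (fPrimeReg x t m z + 1) z := by
  unfold fReg
  have d1 := (hasDerivAt_half_mul_logDown (h.mem_slitPlane_add hm)).comp z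
    ((hasDerivAt_id z).add_const (branchT m))
  have d2 := (hasDerivAt_half_mul_logDown (h.mem_slitPlane_sub hm)).comp z
    ((hasDerivAt_id z).sub_const (branchT m))
  have d3 := (hasDerivAt_id z).const_mul (x : ℂ)
  have d4 := (hasDerivAt_pow 2 z).const_mul (2 * t : ℂ)
  refine (((((d1.add d2).sub_const (branchT m * artanhC (branchT m / (m / 2)))).sub d3).sub
    d4).add_const ((m : ℂ) / 2 * Real.log 2)).congr_deriv ?_
  unfold fPrimeReg
  simp
  ring

lemma hasDerivAt_fUpper (x t : ℝ) (hm : 0 < m) (hz : 0 < z.im) (h : z ∈ Dom m) :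
    HasDerivAt (fUpper x t m) (-log (I * (m / 2 - z)) + fPrimeReg x t m z) z := by
  have e : fUpper x t m = fun z => (m / 2 - z) * log (I * (m / 2 - z))
    + fReg x t m z := funext (fUpper_eq x t m)
  rw [e]
  have d1 := (hasDerivAt_wLog (m := m) hz).comp z ((hasDerivAt_id z).const_sub ((m : ℂ) / 2))
  refine (d1.add (hasDerivAt_fReg x t hm ⟨h.2, Or.inl hz⟩)).congr_deriv ?_
  ring

lemma continuousAt_logDown_add_sub (hm : 0 < m) (h : UpperReg m z) :
    ContinuousAt (fun q : ℂ × ℝ => logDown (q.1 + branchT q.2)) (z, m) ∧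
      ContinuousAt (fun q : ℂ × ℝ => logDown (q.1 - branchT q.2)) (z, m) := by
  have hT := continuous_branchT
  exact ⟨ContinuousAt.comp (g := logDown) (f := fun q : ℂ × ℝ => q.1 + branchT q.2)
      (continuousAt_logDown (h.mem_slitPlane_add hm)) (by fun_prop),
    ContinuousAt.comp (g := logDown) (f := fun q : ℂ × ℝ => q.1 - branchT q.2)
      (continuousAt_logDown (h.mem_slitPlane_sub hm)) (by fun_prop)⟩

lemma continuousAt_fReg (x t : ℝ) (hm : 0 < m) (h : UpperReg m z) :
    ContinuousAt (fun q : ℂ × ℝ => fReg x t q.2 q.1) (z, m) := by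
  have hT := continuous_branchT
  obtain ⟨c1, c2⟩ := continuousAt_logDown_add_sub hm h
  have hm0 : (m : ℂ) / 2 ≠ 0 := by simpa using hm.ne'
  have c3 : ContinuousAt (fun q : ℂ × ℝ => artanhC (branchT q.2 / (q.2 / 2))) (z, m) := by
    refine ContinuousAt.comp (g := artanhC) (f := fun q : ℂ × ℝ => branchT q.2 / (q.2 / 2))
      (hasDerivAt_artanhC_branchT hm).continuousAt ?_
    exact ContinuousAt.div (by fun_prop) (by fun_prop) hm0
  unfold fReg
  fun_prop

lemma continuousAt_fPrimeReg (x t : ℝ) (hm : 0 < m) (h : UpperReg m z) :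
    ContinuousAt (fun q : ℂ × ℝ => fPrimeReg x t q.2 q.1) (z, m) := by
  have hT := continuous_branchT
  obtain ⟨c1, c2⟩ := continuousAt_logDown_add_sub hm h
  unfold fPrimeReg
  fun_prop

lemma continuousAt_fMuReg (hm : 0 < m) (h : UpperReg m z) :
    ContinuousAt (fun q : ℂ × ℝ => fMuReg q.2 q.1) (z, m) := by
  have c1 : ContinuousAt (fun q : ℂ × ℝ => wInt q.1 q.2) (z, m) := by
    refine continuousOn_wInt.continuousAt (IsOpen.mem_nhds ?_ ⟨hm, h.1⟩)
    exact (isOpen_lt continuous_const continuous_snd).inter isOpen_setOf_not_mem_segment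
  unfold fMuReg
  fun_prop

lemma continuousAt_wLog_zero : ContinuousAt (fun w : ℂ => w * log (I * w)) 0 := by
  have h1 : Tendsto (fun w : ℂ => ‖w‖ * Real.log ‖w‖) (𝓝 0) (𝓝 0) := by
    have := (Real.continuous_mul_log.tendsto 0).comp (continuous_norm.tendsto (0 : ℂ) |>.trans
      (by rw [norm_zero]))
    simpa [Function.comp_def] using this
  have h2 : Tendsto (fun w : ℂ => |‖w‖ * Real.log ‖w‖| + ‖w‖ * π) (𝓝 0) (𝓝 0) := by
    have h3 : Tendsto (fun w : ℂ => ‖w‖ * π) (𝓝 0) (𝓝 0) := by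
      have := (Continuous.tendsto (f := fun w : ℂ => ‖w‖ * π) (by fun_prop) 0)
      simpa using this
    simpa using h1.abs.add h3
  rw [ContinuousAt, zero_mul]
  refine squeeze_zero_norm (fun w => ?_) h2
  rw [norm_mul, abs_mul, abs_of_nonneg (norm_nonneg w), ← mul_add]
  refine mul_le_mul_of_nonneg_left ?_ (norm_nonneg _)
  refine (norm_le_abs_re_add_abs_im _).trans ?_
  rw [log_re, log_im, norm_mul, norm_I, one_mul]
  gcongr
  exact abs_arg_le_pi _

/-- In the moving frame `f` is jointly continuous up to the point `μ/2`. -/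
lemma continuousAt_fUpper (x t : ℝ) (hm : 0 < m) (h : UpperReg m z) :
    ContinuousAt (fun q : ℂ × ℝ => fUpper x t q.2 q.1) (z, m) := by
  have e : (fun q : ℂ × ℝ => fUpper x t q.2 q.1) = fun q : ℂ × ℝ =>
      (q.2 / 2 - q.1) * log (I * (q.2 / 2 - q.1))
    + fReg x t q.2 q.1 := funext fun q => fUpper_eq x t q.2 q.1
  rw [e]
  refine ContinuousAt.add ?_ (continuousAt_fReg x t hm h)
  refine ContinuousAt.comp (g := fun w : ℂ => w * log (I * w))
    (f := fun q : ℂ × ℝ => q.2 / 2 - q.1) ?_ (by fun_prop)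
  rcases h.2 with h2 | h2
  · exact (hasDerivAt_wLog h2).continuousAt
  · simp only [h2, sub_self]
    exact continuousAt_wLog_zero

/-- The derivative of `f` along `m ↦ (y + κ (m - m₁), m)`, away from the value of `m` with `T = 0`.
-/
lemma hasDerivAt_fUpper_param_of_ne (x t : ℝ) (hm : 0 < m) (hτ : tau m ≠ 0) (hz : 0 < z.im)
    (h : z ∈ Dom m) (κ m₁ : ℝ) (y : ℂ) (hy : y + κ * (m - m₁) = z) :
    HasDerivAt (fun m : ℝ => fUpper x t m (y + κ * (m - m₁)))
      (κ * (-log (I * (m / 2 - z)) + fPrimeReg x t m z) +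
        (log (I * (m / 2 - z)) / 2 + fMuReg m z)) m := by
  have hU : UpperReg m z := ⟨h.2, Or.inl hz⟩
  have e : (fun m : ℝ => fUpper x t m (y + κ * (m - m₁))) = fun m : ℝ =>
      (m / 2 - (y + κ * (m - m₁))) * log (I * (m / 2 - (y + κ * (m - m₁))))
      + fReg x t m (y + κ * (m - m₁)) := funext fun m => fUpper_eq x t m _
  rw [e]
  have dm : HasDerivAt (fun m : ℝ => (m : ℂ)) 1 m := ofRealCLM.hasDerivAt
  have dZ : HasDerivAt (fun m : ℝ => y + (κ : ℂ) * ((m : ℂ) - m₁)) κ m := by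
    simpa using ((dm.sub_const (m₁ : ℂ)).const_mul (κ : ℂ)).const_add y
  have dp : HasDerivAt (fun m : ℝ => (m : ℂ) / 2) (1 / 2) m := dm.div_const 2
  have dT := hasDerivAt_branchT hτ
  have hT0 := branchT_ne_zero hτ
  have hm0 : (m : ℂ) ≠ 0 := by exact_mod_cast hm.ne'
  have d1 : HasDerivAt (fun m : ℝ => (m / 2 - (y + κ * (m - m₁))) *
        log (I * (m / 2 - (y + κ * (m - m₁)))))
        ((log (I * (m / 2 - z)) + 1) * (1 / 2 - κ)) m :=
    HasDerivAt.comp (h₂ := fun w : ℂ => w * log (I * w)) m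
      (by rw [hy]; exact hasDerivAt_wLog hz) (dp.sub dZ)
  have d2 := HasDerivAt.comp (h₂ := fun w : ℂ => w / 2 * logDown w) m
    (h := fun m : ℝ => y + (κ : ℂ) * ((m : ℂ) - m₁) + branchT m)
    (by rw [hy]; exact hasDerivAt_half_mul_logDown (hU.mem_slitPlane_add hm)) (dZ.add dT)
  have d3 := HasDerivAt.comp (h₂ := fun w : ℂ => w / 2 * logDown w) m
    (h := fun m : ℝ => y + (κ : ℂ) * ((m : ℂ) - m₁) - branchT m)
    (by rw [hy]; exact hasDerivAt_half_mul_logDown (hU.mem_slitPlane_sub hm)) (dZ.sub dT)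
  have d4 := dT.mul (HasDerivAt.comp (h₂ := artanhC) m
    (h := fun m : ℝ => branchT m / (m / 2))
    (hasDerivAt_artanhC_branchT hm)
    (dT.div dp (by simpa using hm.ne')))
  have d5 := dZ.const_mul (x : ℂ)
  have d6 := (dZ.pow 2).const_mul (2 * t : ℂ)
  have d7 := dp.mul_const (Real.log 2 : ℂ)
  have key := d1.add (((((d2.add d3).sub d4).sub d5).sub d6).add d7)
  refine key.congr_deriv ?_
  have hW := branchT_mul_wInt hm hU
  have hsq := branchT_sq m
  have hτm : (tau m : ℂ) = (m : ℂ) ^ 2 / 4 - 1 := by unfold tau; push_cast; ring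
  have hA : artanhC (branchT m / (m / 2)) = (logDown (z + branchT m) -
    logDown (z - branchT m)) / 2 - branchT m * wInt z m := by rw [hW]; ring
  have hden : 1 - (branchT m / (m / 2)) ^ 2 = 4 / (m : ℂ) ^ 2 := by
    rw [div_pow, hsq, hτm]
    field_simp
    ring
  simp only [Function.comp_apply, hA, hden, hy]
  unfold fPrimeReg fMuReg
  have hsq' : branchT m ^ 2 = (m : ℂ) ^ 2 / 4 - 1 := by rw [hsq, hτm]
  field_simp
  linear_combination (16 * branchT m) * hsq'

/-- An isolated exception to differentiability is removed if the derivative extends continuously;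
this covers `T = 0`, that is `m = 2`. -/
lemma hasDerivAt_of_eventually_ne {E : Type*} [NormedAddCommGroup E] [NormedSpace ℝ E]
    {φ ψ : ℝ → E} {a : ℝ} (h : ∀ᶠ y in 𝓝[≠] a, HasDerivAt φ (ψ y) y) (hφ : ContinuousAt φ a)
    (hψ : ContinuousAt ψ a) : HasDerivAt φ (ψ a) a := by
  have key : ∀ S : Set ℝ, S ⊆ {a}ᶜ → {y | HasDerivAt φ (ψ y) y} ∩ S ∈ 𝓝[S] a ∧
      Tendsto (fun y => deriv φ y) (𝓝[S] a) (𝓝 (ψ a)) := by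
    intro S hS
    have h1 : ∀ᶠ y in 𝓝[S] a, HasDerivAt φ (ψ y) y := h.filter_mono (nhdsWithin_mono _ hS)
    refine ⟨inter_mem h1 self_mem_nhdsWithin, ?_⟩
    refine (hψ.tendsto.mono_left nhdsWithin_le_nhds).congr' ?_
    filter_upwards [h1] with y hy using hy.deriv.symm
  have hd : ∀ S : Set ℝ, DifferentiableOn ℝ φ ({y | HasDerivAt φ (ψ y) y} ∩ S) := fun S y hy =>
    hy.1.differentiableAt.differentiableWithinAt
  obtain ⟨a1, a2⟩ := key (Ioi a) fun y hy => ne_of_gt hy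
  obtain ⟨b1, b2⟩ := key (Iio a) fun y hy => ne_of_lt hy
  have A := hasDerivWithinAt_Ici_of_tendsto_deriv (hd _) hφ.continuousWithinAt a1 a2
  have B := hasDerivWithinAt_Iic_of_tendsto_deriv (hd _) hφ.continuousWithinAt b1 b2
  simpa using B.union A

lemma upperReg_eventually (hz : 0 < z.im) (h : z ∈ Dom m) :
    ∀ᶠ q : ℂ × ℝ in 𝓝 (z, m), 0 < q.1.im ∧ q.1 ∈ Dom q.2 :=
  IsOpen.mem_nhds ((isOpen_lt continuous_const (continuous_im.comp continuous_fst)).inter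
    isOpen_setOf_mem_Dom) (show (z, m) ∈ {q : ℂ × ℝ | 0 < q.1.im} ∩ _ from ⟨hz, h⟩)

/-- The derivative of `f` along a line in the `(z, μ)` space.  At `μ = 2`, where `T` is not
differentiable, it is obtained as a limit. -/
lemma hasDerivAt_fUpper_param (x t : ℝ) (hm : 0 < m) (hz : 0 < z.im) (h : z ∈ Dom m) (κ m₁ : ℝ)
    (y : ℂ) (hy : y + κ * (m - m₁) = z) :
    HasDerivAt (fun m : ℝ => fUpper x t m (y + κ * (m - m₁)))
      (κ * (-log (I * (m / 2 - z)) + fPrimeReg x t m z) +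
        (log (I * (m / 2 - z)) / 2 + fMuReg m z)) m := by
  set Z : ℝ → ℂ := fun m => y + κ * (m - m₁) with hZ
  have hZc : Continuous fun m => (Z m, m) := by simp only [hZ]; fun_prop
  have hU : UpperReg m z := ⟨h.2, Or.inl hz⟩
  have hZm : (Z m, m) = (z, m) := by simp only [hZ, hy]
  have hZt : Tendsto (fun m => (Z m, m)) (𝓝 m) (𝓝 (z, m)) := hZm ▸ hZc.tendsto m
  have main := hasDerivAt_of_eventually_ne (a := m) (φ := fun m : ℝ => fUpper x t m (Z m))
    (ψ := fun m => (κ * (-log (I * (m / 2 - Z m)) + fPrimeReg x t m (Z m)) +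
        (log (I * (m / 2 - Z m)) / 2 + fMuReg m (Z m)))) ?_ ?_ ?_
  · have e : Z m = z := hy
    simpa only [e] using main
  · have h1 : ∀ᶠ m' in 𝓝[≠] m, tau m' ≠ 0 := by
      by_cases h0 : tau m = 0
      · filter_upwards [self_mem_nhdsWithin, mem_nhdsWithin_of_mem_nhds (lt_mem_nhds hm)]
          with m' hm' hpos h0'
        apply hm'
        have e1 := half_sq_sub_tau m
        have e2 := half_sq_sub_tau m'
        rw [h0] at e1
        rw [h0'] at e2
        rw [mem_singleton_iff]
        nlinarith
      · exact (continuous_tau.continuousAt.eventually_ne h0).filter_mono nhdsWithin_le_nhds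
    have h2 := (hZt.eventually (upperReg_eventually hz h)).filter_mono
      (nhdsWithin_le_nhds (s := {m}ᶜ))
    filter_upwards [h1, h2, mem_nhdsWithin_of_mem_nhds (lt_mem_nhds hm)] with m' a1 a2 a3
    exact hasDerivAt_fUpper_param_of_ne x t a3 a1 a2.1 a2.2 κ m₁ y rfl
  · exact ContinuousAt.comp_of_eq (g := fun q : ℂ × ℝ => fUpper x t q.2 q.1)
      (f := fun m => (Z m, m)) (continuousAt_fUpper x t hm hU) hZc.continuousAt hZm
  · have c1 : ContinuousAt (fun m : ℝ => log (I * (m / 2 - Z m))) m := by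
      refine ContinuousAt.clog (by simp only [hZ]; fun_prop) ?_
      have e : Z m = z := hy
      rw [e]
      exact I_mul_mem_slitPlane hz
    have c2 : ContinuousAt (fun m => fPrimeReg x t m (Z m)) m :=
      ContinuousAt.comp_of_eq (g := fun q : ℂ × ℝ => fPrimeReg x t q.2 q.1)
        (f := fun m => (Z m, m)) (continuousAt_fPrimeReg x t hm hU) hZc.continuousAt hZm
    have c3 : ContinuousAt (fun m => fMuReg m (Z m)) m :=
      ContinuousAt.comp_of_eq (g := fun q : ℂ × ℝ => fMuReg q.2 q.1)
        (f := fun m => (Z m, m)) (continuousAt_fMuReg hm hU) hZc.continuousAt hZm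
    fun_prop

lemma f_eq_fUpper {x t m : ℝ} (hz : 0 ≤ z.im) : f x t m z = fUpper x t m z := if_pos hz

/-- Schwarz reflection. -/
lemma f_conj {x t m : ℝ} (hz : z.im ≠ 0) : f x t m (conj z) = conj (f x t m z) := by
  unfold f
  rcases hz.lt_or_gt with h | h
  · rw [if_pos (by simp; exact h.le), if_neg (by linarith), conj_conj]
  · rw [if_neg (by simp; exact h), if_pos h.le, conj_conj]

lemma hasDerivAt_f_upper (x t : ℝ) (hm : 0 < m) (hz : 0 < z.im) (h : z ∈ Dom m) :
    HasDerivAt (f x t m) (-log (I * (m / 2 - z)) + fPrimeReg x t m z) z := by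
  refine (hasDerivAt_fUpper x t hm hz h).congr_of_eventuallyEq ?_
  filter_upwards [(isOpen_lt continuous_const continuous_im).mem_nhds hz] with w hw
  exact f_eq_fUpper (le_of_lt hw)

lemma fPrime_upper (x t : ℝ) (hm : 0 < m) (hz : 0 < z.im) (h : z ∈ Dom m) :
    fPrime x t m z = -log (I * (m / 2 - z)) + fPrimeReg x t m z :=
  (hasDerivAt_f_upper x t hm hz h).deriv

lemma f_eventually_conj {x t m : ℝ} (hz : z.im ≠ 0) :
    f x t m =ᶠ[𝓝 z] fun w => conj (f x t m (conj w)) := by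
  filter_upwards [(isOpen_ne_fun continuous_im continuous_const).mem_nhds hz] with w hw
  rw [f_conj hw, conj_conj]

lemma hasDerivAt_f (x t : ℝ) (hm : 0 < m) (h : z ∈ Dom m) :
    HasDerivAt (f x t m) (fPrime x t m z) z := by
  refine DifferentiableAt.hasDerivAt ?_
  rcases h.1.lt_or_gt with h1 | h1
  · have h2 := (hasDerivAt_f_upper x t hm (z := conj z) (by simpa using h1)
      (conj_mem_Dom.2 h)).differentiableAt
    exact (differentiableAt_conj_conj_iff.2 h2).congr_of_eventuallyEq (f_eventually_conj h.1)
  · exact (hasDerivAt_f_upper x t hm h1 h).differentiableAt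

lemma fPrime_conj {x t m : ℝ} (hz : z.im ≠ 0) : fPrime x t m (conj z) = conj (fPrime x t m z) := by
  unfold fPrime
  have h1 : (conj z).im ≠ 0 := by simpa using hz
  change deriv (f x t m) _ = conj (deriv (f x t m) z)
  rw [(f_eventually_conj h1).deriv_eq]
  change deriv (conj ∘ f x t m ∘ conj) _ = _
  rw [deriv_conj_conj]
  simp

lemma hasDerivAt_f_param_upper (x t : ℝ) (hm : 0 < m) (hz : 0 < z.im) (h : z ∈ Dom m) (κ m₁ : ℝ)
    (y : ℂ) (hy : y + κ * (m - m₁) = z) :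
    HasDerivAt (fun m : ℝ => f x t m (y + κ * (m - m₁)))
      (κ * (-log (I * (m / 2 - z)) + fPrimeReg x t m z) +
        (log (I * (m / 2 - z)) / 2 + fMuReg m z)) m := by
  refine (hasDerivAt_fUpper_param x t hm hz h κ m₁ y hy).congr_of_eventuallyEq ?_
  have h1 : ContinuousAt (fun m : ℝ => (y + κ * ((m : ℂ) - m₁)).im) m :=
    Continuous.continuousAt (by fun_prop)
  filter_upwards [h1.eventually (lt_mem_nhds (show 0 < (y + κ * ((m : ℂ) - m₁)).im by rwa [hy]))]
    with m' hm'
  exact f_eq_fUpper hm'.le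

lemma fMu_upper (x t : ℝ) (hm : 0 < m) (hz : 0 < z.im) (h : z ∈ Dom m) :
    fMu x t m z = log (I * (m / 2 - z)) / 2 + fMuReg m z := by
  have h1 := hasDerivAt_f_param_upper x t hm hz h 0 0 z (by simp)
  simp only [ofReal_zero, zero_mul, add_zero, zero_add] at h1
  exact h1.deriv

lemma fMu_conj {x t m : ℝ} (hz : z.im ≠ 0) : fMu x t m (conj z) = conj (fMu x t m z) := by
  unfold fMu
  simp only [f_conj hz]
  exact deriv.star (f := fun m => f x t m z)

lemma hasDerivAt_f_param (x t : ℝ) (hm : 0 < m) (h : z ∈ Dom m) (κ m₁ : ℝ) (y : ℂ)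
    (hy : y + κ * (m - m₁) = z) :
    HasDerivAt (fun m : ℝ => f x t m (y + κ * (m - m₁))) (κ * fPrime x t m z + fMu x t m z) m := by
  rcases h.1.lt_or_gt with h1 | h1
  · have e := hasDerivAt_f_param_upper x t hm (z := conj z) (by simpa using h1)
      (conj_mem_Dom.2 h) κ m₁ (conj y) (by rw [← hy]; simp)
    rw [← fPrime_upper x t hm (by simpa using h1) (conj_mem_Dom.2 h),
      ← fMu_upper x t hm (by simpa using h1) (conj_mem_Dom.2 h), fPrime_conj h.1, fMu_conj h.1] at e
    have e2 := e.star
    have h3 : ContinuousAt (fun m : ℝ => (y + κ * ((m : ℂ) - m₁)).im) m :=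
      Continuous.continuousAt (by fun_prop)
    refine (e2.congr_of_eventuallyEq ?_).congr_deriv (by simp)
    filter_upwards [h3.eventually (gt_mem_nhds (show (y + κ * ((m : ℂ) - m₁)).im < 0 by rwa [hy]))]
      with m' hm'
    have e3 : conj y + κ * ((m' : ℂ) - m₁) = conj (y + κ * ((m' : ℂ) - m₁)) := by simp
    simp only [e3, f_conj hm'.ne]
    simp
  · have e := hasDerivAt_f_param_upper x t hm h1 h κ m₁ y hy
    rwa [← fPrime_upper x t hm h1 h, ← fMu_upper x t hm h1 h] at e

/-- In the moving frame, the logarithmic singularities at `μ/2` cancel in the derivative of `f` with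
respect to the parameter. -/
lemma half_fPrime_add_fMu (x t : ℝ) (hm : 0 < m) (hz : 0 < z.im) (h : z ∈ Dom m) :
    ((1 / 2 : ℝ) : ℂ) * fPrime x t m z + fMu x t m z = fPrimeReg x t m z / 2 + fMuReg m z := by
  rw [fPrime_upper x t hm hz h, fMu_upper x t hm hz h]
  push_cast
  ring

/-! ### The behaviour of `f` at `μ/2` -/

lemma ball_half_mem_Dom (hm : 0 < m) (hz : z ∈ ball ((m : ℂ) / 2) (m / 2 - √(tau m))) :
    √(tau m) < z.re ∧ (z.im ≠ 0 → z ∈ Dom m) := by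
  have h1 : √(tau m) < z.re := by
    rw [mem_ball, Complex.dist_eq] at hz
    have h2 := (abs_re_le_norm _).trans_lt hz
    rw [abs_lt] at h2
    simp at h2
    linarith [h2.1]
  refine ⟨h1, fun him => ⟨him, fun hs => ?_⟩⟩
  obtain ⟨a, b, ha, hb, hab, rfl⟩ := hs
  have e1 : (a • -branchT m + b • branchT m).re = (b - a) * √(tau m) := by simp [branchT_re]; ring
  rw [e1] at h1
  have := Real.sqrt_nonneg (tau m)
  nlinarith

lemma artanhC_conj (h1 : 1 + w ∈ slitPlane) (h2 : 1 - w ∈ slitPlane) :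
    artanhC (conj w) = conj (artanhC w) := by
  unfold artanhC
  have e1 : 1 + conj w = conj (1 + w) := by simp
  have e2 : 1 - conj w = conj (1 - w) := by simp
  rw [e1, e2, log_conj _ (slitPlane_arg_ne_pi h1),
    log_conj _ (slitPlane_arg_ne_pi h2), map_div₀, map_sub, conj_ofNat]

lemma artanhC_neg (w : ℂ) : artanhC (-w) = -artanhC w := by
  unfold artanhC
  rw [sub_neg_eq_add, ← sub_eq_add_neg]
  ring

lemma conj_branchT (m : ℝ) : conj (branchT m) = branchT m ∨ conj (branchT m) = -branchT m := by
  rw [← sq_eq_sq_iff_eq_or_eq_neg, ← map_pow, branchT_sq, conj_ofReal]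

lemma fReg_conj (x t : ℝ) (hm : 0 < m) (hz : √(tau m) < z.re) :
    fReg x t m (conj z) = conj (fReg x t m z) := by
  obtain ⟨n1, n2⟩ := one_add_sub_mem_slitPlane hm
  have hA : conj (artanhC (branchT m / (m / 2))) = artanhC (conj (branchT m) / ((m : ℂ) / 2)) := by
    rw [← artanhC_conj n1 n2, map_div₀, map_div₀, conj_ofReal, conj_ofNat]
  have h0 := Real.sqrt_nonneg (tau m)
  have L : ∀ w : ℂ, 0 < w.re → conj (logDown w) = logDown (conj w) := by
    intro w hw
    rw [logDown_eq_log hw, logDown_eq_log (by simpa using hw), log_conj]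
    exact slitPlane_arg_ne_pi (mem_slitPlane_iff.2 (Or.inl hw))
  have L1 := L (z + branchT m) (by simp [branchT_re]; linarith)
  have L2 := L (z - branchT m) (by simp [branchT_re]; linarith)
  unfold fReg
  simp only [map_add, map_sub, map_mul, map_div₀, map_pow, conj_ofReal, conj_ofNat, L1, L2, hA]
  rcases conj_branchT m with e | e
  · rw [e]
  · rw [e, neg_div, artanhC_neg]
    simp only [sub_neg_eq_add, ← sub_eq_add_neg]
    ring

lemma differentiableAt_fReg (x t : ℝ) (hz : √(tau m) < z.re) :
    DifferentiableAt ℂ (fReg x t m) z := by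
  have h0 := Real.sqrt_nonneg (tau m)
  have s1 : -I * (z + branchT m) ∈ slitPlane :=
    neg_I_mul_mem_slitPlane (Or.inr (by simp [branchT_re]; linarith))
  have s2 : -I * (z - branchT m) ∈ slitPlane :=
    neg_I_mul_mem_slitPlane (Or.inr (by simp [branchT_re]; linarith))
  have d1 := ((hasDerivAt_half_mul_logDown s1).comp z
    ((hasDerivAt_id z).add_const (branchT m))).differentiableAt
  have d2 := ((hasDerivAt_half_mul_logDown s2).comp z
    ((hasDerivAt_id z).sub_const (branchT m))).differentiableAt
  have d3 : DifferentiableAt ℂ (fun z => (z + branchT m) / 2 * logDown (z + branchT m)) z := d1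
  have d4 : DifferentiableAt ℂ (fun z => (z - branchT m) / 2 * logDown (z - branchT m)) z := d2
  unfold fReg
  fun_prop

lemma f_eq_of_im_pos {x t m : ℝ} (hz : 0 < z.im) :
    f x t m z = (m / 2 - z) * log (I * (m / 2 - z)) + fReg x t m z := by
  rw [f_eq_fUpper hz.le, fUpper_eq]

lemma f_eq_of_im_neg {x t m : ℝ} (hm : 0 < m) (hz : z.im < 0) (hre : √(tau m) < z.re) :
    f x t m z = (m / 2 - z) * log (-I * (m / 2 - z)) + fReg x t m z := by
  have h1 : 0 < (conj z).im := by simpa using hz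
  have h2 := f_conj (x := x) (t := t) (m := m) (z := conj z) h1.ne'
  rw [conj_conj] at h2
  rw [h2, f_eq_of_im_pos h1, map_add, fReg_conj x t hm hre, conj_conj, map_mul,
    ← log_conj _ (slitPlane_arg_ne_pi (I_mul_mem_slitPlane h1))]
  simp [conj_ofNat]

lemma fReg_half_conj (x t : ℝ) (hm : 0 < m) :
    conj (fReg x t m ((m : ℂ) / 2)) = fReg x t m ((m : ℂ) / 2) := by
  rw [← fReg_conj x t hm (by simpa using sqrt_tau_lt hm)]
  simp [conj_ofNat]

/-- `f` has a real limit at `μ/2` from each side. -/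
lemma fUpper_half_conj (x t : ℝ) (hm : 0 < m) :
    conj (fUpper x t m ((m : ℂ) / 2)) = fUpper x t m ((m : ℂ) / 2) := by
  rw [fUpper_eq]
  simp [fReg_half_conj x t hm]

/-! ### Uniqueness in the Riemann-Hilbert problem -/

lemma volume_image_eq_zero {L : NNReal} (hc : LipschitzOnWith L c (Icc 0 1)) :
    volume (c '' Icc 0 1) = 0 := by
  have h1 : dimH (c '' Icc 0 1) < (2 : NNReal) := by
    have h2 : dimH (Icc (0 : ℝ) 1) ≤ 1 := by
      refine (dimH_mono (subset_univ _)).trans ?_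
      rw [Real.dimH_univ]
    calc dimH (c '' Icc 0 1) ≤ 1 := hc.dimH_image_le.trans h2
      _ < _ := by norm_num
  refine measure_zero_of_dimH_lt (d := 2) ?_ h1
  have h3 : (Measure.hausdorffMeasure ((2 : NNReal) : ℝ) : Measure ℂ).IsAddHaarMeasure := by
    have := isAddHaarMeasure_hausdorffMeasure (E := ℂ)
    rw [finrank_real_complex] at this
    exact_mod_cast this
  exact Measure.absolutelyContinuous_isAddHaarMeasure _ _

lemma IsContour.exists_lipschitz (h : IsContour α μ γ) :
    ∃ (c : ℝ → ℂ) (L : NNReal), LipschitzOnWith L c (Icc 0 1) ∧ c '' Icc 0 1 = γ := by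
  obtain ⟨-, ⟨c, ⟨L, hL⟩, -, -, -, hc⟩, -⟩ := h
  exact ⟨c, L, hL, hc⟩

lemma IsContour.volume_eq_zero (h : IsContour α μ γ) : volume γ = 0 := by
  obtain ⟨c, L, hL, rfl⟩ := h.exists_lipschitz
  exact volume_image_eq_zero hL

lemma volume_compl_Dom (μ : ℝ) : volume (Dom μ)ᶜ = 0 := by
  have h1 : (Dom μ)ᶜ ⊆ (LinearMap.ker imLm : Set ℂ) ∪
      (fun s : ℝ => ((2 * s - 1 : ℝ) : ℂ) * branchT μ) '' Icc 0 1 := by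
    intro z hz
    unfold Dom at hz
    simp only [mem_compl_iff, mem_ofPred_eq, not_and_or, not_not] at hz
    rcases hz with hz | ⟨a, b, ha, hb, hab, rfl⟩
    · simp_all
    · right
      refine ⟨b, ⟨hb, by linarith⟩, ?_⟩
      have : a = 1 - b := by linarith
      subst this
      simp only [real_smul]
      push_cast
      ring
  refine measure_mono_null h1 (measure_union_null ?_ ?_)
  · refine Measure.addHaar_submodule _ _ fun h => ?_
    have : I ∈ LinearMap.ker imLm := by simp_all
    simp at this
  · refine volume_image_eq_zero (L := (2 * ‖branchT μ‖).toNNReal)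
      (LipschitzOnWith.of_dist_le_mul fun a _ b _ => ?_)
    rw [dist_eq_norm, ← sub_mul, norm_mul, ← ofReal_sub, Complex.norm_real,
      Real.coe_toNNReal _ (by positivity), Real.dist_eq, Real.norm_eq_abs,
      show 2 * a - 1 - (2 * b - 1) = 2 * (a - b) by ring, abs_mul, abs_two]
    exact le_of_eq (by ring)

lemma dense_compl_of_volume_eq_zero {S : Set ℂ} (h : volume S = 0) : Dense Sᶜ := by
  rw [← interior_eq_empty_iff_dense_compl]
  by_contra hne
  exact (isOpen_interior.measure_ne_zero volume (nonempty_iff_ne_empty.2 hne))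
    (measure_mono_null interior_subset h)

lemma IsContour.volume_compl (h : IsContour α μ γ) : volume (Dom μ \ γ)ᶜ = 0 := by
  rw [sdiff_eq, compl_inter, compl_compl]
  exact measure_union_null (volume_compl_Dom μ) h.volume_eq_zero

lemma IsContour.dense (h : IsContour α μ γ) : Dense (Dom μ \ γ) := by
  simpa using dense_compl_of_volume_eq_zero h.volume_compl

lemma IsContour.neBot (h : IsContour α μ γ) (w : ℂ) :
    (𝓝[Dom μ \ γ] w).NeBot := mem_closure_iff_nhdsWithin_neBot.1 (h.dense w)

lemma IsContour.isOpen_compl (h : IsContour α μ γ) : IsOpen γᶜ := h.isCompact.isClosed.isOpen_compl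

lemma IsContour.isOpen_Dom_diff (h : IsContour α μ γ) :
    IsOpen (Dom μ \ γ) := (isOpen_Dom μ).inter h.isOpen_compl

lemma IsRadical.tendsto_inv {R : ℂ → ℂ} (hR : IsRadical γ α R) :
    Tendsto (fun z => (R z)⁻¹) (cocompact ℂ) (𝓝 0) := by
  have h1 : Tendsto (fun z : ℂ => z⁻¹) (cocompact ℂ) (𝓝 0) :=
    (tendsto_inv₀_cobounded (α := ℂ)).mono_left (cobounded_eq_cocompact (α := ℂ)).ge
  have h2 := (hR.2.2.inv₀ (by norm_num)).mul h1
  rw [mul_zero] at h2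
  refine h2.congr' ?_
  filter_upwards [(isCompact_singleton (x := (0 : ℂ))).compl_mem_cocompact] with z hz
  have hz' : z ≠ 0 := hz
  field_simp

/-- A solution of the Riemann-Hilbert problem divided by the radical is continuous across the
contour. -/
lemma SolvesRHP.exists_tendsto_div {x t μ : ℝ} {k : ℂ → ℂ} (hk : SolvesRHP x t μ γ α k)
    (h : IsContour α μ γ) (hw : w ∈ γ) (h1 : w ≠ α) (h2 : w ≠ conj α) :
    ∃ l, Tendsto (fun z => k z / radical γ α z) (𝓝[Dom μ \ γ] w) (𝓝 l) := by
  obtain ⟨⟨kp, km, ⟨Φ, hΦ, hlim⟩, hsum⟩, -, -⟩ := hk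
  obtain ⟨s, hs, rfl⟩ := h.exists_homeo_eq hΦ hw h1 h2
  obtain ⟨r, hr, hrp, hrm⟩ := h.radical_sides hΦ hs
  obtain ⟨hkp, hkm⟩ := hlim s hs
  refine ⟨kp (Φ s) / r, tendsto_of_sides (u := fun z => k z / radical γ α z) hΦ hs ?_ ?_⟩
  · exact hkp.div (hrp.mono_left (nhdsWithin_mono _ fun z hz => hz.1)) hr
  · have h3 := hkm.div (hrm.mono_left (nhdsWithin_mono _ fun z hz => hz.1)) (neg_ne_zero.2 hr)
    have h4 := hsum (Φ s) hw h1 h2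
    rwa [show kp (Φ s) / r = km (Φ s) / -r by
      rw [eq_neg_of_add_eq_zero_left h4, neg_div, div_neg]]

/-- If `u` is analytic near the point `a` except at `a`, with `|z - a|^(1/2) |u|` bounded, then `a`
is a removable singularity. -/
lemma exists_tendsto_of_sqrt_bound {u q : ℂ → ℂ} {a : ℂ} {C : ℝ}
    (hu : ∀ᶠ z in 𝓝[≠] a, DifferentiableAt ℂ u z) (hq : ContinuousAt q a) (hq0 : q a ≠ 0)
    (hb : ∀ᶠ z in 𝓝[≠] a, ‖u z‖ ^ 2 * ‖(z - a) * q z‖ ≤ C) : ∃ l, Tendsto u (𝓝[≠] a) (𝓝 l) := by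
  refine ⟨_, tendsto_limUnder_of_differentiable_on_punctured_nhds_of_isLittleO hu ?_⟩
  have h1 : u =o[𝓝[≠] a] fun z => (z - a)⁻¹ := by
    rw [Asymptotics.isLittleO_iff]
    intro c hc
    have h2 : Tendsto (fun z => C * ‖z - a‖ / ‖q z‖) (𝓝 a) (𝓝 0) := by
      have h3 : Tendsto (fun z => C * ‖z - a‖) (𝓝 a) (𝓝 0) := by
        have := Continuous.tendsto (f := fun z => C * ‖z - a‖) (by fun_prop) a
        simpa using this
      have h4 := h3.div hq.norm (norm_ne_zero_iff.2 hq0)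
      rw [zero_div] at h4
      exact h4
    have h4 := (h2.eventually (gt_mem_nhds (show 0 < c ^ 2 by positivity))).filter_mono
      (nhdsWithin_le_nhds (s := {a}ᶜ))
    have h5 := (hq.eventually_ne hq0).filter_mono (nhdsWithin_le_nhds (s := {a}ᶜ))
    filter_upwards [hb, h4, h5, self_mem_nhdsWithin] with z b1 b2 b3 b4
    have b5 : 0 < ‖z - a‖ := norm_pos_iff.2 (sub_ne_zero.2 b4)
    have b6 : 0 < ‖q z‖ := norm_pos_iff.2 b3
    rw [norm_inv, ← div_eq_mul_inv, le_div_iff₀ b5]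
    refine le_of_lt (lt_of_pow_lt_pow_left₀ 2 hc.le (lt_of_le_of_lt ?_ b2))
    rw [le_div_iff₀ b6]
    rw [norm_mul] at b1
    calc (‖u z‖ * ‖z - a‖) ^ 2 * ‖q z‖ = ‖u z‖ ^ 2 * (‖z - a‖ * ‖q z‖) * ‖z - a‖ := by ring
      _ ≤ C * ‖z - a‖ := by gcongr
  have h2 : (fun _ : ℂ => u a) =o[𝓝[≠] a] fun z => (z - a)⁻¹ := by
    rw [Asymptotics.isLittleO_iff]
    intro c hc
    have h2 : Tendsto (fun z => ‖u a‖ * ‖z - a‖) (𝓝 a) (𝓝 0) := by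
      have := Continuous.tendsto (f := fun z => ‖u a‖ * ‖z - a‖) (by fun_prop) a
      simpa using this
    filter_upwards [(h2.eventually (gt_mem_nhds hc)).filter_mono
      (nhdsWithin_le_nhds (s := {a}ᶜ)), self_mem_nhdsWithin] with z b2 b4
    have b5 : 0 < ‖z - a‖ := norm_pos_iff.2 (sub_ne_zero.2 b4)
    rw [norm_inv, ← div_eq_mul_inv, le_div_iff₀ b5]
    exact b2.le
  exact h1.sub h2

/-- The Riemann-Hilbert problem has at most one solution. -/
lemma SolvesRHP.unique {x t μ : ℝ} {h k : ℂ → ℂ} (hγ : IsContour α μ γ)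
    (hh : SolvesRHP x t μ γ α h) (hk : SolvesRHP x t μ γ α k) : EqOn k h (Dom μ \ γ) := by
  have hR := hγ.isRadical
  set R := radical γ α with hRdef
  obtain ⟨-, ⟨G₁, hG₁d, ⟨l₁, hl₁⟩, hG₁⟩, ⟨C₁, hC₁, hC₁'⟩⟩ := id hh
  obtain ⟨-, ⟨G₂, hG₂d, ⟨l₂, hl₂⟩, hG₂⟩, ⟨C₂, hC₂, hC₂'⟩⟩ := id hk
  set u : ℂ → ℂ := fun z => (G₂ z - G₁ z) / R z with hu
  have hud : DifferentiableOn ℂ u γᶜ := (hG₂d.sub hG₁d).div hR.1 fun z hz => hR.ne_zero hγ hz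
  have hue : ∀ z ∈ Dom μ \ γ, u z = k z / R z - h z / R z := by
    intro z hz
    rw [hu]
    simp only
    rw [hG₂ z hz, hG₁ z hz, ← sub_div]
    congr 1
    ring
  set A := Dom μ \ γ with hA
  have hAd : Dense A := hγ.dense
  have hAo : IsOpen A := hγ.isOpen_Dom_diff
  set O : Set ℂ := {α, conj α}ᶜ with hOdef
  have hO : IsOpen O := by simp_all
  have hlim : ∀ w ∈ O, ∃ l, Tendsto u (𝓝[A] w) (𝓝 l) := by
    intro w hw
    by_cases hwγ : w ∈ γ
    · simp only [hOdef, mem_compl_iff, mem_insert_iff, mem_singleton_iff, not_or] at hw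
      obtain ⟨a, ha⟩ := hk.exists_tendsto_div hγ hwγ hw.1 hw.2
      obtain ⟨b, hb⟩ := hh.exists_tendsto_div hγ hwγ hw.1 hw.2
      refine ⟨a - b, (ha.sub hb).congr' ?_⟩
      filter_upwards [self_mem_nhdsWithin] with z hz using (hue z hz).symm
    · exact ⟨_, (hud.continuousOn w hwγ).mono_left (nhdsWithin_mono _ fun z hz => hz.2)⟩
  set v := extendFrom A u with hv
  have hvc : ContinuousOn v O := continuousOn_extendFrom (fun w _ => hAd w) hlim
  have hvu : EqOn v u γᶜ := fun w hw => extendFrom_eq (hAd w)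
    ((hud.continuousOn w hw).mono_left (nhdsWithin_mono _ fun z hz => hz.2))
  obtain ⟨c, L, hL, hc⟩ := hγ.exists_lipschitz
  have hvd : DifferentiableOn ℂ v O := by
    refine differentiableOn_of_continuousOn_off_curve hO hL hvc ?_
    rw [hc]
    exact (hud.congr hvu).mono fun z hz => hz.2
  have hne := hγ.ne_conj
  have hend : ∀ a ∈ ({α, conj α} : Set ℂ), ∃ l, Tendsto v (𝓝[≠] a) (𝓝 l) := by
    intro a ha
    obtain ⟨b, hab, hq, hba⟩ : ∃ b, a ≠ b ∧ (∀ z, (z - a) * (z - b) = (z - α) *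
        (z - conj α)) ∧ ({α, conj α} : Set ℂ) = {a, b} := by
      rcases ha with rfl | ha
      · exact ⟨_, hne, fun z => rfl, rfl⟩
      · rw [mem_singleton_iff] at ha
        exact ⟨α, by rw [ha]; exact hne.symm, fun z => by rw [ha]; ring, by rw [ha, pair_comm]⟩
    have hOn : O ∈ 𝓝[≠] a := by
      have h1 : ({b}ᶜ : Set ℂ) ∈ 𝓝 a := by simp_all
      filter_upwards [mem_nhdsWithin_of_mem_nhds h1, self_mem_nhdsWithin] with z h1 h2
      rw [hOdef, hba]
      simp only [mem_compl_iff, mem_singleton_iff] at h1 h2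
      simp [h1, h2]
    obtain ⟨C, hC⟩ : ∃ C, ∀ᶠ z in 𝓝[A] a, ‖k z - h z‖ ≤ C := by
      refine ⟨C₂ + C₁, ?_⟩
      rcases ha with rfl | ha
      · filter_upwards [hC₁, hC₂] with z h1 h2
        exact (norm_sub_le _ _).trans (add_le_add h2 h1)
      · rw [mem_singleton_iff] at ha
        subst ha
        filter_upwards [hC₁', hC₂'] with z h1 h2
        exact (norm_sub_le _ _).trans (add_le_add h2 h1)
    refine exists_tendsto_of_sqrt_bound (q := fun z => z - b) (C := C ^ 2) ?_ (by fun_prop)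
      (sub_ne_zero.2 hab) ?_
    · filter_upwards [hOn] with z hz using hvd.differentiableAt (hO.mem_nhds hz)
    · rw [eventually_nhdsWithin_iff, _root_.eventually_nhds_iff] at hC
      obtain ⟨N, hN, hNo, haN⟩ := hC
      filter_upwards [hOn, mem_nhdsWithin_of_mem_nhds (hNo.mem_nhds haN)] with z hz hzN
      have : (𝓝[A] z).NeBot := mem_closure_iff_nhdsWithin_neBot.1 (hAd z)
      have h1 : Tendsto (fun z => ‖v z‖ ^ 2 * ‖(z - a) * (z - b)‖) (𝓝[A] z)
          (𝓝 (‖v z‖ ^ 2 * ‖(z - a) * (z - b)‖)) := by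
        have := (hvc.continuousAt (hO.mem_nhds hz))
        have h2 : ContinuousAt (fun z => ‖v z‖ ^ 2 * ‖(z - a) * (z - b)‖) z := by fun_prop
        exact h2.tendsto.mono_left nhdsWithin_le_nhds
      refine le_of_tendsto h1 ?_
      filter_upwards [self_mem_nhdsWithin, mem_nhdsWithin_of_mem_nhds (hNo.mem_nhds hzN)]
        with y hy hyN
      rw [hvu hy.2, hue y hy, ← sub_div, norm_div, hq, ← hR.2.1 y hy.2, norm_pow, ← mul_pow,
        div_mul_cancel₀ _ (norm_ne_zero_iff.2 (hR.ne_zero hγ hy.2))]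
      exact pow_le_pow_left₀ (norm_nonneg _) (hN y hyN hy) 2
  set w := extendFrom O v with hw
  have hOd : Dense O := (Set.toFinite _).countable.dense_compl ℝ
  have hwc : Continuous w := by
    rw [← continuousOn_univ]
    refine continuousOn_extendFrom (fun z _ => hOd z) fun z _ => ?_
    by_cases hz : z ∈ O
    · exact ⟨_, (hvc.continuousAt (hO.mem_nhds hz)).tendsto.mono_left nhdsWithin_le_nhds⟩
    · have hz' : z ∈ ({α, conj α} : Set ℂ) := not_not.1 hz
      obtain ⟨l, hl⟩ := hend z hz'
      exact ⟨l, hl.mono_left (nhdsWithin_mono _ fun y hy e => hy (e ▸ hz'))⟩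
  have hwv : EqOn w v O := fun z hz => extendFrom_eq (hOd z)
    ((hvc.continuousAt (hO.mem_nhds hz)).tendsto.mono_left nhdsWithin_le_nhds)
  have hwd : Differentiable ℂ w := by
    rw [← differentiableOn_univ]
    refine differentiableOn_of_continuousOn_off_curve isOpen_univ hL hwc.continuousOn ?_
    rw [hc]
    refine (hvd.congr hwv).mono fun z hz => ?_
    rw [hOdef]
    rintro (rfl | h1)
    · exact hz.2 hγ.left_mem
    · rw [mem_singleton_iff] at h1
      exact hz.2 (h1 ▸ hγ.conj_mem.2 hγ.left_mem)
  have hOγ : γᶜ ⊆ O := by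
    rintro z hz (rfl | h1)
    · exact hz hγ.left_mem
    · rw [mem_singleton_iff] at h1
      exact hz (h1 ▸ hγ.conj_mem.2 hγ.left_mem)
  have hw0 : Tendsto w (cocompact ℂ) (𝓝 0) := by
    have h1 := (hl₂.sub hl₁).mul hR.tendsto_inv
    rw [mul_zero] at h1
    refine h1.congr' ?_
    filter_upwards [hγ.isCompact.compl_mem_cocompact] with z hz
    rw [hwv (hOγ hz), hvu hz]
    simp only [hu, div_eq_mul_inv]
  intro z hz
  have h1 := hwd.apply_eq_of_tendsto_cocompact z hw0
  rw [hwv (hOγ hz.2), hvu hz.2, hue z hz, ← sub_div, div_eq_zero_iff] at h1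
  rcases h1 with h1 | h1
  · exact sub_eq_zero.1 h1
  · exact (hR.ne_zero hγ hz.2 h1).elim

/-! ### Loops and winding numbers -/

/-- The points of the loop with upper half `σ`. -/
def loopTrace (σ : ℝ → ℂ) : Set ℂ := σ '' Icc 0 1 ∪ mirror σ '' Icc 0 1

/-- The winding number of the loop with upper half `σ`. -/
def loopWind (σ : ℝ → ℂ) (z : ℂ) : ℂ :=
  (2 * π * I)⁻¹ * loopInt σ (fun ζ => (ζ - z)⁻¹)

lemma conj_two_pi_I_inv : conj (2 * π * I)⁻¹ = -(2 * π * I)⁻¹ := by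
  simp only [map_inv₀, map_mul, conj_ofReal, conj_I, conj_ofNat]
  rw [mul_neg, inv_neg]

lemma IsLoop.nice (h : IsLoop γ μ σ) : NiceCurve σ :=
  h.1.niceCurve

lemma mem_loopTrace_conj : conj z ∈ loopTrace σ ↔ z ∈ loopTrace σ := by
  have key : ∀ z : ℂ, z ∈ loopTrace σ → conj z ∈ loopTrace σ := by
    rintro z (⟨s, hs, rfl⟩ | ⟨s, hs, rfl⟩)
    · exact Or.inr ⟨1 - s, ⟨by linarith [hs.2], by linarith [hs.1]⟩, by simp [mirror]⟩
    · exact Or.inl ⟨1 - s, ⟨by linarith [hs.2], by linarith [hs.1]⟩, by simp [mirror]⟩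
  exact ⟨fun h => by simpa using key _ h, key z⟩

lemma NiceCurve.isCompact_loopTrace (h : NiceCurve σ) : IsCompact (loopTrace σ) :=
  (isCompact_Icc.image_of_continuousOn h.continuousOn).union
    (isCompact_Icc.image_of_continuousOn h.mirror.continuousOn)

lemma IsLoop.mem_Icc (h : IsLoop γ μ σ) (hs : s ∈ Icc 0 1) :
    σ s = (μ : ℂ) / 2 ∨ (0 < (σ s).im ∧ σ s ∈ Dom μ ∧ σ s ∉ γ) := by
  obtain ⟨-, h0, h1, -, h2, -⟩ := h
  rcases eq_or_lt_of_le hs.1 with e | hs0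
  · simp_all
  rcases eq_or_lt_of_le hs.2 with e | hs1
  · simp_all
  exact Or.inr (h2 s ⟨hs0, hs1⟩)

lemma IsLoop.upperReg (hμ : 0 < μ) (h : IsLoop γ μ σ) (hs : s ∈ Icc 0 1) : UpperReg μ (σ s) := by
  rcases h.mem_Icc hs with e | ⟨h1, h2, -⟩
  · rw [e]; exact ⟨half_not_mem_segment hμ, Or.inr rfl⟩
  · exact ⟨h2.2, Or.inl h1⟩

lemma IsLoop.mem_loopTrace (h : IsLoop γ μ σ) (hγ : IsContour α μ γ) (hz : z ∈ loopTrace σ) :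
    z = (μ : ℂ) / 2 ∨ z ∈ Dom μ \ γ := by
  rcases hz with ⟨s, hs, rfl⟩ | ⟨s, hs, rfl⟩
  · exact (h.mem_Icc hs).imp_right fun h => ⟨h.2.1, h.2.2⟩
  · have hs' : 1 - s ∈ Icc 0 1 := ⟨by linarith [hs.2], by linarith [hs.1]⟩
    refine (h.mem_Icc hs').imp (fun e => ?_) fun h => ⟨?_, ?_⟩
    · unfold mirror
      rw [e]
      simp [conj_ofNat]
    · exact conj_mem_Dom.2 h.2.1
    · exact fun h' => h.2.2 (hγ.conj_mem.1 h')

lemma IsLoop.half_mem_loopTrace (h : IsLoop γ μ σ) :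
    (μ : ℂ) / 2 ∈ loopTrace σ := Or.inl ⟨0, by simp, h.2.1⟩

lemma NiceCurve.curveIntegrable_cauchy (hc : NiceCurve c)
    (hg : ContinuousOn (fun s => g (c s)) (Ioo 0 1)) (hb : ∃ C, ∀ s ∈ Ioo 0 1, ‖g (c s)‖ ≤ C)
    (hz : z ∉ c '' Icc 0 1) : CurveIntegrable c (fun ζ => g ζ / (ζ - z)) := by
  have hne : ∀ s ∈ Icc 0 1, c s - z ≠ 0 := fun s hs h => hz ⟨s, hs, sub_eq_zero.1 h⟩
  obtain ⟨C, hC⟩ := hb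
  obtain ⟨M, hM⟩ := isCompact_Icc.exists_bound_of_continuousOn
    ((hc.continuousOn.sub continuousOn_const).inv₀ hne)
  refine hc.curveIntegrable ?_ ⟨C * M, fun s hs => ?_⟩
  · exact hg.div ((hc.continuousOn.mono Ioo_subset_Icc_self).sub continuousOn_const)
      fun s hs => hne s (Ioo_subset_Icc_self hs)
  · rw [div_eq_mul_inv, norm_mul]
    exact mul_le_mul (hC s hs) (hM s (Ioo_subset_Icc_self hs)) (norm_nonneg _)
      ((norm_nonneg _).trans (hC s hs))

lemma NiceCurve.curveIntegrable_inv (hc : NiceCurve c) (hz : z ∉ c '' Icc 0 1) :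
    CurveIntegrable c (fun ζ => (ζ - z)⁻¹) := by
  have := hc.curveIntegrable_cauchy (g := fun _ => 1) continuousOn_const ⟨1, by simp⟩ hz
  simpa only [one_div] using this

/-- A closed curve avoiding the vertical half line from `z` downwards does not wind around `z`. -/
lemma NiceCurve.curveInt_inv_eq_zero (hc : NiceCurve c) (h01 : c 0 = c 1)
    (h : ∀ s ∈ Icc 0 1, -I * (c s - z) ∈ slitPlane) : curveInt c (fun ζ => (ζ - z)⁻¹) = 0 := by
  have hz : z ∉ c '' Icc 0 1 := by
    rintro ⟨s, hs, rfl⟩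
    have := h s hs
    simp at this
  rw [hc.curveInt_eq_sub (P := fun ζ => logDown (ζ - z)) ?_ ?_ (hc.curveIntegrable_inv hz), h01,
    sub_self]
  · intro s hs
    exact ContinuousAt.comp_continuousWithinAt (g := logDown) (f := fun s => c s - z)
      (continuousAt_logDown (h s hs)) ((hc.continuousOn s hs).sub continuousWithinAt_const)
  · intro s hs
    have h1 := (hasDerivAt_logDown (h s (Ioo_subset_Icc_self hs))).comp (c s)
      ((hasDerivAt_id (c s)).sub_const z)
    simpa [Function.comp_def] using h1

lemma IsLoop.curveInt_inv_eq_zero_of_im_nonpos (h : IsLoop γ μ σ) (hz : z.im ≤ 0)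
    (hzp : z ≠ (μ : ℂ) / 2) : curveInt σ (fun ζ => (ζ - z)⁻¹) = 0 := by
  refine h.nice.curveInt_inv_eq_zero (h.2.1.trans h.2.2.1.symm) fun s hs => ?_
  apply neg_I_mul_mem_slitPlane
  rcases h.mem_Icc hs with e | ⟨h1, -⟩
  · rw [e]
    rcases hz.lt_or_eq with h2 | h2
    · simp_all
    · right
      intro h3
      apply hzp
      refine Complex.ext ?_ (by simp [h2])
      rw [Complex.sub_re, sub_eq_zero] at h3
      exact h3.symm
  · left
    rw [Complex.sub_im]
    linarith

lemma IsLoop.curveInt_inv_eq_zero_of_mem_segment (hμ : 0 < μ) (h : IsLoop γ μ σ)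
    (hz : z ∈ segment ℝ (-branchT μ) (branchT μ)) : curveInt σ (fun ζ => (ζ - z)⁻¹) = 0 := by
  refine h.nice.curveInt_inv_eq_zero (h.2.1.trans h.2.2.1.symm) fun s hs => ?_
  obtain ⟨a, b, ha, hb, hab, rfl⟩ := hz
  have := (h.upperReg hμ hs).mem_slitPlane hμ (u := a - b) ⟨by linarith, by linarith⟩
  convert this using 2
  simp only [real_smul]
  push_cast
  ring

lemma curveInt_mirror_inv (σ : ℝ → ℂ) (z : ℂ) :
    curveInt (mirror σ) (fun ζ => (ζ - z)⁻¹) = -conj (curveInt σ (fun ζ => (ζ - conj z)⁻¹)) := by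
  rw [curveInt_mirror]
  simp

/-- The complement of `Dom μ` less `μ/2` lies outside every loop. -/
lemma IsLoop.loopWind_eq_zero (hμ : 0 < μ) (h : IsLoop γ μ σ) (hz : z ∉ Dom μ)
    (hzp : z ≠ (μ : ℂ) / 2) : loopWind σ z = 0 := by
  have hz' : conj z ∉ Dom μ := fun h => hz (conj_mem_Dom.1 h)
  have hzp' : conj z ≠ (μ : ℂ) / 2 := by
    intro e
    apply hzp
    rw [← conj_conj z, e]
    simp [conj_ofNat]
  have key : ∀ z : ℂ, z ∉ Dom μ → z ≠ (μ : ℂ) / 2 → curveInt σ (fun ζ => (ζ - z)⁻¹) = 0 := by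
    intro z hz hzp
    unfold Dom at hz
    simp only [mem_ofPred_eq, not_and_or, not_not] at hz
    rcases hz with hz | hz
    · exact h.curveInt_inv_eq_zero_of_im_nonpos hz.le hzp
    · exact h.curveInt_inv_eq_zero_of_mem_segment hμ hz
  unfold loopWind loopInt
  rw [curveInt_mirror_inv, key z hz hzp, key _ hz' hzp']
  simp

lemma IsLoop.loopWind_eq_neg_one (h : IsLoop γ μ σ) (hγ : IsContour α μ γ) (hz : z ∈ γ)
    (hzp : z ≠ (μ : ℂ) / 2) : loopWind σ z = -1 := by
  have him : z.im ≠ 0 := fun h0 => hzp (hγ.eq_of_im_eq_zero hz h0)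
  have hzp' : conj z ≠ (μ : ℂ) / 2 := by
    intro e
    apply hzp
    rw [← conj_conj z, e]
    simp [conj_ofNat]
  have hw := h.2.2.2.2.2
  unfold loopWind loopInt
  rw [curveInt_mirror_inv, mul_add]
  rcases him.lt_or_gt with h1 | h1
  · rw [h.curveInt_inv_eq_zero_of_im_nonpos h1.le hzp, mul_zero, zero_add, mul_neg, ← neg_mul,
      ← conj_two_pi_I_inv, ← map_mul, hw _ (hγ.conj_mem.2 hz) (by simpa using h1)]
    simp
  · rw [h.curveInt_inv_eq_zero_of_im_nonpos (z := conj z) (by simpa using h1.le) hzp', hw z hz h1]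
    simp

lemma NiceCurve.exists_int_curveInt_inv (hc : NiceCurve c) (h01 : c 0 = c 1)
    (hz : z ∉ c '' Icc 0 1) : ∃ n : ℤ, (2 * π * I)⁻¹ * curveInt c (fun ζ => (ζ - z)⁻¹) = n := by
  obtain ⟨L, hL⟩ := hc.lip
  have h1 := exp_curveInt_inv hL hz
  have h2 : z - c 0 ≠ 0 := fun e => hz ⟨0, by simp, (sub_eq_zero.1 e).symm⟩
  rw [← h01, div_self h2] at h1
  obtain ⟨n, hn⟩ := exp_eq_one_iff.1 h1
  refine ⟨n, ?_⟩
  simp only [one_div] at hn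
  rw [hn]
  have := two_pi_I_ne_zero
  field_simp

lemma mirror_zero_one (h01 : σ 0 = σ 1) : mirror σ 0 = mirror σ 1 := by
  simp [mirror, h01]

lemma NiceCurve.exists_int_loopWind (hσ : NiceCurve σ) (h01 : σ 0 = σ 1) (hz : z ∉ loopTrace σ) :
    ∃ n : ℤ, loopWind σ z = n := by
  obtain ⟨n, hn⟩ := hσ.exists_int_curveInt_inv h01 fun h => hz (Or.inl h)
  obtain ⟨m, hm⟩ := hσ.mirror.exists_int_curveInt_inv (mirror_zero_one h01) fun h => hz (Or.inr h)
  refine ⟨n + m, ?_⟩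
  unfold loopWind loopInt
  rw [mul_add, hn, hm]
  push_cast
  rfl

lemma NiceCurve.differentiableOn_loopWind (hσ : NiceCurve σ) :
    DifferentiableOn ℂ (loopWind σ) (loopTrace σ)ᶜ := by
  have key : ∀ c : ℝ → ℂ, NiceCurve c → DifferentiableOn ℂ
      (fun z => curveInt c (fun ζ => (ζ - z)⁻¹)) (c '' Icc 0 1)ᶜ := by
    intro c hc
    have := differentiableOn_cauchyInt hc.lip (g := fun _ => 1) continuousOn_const ⟨1, by simp⟩
    simpa only [one_div] using this
  refine DifferentiableOn.const_mul (DifferentiableOn.add ((key σ hσ).mono ?_)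
    ((key _ hσ.mirror).mono ?_)) _
  · exact fun z hz h => hz (Or.inl h)
  · exact fun z hz h => hz (Or.inr h)

/-- Winding numbers are locally constant. -/
lemma NiceCurve.loopWind_eventuallyEq (hσ : NiceCurve σ) (h01 : σ 0 = σ 1) (hz : z ∉ loopTrace σ)
    : ∀ᶠ w in 𝓝 z, w ∉ loopTrace σ ∧ loopWind σ w = loopWind σ z := by
  have hop : (loopTrace σ)ᶜ ∈ 𝓝 z := hσ.isCompact_loopTrace.isClosed.isOpen_compl.mem_nhds hz
  have h1 := (hσ.differentiableOn_loopWind.differentiableAt hop).continuousAt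
  filter_upwards [hop, h1.eventually (ball_mem_nhds _ one_pos)] with w hw hw'
  refine ⟨hw, ?_⟩
  obtain ⟨n, hn⟩ := hσ.exists_int_loopWind h01 hw
  obtain ⟨m, hm⟩ := hσ.exists_int_loopWind h01 hz
  rw [hn, hm, Complex.dist_eq] at hw'
  rw [hn, hm]
  have h2 : |(n - m : ℤ)| < 1 := by
    rw [← Int.cast_sub, norm_intCast] at hw'
    exact_mod_cast hw'
  rw [Int.abs_lt_one_iff, sub_eq_zero] at h2
  rw [h2]

lemma NiceCurve.loopWind_eventually_cocompact (hσ : NiceCurve σ) (h01 : σ 0 = σ 1) :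
    ∀ᶠ w in cocompact ℂ, w ∉ loopTrace σ ∧ loopWind σ w = 0 := by
  have key : ∀ c : ℝ → ℂ, NiceCurve c →
      Tendsto (fun z => curveInt c (fun ζ => (ζ - z)⁻¹)) (cocompact ℂ) (𝓝 0) := by
    intro c hc
    have := tendsto_cauchyInt_cocompact hc.lip (g := fun _ => 1) ⟨1, by simp⟩
    simpa only [one_div] using this
  have h1 : Tendsto (loopWind σ) (cocompact ℂ) (𝓝 0) := by
    have := ((key σ hσ).add (key _ hσ.mirror)).const_mul (2 * π * I)⁻¹
    rw [add_zero, mul_zero] at this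
    exact this
  filter_upwards [hσ.isCompact_loopTrace.compl_mem_cocompact,
    h1.eventually (ball_mem_nhds _ one_pos)] with w hw hw'
  refine ⟨hw, ?_⟩
  obtain ⟨n, hn⟩ := hσ.exists_int_loopWind h01 hw
  rw [hn, dist_zero_right, norm_intCast] at hw'
  have h2 : |n| < 1 := by exact_mod_cast hw'
  rw [Int.abs_lt_one_iff] at h2
  rw [hn, h2]
  simp

/-! ### The Cauchy integral of `f / R` -/

/-- `(1/2πi) ∮ f(ζ) / ((ζ - y) R(ζ)) dζ`. -/
def cauchyE (x t μ : ℝ) (γ : Set ℂ) (α : ℂ) (σ : ℝ → ℂ) (y : ℂ) : ℂ :=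
  (2 * π * I)⁻¹ * loopInt σ (fun ζ => f x t μ ζ / ((ζ - y) * radical γ α ζ))

lemma modK_eq_cauchyE (x t μ : ℝ) (γ : Set ℂ) (α : ℂ) (σ : ℝ → ℂ) :
    modK x t μ γ α σ = cauchyE x t μ γ α σ α := rfl

lemma IsLoop.continuousOn_f (hμ : 0 < μ) (h : IsLoop γ μ σ) (x t : ℝ) :
    ContinuousOn (fun s => f x t μ (σ s)) (Icc 0 1) := by
  have h1 : ContinuousOn (fun s => fUpper x t μ (σ s)) (Icc 0 1) := by
    intro s hs
    exact ContinuousAt.comp_continuousWithinAt (g := fun q : ℂ × ℝ => fUpper x t q.2 q.1)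
      (f := fun s => (σ s, μ)) (continuousAt_fUpper x t hμ (h.upperReg hμ hs))
      ((h.nice.continuousOn s hs).prodMk continuousWithinAt_const)
  refine h1.congr fun s hs => f_eq_fUpper ?_
  rcases h.mem_Icc hs with e | ⟨h1, -⟩
  · rw [e]; simp
  · exact h1.le

lemma IsLoop.sub_ne_zero (h : IsLoop γ μ σ) (hγ : IsContour α μ γ) (hs : s ∈ Icc 0 1) :
    (σ s - α) * (σ s - conj α) ≠ 0 := by
  have key : ∀ a ∈ γ, a.im ≠ 0 → σ s - a ≠ 0 := by
    intro a ha him e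
    rcases h.mem_Icc hs with e' | ⟨-, -, h1⟩
    · rw [e', sub_eq_zero] at e
      rw [← e] at him
      simp at him
    · exact h1 (sub_eq_zero.1 e ▸ ha)
  refine mul_ne_zero (key _ hγ.left_mem hγ.1.ne') (key _ (hγ.conj_mem.2 hγ.left_mem) ?_)
  simpa using hγ.1.ne'

lemma IsLoop.exists_inv_radical_bound (h : IsLoop γ μ σ) (hγ : IsContour α μ γ) :
    ∃ C, 0 ≤ C ∧ ∀ s ∈ Ioo 0 1, ‖(radical γ α (σ s))⁻¹‖ ≤ C := by
  have hc := h.nice.continuousOn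
  obtain ⟨C, hC⟩ := isCompact_Icc.exists_bound_of_continuousOn
    (f := fun s => ((σ s - α) * (σ s - conj α))⁻¹)
    (ContinuousOn.inv₀ (by fun_prop) fun s hs => h.sub_ne_zero hγ hs)
  refine ⟨√C, Real.sqrt_nonneg _, fun s hs => Real.le_sqrt_of_sq_le ?_⟩
  rw [← norm_pow, inv_pow, hγ.isRadical.2.1 _ (h.2.2.2.2.1 s hs).2.2]
  exact hC s (Ioo_subset_Icc_self hs)

lemma IsLoop.continuousOn_radical (h : IsLoop γ μ σ) (hγ : IsContour α μ γ) :
    ContinuousOn (fun s => radical γ α (σ s)) (Ioo 0 1) :=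
  hγ.isRadical.1.continuousOn.comp (h.nice.continuousOn.mono Ioo_subset_Icc_self)
    fun s hs => (h.2.2.2.2.1 s hs).2.2

lemma IsLoop.radical_ne_zero (h : IsLoop γ μ σ) (hγ : IsContour α μ γ) (hs : s ∈ Ioo 0 1) :
    radical γ α (σ s) ≠ 0 := hγ.isRadical.ne_zero hγ (h.2.2.2.2.1 s hs).2.2

lemma IsLoop.fR_bound (hμ : 0 < μ) (h : IsLoop γ μ σ) (hγ : IsContour α μ γ) (x t : ℝ) :
    ContinuousOn (fun s => f x t μ (σ s) / radical γ α (σ s)) (Ioo 0 1) ∧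
      ∃ C, ∀ s ∈ Ioo 0 1, ‖f x t μ (σ s) / radical γ α (σ s)‖ ≤ C := by
  have h1 := h.continuousOn_f hμ x t
  obtain ⟨C, hC⟩ := isCompact_Icc.exists_bound_of_continuousOn h1
  obtain ⟨M, hM0, hM⟩ := h.exists_inv_radical_bound hγ
  refine ⟨(h1.mono Ioo_subset_Icc_self).div (h.continuousOn_radical hγ)
    fun s hs => h.radical_ne_zero hγ hs, C * M, fun s hs => ?_⟩
  have h2 := hC s (Ioo_subset_Icc_self hs)
  rw [div_eq_mul_inv, norm_mul]
  exact mul_le_mul h2 (hM s hs) (norm_nonneg _) ((norm_nonneg _).trans h2)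

lemma IsLoop.mirror_mem (h : IsLoop γ μ σ) (hs : s ∈ Ioo 0 1) :
    1 - s ∈ Ioo 0 1 ∧ 0 < (σ (1 - s)).im ∧ σ (1 - s) ∈ Dom μ ∧ σ (1 - s) ∉ γ := by
  have : 1 - s ∈ Ioo 0 1 := by simp_all
  exact ⟨this, h.2.2.2.2.1 _ this⟩

lemma IsLoop.fR_bound_mirror (hμ : 0 < μ) (h : IsLoop γ μ σ) (hγ : IsTameContour α μ γ) (x t : ℝ) :
    ContinuousOn (fun s => f x t μ (mirror σ s) / radical γ α (mirror σ s)) (Ioo 0 1) ∧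
      ∃ C, ∀ s ∈ Ioo 0 1, ‖f x t μ (mirror σ s) / radical γ α (mirror σ s)‖ ≤ C := by
  obtain ⟨h1, C, hC⟩ := h.fR_bound hμ hγ.contour x t
  have key : ∀ s ∈ Ioo 0 1, f x t μ (mirror σ s) / radical γ α (mirror σ s) =
      conj (f x t μ (σ (1 - s)) / radical γ α (σ (1 - s))) := by
    intro s hs
    obtain ⟨-, a, b, c⟩ := h.mirror_mem hs
    unfold mirror
    rw [f_conj a.ne', hγ.radical_conj c, map_div₀]
  constructor
  · refine ContinuousOn.congr ?_ key
    refine continuous_conj.comp_continuousOn ?_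
    exact h1.comp (by fun_prop) fun s hs => (h.mirror_mem hs).1
  · refine ⟨C, fun s hs => ?_⟩
    rw [key s hs, RCLike.norm_conj]
    exact hC _ (h.mirror_mem hs).1

lemma fR_rearrange (x t μ : ℝ) (γ : Set ℂ) (α y : ℂ) :
    (fun ζ => f x t μ ζ / ((ζ - y) * radical γ α ζ)) =
      fun ζ => (fun ζ => f x t μ ζ / radical γ α ζ) ζ / (ζ - y) := by
  funext ζ
  rw [mul_comm, div_div]

lemma IsLoop.differentiableOn_cauchyE (hμ : 0 < μ) (h : IsLoop γ μ σ) (hγ : IsTameContour α μ γ)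
    (x t : ℝ) : DifferentiableOn ℂ (cauchyE x t μ γ α σ) (loopTrace σ)ᶜ := by
  obtain ⟨a1, a2⟩ := h.fR_bound hμ hγ.contour x t
  obtain ⟨b1, b2⟩ := h.fR_bound_mirror hμ hγ x t
  unfold cauchyE loopInt
  simp only [fR_rearrange]
  refine DifferentiableOn.const_mul (DifferentiableOn.add
    ((differentiableOn_cauchyInt (g := fun ζ => f x t μ ζ / radical γ α ζ)
      h.nice.lip a1 a2).mono ?_)
    ((differentiableOn_cauchyInt (g := fun ζ => f x t μ ζ / radical γ α ζ)
      h.nice.mirror.lip b1 b2).mono ?_)) _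
  · exact fun z hz h => hz (Or.inl h)
  · exact fun z hz h => hz (Or.inr h)

/-- A Cauchy integral decays like `1/w`. -/
lemma NiceCurve.exists_tendsto_mul_cauchyInt (hc : NiceCurve c)
    (hg : ContinuousOn (fun s => g (c s)) (Ioo 0 1)) (hb : ∃ C, ∀ s ∈ Ioo 0 1, ‖g (c s)‖ ≤ C) :
    ∃ l, Tendsto (fun w => w * curveInt c (fun z => g z / (z - w))) (cocompact ℂ) (𝓝 l) := by
  obtain ⟨C, hC⟩ := hb
  obtain ⟨M, hM⟩ := isCompact_Icc.exists_bound_of_continuousOn hc.continuousOn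
  have hb' : ∃ C, ∀ s ∈ Ioo 0 1, ‖(fun z => g z * z) (c s)‖ ≤ C := by
    refine ⟨C * M, fun s hs => ?_⟩
    rw [norm_mul]
    exact mul_le_mul (hC s hs) (hM s (Ioo_subset_Icc_self hs)) (norm_nonneg _)
      ((norm_nonneg _).trans (hC s hs))
  have hg' : ContinuousOn (fun s => (fun z => g z * z) (c s)) (Ioo 0 1) :=
    hg.mul (hc.continuousOn.mono Ioo_subset_Icc_self)
  have h1 := tendsto_cauchyInt_cocompact (g := fun z => g z * z) hc.lip hb'
  refine ⟨0 - curveInt c g, (h1.sub_const _).congr' ?_⟩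
  have hK := (isCompact_Icc.image_of_continuousOn hc.continuousOn).compl_mem_cocompact
  filter_upwards [hK] with w hw
  have i1 := hc.curveIntegrable_cauchy (g := fun z => g z * z) hg' hb' hw
  have i2 := hc.curveIntegrable hg ⟨C, hC⟩
  unfold curveInt
  rw [← intervalIntegral.integral_sub i1 i2, ← intervalIntegral.integral_const_mul]
  refine intervalIntegral.integral_congr fun s hs => ?_
  rw [uIcc_of_le zero_le_one] at hs
  have hne : c s - w ≠ 0 := fun e => hw ⟨s, hs, sub_eq_zero.1 e⟩
  simp only
  field_simp
  ring

lemma IsLoop.exists_tendsto_mul_cauchyE (hμ : 0 < μ) (h : IsLoop γ μ σ) (hγ : IsTameContour α μ γ)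
    (x t : ℝ) : ∃ l, Tendsto (fun w => w * cauchyE x t μ γ α σ w) (cocompact ℂ) (𝓝 l) := by
  obtain ⟨a1, a2⟩ := h.fR_bound hμ hγ.contour x t
  obtain ⟨b1, b2⟩ := h.fR_bound_mirror hμ hγ x t
  obtain ⟨l, hl⟩ := h.nice.exists_tendsto_mul_cauchyInt
    (g := fun ζ => f x t μ ζ / radical γ α ζ) a1 a2
  obtain ⟨m, hm⟩ := h.nice.mirror.exists_tendsto_mul_cauchyInt
    (g := fun ζ => f x t μ ζ / radical γ α ζ) b1 b2
  refine ⟨(2 * π * I)⁻¹ * (l + m), ((hl.add hm).const_mul _).congr fun w => ?_⟩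
  unfold cauchyE loopInt
  simp only [fR_rearrange]
  ring

lemma NiceCurve.integral_dslope_eq (hc : NiceCurve c)
    (hg : ContinuousOn (fun s => g (c s)) (Ioo 0 1)) (hb : ∃ C, ∀ s ∈ Ioo 0 1, ‖g (c s)‖ ≤ C)
    (hw : w ∉ c '' Icc 0 1) :
    ∫ s in (0 : ℝ)..1, dslope g w (c s) * deriv c s =
      curveInt c (fun z => g z / (z - w)) - g w * curveInt c (fun z => (z - w)⁻¹) := by
  have i1 := hc.curveIntegrable_cauchy hg hb hw
  have i2 := hc.curveIntegrable_inv hw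
  unfold curveInt
  rw [← intervalIntegral.integral_const_mul, ← intervalIntegral.integral_sub i1 (i2.const_mul _)]
  refine intervalIntegral.integral_congr fun s hs => ?_
  rw [uIcc_of_le zero_le_one] at hs
  have hne : c s ≠ w := by simp_all
  simp only
  rw [dslope_of_ne _ hne, slope_def_field]
  have : c s - w ≠ 0 := by positivity
  field_simp

/-- Dixon's function: it is `cauchyE - loopWind · f / R` off the loop, and it is analytic across
the loop. -/
def dixonH (x t μ : ℝ) (γ : Set ℂ) (α : ℂ) (σ : ℝ → ℂ) (w : ℂ) : ℂ :=
  (2 * π * I)⁻¹ *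
    ((∫ s in (0 : ℝ)..1, dslope (fun ζ => f x t μ ζ / radical γ α ζ) w (σ s) * deriv σ s) +
      ∫ s in (0 : ℝ)..1, dslope (fun ζ => f x t μ ζ / radical γ α ζ) w (mirror σ s) *
        deriv (mirror σ) s)

lemma IsContour.differentiableOn_fR (hμ : 0 < μ) (hγ : IsContour α μ γ) (x t : ℝ) :
    DifferentiableOn ℂ (fun ζ => f x t μ ζ / radical γ α ζ) (Dom μ \ γ) := by
  refine DifferentiableOn.div ?_ (hγ.isRadical.1.mono fun z hz => hz.2) fun z hz =>
    hγ.isRadical.ne_zero hγ hz.2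
  exact fun z hz => (hasDerivAt_f x t hμ hz.1).differentiableAt.differentiableWithinAt

lemma IsLoop.differentiableOn_dixonH (hμ : 0 < μ) (h : IsLoop γ μ σ) (hγ : IsTameContour α μ γ)
    (x t : ℝ) : DifferentiableOn ℂ (dixonH x t μ γ α σ) (Dom μ \ γ) := by
  have hd := hγ.contour.differentiableOn_fR hμ x t
  have hO := hγ.contour.isOpen_Dom_diff
  refine DifferentiableOn.const_mul (DifferentiableOn.add ?_ ?_) _
  · exact differentiableOn_integral_dslope h.nice hO (fun s hs => (h.2.2.2.2.1 s hs).2) hd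
      (h.fR_bound hμ hγ.contour x t).2
  · refine differentiableOn_integral_dslope h.nice.mirror hO (fun s hs => ?_) hd
      (h.fR_bound_mirror hμ hγ x t).2
    obtain ⟨-, -, b, c⟩ := h.mirror_mem hs
    exact ⟨conj_mem_Dom.2 b, fun h' => c (hγ.contour.conj_mem.1 h')⟩

lemma IsLoop.dixonH_eq (hμ : 0 < μ) (h : IsLoop γ μ σ) (hγ : IsTameContour α μ γ) (x t : ℝ)
    (hw : w ∉ loopTrace σ) :
    dixonH x t μ γ α σ w = cauchyE x t μ γ α σ w - loopWind σ w * (f x t μ w / radical γ α w) := by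
  obtain ⟨a1, a2⟩ := h.fR_bound hμ hγ.contour x t
  obtain ⟨b1, b2⟩ := h.fR_bound_mirror hμ hγ x t
  unfold dixonH
  rw [h.nice.integral_dslope_eq a1 a2 fun h => hw (Or.inl h),
    h.nice.mirror.integral_dslope_eq b1 b2 fun h => hw (Or.inr h)]
  unfold cauchyE loopWind loopInt
  simp only [fR_rearrange]
  ring

/-! ### The solution of the Riemann-Hilbert problem -/

/-- The solution of the Riemann-Hilbert problem, written with the help of a loop `σ`. -/
def solH (x t μ : ℝ) (γ : Set ℂ) (α : ℂ) (σ : ℝ → ℂ) (z : ℂ) : ℂ :=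
  radical γ α z * dixonH x t μ γ α σ z - f x t μ z

lemma IsLoop.solH_eq (hμ : 0 < μ) (h : IsLoop γ μ σ) (hγ : IsTameContour α μ γ) (x t : ℝ)
    (hz : z ∉ loopTrace σ) (hzγ : z ∉ γ) :
    solH x t μ γ α σ z = radical γ α z * cauchyE x t μ γ α σ z -
      (loopWind σ z + 1) * f x t μ z := by
  have hR := hγ.contour.isRadical.ne_zero hγ.contour hzγ
  unfold solH
  rw [h.dixonH_eq hμ hγ x t hz]
  field_simp
  ring

lemma IsLoop.closed (h : IsLoop γ μ σ) : σ 0 = σ 1 :=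
  h.2.1.trans h.2.2.1.symm

lemma IsLoop.not_mem_loopTrace (h : IsLoop γ μ σ) (hγ : IsContour α μ γ) (hz : z ∈ γ)
    (hzp : z ≠ (μ : ℂ) / 2) : z ∉ loopTrace σ := by
  intro h'
  rcases h.mem_loopTrace hγ h' with h1 | h1
  · exact hzp h1
  · exact h1.2 hz

/-- Near the contour the solution is the radical times an analytic function. -/
lemma IsLoop.solH_eventually (hμ : 0 < μ) (h : IsLoop γ μ σ) (hγ : IsTameContour α μ γ) (x t : ℝ)
    (hw : w ∈ γ) (hwp : w ≠ (μ : ℂ) / 2) :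
    ∀ᶠ z in 𝓝 w, z ∉ γ → solH x t μ γ α σ z = radical γ α z * cauchyE x t μ γ α σ z := by
  have hwt := h.not_mem_loopTrace hγ.contour hw hwp
  filter_upwards [h.nice.loopWind_eventuallyEq h.closed hwt] with z hz hzγ
  rw [h.solH_eq hμ hγ x t hz.1 hzγ, hz.2, h.loopWind_eq_neg_one hγ.contour hw hwp]
  ring

lemma IsLoop.continuousAt_cauchyE (hμ : 0 < μ) (h : IsLoop γ μ σ) (hγ : IsTameContour α μ γ)
    (x t : ℝ) (hw : w ∉ loopTrace σ) : DifferentiableAt ℂ (cauchyE x t μ γ α σ) w :=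
  (h.differentiableOn_cauchyE hμ hγ x t).differentiableAt
    (h.nice.isCompact_loopTrace.isClosed.isOpen_compl.mem_nhds hw)

/-- `h + f` is analytic off the contour, also across the cuts of `f`, and at infinity. -/
lemma IsLoop.exists_extension (hμ : 0 < μ) (h : IsLoop γ μ σ) (hγ : IsTameContour α μ γ) (x t : ℝ) :
    ∃ G : ℂ → ℂ, DifferentiableOn ℂ G γᶜ ∧ (∃ l : ℂ, Tendsto G (cocompact ℂ) (𝓝 l)) ∧
      ∀ z ∈ Dom μ \ γ, G z = solH x t μ γ α σ z + f x t μ z := by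
  classical
  have hR := hγ.contour.isRadical
  have hp : (μ : ℂ) / 2 ∈ γ := hγ.contour.2.2.2.1
  set G : ℂ → ℂ := fun z => radical γ α z * (if z ∈ Dom μ then dixonH x t μ γ α σ z else
    cauchyE x t μ γ α σ z) with hG
  have hnear : ∀ z, z ∉ Dom μ → z ∉ γ → G =ᶠ[𝓝 z]
      fun z => radical γ α z * cauchyE x t μ γ α σ z := by
    intro z hz hzγ
    have hzp : z ≠ (μ : ℂ) / 2 := fun e => hzγ (e ▸ hp)
    have hzt : z ∉ loopTrace σ := fun h' =>
      (h.mem_loopTrace hγ.contour h').elim hzp fun h1 => hz h1.1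
    filter_upwards [h.nice.loopWind_eventuallyEq h.closed hzt] with y hy
    simp only [hG]
    split_ifs
    · rw [h.dixonH_eq hμ hγ x t hy.1, hy.2, h.loopWind_eq_zero hμ hz hzp]
      ring
    · rfl
  refine ⟨G, ?_, ?_, ?_⟩
  · intro z hz
    have hRz := hR.1.differentiableAt (hγ.contour.isOpen_compl.mem_nhds hz)
    by_cases hzD : z ∈ Dom μ
    · have h1 := (h.differentiableOn_dixonH hμ hγ x t).differentiableAt
        (hγ.contour.isOpen_Dom_diff.mem_nhds ⟨hzD, hz⟩)
      refine (DifferentiableAt.congr_of_eventuallyEq (hRz.mul h1) ?_).differentiableWithinAt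
      filter_upwards [(isOpen_Dom μ).mem_nhds hzD] with y hy
      simp only [hG, if_pos hy, Pi.mul_apply]
    · have hzp : z ≠ (μ : ℂ) / 2 := fun e => hz (e ▸ hp)
      have hzt : z ∉ loopTrace σ := fun h' =>
        (h.mem_loopTrace hγ.contour h').elim hzp fun h1 => hzD h1.1
      exact ((hRz.mul (h.continuousAt_cauchyE hμ hγ x t hzt)).congr_of_eventuallyEq
        (hnear z hzD hz)).differentiableWithinAt
  · obtain ⟨l, hl⟩ := h.exists_tendsto_mul_cauchyE hμ hγ x t
    refine ⟨-1 * l, (hR.2.2.mul hl).congr' ?_⟩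
    filter_upwards [h.nice.loopWind_eventually_cocompact h.closed,
      (isCompact_singleton (x := (0 : ℂ))).compl_mem_cocompact] with z hz hz0
    have hz0' : z ≠ 0 := hz0
    have e1 : G z = radical γ α z * cauchyE x t μ γ α σ z := by
      simp only [hG]
      split_ifs
      · rw [h.dixonH_eq hμ hγ x t hz.1, hz.2]
        ring
      · rfl
    rw [e1]
    field_simp
  · intro z hz
    simp only [hG, if_pos hz.1, solH]
    ring

open ENNReal in
/-- A Cauchy type integral is bounded by the potential of the length measure. -/
lemma NiceCurve.exists_enorm_cauchyInt_le (hc : NiceCurve c)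
    (hb : ∃ C, ∀ s ∈ Ioo 0 1, ‖g (c s)‖ ≤ C) :
    ∃ C : NNReal, ∀ w, ‖curveInt c (fun ζ => g ζ / (ζ - w))‖ₑ ≤ C *
      ∫⁻ z, ‖z - w‖ₑ⁻¹ ∂(Measure.map c (volume.restrict (Ioc (0 : ℝ) 1))) := by
  obtain ⟨C, hC⟩ := hb
  obtain ⟨L, hL0, hL⟩ := exists_deriv_bound hc.lip
  have hC0 : 0 ≤ C := (norm_nonneg _).trans (hC (1 / 2) (by norm_num))
  refine ⟨(C * L).toNNReal, fun w => ?_⟩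
  change _ ≤ ENNReal.ofReal (C * L) * _
  have hcm : AEMeasurable c (volume.restrict (Ioc (0 : ℝ) 1)) :=
    (hc.continuousOn.mono Ioc_subset_Icc_self).aemeasurable measurableSet_Ioc
  rw [lintegral_map' (by fun_prop) hcm]
  unfold curveInt
  rw [intervalIntegral.integral_of_le zero_le_one]
  refine (enorm_integral_le_lintegral_enorm _).trans ?_
  have hm : AEMeasurable (fun s => ‖c s - w‖ₑ⁻¹) (volume.restrict (Ioc (0 : ℝ) 1)) := by fun_prop
  rw [← lintegral_const_mul'' _ hm]
  refine lintegral_mono_ae ?_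
  filter_upwards [ae_mem_Ioo] with s hs
  have e1 : ‖(c s - w)⁻¹‖ₑ ≤ ‖c s - w‖ₑ⁻¹ := by
    by_cases h0 : c s - w = 0
    · rw [h0]; simp
    · rw [enorm_inv h0]
  have e2 : ‖g (c s)‖ₑ * ‖deriv c s‖ₑ ≤ ENNReal.ofReal (C * L) := by
    rw [← enorm_mul, ← ofReal_norm, norm_mul]
    exact ENNReal.ofReal_le_ofReal (mul_le_mul (hC s hs) (hL s hs) (norm_nonneg _) hC0)
  calc ‖g (c s) / (c s - w) * deriv c s‖ₑ
      = (‖g (c s)‖ₑ * ‖deriv c s‖ₑ) * ‖(c s - w)⁻¹‖ₑ := by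
        rw [enorm_mul, div_eq_mul_inv, enorm_mul]; ring
    _ ≤ _ := by gcongr

/-- The length measure of a loop: the push-forward of the measure of the parameter interval. -/
abbrev loopMeasure (σ : ℝ → ℂ) : Measure ℂ :=
  Measure.map σ (volume.restrict (Ioc (0 : ℝ) 1)) +
    Measure.map (mirror σ) (volume.restrict (Ioc (0 : ℝ) 1))

/-- Cauchy integrals are dominated by the potential of the length measure. -/
lemma IsLoop.exists_enorm_loopInt_le (h : IsLoop γ μ σ) (ha : ∃ C, ∀ s ∈ Ioo 0 1, ‖g (σ s)‖ ≤ C)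
    (hb : ∃ C, ∀ s ∈ Ioo 0 1, ‖g (mirror σ s)‖ ≤ C) :
    ∃ C : NNReal, ∀ w, ‖(2 * π * I)⁻¹ * loopInt σ (fun ζ => g ζ / (ζ - w))‖ₑ ≤ C *
      ∫⁻ z, ‖z - w‖ₑ⁻¹ ∂(loopMeasure σ) := by
  obtain ⟨C₁, h₁⟩ := h.nice.exists_enorm_cauchyInt_le ha
  obtain ⟨C₂, h₂⟩ := h.nice.mirror.exists_enorm_cauchyInt_le hb
  refine ⟨‖(2 * π * I : ℂ)⁻¹‖₊ * (C₁ + C₂), fun w => ?_⟩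
  rw [enorm_mul, loopMeasure, lintegral_add_measure, ENNReal.coe_mul, ENNReal.coe_add,
    ← enorm_eq_nnnorm]
  simp only [mul_assoc ‖(2 * π * I : ℂ)⁻¹‖ₑ]
  refine mul_le_mul' le_rfl ((enorm_add_le _ _).trans ((add_le_add (h₁ w) (h₂ w)).trans ?_))
  rw [add_mul]
  gcongr
  · exact le_self_add
  · exact le_add_self

lemma csqrt_ofReal_sq {r : ℝ} (hr : 0 < r) : csqrt ((r : ℂ) ^ 2) = r := by
  unfold csqrt
  rw [← ofReal_pow, ← ofReal_log (by positivity), Real.log_pow]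
  push_cast
  rw [mul_div_cancel_left₀ _ two_ne_zero, ← ofReal_exp, Real.exp_log hr]

lemma eventually_eq_of_sq_eq {u v : ℂ → ℂ} (hu : ContinuousAt u z) (hv : ContinuousAt v z)
    (h : u z = v z) (h0 : v z ≠ 0) (hsq : ∀ᶠ y in 𝓝 z, u y ^ 2 = v y ^ 2) :
    ∀ᶠ y in 𝓝 z, u y = v y := by
  have h1 : u z + v z ≠ 0 := by
    rw [h, ← two_mul]
    exact mul_ne_zero two_ne_zero h0
  filter_upwards [hsq, (hu.add hv).eventually_ne h1] with y h2 h3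
  rcases sq_eq_sq_iff_eq_or_eq_neg.1 h2 with h4 | h4
  · exact h4
  · exact (h3 (by simp [h4])).elim

/-- `(z - α)(z - ᾱ)`, of which the radical is a square root. -/
def quad (α z : ℂ) : ℂ := (z - α) * (z - conj α)

lemma quad_ofReal (α : ℂ) (x : ℝ) : quad α x = ((‖(x : ℂ) - α‖ : ℝ) : ℂ) ^ 2 := by
  unfold quad
  rw [← ofReal_pow, ← normSq_eq_norm_sq, ← mul_conj]
  simp

lemma log_I_mul_of_re_pos (hre : 0 < w.re) (him : w.im < 0) : log (I * w) = log w + π * I / 2 := by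
  have hw0 : w ≠ 0 := by rintro rfl; simp at hre
  have h1 := abs_arg_lt_pi_div_two_iff.2 (Or.inl hre)
  rw [abs_lt] at h1
  rw [(log_mul_eq_add_log_iff I_ne_zero hw0).2, log_I]
  · ring
  · rw [arg_I]
    have := arg_neg_iff.2 him
    constructor <;> linarith [Real.pi_pos]

lemma log_neg_I_mul_of_re_pos (hre : 0 < w.re) (him : 0 < w.im) :
    log (-I * w) = log w - π * I / 2 := by
  have hw0 : w ≠ 0 := by rintro rfl; simp at hre
  have h1 := abs_arg_lt_pi_div_two_iff.2 (Or.inl hre)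
  rw [abs_lt] at h1
  rw [(log_mul_eq_add_log_iff (neg_ne_zero.2 I_ne_zero) hw0).2, log_neg_I]
  · ring
  · rw [arg_neg_I]
    have := arg_nonneg_iff.2 him.le
    constructor <;> linarith [Real.pi_pos]

/-- `sgn (Im z)`. -/
def sgIm (z : ℂ) : ℂ := if 0 < z.im then 1 else -1

lemma sgIm_eventually (hz : z.im ≠ 0) : ∀ᶠ y in 𝓝 z, sgIm y = sgIm z := by
  have hc := continuous_im.continuousAt (x := z)
  rcases hz.lt_or_gt with h | h
  · filter_upwards [hc.eventually (gt_mem_nhds h)] with y hy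
    rw [sgIm, sgIm, if_neg (not_lt.2 hy.le), if_neg (not_lt.2 h.le)]
  · filter_upwards [hc.eventually (lt_mem_nhds h)] with y hy
    rw [sgIm, sgIm, if_pos hy, if_pos h]

lemma norm_sgIm (z : ℂ) : ‖sgIm z‖ = 1 := by
  unfold sgIm
  split_ifs <;> simp

/-- The jump of `f` across the real axis near `μ/2`: the function
`f - sgn (Im z) (πi/2) e (μ/2 - z)` is analytic to the left of `μ/2` for `e = 1`, and to the right
of `μ/2` for `e = -1`. -/
lemma f_eq_of_re_ne {x t m e : ℝ} (he : e = 1 ∨ e = -1) (hm : 0 < m) (him : z.im ≠ 0)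
    (hre : √(tau m) < z.re) (hl : 0 < e * (m / 2 - z.re)) : f x t m z =
    (m / 2 - z) * log (e * (m / 2 - z)) + fReg x t m z +
      sgIm z * (π * I / 2) * (e * (m / 2 - z)) := by
  have h1 : 0 < ((e : ℂ) * (m / 2 - z)).re := by simpa using hl
  rcases him.lt_or_gt with h | h
  · rw [f_eq_of_im_neg hm h hre, sgIm, if_neg (not_lt.2 h.le)]
    rcases he with rfl | rfl
    · rw [ofReal_one, one_mul] at h1 ⊢
      rw [log_neg_I_mul_of_re_pos h1 (by simpa using h)]
      ring
    · rw [show -I * (m / 2 - z) = I * ((-1 : ℝ) * (m / 2 - z)) by push_cast; ring,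
        log_I_mul_of_re_pos h1 (by simpa using h)]
      push_cast
      ring
  · rw [f_eq_of_im_pos h, sgIm, if_pos h]
    rcases he with rfl | rfl
    · rw [ofReal_one, one_mul] at h1 ⊢
      rw [log_I_mul_of_re_pos h1 (by simpa using h)]
      ring
    · rw [show I * (m / 2 - z) = -I * ((-1 : ℝ) * (m / 2 - z)) by push_cast; ring,
        log_neg_I_mul_of_re_pos h1 (by simpa using h)]
      push_cast
      ring

/-- `f` is bounded near `μ/2`. -/
lemma exists_f_bound_half (x t : ℝ) (hm : 0 < m) :
    ∃ C, ∀ᶠ z in 𝓝 ((m : ℂ) / 2), z.im ≠ 0 → ‖f x t m z‖ ≤ C := by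
  have hU : UpperReg m ((m : ℂ) / 2) := ⟨half_not_mem_segment hm, Or.inr rfl⟩
  have h1 : ContinuousAt (fUpper x t m) ((m : ℂ) / 2) :=
    ContinuousAt.comp (g := fun q : ℂ × ℝ => fUpper x t q.2 q.1)
      (f := fun z => (z, m)) (continuousAt_fUpper x t hm hU) (by fun_prop)
  set C := ‖fUpper x t m ((m : ℂ) / 2)‖ + 1 with hC
  have h2 : ∀ᶠ z in 𝓝 ((m : ℂ) / 2), ‖fUpper x t m z‖ < C :=
    h1.norm.eventually (gt_mem_nhds (by simp [hC]))
  have h3 : ∀ᶠ z in 𝓝 ((m : ℂ) / 2), ‖fUpper x t m (conj z)‖ < C := by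
    have h4 := continuous_conj.tendsto ((m : ℂ) / 2)
    have h5 : conj ((m : ℂ) / 2) = m / 2 := by simp [conj_ofNat]
    rw [h5] at h4
    exact h4.eventually h2
  refine ⟨C, ?_⟩
  filter_upwards [h2, h3] with z a b _
  unfold f
  split_ifs
  · exact a.le
  · rw [RCLike.norm_conj]; exact b.le

/-- The solution divided by the radical has a limit at `μ/2`, although the loop passes through
`μ/2`. -/
lemma IsLoop.exists_tendsto_solH_div_half (hμ : 0 < μ) (h : IsLoop γ μ σ)
    (hγ : IsTameContour α μ γ) (x t : ℝ) :
    ∃ l, Tendsto (fun z => solH x t μ γ α σ z / radical γ α z) (𝓝[Dom μ \ γ] ((μ : ℂ) / 2))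
      (𝓝 l) := by
  have hR := hγ.contour.isRadical
  set R := radical γ α with hRdef
  set p : ℂ := (μ : ℂ) / 2 with hp
  set A := Dom μ \ γ with hA
  have hAd : Dense A := hγ.contour.dense
  have hAo : IsOpen A := hγ.contour.isOpen_Dom_diff
  have hpr : p = ((μ / 2 : ℝ) : ℂ) := by rw [hp]; push_cast; rfl
  have hαr : ∀ y : ℝ, 0 < ‖(y : ℂ) - α‖ := by
    intro y
    rw [norm_pos_iff]
    intro e
    have h1 := congrArg Complex.im e
    have h2 := hγ.contour.1
    simp at h1
    linarith
  set Q : ℂ → ℂ := fun z => csqrt (quad α z) with hQ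
  have hqc : Continuous (quad α) := by unfold quad; fun_prop
  have hqp : quad α p ∈ slitPlane := by
    rw [hpr, quad_ofReal, ← ofReal_pow, ofReal_mem_slitPlane]
    have := hαr (μ / 2)
    positivity
  obtain ⟨C₀, hC₀⟩ := exists_f_bound_half x t hμ
  -- a small disc around `μ/2`
  obtain ⟨ε, hε, hball⟩ : ∃ ε > 0, ∀ z ∈ ball p ε, z ∈ ball p (μ / 2 - √(tau μ)) ∧
      quad α z ∈ slitPlane ∧ (z.im ≠ 0 → ‖f x t μ z‖ ≤ C₀) ∧ ‖(quad α z)⁻¹‖ <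
        ‖(quad α p)⁻¹‖ + 1 ∧ ‖(p - z) / Q z‖ < 1 := by
    have e1 := ball_mem_nhds p (show 0 < μ / 2 - √(tau μ) by linarith [sqrt_tau_lt hμ])
    have e2 := hqc.continuousAt.eventually (isOpen_slitPlane.mem_nhds hqp)
    have hq0 := slitPlane_ne_zero hqp
    have e3 := (hqc.continuousAt.inv₀ hq0).norm.eventually
      (gt_mem_nhds (show ‖(quad α p)⁻¹‖ < ‖(quad α p)⁻¹‖ + 1 by linarith))
    have e4 : ContinuousAt (fun z => ‖(p - z) / Q z‖) p := by
      have : ContinuousAt Q p := ContinuousAt.comp (g := csqrt)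
        (differentiableAt_csqrt hqp).continuousAt hqc.continuousAt
      exact (ContinuousAt.div (by fun_prop) this (csqrt_ne_zero _)).norm
    have e5 := e4.eventually (gt_mem_nhds (show ‖(p - p) / Q p‖ < 1 by simp))
    obtain ⟨ε, hε, hb⟩ := eventually_nhds_iff_ball.1 (e2.and (hC₀.and (e3.and e5)))
    refine ⟨min ε (μ / 2 - √(tau μ)), lt_min hε (by linarith [sqrt_tau_lt hμ]), fun z hz => ?_⟩
    obtain ⟨a1, a2, a3, a4⟩ := hb z (ball_subset_ball (min_le_left _ _) hz)
    exact ⟨ball_subset_ball (min_le_right _ _) hz, a1, a2, a3, a4⟩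
  set B := ball p ε with hB
  have hBre : ∀ z ∈ B, √(tau μ) < z.re := fun z hz => (ball_half_mem_Dom hμ (hball z hz).1).1
  have hBD : ∀ z ∈ B, z.im ≠ 0 → z ∈ Dom μ := fun z hz =>
    (ball_half_mem_Dom hμ (hball z hz).1).2
  have hQd : ∀ z ∈ B, DifferentiableAt ℂ Q z := fun z hz =>
    DifferentiableAt.comp (g := csqrt) z (differentiableAt_csqrt (hball z hz).2.1)
      (by unfold quad; fun_prop)
  have hQ0 : ∀ z, Q z ≠ 0 := fun z => csqrt_ne_zero _
  have hQsq : ∀ z ∈ B, Q z ^ 2 = quad α z := fun z hz =>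
    csqrt_sq (slitPlane_ne_zero (hball z hz).2.1)
  have hQr : ∀ y : ℝ, Q y = ((‖(y : ℂ) - α‖ : ℝ) : ℂ) := by
    intro y
    rw [hQ]
    simp only
    rw [quad_ofReal, csqrt_ofReal_sq (hαr y)]
  have hRsq : ∀ z ∉ γ, R z ^ 2 = quad α z := fun z hz => hR.2.1 z hz
  have hR0 : ∀ z ∉ γ, R z ≠ 0 := fun z hz => hR.ne_zero hγ.contour hz
  -- `k` with the jump across the real axis removed
  set J : ℂ → ℂ := fun z => sgIm z * (π * I / 2) * ((p - z) / Q z) with hJ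
  set M₀ : ℂ → ℂ := fun z => solH x t μ γ α σ z / R z + J z with hM₀
  have hk : ∀ z ∈ A, solH x t μ γ α σ z / R z = dixonH x t μ γ α σ z - f x t μ z / R z := by
    intro z hz
    have := hR0 z hz.2
    change (R z * _ - _) / R z = _
    field_simp
  have hJd : ∀ z ∈ B, z.im ≠ 0 → DifferentiableAt ℂ J z := by
    intro z hz him
    have h1 : DifferentiableAt ℂ (fun y => sgIm z * (π * I / 2) * ((p - y) / Q y)) z :=
      (DifferentiableAt.div (by fun_prop) (hQd z hz) (hQ0 z)).const_mul _
    refine h1.congr_of_eventuallyEq ?_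
    filter_upwards [sgIm_eventually him] with y hy
    simp only [hJ, hy]
  have hM₀d : ∀ z ∈ B ∩ A, DifferentiableAt ℂ M₀ z := by
    rintro z ⟨hzB, hzA⟩
    have hn := hAo.mem_nhds hzA
    have h1 := (h.differentiableOn_dixonH hμ hγ x t).differentiableAt hn
    have h2 := (hγ.contour.differentiableOn_fR hμ x t).differentiableAt hn
    refine (((h1.sub h2).congr_of_eventuallyEq ?_).add (hJd z hzB hzA.1.1))
    filter_upwards [hn] with y hy using hk y hy
  have hlim : ∀ z ∈ B \ {p}, ∃ l, Tendsto M₀ (𝓝[A] z) (𝓝 l) := by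
    rintro z ⟨hzB, hzp⟩
    rw [mem_singleton_iff] at hzp
    by_cases hzγ : z ∈ γ
    · have him : z.im ≠ 0 := fun h0 => hzp (hγ.contour.eq_of_im_eq_zero hzγ h0)
      have h1 := (h.continuousAt_cauchyE hμ hγ x t
        (h.not_mem_loopTrace hγ.contour hzγ hzp)).continuousAt
      refine ⟨_, ((h1.add (hJd z hzB him).continuousAt).tendsto.mono_left
        nhdsWithin_le_nhds).congr' ?_⟩
      filter_upwards [mem_nhdsWithin_of_mem_nhds (h.solH_eventually hμ hγ x t hzγ hzp),
        self_mem_nhdsWithin] with y hy hyA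
      simp only [hM₀]
      rw [hy hyA.2, mul_div_cancel_left₀ _ (hR0 y hyA.2)]
      rfl
    by_cases hzD : z ∈ Dom μ
    · exact ⟨_, (hM₀d z ⟨hzB, hzD, hzγ⟩).continuousAt.tendsto.mono_left nhdsWithin_le_nhds⟩
    · have him : z.im = 0 := by
        by_contra h0
        exact hzD (hBD z hzB h0)
      have hzr : z = ((z.re : ℝ) : ℂ) := Complex.ext (by simp) (by simp [him])
      have hzt : z ∉ loopTrace σ := fun h' =>
        (h.mem_loopTrace hγ.contour h').elim hzp fun h1 => hzD h1.1
      have hE := (h.continuousAt_cauchyE hμ hγ x t hzt).continuousAt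
      have hRc : ContinuousAt R z :=
        (hR.1.differentiableAt (hγ.contour.isOpen_compl.mem_nhds hzγ)).continuousAt
      have hQc : ContinuousAt Q z := (hQd z hzB).continuousAt
      have hreg : ContinuousAt (fReg x t μ) z :=
        (differentiableAt_fReg x t (hBre z hzB)).continuousAt
      have hγn := hγ.contour.isOpen_compl.mem_nhds hzγ
      have hBn := isOpen_ball.mem_nhds hzB
      have hkE : ∀ᶠ y in 𝓝[A] z, solH x t μ γ α σ y / R y =
          cauchyE x t μ γ α σ y - f x t μ y / R y := by
        filter_upwards [mem_nhdsWithin_of_mem_nhds (h.nice.loopWind_eventuallyEq h.closed hzt),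
          self_mem_nhdsWithin] with y hy hyA
        rw [hk y hyA, h.dixonH_eq hμ hγ x t hy.1, hy.2, h.loopWind_eq_zero hμ hzD hzp]
        ring
      have hzre : z.re ≠ μ / 2 := by
        intro e
        apply hzp
        rw [hzr, e, hpr]
      obtain ⟨e, he, hlt, hRQ⟩ : ∃ e : ℝ, (e = 1 ∨ e = -1) ∧ 0 < e * (μ / 2 - z.re) ∧
          R z = e * Q z := by
        rcases hzre.lt_or_gt with hlt | hlt
        · refine ⟨1, Or.inl rfl, by linarith, ?_⟩
          rw [hzr, hQr, ofReal_one, one_mul]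
          exact hγ.contour.radical_real.1 z.re hlt
        · refine ⟨-1, Or.inr rfl, by linarith, ?_⟩
          rw [hzr, hQr, ofReal_neg, ofReal_one, neg_one_mul]
          exact hγ.contour.radical_real.2 z.re hlt
      have he0 : (e : ℂ) ≠ 0 := by rcases he with rfl | rfl <;> simp
      have he2 : (e : ℂ) ^ 2 = 1 := by rcases he with rfl | rfl <;> simp
      have hev := eventually_eq_of_sq_eq (v := fun y => e * Q y) hRc (by fun_prop) hRQ
        (mul_ne_zero he0 (hQ0 z)) (by
          filter_upwards [hγn, hBn] with y h1 h2
          rw [hRsq y h1, mul_pow, he2, hQsq y h2, one_mul])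
      have hlog : ContinuousAt (fun y => log (e * (p - y))) z := by
        refine ContinuousAt.clog (by fun_prop) (mem_slitPlane_iff.2 (Or.inl ?_))
        rw [hpr]
        simpa using hlt
      have hc : ContinuousAt (fun y => cauchyE x t μ γ α σ y -
          ((p - y) * log (e * (p - y)) + fReg x t μ y) / R y) z :=
        hE.sub (ContinuousAt.div (by fun_prop) hRc (hR0 z hzγ))
      have hle : ∀ᶠ y in 𝓝 z, 0 < e * (μ / 2 - y.re) :=
        (Continuous.tendsto (by fun_prop) z).eventually (lt_mem_nhds hlt)
      refine ⟨_, (hc.tendsto.mono_left nhdsWithin_le_nhds).congr' ?_⟩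
      filter_upwards [hkE, self_mem_nhdsWithin, mem_nhdsWithin_of_mem_nhds hev,
        mem_nhdsWithin_of_mem_nhds hBn, mem_nhdsWithin_of_mem_nhds hle] with y h1 h2 h3 h4 h5
      have h6 : e * (p - y) / R y = (p - y) / Q y := by rw [h3, mul_div_mul_left _ _ he0]
      simp only [hM₀, hJ]
      rw [h1, f_eq_of_re_ne he hμ h2.1.1 (hBre y h4) h5, ← hp, ← h6]
      ring
  set M := extendFrom A M₀ with hM
  have hBo : IsOpen (B \ {p}) := isOpen_ball.sdiff isClosed_singleton
  have hMc : ContinuousOn M (B \ {p}) := continuousOn_extendFrom (fun w _ => hAd w) hlim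
  have hMM : ∀ z ∈ B ∩ A, M z = M₀ z := fun z hz => extendFrom_eq (hAd z)
    ((hM₀d z hz).continuousAt.tendsto.mono_left nhdsWithin_le_nhds)
  have hMd : DifferentiableOn ℂ M (B \ {p}) := by
    obtain ⟨c, L, hL, hc⟩ := hγ.contour.exists_lipschitz
    refine differentiableOn_of_continuousOn_off_curve hBo hL hMc ?_
    rw [hc]
    have hlip : LipschitzOnWith (2 * ε).toNNReal
        (fun s : ℝ => p + ((ε * (2 * s - 1) : ℝ) : ℂ)) (Icc 0 1) := by
      refine LipschitzOnWith.of_dist_le_mul fun a _ b _ => ?_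
      rw [dist_add_left, Complex.dist_eq, ← ofReal_sub, Complex.norm_real,
        Real.coe_toNNReal _ (by positivity), Real.dist_eq, Real.norm_eq_abs,
        show ε * (2 * a - 1) - ε * (2 * b - 1) = 2 * ε * (a - b) by ring, abs_mul,
        abs_of_pos (show 0 < 2 * ε by positivity)]
    refine differentiableOn_of_continuousOn_off_curve (hBo.sdiff hγ.contour.isCompact.isClosed)
      hlip (hMc.mono sdiff_subset) ?_
    rintro z ⟨⟨⟨hzB, hzp⟩, hzγ⟩, hzr⟩
    have him : z.im ≠ 0 := by
      intro h0
      apply hzr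
      have h1 : |z.re - μ / 2| < ε := by
        rw [hB, mem_ball, Complex.dist_eq] at hzB
        have h2 := (abs_re_le_norm _).trans_lt hzB
        rw [hpr] at h2
        simpa using h2
      rw [abs_lt] at h1
      refine ⟨(1 + (z.re - μ / 2) / ε) / 2, ⟨?_, ?_⟩, ?_⟩
      · have : -1 ≤ (z.re - μ / 2) / ε := by rw [le_div_iff₀ hε]; linarith
        linarith
      · have : (z.re - μ / 2) / ε ≤ 1 := by rw [div_le_iff₀ hε]; linarith
        linarith
      · have e : ε * (2 * ((1 + (z.re - μ / 2) / ε) / 2) - 1) = z.re - μ / 2 := by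
          field_simp
          ring
        simp only [e, hpr]
        refine Complex.ext ?_ ?_
        · rw [← ofReal_add, ofReal_re]; ring
        · rw [← ofReal_add, ofReal_im, h0]
    have hzA : z ∈ B ∩ A := ⟨hzB, hBD z hzB him, hzγ⟩
    refine ((hM₀d z hzA).congr_of_eventuallyEq ?_).differentiableWithinAt
    filter_upwards [(isOpen_ball.inter hAo).mem_nhds hzA] with y hy using hMM y hy
  obtain ⟨l, hl⟩ : ∃ l, Tendsto M (𝓝[≠] p) (𝓝 l) := by
    obtain ⟨a1, a2⟩ := h.fR_bound hμ hγ.contour x t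
    obtain ⟨b1, b2⟩ := h.fR_bound_mirror hμ hγ x t
    obtain ⟨K₁, hK₁⟩ := h.exists_enorm_loopInt_le (g := fun ζ => f x t μ ζ / radical γ α ζ) a2 b2
    obtain ⟨K₂, hK₂⟩ := h.exists_enorm_loopInt_le (g := fun _ => 1) ⟨1, by simp⟩ ⟨1, by simp⟩
    have hatom : ∀ c : ℝ → ℂ, NiceCurve c → (∀ s ∈ Ioo 0 1, c s ≠ p) →
        Measure.map c (volume.restrict (Ioc (0 : ℝ) 1)) {p} = 0 := by
      intro c hc hcp
      have hcm : AEMeasurable c (volume.restrict (Ioc (0 : ℝ) 1)) :=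
        (hc.continuousOn.mono Ioc_subset_Icc_self).aemeasurable measurableSet_Ioc
      rw [Measure.map_apply_of_aemeasurable hcm (measurableSet_singleton p)]
      have : ∀ᵐ s ∂(volume.restrict (Ioc (0 : ℝ) 1)), ¬ (s ∈ c ⁻¹' {p}) := by
        filter_upwards [ae_mem_Ioo] with s hs using hcp s hs
      exact measure_eq_zero_iff_ae_notMem.2 this
    have hpim : p.im = 0 := by rw [hpr, ofReal_im]
    set N : ℝ := C₀ * √(‖(quad α p)⁻¹‖ + 1) with hN
    refine exists_tendsto_of_le_potential hε hMd (loopMeasure σ) ?_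
      (K₁ + K₂ * N.toNNReal + N.toNNReal + (Real.toNNReal π : ℝ)) ?_
    · rw [loopMeasure, Measure.add_apply, hatom _ h.nice, hatom _ h.nice.mirror, add_zero]
      · intro s hs e
        have h1 := (h.mirror_mem hs).2.1
        have h2 := congrArg Complex.im e
        rw [hpim] at h2
        simp [mirror] at h2
        linarith
      · intro s hs e
        have h1 := (h.2.2.2.2.1 s hs).1
        rw [e, hpim] at h1
        exact lt_irrefl _ h1
    · have hae1 : ∀ᵐ w : ℂ, w ∈ A := by
        rw [ae_iff]
        exact hγ.contour.volume_compl
      have hae2 : ∀ᵐ w : ℂ, w ∉ loopTrace σ := by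
        rw [ae_iff]
        simp only [not_not]
        obtain ⟨L₁, hL₁⟩ := h.nice.lip
        obtain ⟨L₂, hL₂⟩ := h.nice.mirror.lip
        exact measure_union_null (volume_image_eq_zero hL₁)
          (volume_image_eq_zero hL₂)
      filter_upwards [hae1, hae2] with w hwA hwt hwB
      rw [hMM w ⟨hwB, hwA⟩]
      have hg : ‖f x t μ w / R w‖ₑ ≤ N.toNNReal := by
        obtain ⟨-, -, c1, c2, -⟩ := hball w hwB
        have c3 : ‖(R w)⁻¹‖ ≤ √(‖(quad α p)⁻¹‖ + 1) := by
          refine Real.le_sqrt_of_sq_le ?_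
          rw [← norm_pow, inv_pow, hRsq w hwA.2]
          exact c2.le
        rw [← ofReal_norm, div_eq_mul_inv, norm_mul]
        exact ENNReal.ofReal_le_ofReal (mul_le_mul (c1 hwA.1.1) c3 (norm_nonneg _)
          ((norm_nonneg _).trans (c1 hwA.1.1)))
      have hJb : ‖J w‖ₑ ≤ Real.toNNReal π := by
        obtain ⟨-, -, -, -, c3⟩ := hball w hwB
        have e : ‖(π * I / 2 : ℂ)‖ = π / 2 := by simp [abs_of_pos Real.pi_pos]
        rw [← ofReal_norm, hJ, norm_mul, norm_mul, norm_sgIm, one_mul, e]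
        exact ENNReal.ofReal_le_ofReal (by nlinarith [Real.pi_pos])
      have hEb := hK₁ w
      rw [← fR_rearrange] at hEb
      have hnb := hK₂ w
      simp only [one_div] at hnb
      have hform : M₀ w = cauchyE x t μ γ α σ w - (loopWind σ w + 1) * (f x t μ w / R w) + J w := by
        simp only [hM₀]
        rw [hk w hwA, h.dixonH_eq hμ hγ x t hwt]
        ring
      have hle : ‖M₀ w‖ₑ ≤
          ‖cauchyE x t μ γ α σ w‖ₑ + (‖loopWind σ w‖ₑ + 1) * ‖f x t μ w / R w‖ₑ + ‖J w‖ₑ := by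
        rw [hform]
        refine (enorm_add_le _ _).trans (add_le_add_left (enorm_sub_le.trans ?_) _)
        rw [enorm_mul]
        gcongr
        exact (enorm_add_le _ _).trans (by simp)
      have hC : ENNReal.ofReal (K₁ + K₂ * N.toNNReal + N.toNNReal + (Real.toNNReal π : ℝ)) =
          K₁ + K₂ * N.toNNReal + N.toNNReal + Real.toNNReal π := by
        exact_mod_cast ENNReal.ofReal_coe_nnreal
      rw [hC]
      generalize ∫⁻ z, ‖z - w‖ₑ⁻¹ ∂(loopMeasure σ) = P at hEb hnb ⊢
      refine (hle.trans (add_le_add (add_le_add hEb (mul_le_mul' (add_le_add_left hnb 1) hg))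
        hJb)).trans ((le_self_add (b := K₁ + K₂ * N.toNNReal + N.toNNReal * P +
          Real.toNNReal π * P)).trans_eq ?_)
      ring
  -- remove the correction again
  have hJ0 : Tendsto J (𝓝[A] p) (𝓝 0) := by
    have h1 : Tendsto (fun z => ‖(π * I / 2) * ((p - z) / Q z)‖) (𝓝 p) (𝓝 0) := by
      have hQp : ContinuousAt Q p := (hQd p (mem_ball_self hε)).continuousAt
      have h2 : ContinuousAt (fun z => ‖(π * I / 2) * ((p - z) / Q z)‖) p :=
        (continuousAt_const.mul (ContinuousAt.div (by fun_prop) hQp (hQ0 p))).norm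
      have h3 := h2.tendsto
      simpa using h3
    refine (squeeze_zero_norm (fun z => ?_) h1).mono_left nhdsWithin_le_nhds
    simp only [hJ]
    rw [mul_assoc, norm_mul, norm_sgIm, one_mul]
  refine ⟨l - 0, ((hl.mono_left (nhdsWithin_mono p ?_)).sub hJ0).congr' ?_⟩
  · rintro z hz rfl
    exact hz.2 hγ.contour.2.2.2.1
  · filter_upwards [self_mem_nhdsWithin, mem_nhdsWithin_of_mem_nhds
      (ball_mem_nhds p hε)] with z hz hzB
    rw [hMM z ⟨hzB, hz⟩]
    simp only [hM₀]
    ring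

lemma IsLoop.tendsto_solH_div (hμ : 0 < μ) (h : IsLoop γ μ σ) (hγ : IsTameContour α μ γ)
    (x t : ℝ) (hw : w ∈ γ) (hwp : w ≠ (μ : ℂ) / 2) :
    Tendsto (fun z => solH x t μ γ α σ z / radical γ α z) (𝓝[Dom μ \ γ] w)
      (𝓝 (cauchyE x t μ γ α σ w)) := by
  have h1 := (h.continuousAt_cauchyE hμ hγ x t
    (h.not_mem_loopTrace hγ.contour hw hwp)).continuousAt
  refine (h1.tendsto.mono_left nhdsWithin_le_nhds).congr' ?_
  filter_upwards [mem_nhdsWithin_of_mem_nhds (h.solH_eventually hμ hγ x t hw hwp),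
    self_mem_nhdsWithin] with y hy hyA
  rw [hy hyA.2, mul_div_cancel_left₀ _ (hγ.contour.isRadical.ne_zero hγ.contour hyA.2)]

lemma IsLoop.exists_tendsto_solH_div (hμ : 0 < μ) (h : IsLoop γ μ σ) (hγ : IsTameContour α μ γ)
    (x t : ℝ) (hw : w ∈ γ) :
    ∃ l, Tendsto (fun z => solH x t μ γ α σ z / radical γ α z) (𝓝[Dom μ \ γ] w) (𝓝 l) := by
  by_cases hwp : w = (μ : ℂ) / 2
  · rw [hwp]
    exact h.exists_tendsto_solH_div_half hμ hγ x t
  · exact ⟨_, h.tendsto_solH_div hμ hγ x t hw hwp⟩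

lemma IsContour.ne_half (h : IsContour α μ γ) : α ≠ (μ : ℂ) / 2 ∧ conj α ≠ (μ : ℂ) / 2 := by
  have h1 := h.1
  constructor <;> intro e <;> have e2 := congrArg Complex.im e <;> simp at e2 <;> linarith

lemma IsLoop.solH_bounded (hμ : 0 < μ) (h : IsLoop γ μ σ) (hγ : IsTameContour α μ γ) (x t : ℝ)
    (hw : w ∈ γ) (hwp : w ≠ (μ : ℂ) / 2) :
    ∃ C, ∀ᶠ z in 𝓝[Dom μ \ γ] w, ‖solH x t μ γ α σ z‖ ≤ C := by
  have h1 := (h.continuousAt_cauchyE hμ hγ x t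
    (h.not_mem_loopTrace hγ.contour hw hwp)).continuousAt
  have hqc : ContinuousAt (quad α) w := by
    unfold quad
    fun_prop
  have h2 : ContinuousAt (fun z => √‖quad α z‖ * ‖cauchyE x t μ γ α σ z‖) w :=
    (Real.continuous_sqrt.continuousAt.comp hqc.norm).mul h1.norm
  refine ⟨√‖quad α w‖ * ‖cauchyE x t μ γ α σ w‖ + 1, ?_⟩
  filter_upwards [mem_nhdsWithin_of_mem_nhds (h.solH_eventually hμ hγ x t hw hwp),
    mem_nhdsWithin_of_mem_nhds (h2.eventually (gt_mem_nhds (lt_add_one _))),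
    self_mem_nhdsWithin] with z a b c
  rw [a c.2, norm_mul]
  have e : ‖radical γ α z‖ = √‖quad α z‖ := by
    rw [quad, ← hγ.contour.isRadical.2.1 z c.2, norm_pow, Real.sqrt_sq (norm_nonneg _)]
  rw [e]
  exact b.le

/-- Every loop around a tame contour gives a solution of the Riemann-Hilbert problem. -/
lemma IsLoop.solvesRHP (hμ : 0 < μ) (h : IsLoop γ μ σ) (hγ : IsTameContour α μ γ) (x t : ℝ) :
    SolvesRHP x t μ γ α (solH x t μ γ α σ) := by
  classical
  refine ⟨?_, h.exists_extension hμ hγ x t, ?_⟩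
  · obtain ⟨Φ, hΦ⟩ := hγ.homeo
    have hmem : ∀ s ∈ Ioo (-1 : ℝ) 1, Φ s ∈ γ := fun s hs =>
      hΦ ▸ mem_image_of_mem Φ (mem_image_of_mem _ (Ioo_subset_Icc_self hs))
    choose! r hr0 hrp hrm using fun s (hs : s ∈ Ioo (-1 : ℝ) 1) => hγ.contour.radical_sides hΦ hs
    choose! l hl using fun s (hs : s ∈ Ioo (-1 : ℝ) 1) =>
      h.exists_tendsto_solH_div hμ hγ x t (hmem s hs)
    have hre : ∀ s : ℝ, (Φ.symm (Φ s)).re = s := fun s => by simp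
    refine ⟨fun w => l (Φ.symm w).re * r (Φ.symm w).re, fun w => l (Φ.symm w).re *
      -r (Φ.symm w).re, ⟨Φ, hΦ, fun s hs => ?_⟩, fun w _ _ _ => by ring⟩
    simp only [hre]
    have hmap : ∀ S : Set ℂ, (∀ z ∈ S, z.im ≠ 0) →
        Tendsto Φ (𝓝[{z | z ∈ S ∧ Φ z ∈ Dom μ}] (s : ℂ)) (𝓝[Dom μ \ γ] (Φ s)) := by
      intro S hS
      refine tendsto_nhdsWithin_iff.2
        ⟨(Φ.continuous.tendsto _).mono_left nhdsWithin_le_nhds, ?_⟩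
      filter_upwards [self_mem_nhdsWithin] with z hz
      refine ⟨hz.2, fun hzγ => ?_⟩
      rw [← hΦ] at hzγ
      obtain ⟨_, ⟨y, -, rfl⟩, e⟩ := hzγ
      have h1 := hS z hz.1
      rw [← Φ.injective e] at h1
      simp at h1
    have key : ∀ (S : Set ℂ) (ρ : ℂ), (∀ z ∈ S, z.im ≠ 0) →
        Tendsto (fun z => radical γ α (Φ z)) (𝓝[S] (s : ℂ)) (𝓝 ρ) →
        Tendsto (fun z => solH x t μ γ α σ (Φ z)) (𝓝[{z | z ∈ S ∧ Φ z ∈ Dom μ}] (s : ℂ))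
          (𝓝 (l s * ρ)) := by
      intro S ρ hS hρ
      have h1 := ((hl s hs).comp (hmap S hS)).mul
        (hρ.mono_left (nhdsWithin_mono _ (fun z (hz : z ∈ S ∧ Φ z ∈ Dom μ) => hz.1)))
      refine h1.congr' ?_
      filter_upwards [(hmap S hS).eventually self_mem_nhdsWithin] with z hz
      simp only [Function.comp_apply]
      rw [div_mul_cancel₀ _ (hγ.contour.isRadical.ne_zero hγ.contour hz.2)]
    exact ⟨key {z | 0 < z.im} _ (fun z hz => ne_of_gt hz) (hrp s hs),
      key {z | z.im < 0} _ (fun z hz => ne_of_lt hz) (hrm s hs)⟩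
  · obtain ⟨n1, n2⟩ := hγ.contour.ne_half
    obtain ⟨C₁, h1⟩ := h.solH_bounded hμ hγ x t hγ.contour.left_mem n1
    obtain ⟨C₂, h2⟩ := h.solH_bounded hμ hγ x t (hγ.contour.conj_mem.2 hγ.contour.left_mem) n2
    refine ⟨max C₁ C₂, ?_, ?_⟩
    · filter_upwards [h1] with z hz using hz.trans (le_max_left _ _)
    · filter_upwards [h2] with z hz using hz.trans (le_max_right _ _)

/-- `K` does not depend on the loop: it is the limit of `h / R` at the end point. -/
lemma IsLoop.modK_eq (hμ : 0 < μ) {σ₁ σ₂ : ℝ → ℂ} (h₁ : IsLoop γ μ σ₁) (h₂ : IsLoop γ μ σ₂)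
    (hγ : IsTameContour α μ γ) (x t : ℝ) : modK x t μ γ α σ₁ = modK x t μ γ α σ₂ := by
  have hu := SolvesRHP.unique hγ.contour (h₁.solvesRHP hμ hγ x t) (h₂.solvesRHP hμ hγ x t)
  have key : ∀ σ, IsLoop γ μ σ → Tendsto (fun z => solH x t μ γ α σ z / radical γ α z)
      (𝓝[Dom μ \ γ] α) (𝓝 (modK x t μ γ α σ)) := fun σ h =>
    h.tendsto_solH_div hμ hγ x t hγ.contour.left_mem hγ.contour.ne_half.1
  have := hγ.contour.neBot α
  refine tendsto_nhds_unique (key σ₁ h₁) ((key σ₂ h₂).congr' ?_)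
  filter_upwards [self_mem_nhdsWithin] with z hz
  rw [hu hz]

lemma IsLoop.inside_subset (hμ : 0 < μ) (h : IsLoop γ μ σ) (hz : z ∈ inside σ) :
    z ∈ Dom μ ∧ z ∉ loopTrace σ ∧ loopWind σ z = -1 := by
  obtain ⟨h1, h2, h3⟩ := hz
  have h4 : z ∉ loopTrace σ := fun h' => h'.elim h1 h2
  have h5 : loopWind σ z = -1 := h3
  refine ⟨?_, h4, h5⟩
  by_contra hD
  have hzp : z ≠ (μ : ℂ) / 2 := fun e => h4 (e ▸ h.half_mem_loopTrace)
  rw [h.loopWind_eq_zero hμ hD hzp] at h5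
  norm_num at h5

/-! ### Deformations of the plane that move the end points of a contour -/

/-- The tent function of radius `ρ` around `b₀`. -/
def bump (b₀ : ℂ) (ρ : ℝ) (z : ℂ) : ℝ := max 0 (1 - ‖z - b₀‖ / ρ)

/-- A deformation of the plane, symmetric in the real axis, which moves `b₀` to `b` and changes
only the points near `b₀` and near its conjugate. -/
def chi (b₀ : ℂ) (ρ : ℝ) (b z : ℂ) : ℂ :=
  z + bump b₀ ρ z * (b - b₀) + bump b₀ ρ (conj z) * conj (b - b₀)

/-- The inverse of the deformation `chi`. -/
def chiInv (b₀ : ℂ) (ρ : ℝ) (b : ℂ) : ℂ → ℂ := Function.invFun (chi b₀ ρ b)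

lemma bump_nonneg (b₀ : ℂ) (ρ : ℝ) (z : ℂ) : 0 ≤ bump b₀ ρ z := le_max_left _ _

lemma bump_le_one (b₀ : ℂ) {ρ : ℝ} (hρ : 0 < ρ) (z : ℂ) : bump b₀ ρ z ≤ 1 :=
  max_le zero_le_one (by linarith [div_nonneg (norm_nonneg (z - b₀)) hρ.le])

lemma bump_eq_zero {b₀ : ℂ} {ρ : ℝ} (hρ : 0 < ρ) (h : ρ ≤ ‖z - b₀‖) : bump b₀ ρ z = 0 :=
  max_eq_left (by linarith [(one_le_div hρ).2 h])

lemma bump_self (b₀ : ℂ) (ρ : ℝ) : bump b₀ ρ b₀ = 1 := by simp [bump]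

lemma abs_bump_sub_le (b₀ : ℂ) {ρ : ℝ} (hρ : 0 < ρ) (z w : ℂ) :
    |bump b₀ ρ z - bump b₀ ρ w| ≤ ‖z - w‖ / ρ := by
  unfold bump
  refine (abs_max_sub_max_le_max _ _ _ _).trans (max_le ?_ ?_)
  · rw [sub_self, abs_zero]
    positivity
  · rw [show (1 - ‖z - b₀‖ / ρ) - (1 - ‖w - b₀‖ / ρ) = (‖w - b₀‖ - ‖z - b₀‖) / ρ by ring, abs_div,
      abs_of_pos hρ]
    gcongr
    refine (abs_norm_sub_norm_le _ _).trans ?_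
    rw [sub_sub_sub_cancel_right, norm_sub_rev]

lemma chi_conj (b₀ : ℂ) (ρ : ℝ) (b z : ℂ) : chi b₀ ρ b (conj z) = conj (chi b₀ ρ b z) := by
  simp only [chi, map_add, map_mul, conj_conj, conj_ofReal]
  ring

lemma chi_self (b₀ : ℂ) (ρ : ℝ) (z : ℂ) : chi b₀ ρ b₀ z = z := by simp [chi]

/-- For small `b - b₀` the deformation is a Lipschitz perturbation of the identity. -/
lemma norm_chi_sub_sub_le (b₀ : ℂ) {ρ : ℝ} (hρ : 0 < ρ) (hb : ‖b - b₀‖ < ρ / 4) (z w : ℂ) :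
    ‖chi b₀ ρ b z - chi b₀ ρ b w - (z - w)‖ ≤ 1 / 2 * ‖z - w‖ := by
  have e : chi b₀ ρ b z - chi b₀ ρ b w - (z - w) =
      ((bump b₀ ρ z - bump b₀ ρ w : ℝ) : ℂ) * (b - b₀) +
      ((bump b₀ ρ (conj z) - bump b₀ ρ (conj w) : ℝ) : ℂ) * conj (b - b₀) := by
    simp only [chi]
    push_cast
    ring
  have h1 := abs_bump_sub_le b₀ hρ z w
  have h2 := abs_bump_sub_le b₀ hρ (conj z) (conj w)
  rw [← map_sub, Complex.norm_conj] at h2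
  have h3 : ‖z - w‖ / ρ * ‖b - b₀‖ ≤ 1 / 4 * ‖z - w‖ := by
    rw [div_mul_eq_mul_div, div_le_iff₀ hρ]
    nlinarith [norm_nonneg (z - w)]
  rw [e]
  refine (norm_add_le _ _).trans ?_
  rw [norm_mul, norm_mul, Complex.norm_conj, Complex.norm_real, Complex.norm_real,
    Real.norm_eq_abs, Real.norm_eq_abs]
  have h4 := mul_le_mul_of_nonneg_right h1 (norm_nonneg (b - b₀))
  have h5 := mul_le_mul_of_nonneg_right h2 (norm_nonneg (b - b₀))
  linarith

lemma norm_chi_sub_chi_le (b₀ : ℂ) {ρ : ℝ} (hρ : 0 < ρ) (b b' z : ℂ) :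
    ‖chi b₀ ρ b z - chi b₀ ρ b' z‖ ≤ 2 * ‖b - b'‖ := by
  have e : chi b₀ ρ b z - chi b₀ ρ b' z = bump b₀ ρ z * (b - b') +
      bump b₀ ρ (conj z) * conj (b - b') := by
    simp only [chi, map_sub]
    ring
  rw [e]
  refine (norm_add_le _ _).trans ?_
  rw [norm_mul, norm_mul, Complex.norm_conj, Complex.norm_real, Complex.norm_real,
    Real.norm_of_nonneg (bump_nonneg _ _ _), Real.norm_of_nonneg (bump_nonneg _ _ _)]
  have h1 := mul_le_mul_of_nonneg_right (bump_le_one b₀ hρ z) (norm_nonneg (b - b'))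
  have h2 := mul_le_mul_of_nonneg_right (bump_le_one b₀ hρ (conj z))
    (norm_nonneg (b - b'))
  linarith

lemma norm_sub_le_norm_chi_sub (b₀ : ℂ) {ρ : ℝ} (hρ : 0 < ρ) (hb : ‖b - b₀‖ < ρ / 4) (z w : ℂ) :
    ‖z - w‖ ≤ 2 * ‖chi b₀ ρ b z - chi b₀ ρ b w‖ := by
  have h1 := norm_chi_sub_sub_le b₀ hρ hb z w
  have h2 := norm_sub_norm_le (z - w) (chi b₀ ρ b z - chi b₀ ρ b w)
  rw [norm_sub_rev (z - w)] at h2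
  linarith

lemma exists_chi_homeo (b₀ : ℂ) {ρ : ℝ} (hρ : 0 < ρ) (hb : ‖b - b₀‖ < ρ / 4) :
    ∃ Φ : ℂ ≃ₜ ℂ, ⇑Φ = chi b₀ ρ b := by
  have h : ApproximatesLinearOn (chi b₀ ρ b)
      ((ContinuousLinearEquiv.refl ℝ ℂ : ℂ ≃L[ℝ] ℂ) : ℂ →L[ℝ] ℂ) univ (1 / 2 : NNReal) := by
    intro z _ w _
    simpa using norm_chi_sub_sub_le b₀ hρ hb z w
  refine ⟨h.toHomeomorph _ (Or.inr ?_), rfl⟩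
  have : ‖((ContinuousLinearEquiv.refl ℝ ℂ).symm : ℂ →L[ℝ] ℂ)‖₊ = 1 := by simp
  rw [this, inv_one, ← NNReal.coe_lt_coe]
  norm_num

lemma chi_chiInv (b₀ : ℂ) {ρ : ℝ} (hρ : 0 < ρ) (hb : ‖b - b₀‖ < ρ / 4) (y : ℂ) :
    chi b₀ ρ b (chiInv b₀ ρ b y) = y := by
  obtain ⟨Φ, hΦ⟩ := exists_chi_homeo b₀ hρ hb
  exact Function.invFun_eq (hΦ ▸ Φ.surjective y)

lemma chiInv_chi (b₀ : ℂ) {ρ : ℝ} (hρ : 0 < ρ) (hb : ‖b - b₀‖ < ρ / 4) (y : ℂ) :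
    chiInv b₀ ρ b (chi b₀ ρ b y) = y := by
  obtain ⟨Φ, hΦ⟩ := exists_chi_homeo b₀ hρ hb
  exact Function.leftInverse_invFun (hΦ ▸ Φ.injective) y

lemma continuous_bump (b₀ : ℂ) (ρ : ℝ) : Continuous (bump b₀ ρ) := by
  unfold bump
  fun_prop

lemma continuous_chi (b₀ : ℂ) (ρ : ℝ) : Continuous fun q : ℂ × ℂ => chi b₀ ρ q.1 q.2 := by
  have := continuous_bump b₀ ρ
  have h2 := continuous_conj
  unfold chi
  fun_prop

lemma continuousAt_chiInv (b₀ : ℂ) {ρ : ℝ} (hρ : 0 < ρ) (hb : ‖b - b₀‖ < ρ / 4) (y : ℂ) :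
    ContinuousAt (fun q : ℂ × ℂ => chiInv b₀ ρ q.1 q.2) (b, y) := by
  have hev : ∀ᶠ q : ℂ × ℂ in 𝓝 (b, y), ‖q.1 - b₀‖ < ρ / 4 :=
    (continuous_fst.sub continuous_const).norm.continuousAt.eventually (gt_mem_nhds hb)
  refine tendsto_iff_norm_sub_tendsto_zero.2 ?_
  refine squeeze_zero' (g := fun q : ℂ × ℂ => 2 * (‖q.2 - y‖ + 2 * ‖b - q.1‖))
    (Eventually.of_forall fun _ => norm_nonneg _) ?_ ?_
  · filter_upwards [hev] with q hq
    refine (norm_sub_le_norm_chi_sub b₀ hρ hq _ _).trans ?_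
    gcongr
    rw [chi_chiInv b₀ hρ hq]
    have h1 := norm_chi_sub_chi_le b₀ hρ b q.1 (chiInv b₀ ρ b y)
    rw [chi_chiInv b₀ hρ hb] at h1
    have h2 := norm_add_le (q.2 - y) (y - chi b₀ ρ q.1 (chiInv b₀ ρ b y))
    rw [sub_add_sub_cancel] at h2
    linarith
  · have : Continuous fun q : ℂ × ℂ => 2 * (‖q.2 - y‖ + 2 * ‖b - q.1‖) := by fun_prop
    simpa using this.tendsto (b, y)

/-- Points closer to the real axis than the support of the deformation are fixed. -/
lemma chi_of_abs_im_le {b₀ : ℂ} {ρ : ℝ} (hρ : 0 < ρ) (h2 : 2 * ρ ≤ b₀.im) (b : ℂ)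
    (hz : |z.im| ≤ ρ) : chi b₀ ρ b z = z := by
  have key : ∀ w : ℂ, |w.im| ≤ ρ → bump b₀ ρ w = 0 := by
    intro w hw
    refine bump_eq_zero hρ ?_
    have h3 := abs_im_le_norm (w - b₀)
    rw [Complex.sub_im] at h3
    have h4 := abs_le.1 hw
    have h5 := neg_abs_le (w.im - b₀.im)
    linarith
  rw [chi, key z hz, key (conj z) (by rwa [conj_im, abs_neg])]
  simp

lemma chi_of_norm_le {b₀ : ℂ} {ρ : ℝ} (hρ : 0 < ρ) (h2 : 2 * ρ ≤ b₀.im) (b : ℂ) (hz : ‖z‖ ≤ ρ) :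
    chi b₀ ρ b z = z :=
  chi_of_abs_im_le hρ h2 b ((abs_im_le_norm z).trans hz)

lemma chi_zero {b₀ : ℂ} {ρ : ℝ} (hρ : 0 < ρ) (h2 : 2 * ρ ≤ b₀.im) (b : ℂ) : chi b₀ ρ b 0 = 0 :=
  chi_of_norm_le hρ h2 b (by simpa using hρ.le)

lemma chi_base {b₀ : ℂ} {ρ : ℝ} (hρ : 0 < ρ) (h2 : 2 * ρ ≤ b₀.im) (b : ℂ) : chi b₀ ρ b b₀ = b := by
  have : bump b₀ ρ (conj b₀) = 0 := by
    refine bump_eq_zero hρ ?_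
    have h3 := abs_im_le_norm (conj b₀ - b₀)
    rw [Complex.sub_im, conj_im] at h3
    have h5 := neg_abs_le (-b₀.im - b₀.im)
    linarith
  rw [chi, this, bump_self]
  simp

lemma chi_conj_base {b₀ : ℂ} {ρ : ℝ} (hρ : 0 < ρ) (h2 : 2 * ρ ≤ b₀.im) (b : ℂ) :
    chi b₀ ρ b (conj b₀) = conj b := by
  rw [chi_conj, chi_base hρ h2]

lemma chi_im_pos {b₀ : ℂ} {ρ : ℝ} (hρ : 0 < ρ) (h2 : 2 * ρ ≤ b₀.im) (hb : ‖b - b₀‖ < ρ / 4)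
    (hz : 0 < z.im) : 0 < (chi b₀ ρ b z).im := by
  rcases le_total |z.im| ρ with h | h
  · rwa [chi_of_abs_im_le hρ h2 b h]
  · rw [abs_of_pos hz] at h
    have h3 : bump b₀ ρ (conj z) = 0 := by
      refine bump_eq_zero hρ ?_
      have h3 := abs_im_le_norm (conj z - b₀)
      rw [Complex.sub_im, conj_im] at h3
      have h5 := neg_abs_le (-z.im - b₀.im)
      linarith
    rw [chi, h3]
    have h4 := abs_im_le_norm (b - b₀)
    have h5 := neg_abs_le (b - b₀).im
    have h6 := bump_nonneg b₀ ρ z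
    have h7 := bump_le_one b₀ hρ z
    have e : (z + (bump b₀ ρ z : ℂ) * (b - b₀) +
        ((0 : ℝ) : ℂ) * conj (b - b₀)).im = z.im + bump b₀ ρ z * (b - b₀).im := by
      simp
    rw [e]
    nlinarith

lemma chi_im_nonpos {b₀ : ℂ} {ρ : ℝ} (hρ : 0 < ρ) (h2 : 2 * ρ ≤ b₀.im) (hb : ‖b - b₀‖ < ρ / 4)
    (hz : z.im ≤ 0) : (chi b₀ ρ b z).im ≤ 0 := by
  rcases hz.lt_or_eq with h | h
  · have h1 := chi_im_pos hρ h2 hb (z := conj z) (by simpa using h)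
    rw [chi_conj, conj_im] at h1
    linarith
  · rw [chi_of_abs_im_le hρ h2 b (by rw [h, abs_zero]; exact hρ.le), h]

lemma chi_div_mem_slitPlane {b₀ : ℂ} {ρ : ℝ} (hρ : 0 < ρ) (hb : ‖b - b₀‖ < ρ / 4) {z w : ℂ}
    (h : z ≠ w) : (chi b₀ ρ b z - chi b₀ ρ b w) / (z - w) ∈ slitPlane := by
  have hne : z - w ≠ 0 := sub_ne_zero.2 h
  apply ball_one_subset_slitPlane
  rw [mem_ball_iff_norm, div_sub_one hne, norm_div, div_lt_one (norm_pos_iff.2 hne)]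
  have := norm_chi_sub_sub_le b₀ hρ hb z w
  have h3 := norm_pos_iff.2 hne
  linarith

/-! ### The family of contours -/

/-- The contour from which the family of contours is obtained by deformation. -/
structure BaseContour where
  /-- the end point in the upper half plane -/
  α₀ : ℂ
  /-- the parameter -/
  μ₀ : ℝ
  /-- the arc -/
  γ₀ : Set ℂ
  pos : 0 < μ₀
  tame : IsTameContour α₀ μ₀ γ₀

namespace BaseContour

/-- The end point of the contour relative to the point `μ₀/2`. -/
def b₀ (D : BaseContour) : ℂ := D.α₀ - D.μ₀ / 2

/-- The radius of the region around the end points in which the contour is deformed. -/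
def ρ (D : BaseContour) : ℝ := D.α₀.im / 2

/-- The contour relative to the point `μ₀/2`. -/
def S (D : BaseContour) : Set ℂ := {ξ | D.μ₀ / 2 + ξ ∈ D.γ₀}

/-- The deformation that moves the end point to `b`. -/
def defo (D : BaseContour) : ℂ → ℂ → ℂ := chi D.b₀ D.ρ

/-- The inverse of the deformation that moves the end point to `b`. -/
def undo (D : BaseContour) : ℂ → ℂ → ℂ := chiInv D.b₀ D.ρ

/-- The contour `γ(a, m)`: relative to the point `m/2`, the base contour is deformed such that its
end point becomes `a - m/2`. -/
def fam (D : BaseContour) (a : ℂ) (m : ℝ) : Set ℂ :=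
  {z | D.undo (a - m / 2) (z - m / 2) ∈ D.S}

/-- The end points `b` (relative to `m/2`) for which the deformation is invertible. -/
def Near (D : BaseContour) (b : ℂ) : Prop := ‖b - D.b₀‖ < D.ρ / 4

/-- The parameters `b`, `m` for which the deformed contour lies in the domain of analyticity. -/
structure Adm (D : BaseContour) (b : ℂ) (m : ℝ) : Prop where
  near : D.Near b
  pos : 0 < m
  dom : ∀ ξ ∈ D.S, ξ ≠ 0 → m / 2 + D.defo b ξ ∈ Dom m

variable (D : BaseContour)

lemma im_b₀ : D.b₀.im = D.α₀.im := by simp [b₀]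

lemma ρ_pos : 0 < D.ρ := half_pos D.tame.contour.1

lemma two_ρ : 2 * D.ρ ≤ D.b₀.im := by rw [im_b₀, ρ]; linarith

lemma near_b₀ : D.Near D.b₀ := by
  have := D.ρ_pos
  rw [Near, sub_self, norm_zero]
  positivity

lemma mem_S {ξ : ℂ} : ξ ∈ D.S ↔ D.μ₀ / 2 + ξ ∈ D.γ₀ := Iff.rfl

lemma fam_add {b y : ℂ} : m / 2 + y ∈ D.fam (b + m / 2) m ↔ D.undo b y ∈ D.S := by
  rw [fam, mem_ofPred_eq, add_sub_cancel_right, add_sub_cancel_left]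

lemma fam_base : D.fam D.α₀ D.μ₀ = D.γ₀ := by
  ext z
  have h := chiInv_chi D.b₀ D.ρ_pos D.near_b₀ (z - D.μ₀ / 2)
  rw [chi_self] at h
  rw [fam, mem_ofPred_eq, undo, ← b₀, h, mem_S, add_sub_cancel]

variable {D}

lemma defo_undo (hb : D.Near b) (y : ℂ) : D.defo b (D.undo b y) = y :=
  chi_chiInv D.b₀ D.ρ_pos hb y

lemma undo_defo (hb : D.Near b) (y : ℂ) : D.undo b (D.defo b y) = y :=
  chiInv_chi D.b₀ D.ρ_pos hb y

lemma defo_of_norm_le (b : ℂ) (hz : ‖z‖ ≤ D.ρ) : D.defo b z = z :=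
  chi_of_norm_le D.ρ_pos D.two_ρ b hz

lemma undo_of_norm_le (hb : D.Near b) (hz : ‖z‖ ≤ D.ρ) : D.undo b z = z := by
  have := undo_defo hb z
  rwa [defo_of_norm_le b hz] at this

lemma defo_ofReal (b : ℂ) (r : ℝ) : D.defo b r = r :=
  chi_of_abs_im_le D.ρ_pos D.two_ρ b (by simpa using D.ρ_pos.le)

lemma undo_ofReal (hb : D.Near b) (r : ℝ) : D.undo b r = r := by
  have := undo_defo hb r
  rwa [defo_ofReal] at this

lemma continuous_defo : Continuous fun q : ℂ × ℂ => D.defo q.1 q.2 := continuous_chi _ _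

lemma continuousAt_undo (hb : D.Near b) (y : ℂ) :
    ContinuousAt (fun q : ℂ × ℂ => D.undo q.1 q.2) (b, y) := continuousAt_chiInv D.b₀ D.ρ_pos hb y

lemma near_eventually (hb : D.Near b) : ∀ᶠ b' in 𝓝 b, D.Near b' :=
  (continuous_id.sub continuous_const).norm.continuousAt.eventually (gt_mem_nhds hb)

lemma isCompact_S : IsCompact D.S :=
  (Homeomorph.addLeft ((D.μ₀ : ℂ) / 2)).isClosedEmbedding.isCompact_preimage
    D.tame.contour.isCompact

lemma conj_mem_S {ξ : ℂ} : conj ξ ∈ D.S ↔ ξ ∈ D.S := by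
  rw [mem_S, mem_S, ← D.tame.contour.conj_mem, map_add, conj_conj, map_div₀,
    conj_ofReal, conj_ofNat]

lemma zero_mem_S : (0 : ℂ) ∈ D.S := by
  rw [mem_S, add_zero]
  exact D.tame.contour.2.2.2.1

lemma b₀_mem_S : D.b₀ ∈ D.S := by
  rw [mem_S, b₀, add_sub_cancel]
  exact D.tame.contour.left_mem

lemma im_ne_zero_of_mem_S {ξ : ℂ} (h : ξ ∈ D.S) (h0 : ξ ≠ 0) : ξ.im ≠ 0 := by
  have := (D.tame.contour.2.2.2.2 _ h (by simpa using h0)).1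
  simpa using this

lemma adm_base : D.Adm D.b₀ D.μ₀ := by
  refine ⟨D.near_b₀, D.pos, fun ξ hξ h0 => ?_⟩
  rw [defo, chi_self]
  exact D.tame.contour.2.2.2.2 _ hξ (by simpa using h0)

lemma image_defo_S (hb : D.Near b) (m : ℝ) :
    D.fam (b + m / 2) m = (fun ξ => m / 2 + D.defo b ξ) '' D.S := by
  ext z
  constructor
  · intro h
    rw [← add_sub_cancel ((m : ℂ) / 2) z, fam_add] at h
    exact ⟨_, h, by simp only [defo_undo hb]; ring⟩
  · rintro ⟨ξ, hξ, rfl⟩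
    rwa [fam_add, undo_defo hb]

lemma Adm.isTameContour (h : D.Adm b m) : IsTameContour (b + m / 2) m (D.fam (b + m / 2) m) := by
  have hb := h.near
  have hconj : ∀ ξ, m / 2 + D.defo b (conj ξ) = conj (m / 2 + D.defo b ξ) := by
    intro ξ
    rw [defo, chi_conj, map_add, map_div₀, conj_ofReal, conj_ofNat]
  have e1 : D.defo b D.b₀ = b := chi_base D.ρ_pos D.two_ρ b
  have hb₀ : D.b₀ + D.μ₀ / 2 = D.α₀ := by simp [b₀]
  obtain ⟨⟨him, ⟨c, ⟨L, hL⟩, hinj, hc0, hc1, himg⟩, -⟩, ⟨Φ, hΦ⟩⟩ := D.tame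
  obtain ⟨Ψ, hΨ⟩ := exists_chi_homeo D.b₀ D.ρ_pos hb
  have hS : D.S = (fun z => z - (D.μ₀ : ℂ) / 2) '' D.γ₀ := by
    ext ξ
    rw [mem_S]
    constructor
    · intro hξ
      exact ⟨_, hξ, by simp⟩
    · rintro ⟨z, hz, rfl⟩
      simpa using hz
  refine ⟨⟨?_, ⟨fun s => m / 2 + D.defo b (c s - D.μ₀ / 2), ⟨2 * L, ?_⟩, ?_, ?_, ?_, ?_⟩,
    ?_, ?_, ?_⟩, ?_⟩
  · have h1 := chi_im_pos D.ρ_pos D.two_ρ hb (z := D.b₀) (by rw [im_b₀]; exact him)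
    rw [← defo, e1] at h1
    simpa using h1
  · refine LipschitzOnWith.of_dist_le_mul fun s hs u hu => ?_
    have h1 := norm_chi_sub_sub_le D.b₀ D.ρ_pos hb (c s - D.μ₀ / 2) (c u - D.μ₀ / 2)
    rw [sub_sub_sub_cancel_right] at h1
    have h2 := norm_le_norm_add_norm_sub' (D.defo b (c s - D.μ₀ / 2) -
      D.defo b (c u - D.μ₀ / 2)) (c s - c u)
    have h3 := hL.dist_le_mul s hs u hu
    rw [dist_eq_norm] at h3
    rw [dist_add_left, dist_eq_norm]
    push_cast
    have h4 : 0 ≤ (L : ℝ) * dist s u := by positivity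
    have h1' : ‖D.defo b (c s - D.μ₀ / 2) - D.defo b (c u - D.μ₀ / 2) - (c s - c u)‖ ≤
      1 / 2 * ‖c s - c u‖ := h1
    linarith
  · intro s hs u hu hsu
    have h1 : D.defo b (c s - D.μ₀ / 2) = D.defo b (c u - D.μ₀ / 2) := by simp_all
    have h2 := congrArg (D.undo b) h1
    rw [undo_defo hb, undo_defo hb] at h2
    exact hinj hs hu (sub_left_injective h2)
  · change _ + D.defo b (c 0 - _) = _
    have : c 0 - D.μ₀ / 2 = conj D.b₀ := by rw [hc0, b₀, map_sub, map_div₀, conj_ofReal, conj_ofNat]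
    rw [this, hconj, e1, add_comm]
  · change _ + D.defo b (c 1 - _) = _
    rw [hc1, ← b₀, e1, add_comm]
  · rw [image_defo_S hb, hS, ← himg, image_image, image_image]
  · rw [image_defo_S hb]
    rintro _ ⟨ξ, hξ, rfl⟩
    exact ⟨_, conj_mem_S.2 hξ, hconj ξ⟩
  · rw [image_defo_S hb]
    refine ⟨0, zero_mem_S, ?_⟩
    simp only [defo, chi_zero D.ρ_pos D.two_ρ, add_zero]
  · rw [image_defo_S hb]
    rintro _ ⟨ξ, hξ, rfl⟩ hne
    refine h.dom ξ hξ ?_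
    rintro rfl
    exact hne (by simp only [defo, chi_zero D.ρ_pos D.two_ρ, add_zero])
  · refine ⟨((Φ.trans (Homeomorph.subRight ((D.μ₀ : ℂ) / 2))).trans Ψ).trans
      (Homeomorph.addLeft ((m : ℂ) / 2)), ?_⟩
    rw [image_defo_S hb, hS, ← hΦ]
    simp only [image_image]
    refine image_congr fun s _ => ?_
    change m / 2 + Ψ (Φ s - D.μ₀ / 2) = _
    rw [hΨ, defo]

lemma Adm.isContour (h : D.Adm b m) :
    IsContour (b + m / 2) m (D.fam (b + m / 2) m) := h.isTameContour.contour

/-- The admissible parameters form an open set.  Near the point `m/2`, where the contour meets the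
real axis, it is not deformed. -/
lemma Adm.eventually {b₁ : ℂ} {m₁ : ℝ} (h : D.Adm b₁ m₁) :
    ∀ᶠ q : ℂ × ℝ in 𝓝 (b₁, m₁), D.Adm q.1 q.2 := by
  have key : ∀ᶠ q : ℂ × ℝ in 𝓝 (b₁, m₁), ∀ ξ ∈ D.S, ξ ∈ D.S → ξ ≠ 0 →
      q.2 / 2 + D.defo q.1 ξ ∈ Dom q.2 := by
    refine isCompact_S.eventually_forall_of_forall_eventually
      (P := fun (q : ℂ × ℝ) ξ => ξ ∈ D.S → ξ ≠ 0 → q.2 / 2 + D.defo q.1 ξ ∈ Dom q.2) ?_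
    intro ξ hξ
    have hdc := D.continuous_defo
    have hd : Continuous fun w : (ℂ × ℝ) × ℂ => D.defo w.1.1 w.2 := by fun_prop
    by_cases h0 : ξ = 0
    · have hsmall : ∀ᶠ w : (ℂ × ℝ) × ℂ in 𝓝 ((b₁, m₁), ξ), ‖w.2‖ < D.ρ := by
        refine continuous_snd.norm.continuousAt.eventually (gt_mem_nhds ?_)
        simpa [h0] using D.ρ_pos
      have hseg : ∀ᶠ w : (ℂ × ℝ) × ℂ in 𝓝 ((b₁, m₁), ξ),
          w.1.2 / 2 + w.2 ∉ segment ℝ (-branchT w.1.2) (branchT w.1.2) := by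
        have hc : Continuous fun w : (ℂ × ℝ) × ℂ => (w.1.2 / 2 + w.2, w.1.2) := by fun_prop
        refine hc.continuousAt.eventually (isOpen_setOf_not_mem_segment.mem_nhds ?_)
        simpa [h0] using half_not_mem_segment h.pos
      filter_upwards [hsmall, hseg] with w hw1 hw2 hS hne
      rw [defo_of_norm_le _ hw1.le]
      refine ⟨?_, hw2⟩
      simpa using im_ne_zero_of_mem_S hS hne
    · have hc : Continuous fun w : (ℂ × ℝ) × ℂ => (w.1.2 / 2 + D.defo w.1.1 w.2, w.1.2) := by
        fun_prop
      filter_upwards [hc.continuousAt.eventually (isOpen_setOf_mem_Dom.mem_nhds (h.dom ξ hξ h0))]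
        with w hw _ _ using hw
  filter_upwards [key, (continuous_fst.tendsto (b₁, m₁)).eventually (near_eventually h.near),
    (continuous_snd.tendsto (b₁, m₁)).eventually (lt_mem_nhds h.pos)] with q h1 h2 h3
  exact ⟨h2, h3, fun ξ hξ => h1 ξ hξ hξ⟩

/-! ### The radical of the deformed contours -/

/-- The radical of the deformed contour with end point `b`, relative to the point `m/2`: it does
not depend on `m`, and is obtained from the radical of the base contour by transport with the
deformation and correction by square roots of numbers close to `1`. -/
def rad (D : BaseContour) (b y : ℂ) : ℂ :=
  radical D.γ₀ D.α₀ (D.μ₀ / 2 + D.undo b y) * csqrt ((y - b) / (D.undo b y - D.b₀)) *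
    csqrt ((y - conj b) / (D.undo b y - conj D.b₀))

lemma undo_ne_b₀ {b y : ℂ} (hy : D.undo b y ∉ D.S) : D.undo b y ≠ D.b₀ := fun h =>
  hy (h ▸ b₀_mem_S)

lemma undo_ne_conj_b₀ {b y : ℂ} (hy : D.undo b y ∉ D.S) : D.undo b y ≠ conj D.b₀ :=
  fun h => hy (h ▸ conj_mem_S.2 b₀_mem_S)

lemma slit_left {b y : ℂ} (hb : D.Near b) (hy : D.undo b y ∉ D.S) :
    (y - b) / (D.undo b y - D.b₀) ∈ slitPlane := by
  have := chi_div_mem_slitPlane D.ρ_pos hb (undo_ne_b₀ hy)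
  rwa [chi_base D.ρ_pos D.two_ρ, ← defo, defo_undo hb] at this

lemma slit_right {b y : ℂ} (hb : D.Near b) (hy : D.undo b y ∉ D.S) :
    (y - conj b) / (D.undo b y - conj D.b₀) ∈ slitPlane := by
  have := chi_div_mem_slitPlane D.ρ_pos hb (undo_ne_conj_b₀ hy)
  rwa [chi_conj_base D.ρ_pos D.two_ρ, ← defo, defo_undo hb] at this

lemma rad_sq {b y : ℂ} (hb : D.Near b) (hy : D.undo b y ∉ D.S) :
    D.rad b y ^ 2 = (y - b) * (y - conj b) := by
  have h1 := D.tame.contour.isRadical.2.1 (D.μ₀ / 2 + D.undo b y) hy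
  have e1 : D.μ₀ / 2 + D.undo b y - D.α₀ = D.undo b y - D.b₀ := by rw [b₀]; ring
  have e2 : D.μ₀ / 2 + D.undo b y - conj D.α₀ = D.undo b y - conj D.b₀ := by
    rw [b₀, map_sub, map_div₀, conj_ofReal, conj_ofNat]
    ring
  have h2 := sub_ne_zero.2 (undo_ne_b₀ hy)
  have h3 := sub_ne_zero.2 (undo_ne_conj_b₀ hy)
  rw [rad, mul_pow, mul_pow, h1, e1, e2, csqrt_sq (slitPlane_ne_zero (slit_left hb hy)),
    csqrt_sq (slitPlane_ne_zero (slit_right hb hy))]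
  field_simp

lemma rad_ne_zero {b y : ℂ} (hy : D.undo b y ∉ D.S) : D.rad b y ≠ 0 :=
  mul_ne_zero (mul_ne_zero (D.tame.contour.isRadical.ne_zero D.tame.contour hy)
    (csqrt_ne_zero _)) (csqrt_ne_zero _)

lemma undo_not_mem_eventually {b y : ℂ} (hb : D.Near b) (hy : D.undo b y ∉ D.S) :
    ∀ᶠ q : ℂ × ℂ in 𝓝 (b, y), D.undo q.1 q.2 ∉ D.S :=
  (continuousAt_undo hb y).eventually (isCompact_S.isClosed.isOpen_compl.mem_nhds hy)

lemma continuousAt_rad {b y : ℂ} (hb : D.Near b) (hy : D.undo b y ∉ D.S) :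
    ContinuousAt (fun q : ℂ × ℂ => D.rad q.1 q.2) (b, y) := by
  have hu := continuousAt_undo hb y
  have hcj := continuous_conj
  have h1 : ContinuousAt (radical D.γ₀ D.α₀) (D.μ₀ / 2 + D.undo b y) :=
    (D.tame.contour.isRadical.1.differentiableAt
      (D.tame.contour.isOpen_compl.mem_nhds hy)).continuousAt
  have h1' : ContinuousAt (fun q : ℂ × ℂ =>
      radical D.γ₀ D.α₀ (D.μ₀ / 2 + D.undo q.1 q.2)) (b, y) := by fun_prop
  have h2 : ContinuousAt (fun q : ℂ × ℂ => (q.2 - q.1) / (D.undo q.1 q.2 - D.b₀)) (b, y) :=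
    (by fun_prop : ContinuousAt (fun q : ℂ × ℂ => q.2 - q.1) (b, y)).div
      (hu.sub continuousAt_const) (sub_ne_zero.2 (undo_ne_b₀ hy))
  have h3 : ContinuousAt (fun q : ℂ × ℂ => (q.2 - conj q.1) /
      (D.undo q.1 q.2 - conj D.b₀)) (b, y) :=
    (by fun_prop : Continuous (fun q : ℂ × ℂ => q.2 - conj q.1)).continuousAt.div
      (hu.sub continuousAt_const) (sub_ne_zero.2 (undo_ne_conj_b₀ hy))
  exact (h1'.mul ((differentiableAt_csqrt (slit_left hb hy)).continuousAt.comp_of_eq (g := csqrt)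
    h2 rfl)).mul ((differentiableAt_csqrt (slit_right hb hy)).continuousAt.comp_of_eq (g := csqrt)
    h3 rfl)

/-- The explicit function `rad` is the radical of the deformed contour. -/
lemma Adm.radical_fam (h : D.Adm b m) (hy : D.undo b y ∉ D.S) :
    radical (D.fam (b + m / 2) m) (b + m / 2) (m / 2 + y) = D.rad b y := by
  have hb := h.near
  have hT := h.isTameContour
  have hmem : ∀ z ∈ (D.fam (b + m / 2) m)ᶜ, D.undo b (z - m / 2) ∉ D.S := by
    intro z hz h'
    refine hz ?_
    rwa [← fam_add (m := m), add_sub_cancel] at h'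
  -- both functions are positive at the real number `m/2 - 1`
  have hm1 : D.undo b (-1) = -1 := by simpa using undo_ofReal hb (-1)
  have hm1S : D.undo b (-1) ∉ D.S := by
    intro h'
    rw [hm1] at h'
    exact im_ne_zero_of_mem_S h' (by simp) (by simp)
  have hpt : (m : ℂ) / 2 + (-1) ∈ (D.fam (b + m / 2) m)ᶜ := fun h' => hm1S (fam_add D |>.1 h')
  have hval : radical (D.fam (b + m / 2) m) (b + m / 2) (m / 2 + (-1)) = D.rad b (-1) := by
    have r1 := (hT.contour.radical_real).1 (m / 2 - 1) (by linarith)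
    have r2 := (D.tame.contour.radical_real).1 (D.μ₀ / 2 - 1) (by linarith)
    have e1 : ((m / 2 - 1 : ℝ) : ℂ) = m / 2 + (-1) := by push_cast; ring
    have e2 : ((D.μ₀ / 2 - 1 : ℝ) : ℂ) = D.μ₀ / 2 + (-1) := by push_cast; ring
    rw [e1] at r1
    rw [e2] at r2
    have e3 : (-1 - conj b) / (-1 - conj D.b₀) = conj ((-1 - b) / (-1 - D.b₀)) := by simp
    have hs := slit_left hb hm1S
    rw [hm1] at hs
    have e4 : D.rad b (-1) = ((‖D.μ₀ / 2 + (-1) - D.α₀‖ *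
        ‖csqrt ((-1 - b) / (-1 - D.b₀))‖ ^ 2 : ℝ) : ℂ) := by
      rw [rad, hm1, e3, csqrt_conj hs, mul_assoc, mul_conj, r2, normSq_eq_norm_sq]
      push_cast
      rfl
    have h5 := rad_sq hb hm1S
    have h6 := hT.contour.isRadical.2.1 _ hpt
    have h7 : (radical (D.fam (b + m / 2) m) (b + m / 2) (m / 2 + (-1))) ^ 2 =
        D.rad b (-1) ^ 2 := by
      rw [h5, h6]
      simp only [map_add, map_div₀, conj_ofReal, conj_ofNat]
      ring
    rw [r1, e4] at h7 ⊢
    norm_cast at h7 ⊢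
    exact (pow_left_inj₀ (norm_nonneg _) (by positivity) two_ne_zero).1 h7
  have h1 : EqOn (radical (D.fam (b + m / 2) m) (b + m / 2))
      (fun z => D.rad b (z - m / 2)) (D.fam (b + m / 2) m)ᶜ := by
    refine hT.isPreconnected_compl.eq_of_sq_eq hT.contour.isRadical.1.continuousOn ?_ ?_
      (fun {z} hz => rad_ne_zero (hmem z hz)) hpt ?_
    · intro z hz
      have h2 := continuousAt_rad hb (hmem z hz)
      exact (h2.comp_of_eq (g := fun q : ℂ × ℂ => D.rad q.1 q.2)
        (f := fun z : ℂ => (b, z - m / 2)) (by fun_prop) rfl).continuousWithinAt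
    · intro z hz
      simp only [Pi.pow_apply]
      rw [hT.contour.isRadical.2.1 z hz, rad_sq hb (hmem z hz)]
      simp only [map_add, map_div₀, conj_ofReal, conj_ofNat]
      ring
    · simp_all
  have h2 := h1 (x := m / 2 + y) fun h' => hy (fam_add D |>.1 h')
  simpa using h2

end BaseContour

/-! ### Persistence of loops -/

lemma curveInt_const_add (σ : ℝ → ℂ) (d : ℂ) (g : ℂ → ℂ) :
    curveInt (fun s => d + σ s) g = curveInt σ (fun ζ => g (d + ζ)) := by
  simp only [curveInt, deriv_const_add]

lemma IsPiecewiseRegular.const_add (h : IsPiecewiseRegular σ) (d : ℂ) :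
    IsPiecewiseRegular (fun s => d + σ s) := by
  obtain ⟨n, p, h0, h1, hp⟩ := h
  refine ⟨n, p, h0, h1, fun i hi => ⟨(hp i hi).1, contDiffOn_const.add (hp i hi).2.1,
    fun s hs => ?_⟩⟩
  rw [derivWithin_const_add]
  exact (hp i hi).2.2 s hs

lemma IsLoop.wind_eq (hμ : 0 < μ) (h : IsLoop γ μ σ) (hz : 0 < z.im) :
    (2 * π * I)⁻¹ * curveInt σ (fun ζ => (ζ - z)⁻¹) = loopWind σ z := by
  unfold loopWind loopInt
  have hne : conj z ≠ (μ : ℂ) / 2 := by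
    intro e
    have := congrArg Complex.im e
    simp at this
    linarith
  rw [curveInt_mirror_inv, h.curveInt_inv_eq_zero_of_im_nonpos (by simpa using hz.le) hne]
  simp

namespace BaseContour

variable {D : BaseContour}

/-- Translates of a loop remain loops for nearby contours. -/
lemma Adm.loop_eventually {b₁ : ℂ} {m₁ : ℝ} (h : D.Adm b₁ m₁)
    (hσ : IsLoop (D.fam (b₁ + m₁ / 2) m₁) m₁ (fun s => m₁ / 2 + c s)) :
    ∀ᶠ q : ℂ × ℝ in 𝓝 (b₁, m₁), IsLoop (D.fam (q.1 + q.2 / 2) q.2) q.2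
      (fun s => q.2 / 2 + c s) := by
  have hT := h.isTameContour
  set σ : ℝ → ℂ := fun s => m₁ / 2 + c s with hσdef
  have hc0 : c 0 = 0 := by simpa [hσdef] using hσ.2.1
  have hc1 : c 1 = 0 := by simpa [hσdef] using hσ.2.2.1
  have hcc : ContinuousOn c (Icc 0 1) := by
    have := (continuousOn_const (c := -((m₁ : ℂ) / 2))).add hσ.nice.continuousOn
    refine this.congr fun s _ => ?_
    simp [hσdef]
  have hdc := D.continuous_defo
  have hd : Continuous fun w : (ℂ × ℝ) × ℂ => D.defo w.1.1 w.2 := by fun_prop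
  -- the loop stays in the domain of analyticity and off the contour
  have key1 : ∀ᶠ q : ℂ × ℝ in 𝓝 (b₁, m₁), ∀ y ∈ c '' Icc 0 1, 0 < y.im → y ∈ c '' Icc 0 1 →
      q.2 / 2 + y ∈ Dom q.2 ∧ D.undo q.1 y ∉ D.S := by
    refine (isCompact_Icc.image_of_continuousOn hcc).eventually_forall_of_forall_eventually
      (P := fun (q : ℂ × ℝ) y => 0 < y.im → y ∈ c '' Icc 0 1 →
        q.2 / 2 + y ∈ Dom q.2 ∧ D.undo q.1 y ∉ D.S) ?_
    rintro _ ⟨s, hs, rfl⟩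
    have hmem : ∀ y ∈ c '' Icc 0 1, 0 < y.im → m₁ / 2 + y ∈ Dom m₁ ∧ D.undo b₁ y ∉ D.S := by
      rintro _ ⟨s, hs, rfl⟩ hp
      rcases hσ.mem_Icc hs with e | ⟨-, e1, e2⟩
      · have h2 : c s = 0 := by simpa [hσdef] using e
        rw [h2] at hp
        simp at hp
      · exact ⟨e1, fun h' => e2 (fam_add D |>.2 h')⟩
    rcases hσ.mem_Icc hs with e | ⟨h1, h2, h3⟩
    · have h0 : c s = 0 := by simpa [hσdef] using e
      rw [h0]
      have hsmall : ∀ᶠ w : (ℂ × ℝ) × ℂ in 𝓝 ((b₁, m₁), (0 : ℂ)), ‖w.2‖ < D.ρ := by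
        refine continuous_snd.norm.continuousAt.eventually (gt_mem_nhds ?_)
        simpa using D.ρ_pos
      have hseg : ∀ᶠ w : (ℂ × ℝ) × ℂ in 𝓝 ((b₁, m₁), (0 : ℂ)),
          w.1.2 / 2 + w.2 ∉ segment ℝ (-branchT w.1.2) (branchT w.1.2) := by
        have hc : Continuous fun w : (ℂ × ℝ) × ℂ => (w.1.2 / 2 + w.2, w.1.2) := by fun_prop
        refine hc.continuousAt.eventually (isOpen_setOf_not_mem_segment.mem_nhds ?_)
        simpa using half_not_mem_segment h.pos
      have hnear : ∀ᶠ w : (ℂ × ℝ) × ℂ in 𝓝 ((b₁, m₁), (0 : ℂ)), D.Near w.1.1 :=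
        ((continuous_fst.comp continuous_fst).tendsto ((b₁, m₁), (0 : ℂ))).eventually
          (near_eventually h.near)
      filter_upwards [hsmall, hseg, hnear] with w hw1 hw2 hw3 hp hm
      refine ⟨⟨by simpa using hp.ne', hw2⟩, ?_⟩
      have := (hmem _ hm hp).2
      rw [undo_of_norm_le h.near hw1.le] at this
      rwa [undo_of_norm_le hw3 hw1.le]
    · have hun : D.undo b₁ (c s) ∉ D.S := fun h' => h3 (fam_add D |>.2 h')
      have hc : Continuous fun w : (ℂ × ℝ) × ℂ => (w.1.2 / 2 + w.2, w.1.2) := by fun_prop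
      have e1 := hc.continuousAt (x := ((b₁, m₁), c s)) |>.eventually
        (isOpen_setOf_mem_Dom.mem_nhds (show _ ∈ {q : ℂ × ℝ | q.1 ∈ Dom q.2} from h2))
      have hc2 : Continuous fun w : (ℂ × ℝ) × ℂ => (w.1.1, w.2) := by fun_prop
      have e2 := (hc2.tendsto ((b₁, m₁), c s)).eventually (undo_not_mem_eventually h.near hun)
      filter_upwards [e1, e2] with w hw1 hw2 _ _ using ⟨hw1, hw2⟩
  -- the winding number about the points of the contour is unchanged
  have key2 : ∀ᶠ q : ℂ × ℝ in 𝓝 (b₁, m₁), ∀ ξ ∈ D.S, ξ ∈ D.S → 0 < ξ.im →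
      loopWind σ (m₁ / 2 + D.defo q.1 ξ) = -1 := by
    refine isCompact_S.eventually_forall_of_forall_eventually
      (P := fun (q : ℂ × ℝ) ξ => ξ ∈ D.S → 0 < ξ.im → loopWind σ (m₁ / 2 + D.defo q.1 ξ) = -1) ?_
    have hw : ∀ ξ ∈ D.S, ξ ≠ 0 → m₁ / 2 + D.defo b₁ ξ ∉ loopTrace σ ∧
        loopWind σ (m₁ / 2 + D.defo b₁ ξ) = -1 := by
      intro ξ hξ h0
      have h1 : m₁ / 2 + D.defo b₁ ξ ∈ D.fam (b₁ + m₁ / 2) m₁ :=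
        fam_add D |>.2 (by rwa [undo_defo h.near])
      have h2 : m₁ / 2 + D.defo b₁ ξ ≠ m₁ / 2 := by
        intro e
        have e1 : D.defo b₁ ξ = 0 := by simpa using e
        have e2 := undo_defo h.near ξ
        rw [e1, undo_of_norm_le h.near (by simpa using D.ρ_pos.le)] at e2
        exact h0 e2.symm
      exact ⟨hσ.not_mem_loopTrace hT.contour h1 h2, hσ.loopWind_eq_neg_one hT.contour h1 h2⟩
    intro ξ hξ
    by_cases h0 : ξ = 0
    · have hsmall : ∀ᶠ w : (ℂ × ℝ) × ℂ in 𝓝 ((b₁, m₁), ξ), ‖w.2‖ < D.ρ := by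
        refine continuous_snd.norm.continuousAt.eventually (gt_mem_nhds ?_)
        simpa [h0] using D.ρ_pos
      filter_upwards [hsmall] with w hw1 hS hp
      have h2 := (hw w.2 hS (by rintro e; simp [e] at hp)).2
      rwa [defo_of_norm_le _ hw1.le] at h2 ⊢
    · have hc : Continuous fun w : (ℂ × ℝ) × ℂ => m₁ / 2 + D.defo w.1.1 w.2 := by fun_prop
      have h1 := hc.continuousAt (x := ((b₁, m₁), ξ)) |>.eventually
        (hσ.nice.loopWind_eventuallyEq hσ.closed (hw ξ hξ h0).1)
      filter_upwards [h1] with w hw1 _ _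
      rw [hw1.2, (hw ξ hξ h0).2]
  filter_upwards [key1, key2, h.eventually] with q h1 h2 hA
  have hcim : ∀ s ∈ Ioo 0 1, 0 < (c s).im := by
    intro s hs
    simpa [hσdef] using (hσ.2.2.2.2.1 s hs).1
  refine ⟨?_, by simp [hc0], by simp [hc1], ?_, ?_, ?_⟩
  · have := hσ.1.const_add (q.2 / 2 - m₁ / 2)
    have e : (fun s => q.2 / 2 - m₁ / 2 + σ s) = fun s => q.2 / 2 + c s := by grind
    rwa [e] at this
  · intro s hs u hu hsu
    refine hσ.2.2.2.1 hs hu ?_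
    simp only [hσdef]
    rw [add_left_cancel hsu]
  · intro s hs
    have hs' : c s ∈ c '' Icc 0 1 := by grind
    obtain ⟨g1, g2⟩ := h1 _ hs' (hcim s hs) hs'
    exact ⟨by simpa using hcim s hs, g1, fun h' => g2 (fam_add D |>.1 h')⟩
  · intro z hz hp
    rw [image_defo_S hA.near] at hz
    obtain ⟨ξ, hξ, rfl⟩ := hz
    have hp' : 0 < (D.defo q.1 ξ).im := by simpa using hp
    have hξp : 0 < ξ.im := by
      by_contra hcon
      exact absurd (chi_im_nonpos D.ρ_pos D.two_ρ hA.near (not_lt.1 hcon)) (not_le.2 hp')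
    have h3 := h2 ξ hξ hξ hξp
    rw [← hσ.wind_eq h.pos (by simpa using hp')] at h3
    rw [← h3, curveInt_const_add, hσdef, curveInt_const_add]
    simp only [add_sub_add_left_eq_sub]

end BaseContour

/-! ### Dependence of the Cauchy integral on the parameters -/

lemma curveInt_congr {g k : ℂ → ℂ} (h : ∀ s ∈ Ioo 0 1, g (σ s) = k (σ s)) :
    curveInt σ g = curveInt σ k := by
  unfold curveInt
  rw [intervalIntegral.integral_of_le zero_le_one, intervalIntegral.integral_of_le zero_le_one]
  refine integral_congr_ae ?_
  filter_upwards [ae_mem_Ioo] with s hs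
  simp only [h s hs]

/-- A continuous square root of `P` is locally given by the principal square root. -/
lemma eventuallyEq_csqrt {E : Type*} [TopologicalSpace E] {u P : E → ℂ} {q : E}
    (hu : ContinuousAt u q) (hP : ContinuousAt P q) (h0 : u q ≠ 0)
    (hsq : ∀ᶠ y in 𝓝 q, u y ^ 2 = P y) : u =ᶠ[𝓝 q] fun y => u q * csqrt (P y / P q) := by
  have hq := hsq.self_of_nhds
  have hP0 : P q ≠ 0 := hq ▸ pow_ne_zero 2 h0
  have h1 : (1 : ℂ) ∈ slitPlane := by simp
  have hv : ContinuousAt (fun y => u q * csqrt (P y / P q)) q :=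
    continuousAt_const.mul (ContinuousAt.comp_of_eq (g := csqrt) (y := 1)
      (differentiableAt_csqrt h1).continuousAt (hP.div_const _) (div_self hP0))
  have hne : u q + u q * csqrt (P q / P q) ≠ 0 := by simp_all
  filter_upwards [hsq, (hu.add hv).eventually_ne hne, hP.eventually_ne hP0] with y h2 h3 h4
  have h5 : u y ^ 2 = (u q * csqrt (P y / P q)) ^ 2 := by
    rw [mul_pow, csqrt_sq (div_ne_zero h4 hP0), h2, hq, mul_div_cancel₀ _ hP0]
  rcases sq_eq_sq_iff_eq_or_eq_neg.1 h5 with h6 | h6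
  · exact h6
  · simp_all

lemma contDiffAt_csqrt_one : ContDiffAt ℝ 1 csqrt 1 := by
  have h1 : ContDiffAt ℂ 1 csqrt 1 := by
    unfold csqrt
    exact ((contDiffAt_log (by simp)).div_const 2).cexp
  exact h1.restrict_scalars ℝ

/-- A continuous square root of a differentiable function is differentiable where it is nonzero. -/
lemma hasFDerivAt_of_sq_eq {E : Type*} [NormedAddCommGroup E] [NormedSpace ℝ E] {u P : E → ℂ}
    {q : E} {P' : E →L[ℝ] ℂ} (hu : ContinuousAt u q) (hP : HasFDerivAt P P' q) (h0 : u q ≠ 0)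
    (hsq : ∀ᶠ y in 𝓝 q, u y ^ 2 = P y) : HasFDerivAt u ((2 * u q)⁻¹ • P') q := by
  have hq := hsq.self_of_nhds
  have hP0 : P q ≠ 0 := hq ▸ pow_ne_zero 2 h0
  refine HasFDerivAt.congr_of_eventuallyEq ?_ (eventuallyEq_csqrt hu hP.continuousAt h0 hsq)
  have h1 : HasDerivAt (fun w => u q * csqrt (w / P q)) (u q * (1 / 2 * (1 / P q))) (P q) := by
    have h2 := hasDerivAt_csqrt (w := P q / P q) (by rw [div_self hP0]; simp)
    have h3 := (h2.comp (P q) (h₂ := csqrt) (h := fun w => w / P q)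
      ((hasDerivAt_id (P q)).div_const (P q))).const_mul (u q)
    refine h3.congr_deriv ?_
    rw [div_self hP0, csqrt_one, mul_one]
  have h4 := h1.complexToReal_fderiv.comp q hP
  refine h4.congr_fderiv ?_
  ext v
  simp only [ContinuousLinearMap.comp_apply, smul_apply, one_apply_eq_self, smul_eq_mul]
  rw [← hq]
  field_simp

lemma contDiffAt_of_sq_eq {E : Type*} [NormedAddCommGroup E] [NormedSpace ℝ E] {u P : E → ℂ}
    {q : E} (hu : ContinuousAt u q) (hP : ContDiffAt ℝ 1 P q) (h0 : u q ≠ 0)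
    (hsq : ∀ᶠ y in 𝓝 q, u y ^ 2 = P y) : ContDiffAt ℝ 1 u q := by
  have hq := hsq.self_of_nhds
  have hP0 : P q ≠ 0 := hq ▸ pow_ne_zero 2 h0
  refine ContDiffAt.congr_of_eventuallyEq ?_ (eventuallyEq_csqrt hu hP.continuousAt h0 hsq)
  refine contDiffAt_const.mul (ContDiffAt.comp (g := csqrt) q ?_ (hP.div_const _))
  rw [div_self hP0]
  exact contDiffAt_csqrt_one

/-- Differentiation under the integral sign. -/
lemma contDiffAt_integral_mul {E : Type*} [NormedAddCommGroup E] [NormedSpace ℝ E] {w : ℝ → ℂ}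
    (hw : Measurable w) {W : ℝ} (hwb : ∀ s ∈ Ioo 0 1, ‖w s‖ ≤ W) {G : ℝ → E → ℂ}
    {G' : ℝ → E → E →L[ℝ] ℂ} {q₁ : E} {r C : ℝ} (hr : 0 < r)
    (hG : ∀ q ∈ ball q₁ r, ContinuousOn (fun s => G s q) (Ioo 0 1))
    (hGb : ∀ q ∈ ball q₁ r, ∀ s ∈ Ioo 0 1, ‖G s q‖ ≤ C)
    (hG' : ∀ q ∈ ball q₁ r, ContinuousOn (fun s => G' s q) (Ioo 0 1))
    (hGb' : ∀ q ∈ ball q₁ r, ∀ s ∈ Ioo 0 1, ‖G' s q‖ ≤ C)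
    (hGc' : ∀ s ∈ Ioo 0 1, ∀ q ∈ ball q₁ r, ContinuousAt (G' s) q)
    (hd : ∀ s ∈ Ioo 0 1, ∀ q ∈ ball q₁ r, HasFDerivAt (G s) (G' s q) q) :
    ContDiffAt ℝ 1 (fun q => ∫ s in (0 : ℝ)..1, G s q * w s) q₁ ∧
      ∀ v, fderiv ℝ (fun q => ∫ s in (0 : ℝ)..1, G s q * w s) q₁ v =
        ∫ s in (0 : ℝ)..1, G' s q₁ v * w s := by
  have hW : 0 ≤ W := (norm_nonneg _).trans (hwb (1 / 2) (by norm_num))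
  have huI : uIoc (0 : ℝ) 1 = Ioc 0 1 := by simp
  have hae : ∀ᵐ s : ℝ, s ∈ uIoc (0 : ℝ) 1 → s ∈ Ioo 0 1 := by
    rw [← ae_restrict_iff' measurableSet_uIoc, huI]
    exact ae_mem_Ioo
  have hfin : IsFiniteMeasure
      (volume.restrict (uIoc (0 : ℝ) 1)) := by
    rw [huI]
    infer_instance
  have hres : volume.restrict (uIoc (0 : ℝ) 1) = volume.restrict (Ioo (0 : ℝ) 1) := by
    rw [huI, restrict_Ioc_eq_Ioo]
  have hm1 : ∀ q ∈ ball q₁ r, AEStronglyMeasurable (fun s => G s q * w s)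
      (volume.restrict (uIoc (0 : ℝ) 1)) := fun q hq => by
    rw [hres]
    exact ((hG q hq).aestronglyMeasurable measurableSet_Ioo).mul
      hw.stronglyMeasurable.aestronglyMeasurable
  have hm2 : ∀ q ∈ ball q₁ r, AEStronglyMeasurable (fun s => w s • G' s q)
      (volume.restrict (uIoc (0 : ℝ) 1)) := fun q hq => by
    rw [hres]
    exact hw.stronglyMeasurable.aestronglyMeasurable.smul
      ((hG' q hq).aestronglyMeasurable measurableSet_Ioo)
  have hb2 : ∀ q ∈ ball q₁ r, ∀ s ∈ Ioo 0 1, ‖w s • G' s q‖ ≤ W * C := by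
    intro q hq s hs
    rw [norm_smul]
    exact mul_le_mul (hwb s hs) (hGb' q hq s hs) (norm_nonneg _) hW
  have hi1 : ∀ q ∈ ball q₁ r, IntervalIntegrable (fun s => G s q * w s) volume 0 1 := by
    intro q hq
    rw [intervalIntegrable_iff]
    refine Integrable.of_bound (hm1 q hq) (C := C * W) ?_
    rw [ae_restrict_iff' measurableSet_uIoc]
    filter_upwards [hae] with s hs hs'
    rw [norm_mul]
    exact mul_le_mul (hGb q hq s (hs hs')) (hwb s (hs hs')) (norm_nonneg _)
      ((norm_nonneg _).trans (hGb q hq s (hs hs')))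
  have hi2 : ∀ q ∈ ball q₁ r, IntervalIntegrable (fun s => w s • G' s q) volume 0 1 := by
    intro q hq
    rw [intervalIntegrable_iff]
    refine Integrable.of_bound (hm2 q hq) (C := W * C) ?_
    rw [ae_restrict_iff' measurableSet_uIoc]
    filter_upwards [hae] with s hs hs'
    exact hb2 q hq s (hs hs')
  have hder : ∀ q ∈ ball q₁ r, HasFDerivAt (fun q => ∫ s in (0 : ℝ)..1, G s q * w s)
      (∫ s in (0 : ℝ)..1, w s • G' s q) q := by
    intro q hq
    have hnh := isOpen_ball.mem_nhds hq
    refine intervalIntegral.hasFDerivAt_integral_of_dominated_of_fderiv_le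
      (F := fun q s => G s q * w s) (F' := fun q s => w s • G' s q)
      (bound := fun _ => W * C) hnh ?_ (hi1 q hq) (hm2 q hq) ?_ intervalIntegrable_const ?_
    · filter_upwards [hnh] with q' hq' using hm1 q' hq'
    · filter_upwards [hae] with s hs hs' q' hq' using hb2 q' hq' s (hs hs')
    · filter_upwards [hae] with s hs hs' q' hq'
      exact (hd s (hs hs') q' hq').mul_const (w s)
  have hq₁ : q₁ ∈ ball q₁ r := mem_ball_self hr
  constructor
  · rw [contDiffAt_one_iff]
    refine ⟨fun q => ∫ s in (0 : ℝ)..1, w s • G' s q, ball q₁ r,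
      isOpen_ball.mem_nhds hq₁, fun q hq => ?_, hder⟩
    have hnh := isOpen_ball.mem_nhds hq
    refine (intervalIntegral.continuousAt_of_dominated_interval (F := fun q s => w s • G' s q)
      (bound := fun _ => W * C) ?_ ?_ intervalIntegrable_const ?_).continuousWithinAt
    · filter_upwards [hnh] with q' hq' using hm2 q' hq'
    · filter_upwards [hnh] with q' hq'
      filter_upwards [hae] with s hs hs' using hb2 q' hq' s (hs hs')
    · filter_upwards [hae] with s hs hs'
      exact (hGc' s (hs hs') q hq).const_smul (w s)
  · intro v
    rw [(hder q₁ hq₁).fderiv, ContinuousLinearMap.intervalIntegral_apply (hi2 q₁ hq₁)]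
    refine intervalIntegral.integral_congr fun s _ => ?_
    simp only [smul_apply, smul_eq_mul, mul_comm]

/-- The real linear form `(v, w, τ) ↦ p v + r w + r' w̄ + k τ`. -/
def dLin (p r r' k : ℂ) : ℂ × ℂ × ℝ →L[ℝ] ℂ :=
  p • ContinuousLinearMap.fst ℝ ℂ (ℂ × ℝ) +
    r • (ContinuousLinearMap.fst ℝ ℂ ℝ).comp (ContinuousLinearMap.snd ℝ ℂ (ℂ × ℝ)) +
    r' • (conjCLE : ℂ →L[ℝ] ℂ).comp
      ((ContinuousLinearMap.fst ℝ ℂ ℝ).comp (ContinuousLinearMap.snd ℝ ℂ (ℂ × ℝ))) +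
    k • ofRealCLM.comp
      ((ContinuousLinearMap.snd ℝ ℂ ℝ).comp (ContinuousLinearMap.snd ℝ ℂ (ℂ × ℝ)))

lemma dLin_apply (p r r' k : ℂ) (v : ℂ × ℂ × ℝ) :
    dLin p r r' k v = p * v.1 + r * v.2.1 + r' * conj v.2.1 + k * v.2.2 := rfl

lemma norm_dLin_le (p r r' k : ℂ) : ‖dLin p r r' k‖ ≤ ‖p‖ + ‖r‖ + ‖r'‖ + ‖k‖ := by
  refine ContinuousLinearMap.opNorm_le_bound _ (by positivity) fun v => ?_
  rw [dLin_apply]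
  have h1 : ‖v.1‖ ≤ ‖v‖ := norm_fst_le v
  have h2 : ‖v.2‖ ≤ ‖v‖ := norm_snd_le v
  have h3 : ‖v.2.1‖ ≤ ‖v‖ := (norm_fst_le v.2).trans h2
  have h4 : ‖v.2.2‖ ≤ ‖v‖ := (norm_snd_le v.2).trans h2
  refine (norm_add_le _ _).trans ?_
  have h5 := (norm_add_le (p * v.1 + r * v.2.1) (r' * conj v.2.1))
  have h6 := (norm_add_le (p * v.1) (r * v.2.1))
  rw [norm_mul, norm_mul] at h6
  rw [norm_mul r', Complex.norm_conj] at h5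
  rw [norm_mul k, Complex.norm_real]
  have e1 := mul_le_mul_of_nonneg_left h1 (norm_nonneg p)
  have e2 := mul_le_mul_of_nonneg_left h3 (norm_nonneg r)
  have e3 := mul_le_mul_of_nonneg_left h3 (norm_nonneg r')
  have e4 := mul_le_mul_of_nonneg_left h4 (norm_nonneg k)
  linarith

lemma continuous_dLin : Continuous fun a : ℂ × ℂ × ℂ × ℂ => dLin a.1 a.2.1 a.2.2.1 a.2.2.2 := by
  unfold dLin
  fun_prop

namespace BaseContour

variable {D : BaseContour}

lemma hasFDerivAt_rad {b y : ℂ} (hb : D.Near b) (hy : D.undo b y ∉ D.S) (y₂ : ℂ) (m : ℝ) :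
    HasFDerivAt (fun q : ℂ × ℂ × ℝ => D.rad q.2.1 y) (dLin 0 (-(1 / 2) * D.rad b y / (y - b))
      (-(1 / 2) * D.rad b y / (y - conj b)) 0) (y₂, b, m) := by
  have h0 := rad_ne_zero hy
  have hsq := rad_sq hb hy
  have hne : (y - b) * (y - conj b) ≠ 0 := by
    rw [← hsq]
    exact pow_ne_zero 2 h0
  have hP : HasFDerivAt (fun q : ℂ × ℂ × ℝ => (y - q.2.1) * (y - conj q.2.1))
      (dLin 0 (-(y - conj b)) (-(y - b)) 0) (y₂, b, m) := by
    have h1 : HasFDerivAt (fun q : ℂ × ℂ × ℝ => q.2.1) (dLin 0 1 0 0) (y₂, b, m) := by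
      refine (hasFDerivAt_snd.fst : HasFDerivAt (𝕜 := ℝ) (fun q : ℂ × ℂ × ℝ => q.2.1) _
        (y₂, b, m)).congr_fderiv ?_
      ext v <;> simp [dLin_apply]
    have h2 : HasFDerivAt (fun q : ℂ × ℂ × ℝ => conj q.2.1) (dLin 0 0 1 0) (y₂, b, m) := by
      refine (conjCLE.hasFDerivAt.comp (y₂, b, m) h1).congr_fderiv ?_
      ext v <;> simp [dLin_apply]
    refine ((h1.const_sub y).mul (h2.const_sub y)).congr_fderiv ?_
    refine ContinuousLinearMap.ext fun v => ?_
    simp only [dLin_apply, add_apply, smul_apply, neg_apply, smul_eq_mul]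
    ring
  have hcont : ContinuousAt (fun q : ℂ × ℂ × ℝ => D.rad q.2.1 y) (y₂, b, m) :=
    (continuousAt_rad hb hy).comp_of_eq (g := fun q : ℂ × ℂ => D.rad q.1 q.2)
      (f := fun q : ℂ × ℂ × ℝ => (q.2.1, y)) (by fun_prop) rfl
  have hev : ∀ᶠ q : ℂ × ℂ × ℝ in 𝓝 (y₂, b, m),
      D.rad q.2.1 y ^ 2 = (y - q.2.1) * (y - conj q.2.1) := by
    have c1 : Continuous fun q : ℂ × ℂ × ℝ => (q.2.1, y) := by fun_prop
    have c2 : Continuous fun q : ℂ × ℂ × ℝ => q.2.1 := by fun_prop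
    filter_upwards [(c1.tendsto (y₂, b, m)).eventually (undo_not_mem_eventually hb hy),
      (c2.tendsto (y₂, b, m)).eventually (near_eventually hb)] with q h1 h2
    exact rad_sq h2 h1
  refine (hasFDerivAt_of_sq_eq hcont hP h0 hev).congr_fderiv ?_
  have e1 := (mul_ne_zero_iff.1 hne).1
  have e2 := (mul_ne_zero_iff.1 hne).2
  have key : ∀ u v : ℂ, (2 * D.rad b y)⁻¹ * (-(y - conj b) * u + -(y - b) * v) =
      -(1 / 2) * D.rad b y / (y - b) * u +
      -(1 / 2) * D.rad b y / (y - conj b) * v := by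
    intro u v
    field_simp
    linear_combination ((u * (y - conj b) + (y - b) * v)) * hsq
  refine ContinuousLinearMap.ext fun v => ?_
  simp only [smul_apply, dLin_apply, smul_eq_mul, zero_mul, zero_add, add_zero]
  exact key _ _

end BaseContour

/-- Joint continuity gives bounds that are uniform on a compact set and locally uniform in the
parameter. -/
lemma IsCompact.exists_eventually_bound {E : Type*} [TopologicalSpace E] {K : Set ℝ}
    (hK : IsCompact K) {X : ℝ → E → ℂ} {q₁ : E} (h : ∀ s ∈ K, ContinuousWithinAt (fun p : ℝ × E => X
    p.1 p.2) (K ×ˢ univ) (s, q₁)) : ∃ C, ∀ᶠ q in 𝓝 q₁, ∀ s ∈ K, ‖X s q‖ ≤ C := by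
  refine hK.induction_on (p := fun T => ∃ C, ∀ᶠ q in 𝓝 q₁, ∀ s ∈ T, ‖X s q‖ ≤ C) ⟨0, by simp⟩
    ?_ ?_ ?_
  · rintro T T' hT ⟨C, hC⟩
    exact ⟨C, hC.mono fun q hq s hs => hq s (hT hs)⟩
  · rintro T T' ⟨C, hC⟩ ⟨C', hC'⟩
    refine ⟨max C C', ?_⟩
    filter_upwards [hC, hC'] with q h1 h2 s hs
    rcases hs with hs | hs
    · exact (h1 s hs).trans (le_max_left _ _)
    · exact (h2 s hs).trans (le_max_right _ _)
  · intro s hs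
    have h1 := (h s hs).norm.eventually (gt_mem_nhds (lt_add_one ‖X s q₁‖))
    rw [nhdsWithin_prod_eq, nhdsWithin_univ, eventually_prod_iff] at h1
    obtain ⟨pa, ha, pb, hb, hab⟩ := h1
    exact ⟨{s | pa s}, ha, ‖X s q₁‖ + 1, hb.mono fun q hq s hs => (hab hs hq).le⟩

/-- The regular part of the derivative of `f` along the curves on which `z - μ/2` is constant. -/
def fShift (x t m : ℝ) (z : ℂ) : ℂ := fPrimeReg x t m z / 2 + fMuReg m z

lemma continuousAt_fShift (x t : ℝ) (hm : 0 < m) (h : UpperReg m z) :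
    ContinuousAt (fun q : ℂ × ℝ => fShift x t q.2 q.1) (z, m) :=
  ((continuousAt_fPrimeReg x t hm h).div_const 2).add (continuousAt_fMuReg hm h)

lemma hasDerivAt_f_shift (x t : ℝ) (hm : 0 < m) (hy : 0 < y.im) (h : m / 2 + y ∈ Dom m) :
    HasDerivAt (fun m : ℝ => f x t m (m / 2 + y)) (fShift x t m (m / 2 + y)) m := by
  have h1 := hasDerivAt_f_param x t hm h (1 / 2) 0 y (by push_cast; ring)
  rw [half_fPrime_add_fMu x t hm (by simpa using hy) h] at h1
  refine h1.congr_of_eventuallyEq (Eventually.of_forall fun m' => ?_)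
  change f x t m' _ = f x t m' _
  congr 1
  push_cast
  ring

namespace BaseContour

variable {D : BaseContour}

/-- The integrand of the Cauchy integral of `f / R` over the upper half of a loop, as a function
of the parameters `(y, b, m)`, where `y` is the pole and `b` the end point of the contour, both
relative to the point `m/2`. -/
def kern (D : BaseContour) (x t : ℝ) (z : ℂ) (q : ℂ × ℂ × ℝ) : ℂ :=
  f x t q.2.2 (q.2.2 / 2 + z) * (z - q.1)⁻¹ * (D.rad q.2.1 z)⁻¹

/-- The derivative of `kern` with respect to the parameters. -/
def kernDeriv (D : BaseContour) (x t : ℝ) (z : ℂ) (q : ℂ × ℂ × ℝ) : ℂ × ℂ × ℝ →L[ℝ] ℂ :=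
  dLin (D.kern x t z q * (z - q.1)⁻¹) (D.kern x t z q * (z - q.2.1)⁻¹ / 2)
    (D.kern x t z q * (z - conj q.2.1)⁻¹ / 2)
    (fShift x t q.2.2 (q.2.2 / 2 + z) * (z - q.1)⁻¹ * (D.rad q.2.1 z)⁻¹)

lemma hasFDerivAt_kern (x t : ℝ) {z y b : ℂ} (hm : 0 < m) (hb : D.Near b) (hz : 0 < z.im)
    (hD : m / 2 + z ∈ Dom m) (hS : D.undo b z ∉ D.S) (hy : z ≠ y) :
    HasFDerivAt (D.kern x t z) (D.kernDeriv x t z (y, b, m)) (y, b, m) := by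
  have hrad := hasFDerivAt_rad hb hS y m
  have h0 := rad_ne_zero hS
  have hzy := sub_ne_zero.2 hy
  have h1 : HasFDerivAt (fun q : ℂ × ℂ × ℝ => f x t q.2.2 (q.2.2 / 2 + z))
      (dLin 0 0 0 (fShift x t m (m / 2 + z))) (y, b, m) := by
    have e1 : HasFDerivAt (fun q : ℂ × ℂ × ℝ => q.2.2) _ (y, b, m) :=
      (hasFDerivAt_snd.snd : HasFDerivAt (𝕜 := ℝ) (fun q : ℂ × ℂ × ℝ => q.2.2) _ (y, b, m))
    have e2 := (hasDerivAt_f_shift x t hm hz hD).hasFDerivAt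
    refine (HasFDerivAt.comp (g := fun m : ℝ => f x t m (m / 2 + z)) (y, b, m) e2
      e1).congr_fderiv ?_
    refine ContinuousLinearMap.ext fun v => ?_
    rw [dLin_apply]
    simp [mul_comm]
  have h2 : HasFDerivAt (fun q : ℂ × ℂ × ℝ => (z - q.1)⁻¹)
      (dLin (((z - y) ^ 2)⁻¹) 0 0 0) (y, b, m) := by
    have e1 : HasFDerivAt (fun q : ℂ × ℂ × ℝ => z - q.1) (dLin (-1) 0 0 0) (y, b, m) := by
      refine ((hasFDerivAt_fst : HasFDerivAt (𝕜 := ℝ) (fun q : ℂ × ℂ × ℝ => q.1) _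
        (y, b, m)).const_sub z).congr_fderiv ?_
      refine ContinuousLinearMap.ext fun v => ?_
      rw [dLin_apply]
      simp
    refine (HasFDerivAt.comp (g := fun w : ℂ => w⁻¹) (y, b, m)
      (hasDerivAt_inv hzy).complexToReal_fderiv e1).congr_fderiv ?_
    refine ContinuousLinearMap.ext fun v => ?_
    simp [dLin_apply]
  have h3 : HasFDerivAt (fun q : ℂ × ℂ × ℝ => (D.rad q.2.1 z)⁻¹)
      (dLin 0 ((D.rad b z)⁻¹ * (z - b)⁻¹ / 2) ((D.rad b z)⁻¹ * (z - conj b)⁻¹ / 2) 0)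
      (y, b, m) := by
    refine (HasFDerivAt.comp (g := fun w : ℂ => w⁻¹) (y, b, m)
      (hasDerivAt_inv h0).complexToReal_fderiv hrad).congr_fderiv ?_
    refine ContinuousLinearMap.ext fun v => ?_
    simp only [dLin_apply, ContinuousLinearMap.comp_apply, smul_apply, one_apply_eq_self,
      smul_eq_mul]
    field_simp
    ring
  refine ((h1.mul h2).mul h3).congr_fderiv ?_
  refine ContinuousLinearMap.ext fun v => ?_
  simp only [kernDeriv, kern, dLin_apply, add_apply, smul_apply, smul_eq_mul, Pi.mul_apply]
  field_simp
  ring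

/-- The Cauchy integral of `f / R` over the upper half of a loop, in relative coordinates. -/
def upperInt (D : BaseContour) (x t : ℝ) (c : ℝ → ℂ) (q : ℂ × ℂ × ℝ) : ℂ :=
  ∫ s in (0 : ℝ)..1, D.kern x t (c s) q * deriv c s

/-- Relative to `μ/2` the integrand and its derivative are bounded along the loop, locally uniformly
in the parameters. -/
lemma Adm.upperInt_contDiffAt {b₁ : ℂ} {m₁ : ℝ} (h : D.Adm b₁ m₁)
    (hσ : IsLoop (D.fam (b₁ + m₁ / 2) m₁) m₁ (fun s => m₁ / 2 + c s)) (x t : ℝ) {y₁ : ℂ}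
    (hy : ∀ s ∈ Icc 0 1, c s ≠ y₁) :
    ContDiffAt ℝ 1 (D.upperInt x t c) (y₁, b₁, m₁) ∧
      ∀ v, fderiv ℝ (D.upperInt x t c) (y₁, b₁, m₁) v =
        ∫ s in (0 : ℝ)..1, D.kernDeriv x t (c s) (y₁, b₁, m₁) v * deriv c s := by
  have hcN : NiceCurve c := by
    have := (hσ.1.const_add (-((m₁ : ℂ) / 2))).niceCurve
    simpa using this
  have hcc := hcN.continuousOn
  obtain ⟨W, hW0, hW⟩ := exists_deriv_bound hcN.lip
  have hcE : ∀ s ∈ Icc 0 1, ContinuousWithinAt (fun p : ℝ × ℂ × ℂ × ℝ => c p.1)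
      (Icc 0 1 ×ˢ univ) (s, y₁, b₁, m₁) := fun s hs =>
    (hcc s hs).comp continuousWithinAt_fst fun p hp => hp.1
  have hreg : ∀ s ∈ Icc 0 1, UpperReg m₁ (m₁ / 2 + c s) := fun s hs =>
    IsLoop.upperReg (σ := fun s => m₁ / 2 + c s) h.pos hσ hs
  have hcb : ∀ s ∈ Icc 0 1, c s - b₁ ≠ 0 ∧ c s - conj b₁ ≠ 0 := by
    intro s hs
    have h1 := mul_ne_zero_iff.1 (hσ.sub_ne_zero h.isContour hs)
    have e : m₁ / 2 + c s - conj (b₁ + m₁ / 2) = c s - conj b₁ := by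
      simp only [map_add, map_div₀, conj_ofReal, conj_ofNat]
      ring
    refine ⟨fun e' => h1.1 ?_, fun e' => h1.2 ?_⟩
    · rw [← e']
      ring
    · rw [e, e']
  have hX : ∀ (X : ℝ → ℂ × ℂ × ℝ → ℂ), (∀ s ∈ Icc 0 1,
      ContinuousWithinAt (fun p : ℝ × ℂ × ℂ × ℝ => X p.1 p.2) (Icc 0 1 ×ˢ univ) (s, y₁, b₁, m₁)) →
      ∃ C, ∀ᶠ q in 𝓝 (y₁, b₁, m₁), ∀ s ∈ Icc 0 1, ‖X s q‖ ≤ C := fun X hX =>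
    IsCompact.exists_eventually_bound isCompact_Icc hX
  have hXf : ∀ G : ℝ → ℂ → ℂ, (∀ s ∈ Icc 0 1,
      ContinuousAt (fun q : ℂ × ℝ => G q.2 q.1) (m₁ / 2 + c s, m₁)) →
      ∃ C, ∀ᶠ q in 𝓝 (y₁, b₁, m₁), ∀ s ∈ Icc 0 1, ‖G q.2.2 (q.2.2 / 2 + c s)‖ ≤ C := fun G hG =>
    hX (fun s q => G q.2.2 (q.2.2 / 2 + c s)) fun s hs => ContinuousAt.comp_continuousWithinAt
      (g := fun q : ℂ × ℝ => G q.2 q.1) (f := fun p : ℝ × ℂ × ℂ × ℝ =>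
        ((p.2.2.2 / 2 + c p.1, p.2.2.2) : ℂ × ℝ)) (hG s hs)
      ((ContinuousWithinAt.add (by fun_prop) (hcE s hs)).prodMk (by fun_prop))
  have hXi : ∀ k : ℂ × ℂ × ℝ → ℂ, Continuous k → (∀ s ∈ Icc 0 1, c s - k (y₁, b₁, m₁) ≠ 0) →
      ∃ C, ∀ᶠ q in 𝓝 (y₁, b₁, m₁), ∀ s ∈ Icc 0 1, ‖(c s - k q)⁻¹‖ ≤ C := fun k hk hne =>
    hX (fun s q => (c s - k q)⁻¹) fun s hs => ContinuousWithinAt.inv₀ (ContinuousWithinAt.sub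
      (hcE s hs) (hk.comp continuous_snd).continuousWithinAt) (hne s hs)
  have hcj := continuous_conj
  -- bounds for the factors of the integrand, uniform near the given parameters
  obtain ⟨C₁, hC₁⟩ := hXf (fUpper x t) fun s hs => continuousAt_fUpper x t h.pos (hreg s hs)
  obtain ⟨C₂, hC₂⟩ := hXf (fShift x t) fun s hs => continuousAt_fShift x t h.pos (hreg s hs)
  obtain ⟨C₃, hC₃⟩ := hXi (fun q => q.1) (by fun_prop) fun s hs => sub_ne_zero.2 (hy s hs)
  obtain ⟨C₄, hC₄⟩ := hXi (fun q => q.2.1) (by fun_prop) fun s hs => (hcb s hs).1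
  obtain ⟨C₅, hC₅⟩ := hXi (fun q => conj q.2.1) (by fun_prop) fun s hs => (hcb s hs).2
  have hne : ∀ᶠ q : ℂ × ℂ × ℝ in 𝓝 (y₁, b₁, m₁), ∀ z ∈ c '' Icc 0 1, z ≠ q.1 := by
    refine (isCompact_Icc.image_of_continuousOn hcc).eventually_forall_of_forall_eventually
      (P := fun (q : ℂ × ℂ × ℝ) z => z ≠ q.1) ?_
    rintro _ ⟨s, hs, rfl⟩
    have c1 : Continuous fun p : (ℂ × ℂ × ℝ) × ℂ => p.2 - p.1.1 := by fun_prop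
    filter_upwards [c1.continuousAt.eventually_ne
      (show ((y₁, b₁, m₁), c s).2 - ((y₁, b₁, m₁), c s).1.1 ≠ 0 from sub_ne_zero.2 (hy s hs))]
      with p hp using sub_ne_zero.1 hp
  have hA := (continuous_snd.tendsto (y₁, b₁, m₁)).eventually h.eventually
  have hL := (continuous_snd.tendsto (y₁, b₁, m₁)).eventually (h.loop_eventually hσ)
  set C : ℝ := max 1 (max C₁ (max C₂ (max C₃ (max C₄ C₅)))) with hC
  have hC1 : 1 ≤ C := le_max_left _ _
  have hCa : C₁ ≤ C := by simp [hC]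
  have hCb : C₂ ≤ C := by simp [hC]
  have hCc : C₃ ≤ C := by simp [hC]
  have hCd : C₄ ≤ C := by simp [hC]
  have hCe : C₅ ≤ C := by simp [hC]
  have hC0 : 0 ≤ C := zero_le_one.trans hC1
  obtain ⟨r, hr, hball⟩ := eventually_nhds_iff_ball.1
    (((hC₁.and hC₂).and (hC₃.and hC₄)).and ((hC₅.and hne).and (hA.and hL)))
  have hsub : Ioo (0 : ℝ) 1 ⊆ Icc 0 1 := Ioo_subset_Icc_self
  -- what is known about the points of the loop for nearby parameters
  have facts : ∀ q ∈ ball (y₁, b₁, m₁) r, ∀ s ∈ Ioo 0 1,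
      0 < q.2.2 ∧ D.Near q.2.1 ∧ 0 < (c s).im ∧ q.2.2 / 2 + c s ∈ Dom q.2.2 ∧
      D.undo q.2.1 (c s) ∉ D.S ∧ c s ≠ q.1 := by
    intro q hq s hs
    obtain ⟨-, ⟨-, g1⟩, ⟨g2, g3⟩⟩ := hball q hq
    obtain ⟨k1, k2, k3⟩ := g3.2.2.2.2.1 s hs
    exact ⟨g2.pos, g2.near, by simpa using k1, k2, fun h' => k3 (fam_add D |>.2 h'),
      g1 _ (mem_image_of_mem _ (hsub hs))⟩
  -- the integrand and its derivative are jointly continuous in all variables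
  have hcont : ∀ q ∈ ball (y₁, b₁, m₁) r, ∀ s ∈ Ioo 0 1,
      ContinuousAt (fun p : ℝ × ℂ × ℂ × ℝ => D.kern x t (c p.1) p.2) (s, q) ∧
      ContinuousAt (fun p : ℝ × ℂ × ℂ × ℝ => D.kernDeriv x t (c p.1) p.2) (s, q) := by
    intro q hq s hs
    obtain ⟨k0, k1, k2, k3, k4, k5⟩ := facts q hq s hs
    have hc : ContinuousAt c (s, q).1 := hcc.continuousAt (Icc_mem_nhds hs.1 hs.2)
    have hz : ContinuousAt (fun p : ℝ × ℂ × ℂ × ℝ =>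
      ((p.2.2.2 / 2 + c p.1, p.2.2.2) : ℂ × ℝ)) (s, q) := by fun_prop
    have k2' : 0 < (q.2.2 / 2 + c s).im := by simpa using k2
    have hU : UpperReg q.2.2 (q.2.2 / 2 + c s) := ⟨k3.2, Or.inl k2'⟩
    have hnz := mul_ne_zero_iff.1 (rad_sq k1 k4 ▸ pow_ne_zero 2 (rad_ne_zero k4))
    have e1 : ContinuousAt (fun p : ℝ × ℂ × ℂ × ℝ => f x t p.2.2.2 (p.2.2.2 / 2 + c p.1))
        (s, q) := by
      refine (ContinuousAt.comp_of_eq (g := fun q : ℂ × ℝ => fUpper x t q.2 q.1)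
        (continuousAt_fUpper x t k0 hU) hz rfl).congr_of_eventuallyEq ?_
      filter_upwards [(continuous_im.continuousAt.comp hz.fst).eventually (lt_mem_nhds k2')]
        with p hp using f_eq_fUpper hp.le
    have e2 : ContinuousAt (fun p : ℝ × ℂ × ℂ × ℝ => (c p.1 - p.2.1)⁻¹) (s, q) :=
      ContinuousAt.inv₀ (by fun_prop) (sub_ne_zero.2 k5)
    have e3 : ContinuousAt (fun p : ℝ × ℂ × ℂ × ℝ => (c p.1 - p.2.2.1)⁻¹) (s, q) :=
      ContinuousAt.inv₀ (by fun_prop) hnz.1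
    have e4 : ContinuousAt (fun p : ℝ × ℂ × ℂ × ℝ => (c p.1 - conj p.2.2.1)⁻¹) (s, q) :=
      ContinuousAt.inv₀ (by fun_prop) hnz.2
    have e5 : ContinuousAt (fun p : ℝ × ℂ × ℂ × ℝ => (D.rad p.2.2.1 (c p.1))⁻¹) (s, q) :=
      ContinuousAt.inv₀ (ContinuousAt.comp_of_eq (g := fun p : ℂ × ℂ => D.rad p.1 p.2)
        (f := fun p : ℝ × ℂ × ℂ × ℝ => (p.2.2.1, c p.1)) (continuousAt_rad k1 k4) (by fun_prop) rfl)
        (rad_ne_zero k4)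
    have e6 := ContinuousAt.comp_of_eq (g := fun q : ℂ × ℝ => fShift x t q.2 q.1)
      (continuousAt_fShift x t k0 hU) hz rfl
    have e7 := (e1.mul e2).mul e5
    exact ⟨e7, continuous_dLin.continuousAt.comp (f := fun p : ℝ × ℂ × ℂ × ℝ =>
      (D.kern x t (c p.1) p.2 * (c p.1 - p.2.1)⁻¹, D.kern x t (c p.1) p.2 * (c p.1 - p.2.2.1)⁻¹ / 2,
      D.kern x t (c p.1) p.2 * (c p.1 - conj p.2.2.1)⁻¹ / 2,
      fShift x t p.2.2.2 (p.2.2.2 / 2 + c p.1) * (c p.1 - p.2.1)⁻¹ * (D.rad p.2.2.1 (c p.1))⁻¹))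
      ((e7.mul e2).prodMk (((e7.mul e3).div_const 2).prodMk
      (((e7.mul e4).div_const 2).prodMk ((e6.mul e2).mul e5))))⟩
  have hbd : ∀ q ∈ ball (y₁, b₁, m₁) r, ∀ s ∈ Ioo 0 1,
      ‖D.kern x t (c s) q‖ ≤ C ^ 3 ∧ ‖(c s - q.1)⁻¹‖ ≤ C ∧ ‖(c s - q.2.1)⁻¹‖ ≤ C ∧
      ‖(c s - conj q.2.1)⁻¹‖ ≤ C ∧ ‖(D.rad q.2.1 (c s))⁻¹‖ ≤ C ∧
      ‖fShift x t q.2.2 (q.2.2 / 2 + c s)‖ ≤ C := by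
    intro q hq s hs
    obtain ⟨⟨⟨g1, g2⟩, ⟨g3, g4⟩⟩, ⟨g5, -⟩, -⟩ := hball q hq
    obtain ⟨-, k1, k2, k3, k4, -⟩ := facts q hq s hs
    have e1 := (g1 s (hsub hs)).trans hCa
    have e2 := (g2 s (hsub hs)).trans hCb
    have e3 := (g3 s (hsub hs)).trans hCc
    have e4 := (g4 s (hsub hs)).trans hCd
    have e5 := (g5 s (hsub hs)).trans hCe
    have e6 : ‖(D.rad q.2.1 (c s))⁻¹‖ ≤ C := by
      refine le_of_sq_le_sq ?_ hC0
      rw [← norm_pow, inv_pow, rad_sq k1 k4, mul_inv, norm_mul, sq]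
      exact mul_le_mul e4 e5 (norm_nonneg _) hC0
    refine ⟨?_, e3, e4, e5, e6, e2⟩
    have e7 : f x t q.2.2 (q.2.2 / 2 + c s) = fUpper x t q.2.2 (q.2.2 / 2 + c s) :=
      f_eq_fUpper (by simpa using k2.le)
    rw [kern, e7, norm_mul, norm_mul, pow_succ, sq]
    gcongr
  have hM1 : C ^ 3 ≤ 2 * C ^ 4 + C ^ 3 := by nlinarith [pow_nonneg hC0 4]
  refine contDiffAt_integral_mul (measurable_deriv c) hW (G := fun s q => D.kern x t (c s) q)
    (G' := fun s q => D.kernDeriv x t (c s) q) (C := 2 * C ^ 4 + C ^ 3) hr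
    (fun q hq s hs => ((hcont q hq s hs).1.comp (f := fun s => (s, q))
      (by fun_prop)).continuousWithinAt) (fun q hq s hs => (hbd q hq s hs).1.trans hM1) ?_ ?_ ?_ ?_
  · exact fun q hq s hs => ((hcont q hq s hs).2.comp (f := fun s => (s, q))
      (by fun_prop)).continuousWithinAt
  · intro q hq s hs
    obtain ⟨a1, a2, a3, a4, a5, a6⟩ := hbd q hq s hs
    refine (norm_dLin_le _ _ _ _).trans ?_
    simp only [norm_mul, norm_div, norm_ofNat]
    have b1 := mul_le_mul a1 a2 (norm_nonneg _) (pow_nonneg hC0 3)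
    have b2 := mul_le_mul a1 a3 (norm_nonneg _) (pow_nonneg hC0 3)
    have b3 := mul_le_mul a1 a4 (norm_nonneg _) (pow_nonneg hC0 3)
    have b4 := mul_le_mul (mul_le_mul a6 a2 (norm_nonneg _) hC0) a5 (norm_nonneg _)
      (mul_nonneg hC0 hC0)
    rw [← pow_succ] at b1 b2 b3
    rw [← sq, ← pow_succ] at b4
    simp only [Nat.reduceAdd] at b1 b2 b3 b4
    linarith
  · exact fun s hs q hq => (hcont q hq s hs).2.comp (f := fun q => (s, q)) (by fun_prop)
  · intro s hs q hq
    obtain ⟨k0, k1, k2, k3, k4, k5⟩ := facts q hq s hs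
    exact hasFDerivAt_kern x t k0 k1 k2 k3 k4 k5

end BaseContour

/-- The integrand of the derivative of the Cauchy integral of `f / R` with respect to its
parameters: `v`, `w`, `τ` are the velocities of the pole `y` and of the end point `a`, both relative
to `μ/2`, and of `μ`. -/
def dens (x t μ : ℝ) (γ : Set ℂ) (a y v w : ℂ) (τ : ℝ) (ζ : ℂ) : ℂ :=
  ((((1 / 2 : ℝ) : ℂ) * fPrime x t μ ζ + fMu x t μ ζ) * τ +
    f x t μ ζ * (v / (ζ - y) + w / (2 * (ζ - a)) + conj w /
      (2 * (ζ - conj a)))) / ((ζ - y) * radical γ a ζ)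

lemma dens_conj (hγ : IsTameContour α μ γ) (x t : ℝ) (y v w : ℂ) (τ : ℝ) {ζ : ℂ} (hζ : ζ.im ≠ 0)
    (hζγ : ζ ∉ γ) :
    conj (dens x t μ γ α y v w τ (conj ζ)) = dens x t μ γ α (conj y) (conj v) w τ ζ := by
  simp only [dens, map_div₀, map_mul, map_add, map_sub, conj_conj, f_conj hζ, fPrime_conj hζ,
    fMu_conj hζ, hγ.radical_conj hζγ, conj_ofReal, conj_ofNat]
  ring

namespace BaseContour

variable {D : BaseContour}

/-- The Cauchy integral of `f / R` as a function of the parameters `(y, b, m)`, with the pole `y`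
and the end point `b` of the contour relative to the point `m/2`. -/
def relE (D : BaseContour) (x t : ℝ) (c : ℝ → ℂ) (q : ℂ × ℂ × ℝ) : ℂ :=
  cauchyE x t q.2.2 (D.fam (q.2.1 + q.2.2 / 2) q.2.2) (q.2.1 + q.2.2 / 2)
    (fun s => q.2.2 / 2 + c s) (q.2.2 / 2 + q.1)

/-- Conjugation of the first of the parameters. -/
def conjFst : ℂ × ℂ × ℝ →L[ℝ] ℂ × ℂ × ℝ :=
  ((conjCLE : ℂ →L[ℝ] ℂ).comp (ContinuousLinearMap.fst ℝ ℂ (ℂ × ℝ))).prod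
    (ContinuousLinearMap.snd ℝ ℂ (ℂ × ℝ))

lemma conjFst_apply (q : ℂ × ℂ × ℝ) : conjFst q = (conj q.1, q.2) := rfl

/-- By symmetry the Cauchy integral is determined by its upper half. -/
lemma Adm.relE_eq (h : D.Adm b m) (hσ : IsLoop (D.fam (b + m / 2) m) m (fun s => m / 2 + c s))
    (x t : ℝ) (y : ℂ) :
    D.relE x t c (y, b, m) = (2 * π * I)⁻¹ * (D.upperInt x t c (y, b, m) -
      conj (D.upperInt x t c (conjFst (y, b, m)))) := by
  have hT := h.isTameContour
  have hmem := hσ.2.2.2.2.1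
  have key : ∀ y, curveInt (fun s => m / 2 + c s) (fun ζ => f x t m ζ /
      ((ζ - (m / 2 + y)) * radical (D.fam (b + m / 2) m) (b + m / 2) ζ)) =
      D.upperInt x t c (y, b, m) := by
    intro y
    rw [curveInt_const_add]
    refine curveInt_congr (k := fun z => D.kern x t z (y, b, m)) fun s hs => ?_
    have h1 := (hmem s hs).2.2
    rw [fam_add] at h1
    change _ = f x t m (m / 2 + c s) * (c s - y)⁻¹ * (D.rad b (c s))⁻¹
    rw [h.radical_fam h1, add_sub_add_left_eq_sub, div_eq_mul_inv, mul_inv, mul_assoc]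
  rw [relE, cauchyE, loopInt, curveInt_mirror]
  simp only
  rw [key, ← sub_eq_add_neg, conjFst_apply]
  congr 3
  refine (curveInt_congr fun s hs => ?_).trans (key (conj y))
  obtain ⟨h1, h2, h3⟩ := hmem s hs
  rw [f_conj h1.ne', hT.radical_conj h3]
  simp only [map_div₀, map_mul, map_sub, map_add, conj_conj, conj_ofReal, conj_ofNat]

lemma ne_of_not_mem_loopTrace (hy : m / 2 + y ∉ loopTrace (fun s => m / 2 + c s))
    (hs : s ∈ Icc 0 1) : c s ≠ y := fun e => hy (Or.inl ⟨s, hs, by simp only [e]⟩)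

lemma conj_not_mem_loopTrace (hy : m / 2 + y ∉ loopTrace (fun s => m / 2 + c s)) :
    m / 2 + conj y ∉ loopTrace (fun s => m / 2 + c s) := by
  rw [← mem_loopTrace_conj] at hy
  simpa [conj_ofNat] using hy

/-- The Cauchy integral is continuously differentiable in its parameters, and may be differentiated
under the integral sign. -/
lemma Adm.relE_contDiffAt {b₁ : ℂ} {m₁ : ℝ} (h : D.Adm b₁ m₁)
    (hσ : IsLoop (D.fam (b₁ + m₁ / 2) m₁) m₁ (fun s => m₁ / 2 + c s)) (x t : ℝ) {y₁ : ℂ}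
    (hy : m₁ / 2 + y₁ ∉ loopTrace (fun s => m₁ / 2 + c s)) :
    ContDiffAt ℝ 1 (D.relE x t c) (y₁, b₁, m₁) ∧
      ∀ v w τ, fderiv ℝ (D.relE x t c) (y₁, b₁, m₁) (v, w, τ) =
        (2 * π * I)⁻¹ * loopInt (fun s => m₁ / 2 + c s)
          (dens x t m₁ (D.fam (b₁ + m₁ / 2) m₁) (b₁ + m₁ / 2) (m₁ / 2 + y₁)
            v w τ) := by
  have hT := h.isTameContour
  have hmem := hσ.2.2.2.2.1
  obtain ⟨d1, e1⟩ := h.upperInt_contDiffAt hσ x t (y₁ := y₁) fun s hs =>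
    ne_of_not_mem_loopTrace hy hs
  obtain ⟨d2, e2⟩ := h.upperInt_contDiffAt hσ x t (y₁ := conj y₁) fun s hs =>
    ne_of_not_mem_loopTrace (conj_not_mem_loopTrace hy) hs
  have hev : D.relE x t c =ᶠ[𝓝 (y₁, b₁, m₁)] fun q => (2 * π * I)⁻¹ *
      (D.upperInt x t c q - conjCLE (D.upperInt x t c (conjFst q))) := by
    have hA := (continuous_snd.tendsto (y₁, b₁, m₁)).eventually h.eventually
    have hL := (continuous_snd.tendsto (y₁, b₁, m₁)).eventually (h.loop_eventually hσ)
    filter_upwards [hA, hL] with q h1 h2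
    exact h1.relE_eq h2 x t q.1
  have d3 : ContDiffAt ℝ 1 (fun q => D.upperInt x t c (conjFst q)) (y₁, b₁, m₁) := by fun_prop
  have d4 : ContDiffAt ℝ 1 (fun q => conjCLE (D.upperInt x t c (conjFst q)))
      (y₁, b₁, m₁) := by fun_prop
  refine ⟨(contDiffAt_const.mul (d1.sub d4)).congr_of_eventuallyEq hev, fun v w τ => ?_⟩
  have f1 := (d1.differentiableAt one_ne_zero).hasFDerivAt
  have f2 : HasFDerivAt (fun q => D.upperInt x t c (conjFst q))
      ((fderiv ℝ (D.upperInt x t c) (conjFst (y₁, b₁, m₁))).comp conjFst) (y₁, b₁, m₁) :=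
    HasFDerivAt.comp (y₁, b₁, m₁) (g := D.upperInt x t c) (f := conjFst)
      (d2.differentiableAt one_ne_zero).hasFDerivAt conjFst.hasFDerivAt
  have f3 := conjCLE.hasFDerivAt.comp (y₁, b₁, m₁) f2
  have f4 := ((f1.sub f3).const_mul (2 * π * I : ℂ)⁻¹).congr_of_eventuallyEq hev
  rw [f4.fderiv]
  have key : ∀ y, (∀ s ∈ Icc 0 1, c s ≠ y) → ∀ v,
      curveInt (fun s => m₁ / 2 + c s) (dens x t m₁ (D.fam (b₁ + m₁ / 2) m₁)
        (b₁ + m₁ / 2) (m₁ / 2 + y) v w τ) =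
      ∫ s in (0 : ℝ)..1, D.kernDeriv x t (c s) (y, b₁, m₁) (v, w, τ) * deriv c s := by
    intro y hy v
    rw [curveInt_const_add]
    refine curveInt_congr (k := fun z => D.kernDeriv x t z (y, b₁, m₁) (v, w, τ)) fun s hs => ?_
    obtain ⟨g1, g2, g3⟩ := hmem s hs
    have h1 := g3
    rw [fam_add] at h1
    simp only [dens, kernDeriv, kern, dLin_apply]
    rw [half_fPrime_add_fMu x t h.pos g1 g2, h.radical_fam h1, ← fShift]
    have i1 : m₁ / 2 + c s - (b₁ + m₁ / 2) = c s - b₁ := by ring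
    have i2 : m₁ / 2 + c s - conj (b₁ + m₁ / 2) = c s - conj b₁ := by
      simp only [map_add, map_div₀, conj_ofReal, conj_ofNat]
      ring
    rw [i1, i2, add_sub_add_left_eq_sub]
    simp only [div_eq_mul_inv, mul_inv]
    ring
  have hconj : curveInt (mirror (fun s => m₁ / 2 + c s)) (dens x t m₁
      (D.fam (b₁ + m₁ / 2) m₁) (b₁ + m₁ / 2) (m₁ / 2 + y₁) v w τ) =
      -conj (curveInt (fun s => m₁ / 2 + c s) (dens x t m₁
      (D.fam (b₁ + m₁ / 2) m₁) (b₁ + m₁ / 2) (m₁ / 2 + conj y₁)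
        (conj v) w τ)) := by
    rw [curveInt_mirror]
    congr 2
    refine curveInt_congr fun s hs => ?_
    obtain ⟨g1, g2, g3⟩ := hmem s hs
    rw [dens_conj hT x t _ _ _ _ g1.ne' g3]
    simp only [map_add, map_div₀, conj_ofReal, conj_ofNat]
  rw [loopInt, hconj, key y₁ (fun s hs => ne_of_not_mem_loopTrace hy hs), key _ (fun s hs =>
    ne_of_not_mem_loopTrace (conj_not_mem_loopTrace hy) hs), ← e1, ← e2, ← sub_eq_add_neg]
  rfl

end BaseContour

/-! ### Integrability of the derivatives of `f` along the loop -/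

lemma CurveIntegrable.congr {g k : ℂ → ℂ} (hg : CurveIntegrable σ g)
    (h : ∀ s ∈ Ioo 0 1, g (σ s) = k (σ s)) : CurveIntegrable σ k := by
  unfold CurveIntegrable at *
  rw [intervalIntegrable_iff_integrableOn_Ioc_of_le zero_le_one] at *
  refine Integrable.congr hg ?_
  filter_upwards [ae_mem_Ioo] with s hs
  simp only [h s hs]

lemma exists_slope_le {a b e : ℝ} (hab : a < b) (hσ : ContDiffOn ℝ 1 σ (Icc a b))
    (he : e ∈ Icc a b) (h0 : derivWithin σ (Icc a b) e ≠ 0) :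
    ∃ κ : ℝ, 0 < κ ∧ ∀ᶠ s in 𝓝[Icc a b] e, κ * |s - e| ≤ ‖σ s - σ e‖ := by
  have hd := (hσ.differentiableOn one_ne_zero e he).hasDerivWithinAt
  have hd0 := norm_pos_iff.2 h0
  set d := derivWithin σ (Icc a b) e
  refine ⟨‖d‖ / 2, half_pos hd0, ?_⟩
  rw [← insert_sdiff_self_of_mem he, nhdsWithin_insert, eventually_sup]
  refine ⟨by simp, ?_⟩
  rw [hasDerivWithinAt_iff_tendsto_slope] at hd
  filter_upwards [hd.norm.eventually (lt_mem_nhds (half_lt_self hd0)), self_mem_nhdsWithin]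
    with s hs hs0
  rw [slope_def_module, norm_smul, norm_inv, Real.norm_eq_abs, ← div_eq_inv_mul,
    lt_div_iff₀ (abs_pos.2 (sub_ne_zero.2 hs0.2))] at hs
  exact hs.le

/-- A piecewise regular curve leaves its end points with nonzero speed, so that logarithmic
singularities there are integrable along it. -/
lemma IsPiecewiseRegular.exists_slope_le (h : IsPiecewiseRegular σ) :
    (∃ κ : ℝ, 0 < κ ∧ ∀ᶠ s in 𝓝[≥] (0 : ℝ), κ * |s - 0| ≤ ‖σ s - σ 0‖) ∧
      ∃ κ : ℝ, 0 < κ ∧ ∀ᶠ s in 𝓝[≤] (1 : ℝ), κ * |s - 1| ≤ ‖σ s - σ 1‖ := by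
  obtain ⟨n, p, h0, h1, hp⟩ := h
  rcases n with - | k
  · rw [h0] at h1
    exact (zero_ne_one h1).elim
  obtain ⟨g1, g2, g3⟩ := hp 0 k.succ_pos
  obtain ⟨k1, k2, k3⟩ := hp k k.lt_succ_self
  rw [zero_add, h0] at g1 g2 g3
  rw [h1] at k1 k2 k3
  have m1 := left_mem_Icc.2 g1.le
  have m2 := right_mem_Icc.2 k1.le
  rw [← nhdsWithin_Icc_eq_nhdsGE g1, ← nhdsWithin_Icc_eq_nhdsLE k1]
  exact ⟨GenusZero.exists_slope_le g1 g2 m1 (g3 0 m1), GenusZero.exists_slope_le k1 k2 m2 (k3 1 m2)⟩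

/-- By the regularity at the end points, the loop moves away from `μ/2` at least linearly. -/
lemma IsLoop.exists_linear_bound (h : IsLoop γ μ σ) :
    ∃ κ : ℝ, 0 < κ ∧ ∀ s ∈ Icc 0 1, κ * min s (1 - s) ≤ ‖σ s - (μ : ℂ) / 2‖ := by
  have hc := h.nice.continuousOn
  have loc : ∀ s ∈ Icc 0 1, ∃ κ : ℝ, 0 < κ ∧
      ∀ᶠ u in 𝓝[Icc 0 1] s, κ * min u (1 - u) ≤ ‖σ u - (μ : ℂ) / 2‖ := by
    intro s hs
    rcases eq_or_lt_of_le hs.1 with rfl | hs0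
    · obtain ⟨κ, hκ, hev⟩ := h.1.exists_slope_le.1
      rw [h.2.1] at hev
      refine ⟨κ, hκ, (hev.filter_mono (nhdsWithin_mono _ Icc_subset_Ici_self)).mono fun u hu => ?_⟩
      rw [sub_zero] at hu
      exact (mul_le_mul_of_nonneg_left ((min_le_left _ _).trans (le_abs_self _)) hκ.le).trans hu
    rcases eq_or_lt_of_le hs.2 with rfl | hs1
    · obtain ⟨κ, hκ, hev⟩ := h.1.exists_slope_le.2
      rw [h.2.2.1] at hev
      refine ⟨κ, hκ, (hev.filter_mono (nhdsWithin_mono _ Icc_subset_Iic_self)).mono fun u hu => ?_⟩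
      rw [abs_sub_comm] at hu
      exact (mul_le_mul_of_nonneg_left ((min_le_right _ _).trans (le_abs_self _)) hκ.le).trans hu
    · have hpos : 0 < ‖σ s - (μ : ℂ) / 2‖ := by
        rw [norm_pos_iff, _root_.sub_ne_zero]
        intro e
        have := (h.2.2.2.2.1 s ⟨hs0, hs1⟩).1
        rw [e] at this
        simp at this
      refine ⟨_, half_pos hpos, ?_⟩
      filter_upwards [((hc s hs).sub continuousWithinAt_const).norm.eventually
        (lt_mem_nhds (half_lt_self hpos)), self_mem_nhdsWithin] with u hu hu'
      have hu2 : ‖σ s - (μ : ℂ) / 2‖ / 2 < ‖σ u - (μ : ℂ) / 2‖ := hu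
      refine le_trans ?_ hu2.le
      have : min u (1 - u) ≤ 1 := (min_le_left _ _).trans hu'.2
      nlinarith [half_pos hpos]
  refine isCompact_Icc.induction_on (p := fun T => ∃ κ : ℝ, 0 < κ ∧ ∀ s ∈ T,
    s ∈ Icc 0 1 → κ * min s (1 - s) ≤ ‖σ s - (μ : ℂ) / 2‖) ⟨1, one_pos, by simp⟩ ?_ ?_ ?_
    |>.imp fun κ hκ => ⟨hκ.1, fun s hs => hκ.2 s hs hs⟩
  · rintro T T' hT ⟨κ, h0, hκ⟩
    exact ⟨κ, h0, fun s hs => hκ s (hT hs)⟩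
  · rintro T T' ⟨κ, h0, hκ⟩ ⟨κ', h0', hκ'⟩
    refine ⟨min κ κ', lt_min h0 h0', fun s hs hI => ?_⟩
    have hm : 0 ≤ min s (1 - s) := le_min hI.1 (by linarith [hI.2])
    rcases hs with hs | hs
    · exact (mul_le_mul_of_nonneg_right (min_le_left _ _) hm).trans (hκ s hs hI)
    · exact (mul_le_mul_of_nonneg_right (min_le_right _ _) hm).trans (hκ' s hs hI)
  · intro s hs
    obtain ⟨κ, h0, hκ⟩ := loc s hs
    exact ⟨_, hκ, κ, h0, fun u hu _ => hu⟩

/-- Functions with at most a logarithmic singularity at `μ/2` are integrable along the loop. -/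
lemma IsLoop.curveIntegrable_of_log (h : IsLoop γ μ σ)
    (hg : ContinuousOn (fun s => g (σ s)) (Ioo 0 1)) {A B : ℝ} (hb : ∀ s ∈ Ioo 0 1, ‖g (σ s)‖ ≤ A +
    B * ‖log (I * ((μ : ℂ) / 2 - σ s))‖) : CurveIntegrable σ g := by
  obtain ⟨κ, hκ, hlin⟩ := h.exists_linear_bound
  obtain ⟨L, hL0, hL⟩ := exists_deriv_bound h.nice.lip
  obtain ⟨M, hM⟩ := isCompact_Icc.exists_bound_of_continuousOn
    (h.nice.continuousOn.sub (continuousOn_const (c := (μ : ℂ) / 2)))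
  have hlog : ∀ s ∈ Ioo 0 1, ‖log (I * ((μ : ℂ) / 2 - σ s))‖ ≤
      |Real.log κ| + |Real.log M| + |Real.log s| + |Real.log (1 - s)| + π := by
    intro s hs
    have hs' := Ioo_subset_Icc_self hs
    have h1 := hlin s hs'
    have h2 : ‖σ s - (μ : ℂ) / 2‖ ≤ M := hM s hs'
    have hmin : 0 < min s (1 - s) := lt_min hs.1 (by linarith [hs.2])
    have hpos : 0 < ‖σ s - (μ : ℂ) / 2‖ := lt_of_lt_of_le (mul_pos hκ hmin) h1
    have e : ‖I * ((μ : ℂ) / 2 - σ s)‖ = ‖σ s - (μ : ℂ) / 2‖ := by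
      rw [norm_mul, norm_I, one_mul, norm_sub_rev]
    have h3 : log (I * ((μ : ℂ) / 2 - σ s)) = (Real.log ‖σ s - (μ : ℂ) / 2‖ : ℂ) +
          (Complex.arg (I * ((μ : ℂ) / 2 - σ s)) : ℂ) * I := by
      rw [log, e]
    have h4 : |Real.log ‖σ s - (μ : ℂ) / 2‖| ≤
        |Real.log κ| + |Real.log M| + |Real.log s| + |Real.log (1 - s)| := by
      have g1 : Real.log ‖σ s - (μ : ℂ) / 2‖ ≤ Real.log M := Real.log_le_log hpos h2
      have g2 : Real.log κ + Real.log (min s (1 - s)) ≤ Real.log ‖σ s - (μ : ℂ) / 2‖ := by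
        rw [← Real.log_mul hκ.ne' hmin.ne']
        exact Real.log_le_log (mul_pos hκ hmin) h1
      have g3 : -(|Real.log s| + |Real.log (1 - s)|) ≤ Real.log (min s (1 - s)) := by
        rcases min_choice s (1 - s) with e | e <;> rw [e]
        · linarith [neg_abs_le (Real.log s), abs_nonneg (Real.log (1 - s))]
        · linarith [neg_abs_le (Real.log (1 - s)), abs_nonneg (Real.log s)]
      rw [abs_le]
      constructor <;> linarith [neg_abs_le (Real.log κ), le_abs_self (Real.log M),
        abs_nonneg (Real.log κ), abs_nonneg (Real.log M), abs_nonneg (Real.log s),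
        abs_nonneg (Real.log (1 - s))]
    rw [h3]
    refine (norm_add_le _ _).trans (add_le_add ?_ ?_)
    · rwa [Complex.norm_real]
    · rw [norm_mul, norm_I, mul_one, Complex.norm_real]
      exact abs_arg_le_pi _
  have hi1 : IntervalIntegrable (fun s : ℝ => |Real.log s|) volume 0 1 :=
    intervalIntegral.intervalIntegrable_log'.abs
  have hi2 : IntervalIntegrable (fun s : ℝ => |Real.log (1 - s)|) volume 0 1 := by
    have := hi1.comp_sub_left 1
    simp only [sub_zero, sub_self] at this
    exact this.symm
  have hi : IntervalIntegrable (fun s : ℝ =>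
      (A + |B| * (|Real.log κ| + |Real.log M| + |Real.log s| +
      |Real.log (1 - s)| + π)) * L) volume 0 1 := by
    refine IntervalIntegrable.mul_const (IntervalIntegrable.add intervalIntegrable_const
      (IntervalIntegrable.const_mul ?_ _)) _
    exact ((intervalIntegrable_const.add hi1).add hi2).add intervalIntegrable_const
  unfold CurveIntegrable
  rw [intervalIntegrable_iff_integrableOn_Ioc_of_le zero_le_one] at hi ⊢
  refine Integrable.mono' hi ?_ ?_
  · refine AEStronglyMeasurable.mul ?_
      (measurable_deriv σ).stronglyMeasurable.aestronglyMeasurable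
    rw [restrict_Ioc_eq_Ioo]
    exact hg.aestronglyMeasurable measurableSet_Ioo
  · filter_upwards [ae_mem_Ioo] with s hs
    have h5 := hlog s hs
    have h6 : ‖g (σ s)‖ ≤ A + |B| * (|Real.log κ| + |Real.log M| + |Real.log s| +
        |Real.log (1 - s)| + π) := by
      refine (hb s hs).trans ?_
      have := mul_le_mul_of_nonneg_right (le_abs_self B)
        (norm_nonneg (log (I * ((μ : ℂ) / 2 - σ s))))
      have := mul_le_mul_of_nonneg_left h5 (abs_nonneg B)
      linarith
    rw [norm_mul]
    exact mul_le_mul h6 (hL s hs) (norm_nonneg _) ((norm_nonneg _).trans h6)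

/-- The factor `1 / ((ζ - y) R(ζ))` is bounded along the loop. -/
lemma IsLoop.cauchyFactor_bound (h : IsLoop γ μ σ) (hγ : IsContour α μ γ)
    (hy : ∀ s ∈ Icc 0 1, σ s ≠ y) :
    ContinuousOn (fun s => ((σ s - y) * radical γ α (σ s))⁻¹) (Ioo 0 1) ∧
      ∃ C, 0 ≤ C ∧ ∀ s ∈ Ioo 0 1, ‖((σ s - y) * radical γ α (σ s))⁻¹‖ ≤ C := by
  have hc := h.nice.continuousOn
  obtain ⟨M, hM0, hM⟩ := h.exists_inv_radical_bound hγ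
  have h1 : ContinuousOn (fun s => (σ s - y)⁻¹) (Icc 0 1) :=
    (hc.sub continuousOn_const).inv₀ fun s hs => _root_.sub_ne_zero.2 (hy s hs)
  obtain ⟨N, hN⟩ := isCompact_Icc.exists_bound_of_continuousOn h1
  have hN0 : 0 ≤ N := (norm_nonneg _).trans (hN 0 (by simp))
  refine ⟨?_, N * M, mul_nonneg hN0 hM0, fun s hs => ?_⟩
  · simp only [mul_inv]
    exact (h1.mono Ioo_subset_Icc_self).mul ((h.continuousOn_radical hγ).inv₀ fun s hs =>
      h.radical_ne_zero hγ hs)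
  · rw [mul_inv, norm_mul]
    exact mul_le_mul (hN s (Ioo_subset_Icc_self hs)) (hM s hs) (norm_nonneg _) hN0

lemma IsLoop.curveIntegrable_log_add (hμ : 0 < μ) (h : IsLoop γ μ σ) (hγ : IsContour α μ γ)
    (hy : ∀ s ∈ Icc 0 1, σ s ≠ y) {k : ℂ → ℂ} (hk : ∀ z, UpperReg μ z → ContinuousAt k z) (hg : ∀ z
    ∈ Dom μ, 0 < z.im → g z = b * log (I * ((μ : ℂ) / 2 - z)) + k z) :
    CurveIntegrable σ (fun ζ => g ζ / ((ζ - y) * radical γ α ζ)) := by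
  obtain ⟨hc1, C, hC0, hC⟩ := h.cauchyFactor_bound hγ hy
  have hk1 : ContinuousOn (fun s => k (σ s)) (Icc 0 1) := fun s hs =>
    ContinuousAt.comp_continuousWithinAt (g := k) (hk _ (h.upperReg hμ hs))
      (h.nice.continuousOn s hs)
  obtain ⟨M, hM⟩ := isCompact_Icc.exists_bound_of_continuousOn hk1
  have hM0 : 0 ≤ M := (norm_nonneg _).trans (hM 0 (by simp))
  have hlc : ContinuousOn (fun s => log (I * ((μ : ℂ) / 2 - σ s))) (Ioo 0 1) := by
    refine ContinuousOn.clog (continuousOn_const.mul (continuousOn_const.sub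
      (h.nice.continuousOn.mono Ioo_subset_Icc_self))) fun s hs => ?_
    refine I_mul_mem_slitPlane ?_
    have := (h.2.2.2.2.1 s hs).1
    simp [this]
  refine h.curveIntegrable_of_log (A := M * C) (B := ‖b‖ * C) ?_ fun s hs => ?_
  · have h2 : ContinuousOn (fun s => (b * log (I * ((μ : ℂ) / 2 - σ s)) + k (σ s)) *
        ((σ s - y) * radical γ α (σ s))⁻¹) (Ioo 0 1) :=
      ((continuousOn_const.mul hlc).add (hk1.mono Ioo_subset_Icc_self)).mul hc1
    refine h2.congr fun s hs => ?_
    obtain ⟨g1, g2, -⟩ := h.2.2.2.2.1 s hs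
    simp only [hg _ g2 g1, div_eq_mul_inv]
  · obtain ⟨g1, g2, -⟩ := h.2.2.2.2.1 s hs
    rw [hg _ g2 g1, div_eq_mul_inv, norm_mul]
    have h3 := norm_add_le (b * log (I * ((μ : ℂ) / 2 - σ s))) (k (σ s))
    rw [norm_mul] at h3
    have h4 := hM s (Ioo_subset_Icc_self hs)
    have h5 := hC s hs
    calc _ ≤ (‖b‖ * ‖log (I * ((μ : ℂ) / 2 - σ s))‖ + M) * C :=
          mul_le_mul (by linarith) h5 (norm_nonneg _) (by positivity)
      _ = _ := by ring

lemma IsLoop.curveIntegrable_fPrime (hμ : 0 < μ) (h : IsLoop γ μ σ) (hγ : IsContour α μ γ)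
    (x t : ℝ) (hy : ∀ s ∈ Icc 0 1, σ s ≠ y) :
    CurveIntegrable σ (fun ζ => fPrime x t μ ζ / ((ζ - y) * radical γ α ζ)) :=
  h.curveIntegrable_log_add hμ hγ hy (b := -1) (k := fPrimeReg x t μ)
    (fun _ hz => ContinuousAt.comp_of_eq (g := fun q : ℂ × ℝ => fPrimeReg x t q.2 q.1)
      (f := fun z : ℂ => (z, μ)) (continuousAt_fPrimeReg x t hμ hz) (by fun_prop) rfl)
    fun z hz him => by rw [fPrime_upper x t hμ him hz]; ring

lemma IsLoop.curveIntegrable_fMu (hμ : 0 < μ) (h : IsLoop γ μ σ) (hγ : IsContour α μ γ) (x t : ℝ)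
    (hy : ∀ s ∈ Icc 0 1, σ s ≠ y) :
    CurveIntegrable σ (fun ζ => fMu x t μ ζ / ((ζ - y) * radical γ α ζ)) :=
  h.curveIntegrable_log_add hμ hγ hy (b := 1 / 2) (k := fMuReg μ)
    (fun _ hz => ContinuousAt.comp_of_eq (g := fun q : ℂ × ℝ => fMuReg q.2 q.1)
      (f := fun z : ℂ => (z, μ)) (continuousAt_fMuReg hμ hz) (by fun_prop) rfl)
    fun z hz him => by rw [fMu_upper x t hμ him hz]; ring

lemma ne_of_not_mem_loopTrace (hy : y ∉ loopTrace σ) :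
    (∀ s ∈ Icc 0 1, σ s ≠ y) ∧ ∀ s ∈ Icc 0 1, σ s ≠ conj y :=
  ⟨fun s hs e => hy (Or.inl ⟨s, hs, e⟩), fun s hs e =>
    hy (mem_loopTrace_conj.1 (Or.inl ⟨s, hs, e⟩))⟩

lemma IsLoop.loopIntegrable_of_conj (h : IsLoop γ μ σ) (hγ : IsTameContour α μ γ)
    (hg : ∀ z : ℂ, z.im ≠ 0 → g (conj z) = conj (g z))
    (h1 : CurveIntegrable σ (fun ζ => g ζ / ((ζ - y) * radical γ α ζ))) (h2 : CurveIntegrable σ (fun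
    ζ => g ζ / ((ζ - conj y) * radical γ α ζ))) :
    LoopIntegrable σ (fun ζ => g ζ / ((ζ - y) * radical γ α ζ)) := by
  refine ⟨h1, curveIntegrable_mirror (h2.congr fun s hs => ?_)⟩
  obtain ⟨g1, g2, g3⟩ := h.2.2.2.2.1 s hs
  rw [hg _ g1.ne', hγ.radical_conj g3]
  simp only [map_div₀, map_mul, map_sub, conj_conj]

lemma IsLoop.loopIntegrable_fPrime (hμ : 0 < μ) (h : IsLoop γ μ σ) (hγ : IsTameContour α μ γ)
    (x t : ℝ) (hy : y ∉ loopTrace σ) :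
    LoopIntegrable σ (fun ζ => fPrime x t μ ζ / ((ζ - y) * radical γ α ζ)) :=
  h.loopIntegrable_of_conj hγ (fun _ => fPrime_conj)
    (h.curveIntegrable_fPrime hμ hγ.contour x t (ne_of_not_mem_loopTrace hy).1)
    (h.curveIntegrable_fPrime hμ hγ.contour x t (ne_of_not_mem_loopTrace hy).2)

lemma IsLoop.loopIntegrable_fMu (hμ : 0 < μ) (h : IsLoop γ μ σ) (hγ : IsTameContour α μ γ)
    (x t : ℝ) (hy : y ∉ loopTrace σ) :
    LoopIntegrable σ (fun ζ => fMu x t μ ζ / ((ζ - y) * radical γ α ζ)) :=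
  h.loopIntegrable_of_conj hγ (fun _ => fMu_conj)
    (h.curveIntegrable_fMu hμ hγ.contour x t (ne_of_not_mem_loopTrace hy).1)
    (h.curveIntegrable_fMu hμ hγ.contour x t (ne_of_not_mem_loopTrace hy).2)

/-! ### Identities between integrals over the loop -/

lemma IsLoop.loopInt_congr (h : IsLoop γ μ σ) (hγ : IsContour α μ γ) {g k : ℂ → ℂ}
    (hgk : ∀ z ∈ loopTrace σ, z ∈ Dom μ → z ∉ γ → g z = k z) : loopInt σ g = loopInt σ k := by
  unfold loopInt
  congr 1
  · refine curveInt_congr fun s hs => ?_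
    obtain ⟨-, g2, g3⟩ := h.2.2.2.2.1 s hs
    exact hgk _ (Or.inl ⟨s, Ioo_subset_Icc_self hs, rfl⟩) g2 g3
  · refine curveInt_congr fun s hs => ?_
    obtain ⟨-, -, g2, g3⟩ := h.mirror_mem hs
    exact hgk _ (Or.inr ⟨s, Ioo_subset_Icc_self hs, rfl⟩) (conj_mem_Dom.2 g2)
      fun h' => g3 (hγ.conj_mem.1 h')

lemma loopInt_add {g k : ℂ → ℂ} (hg : LoopIntegrable σ g) (hk : LoopIntegrable σ k) :
    loopInt σ (fun ζ => g ζ + k ζ) = loopInt σ g + loopInt σ k := by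
  have key : ∀ c, CurveIntegrable c g → CurveIntegrable c k →
      curveInt c (fun ζ => g ζ + k ζ) = curveInt c g + curveInt c k := by
    intro c h1 h2
    unfold curveInt
    rw [← intervalIntegral.integral_add h1 h2]
    simp only [add_mul]
  rw [loopInt, key _ hg.1 hk.1, key _ hg.2 hk.2, loopInt, loopInt]
  ring

lemma curveInt_const_mul (c : ℝ → ℂ) (a : ℂ) (g : ℂ → ℂ) :
    curveInt c (fun ζ => a * g ζ) = a * curveInt c g := by
  unfold curveInt
  rw [← intervalIntegral.integral_const_mul]
  simp only [mul_assoc]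

lemma loopInt_const_mul (σ : ℝ → ℂ) (a : ℂ) (g : ℂ → ℂ) :
    loopInt σ (fun ζ => a * g ζ) = a * loopInt σ g := by
  rw [loopInt, curveInt_const_mul, curveInt_const_mul, loopInt, mul_add]

lemma LoopIntegrable.const_mul (hg : LoopIntegrable σ g) (a : ℂ) :
    LoopIntegrable σ (fun ζ => a * g ζ) := by
  have key : ∀ c, CurveIntegrable c g → CurveIntegrable c (fun ζ => a * g ζ) := by
    intro c h1
    have := IntervalIntegrable.const_mul h1 a
    unfold CurveIntegrable
    simpa only [mul_assoc] using this
  exact ⟨key _ hg.1, key _ hg.2⟩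

lemma LoopIntegrable.add {g k : ℂ → ℂ} (hg : LoopIntegrable σ g) (hk : LoopIntegrable σ k) :
    LoopIntegrable σ (fun ζ => g ζ + k ζ) := by
  have key : ∀ c, CurveIntegrable c g → CurveIntegrable c k →
      CurveIntegrable c (fun ζ => g ζ + k ζ) := by
    intro c h1 h2
    have := IntervalIntegrable.add h1 h2
    unfold CurveIntegrable
    simpa only [add_mul] using this
  exact ⟨key _ hg.1 hk.1, key _ hg.2 hk.2⟩

lemma LoopIntegrable.congr (h : IsLoop γ μ σ) (hγ : IsContour α μ γ) {g k : ℂ → ℂ}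
    (hg : LoopIntegrable σ g) (hgk : ∀ z ∈ loopTrace σ, z ∈ Dom μ → z ∉ γ → g z = k z) :
    LoopIntegrable σ k := by
  refine ⟨hg.1.congr fun s hs => ?_, hg.2.congr fun s hs => ?_⟩
  · obtain ⟨-, g2, g3⟩ := h.2.2.2.2.1 s hs
    exact hgk _ (Or.inl ⟨s, Ioo_subset_Icc_self hs, rfl⟩) g2 g3
  · obtain ⟨-, -, g2, g3⟩ := h.mirror_mem hs
    exact hgk _ (Or.inr ⟨s, Ioo_subset_Icc_self hs, rfl⟩) (conj_mem_Dom.2 g2)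
      fun h' => g3 (hγ.conj_mem.1 h')

lemma IsLoop.loopIntegrable_fR_mul (hμ : 0 < μ) (h : IsLoop γ μ σ) (hγ : IsTameContour α μ γ)
    (x t : ℝ) {k : ℂ → ℂ} (hk : ContinuousOn k (loopTrace σ)) :
    LoopIntegrable σ (fun ζ => f x t μ ζ / radical γ α ζ * k ζ) := by
  obtain ⟨M, hM⟩ := h.nice.isCompact_loopTrace.exists_bound_of_continuousOn hk
  have key : ∀ c : ℝ → ℂ, NiceCurve c → c '' Icc 0 1 ⊆ loopTrace σ →
      ContinuousOn (fun s => f x t μ (c s) / radical γ α (c s)) (Ioo 0 1) →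
      (∃ C, ∀ s ∈ Ioo 0 1, ‖f x t μ (c s) / radical γ α (c s)‖ ≤ C) →
      CurveIntegrable c (fun ζ => f x t μ ζ / radical γ α ζ * k ζ) := by
    rintro c hc hsub h1 ⟨C, hC⟩
    have hm : ∀ s ∈ Ioo 0 1, c s ∈ loopTrace σ := fun s hs =>
      hsub ⟨s, Ioo_subset_Icc_self hs, rfl⟩
    refine hc.curveIntegrable (h1.mul (hk.comp (hc.continuousOn.mono Ioo_subset_Icc_self) hm))
      ⟨C * M, fun s hs => ?_⟩
    rw [norm_mul]
    exact mul_le_mul (hC s hs) (hM _ (hm s hs)) (norm_nonneg _) ((norm_nonneg _).trans (hC s hs))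
  obtain ⟨a1, a2⟩ := h.fR_bound hμ hγ.contour x t
  obtain ⟨b1, b2⟩ := h.fR_bound_mirror hμ hγ x t
  exact ⟨key _ h.nice subset_union_left a1 a2, key _ h.nice.mirror subset_union_right b1 b2⟩

lemma continuousOn_inv_sub (hy : y ∉ loopTrace σ) :
    ContinuousOn (fun ζ => (ζ - y)⁻¹) (loopTrace σ) :=
  (continuousOn_id.sub continuousOn_const).inv₀ fun ζ hζ e => hy ((sub_eq_zero.1 e : ζ = y) ▸ hζ)

lemma IsLoop.end_not_mem (h : IsLoop γ μ σ) (hγ : IsContour α μ γ) :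
    α ∉ loopTrace σ ∧ conj α ∉ loopTrace σ := by
  have h1 : α ∉ loopTrace σ := by
    refine h.not_mem_loopTrace hγ hγ.left_mem ?_
    intro e
    have := hγ.1
    rw [e] at this
    simp at this
  exact ⟨h1, fun h' => h1 (mem_loopTrace_conj.1 h')⟩

lemma IsLoop.cauchyE_conj (h : IsLoop γ μ σ) (hγ : IsTameContour α μ γ) (x t : ℝ) (y : ℂ) :
    cauchyE x t μ γ α σ (conj y) = conj (cauchyE x t μ γ α σ y) := by
  have key : ∀ y : ℂ, curveInt (mirror σ) (fun ζ => f x t μ ζ / ((ζ - y) * radical γ α ζ)) =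
      -conj (curveInt σ (fun ζ => f x t μ ζ / ((ζ - conj y) * radical γ α ζ))) := by
    intro y
    rw [curveInt_mirror]
    congr 2
    refine curveInt_congr fun s hs => ?_
    obtain ⟨g1, g2, g3⟩ := h.2.2.2.2.1 s hs
    rw [f_conj g1.ne', hγ.radical_conj g3]
    simp only [map_div₀, map_mul, map_sub, conj_conj]
  rw [cauchyE, cauchyE, loopInt, loopInt, key, key, conj_conj, map_mul, conj_two_pi_I_inv,
    map_add, map_neg, conj_conj]
  ring

lemma IsContour.hasDerivAt_radical (h : IsContour α μ γ) (hz : z ∉ γ) :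
    HasDerivAt (radical γ α) (radical γ α z * (1 / (2 * (z - α)) + 1 / (2 * (z - conj α)))) z := by
  have hR := h.isRadical
  have hd := (hR.1.differentiableAt (h.isOpen_compl.mem_nhds hz)).hasDerivAt
  have h0 := hR.ne_zero h hz
  have hsq := hR.2.1 z hz
  have hne : (z - α) * (z - conj α) ≠ 0 := hsq ▸ pow_ne_zero 2 h0
  have h1 : HasDerivAt (fun w => (w - α) * (w - conj α))
      (1 * (z - conj α) + (z - α) * 1) z :=
    ((hasDerivAt_id z).sub_const α).mul ((hasDerivAt_id z).sub_const (conj α))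
  have h2 : HasDerivAt (fun w => radical γ α w ^ 2)
      (1 * (z - conj α) + (z - α) * 1) z := by
    refine h1.congr_of_eventuallyEq ?_
    filter_upwards [h.isOpen_compl.mem_nhds hz] with w hw using hR.2.1 w hw
  have h3 := h2.unique (hd.pow 2)
  refine hd.congr_deriv ?_
  have e1 := (mul_ne_zero_iff.1 hne).1
  have e2 := (mul_ne_zero_iff.1 hne).2
  have h4 : 2 * radical γ α z * deriv (radical γ α) z = (z - conj α) + (z - α) := by simp_all
  have h5 : (2 * radical γ α z) * deriv (radical γ α) z = (2 * radical γ α z) *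
      (radical γ α z * (1 / (2 * (z - α)) + 1 / (2 * (z - conj α)))) := by
    rw [h4]
    field_simp
    rw [hsq]
    ring
  exact mul_left_cancel₀ (mul_ne_zero two_ne_zero h0) h5

/-- A continuous square root of a function with a positive limit has a real limit. -/
lemma exists_real_limit {u P : ℝ → ℂ} {l : Filter ℝ} {r : ℝ} (hr : 0 < r)
    (hl : ∀ T ∈ l, ∃ T' ⊆ T, T' ∈ l ∧ IsPreconnected T') (hP : Tendsto P l (𝓝 ((r : ℂ) ^ 2)))
    {T : Set ℝ} (hT : T ∈ l) (hu : ContinuousOn u T) (hPc : ContinuousOn P T)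
    (hsq : ∀ s ∈ T, u s ^ 2 = P s) : ∃ ε : ℝ, ε ≠ 0 ∧ Tendsto u l (𝓝 (ε : ℂ)) := by
  have hr0 : (r : ℂ) ≠ 0 := by exact_mod_cast hr.ne'
  have h1 : Tendsto (fun s => P s / (r : ℂ) ^ 2) l (𝓝 1) := by
    have := hP.div_const ((r : ℂ) ^ 2)
    rwa [div_self (pow_ne_zero 2 hr0)] at this
  have h11 : (1 : ℂ) ∈ slitPlane := by simp
  have h2 := h1.eventually (isOpen_slitPlane.mem_nhds h11)
  obtain ⟨T', hT', hT'l, hpre⟩ := hl _ (inter_mem hT h2)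
  set v : ℝ → ℂ := fun s => r * csqrt (P s / (r : ℂ) ^ 2) with hv
  have hvl : Tendsto v l (𝓝 (r : ℂ)) := by
    have h3 := ((differentiableAt_csqrt h11).continuousAt.tendsto.comp h1).const_mul (r : ℂ)
    rwa [csqrt_one, mul_one] at h3
  have hvc : ContinuousOn v T' := by
    intro s hs
    refine continuousWithinAt_const.mul (ContinuousAt.comp_continuousWithinAt (g := csqrt)
      (f := fun s => P s / (r : ℂ) ^ 2) (differentiableAt_csqrt (hT' hs).2).continuousAt ?_)
    exact ((hPc s (hT' hs).1).mono (hT'.trans inter_subset_left)).div_const _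
  have hv2 : ∀ s ∈ T', v s ^ 2 = P s := by
    intro s hs
    rw [hv, mul_pow, csqrt_sq (slitPlane_ne_zero (hT' hs).2), mul_div_cancel₀ _ (pow_ne_zero 2 hr0)]
  rcases hpre.eq_or_eq_neg_of_sq_eq (hu.mono (hT'.trans inter_subset_left)) hvc
    (fun s hs => by simp [hv2 s hs, hsq s (hT' hs).1])
    (fun {s} _ => mul_ne_zero hr0 (csqrt_ne_zero _)) with h4 | h4
  · refine ⟨r, hr.ne', hvl.congr' ?_⟩
    filter_upwards [hT'l] with s hs using (h4 hs).symm
  · refine ⟨-r, neg_ne_zero.2 hr.ne', ?_⟩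
    push_cast
    refine hvl.neg.congr' ?_
    filter_upwards [hT'l] with s hs using (h4 hs).symm

/-- The integral of an exact form, whose primitive is only required to have limits at the ends. -/
lemma NiceCurve.curveInt_eq_sub_of_tendsto (hc : NiceCurve c) {P g : ℂ → ℂ}
    (hd : ∀ s ∈ Ioo 0 1, HasDerivAt P (g (c s)) (c s)) (hi : CurveIntegrable c g) {la lb : ℂ}
    (ha : Tendsto (fun s => P (c s)) (𝓝[>] 0) (𝓝 la))
    (hb : Tendsto (fun s => P (c s)) (𝓝[<] 1) (𝓝 lb)) : curveInt c g = lb - la := by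
  obtain ⟨S, hS, hcd⟩ := hc.diff
  have hcont : ContinuousOn (fun s => P (c s)) (Ioo 0 1) := fun s hs =>
    ContinuousAt.comp_continuousWithinAt (g := P) (hd s hs).continuousAt
      ((hc.continuousOn.mono Ioo_subset_Icc_self) s hs)
  rw [← eq_lim_at_left_extendFrom_Ioo zero_lt_one ha,
    ← eq_lim_at_right_extendFrom_Ioo zero_lt_one hb]
  refine integral_eq_of_hasDerivAt_off_countable_of_le _ _ zero_le_one hS
    (continuousOn_Icc_extendFrom_Ioo hcont ha hb) (fun s hs => ?_) hi
  have h1 := (hd s hs.1).comp_of_eq s (hcd s hs).hasDerivAt rfl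
  refine h1.congr_of_eventuallyEq ?_
  filter_upwards [isOpen_Ioo.mem_nhds hs.1] with u hu
  exact extendFrom_extends hcont u hu

/-- `R` takes one of two opposite real values at each end of the loop, according to the side of `γ`.
-/
lemma IsLoop.exists_radical_limits (h : IsLoop γ μ σ) (hγ : IsContour α μ γ) :
    ∃ ε₀ ε₁ : ℝ, ε₀ ≠ 0 ∧ ε₁ ≠ 0 ∧ Tendsto (fun s => radical γ α (σ s)) (𝓝[>] 0) (𝓝 (ε₀ : ℂ)) ∧
      Tendsto (fun s => radical γ α (σ s)) (𝓝[<] 1) (𝓝 (ε₁ : ℂ)) := by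
  have hr : 0 < ‖((μ / 2 : ℝ) : ℂ) - α‖ := by
    rw [norm_pos_iff, _root_.sub_ne_zero]
    intro e
    have := hγ.1
    rw [← e] at this
    simp at this
  have hq := quad_ofReal α (μ / 2)
  have hcs := h.nice.continuousOn
  have hqc : ContinuousOn (fun s => quad α (σ s)) (Icc 0 1) := by
    unfold quad
    fun_prop
  have hsq : ∀ s ∈ Ioo 0 1, radical γ α (σ s) ^ 2 = quad α (σ s) := fun s hs =>
    hγ.isRadical.2.1 _ (h.2.2.2.2.1 s hs).2.2
  have e0 : quad α (σ 0) = ((‖((μ / 2 : ℝ) : ℂ) - α‖ : ℝ) : ℂ) ^ 2 := by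
    rw [← hq, h.2.1]
    push_cast
    rfl
  have e1 : quad α (σ 1) = ((‖((μ / 2 : ℝ) : ℂ) - α‖ : ℝ) : ℂ) ^ 2 := by
    rw [← hq, h.2.2.1]
    push_cast
    rfl
  obtain ⟨ε₀, h1, h2⟩ := exists_real_limit (u := fun s => radical γ α (σ s))
    (P := fun s => quad α (σ s)) (l := 𝓝[>] 0) hr (fun T hT => by
      obtain ⟨u, hu, hT⟩ := mem_nhdsGT_iff_exists_Ioo_subset.1 hT
      exact ⟨_, hT, Ioo_mem_nhdsGT hu, isPreconnected_Ioo⟩) (by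
      rw [← e0]
      refine (hqc 0 (by simp)).mono_left ?_
      rw [← nhdsWithin_Ioo_eq_nhdsGT (zero_lt_one (α := ℝ))]
      exact nhdsWithin_mono _ Ioo_subset_Icc_self) (Ioo_mem_nhdsGT zero_lt_one)
    (h.continuousOn_radical hγ) (hqc.mono Ioo_subset_Icc_self) hsq
  obtain ⟨ε₁, h3, h4⟩ := exists_real_limit (u := fun s => radical γ α (σ s))
    (P := fun s => quad α (σ s)) (l := 𝓝[<] 1) hr (fun T hT => by
      obtain ⟨u, hu, hT⟩ := mem_nhdsLT_iff_exists_Ioo_subset.1 hT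
      exact ⟨_, hT, Ioo_mem_nhdsLT hu, isPreconnected_Ioo⟩) (by
      rw [← e1]
      refine (hqc 1 (by simp)).mono_left ?_
      rw [← nhdsWithin_Ioo_eq_nhdsLT (zero_lt_one (α := ℝ))]
      exact nhdsWithin_mono _ Ioo_subset_Icc_self) (Ioo_mem_nhdsLT zero_lt_one)
    (h.continuousOn_radical hγ) (hqc.mono Ioo_subset_Icc_self) hsq
  exact ⟨ε₀, ε₁, h1, h3, h2, h4⟩

lemma dens_zero (x t μ : ℝ) (γ : Set ℂ) (α y v w ζ : ℂ) : dens x t μ γ α y v w 0 ζ =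
    f x t μ ζ / radical γ α ζ * (v * ((ζ - y)⁻¹ * (ζ - y)⁻¹) + (w / 2) * ((ζ - α)⁻¹ * (ζ - y)⁻¹) +
      (conj w / 2) * ((ζ - conj α)⁻¹ * (ζ - y)⁻¹)) := by
  simp only [dens, div_eq_mul_inv, mul_inv, ofReal_zero, mul_zero, zero_add]
  ring

lemma IsLoop.loopIntegrable_dens_zero (hμ : 0 < μ) (h : IsLoop γ μ σ) (hγ : IsTameContour α μ γ)
    (x t : ℝ) (hy : y ∉ loopTrace σ) (v w : ℂ) : LoopIntegrable σ (dens x t μ γ α y v w 0) := by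
  have h1 := continuousOn_inv_sub hy
  have h2 := continuousOn_inv_sub (h.end_not_mem hγ.contour).1
  have h3 := continuousOn_inv_sub (h.end_not_mem hγ.contour).2
  have h4 := h.loopIntegrable_fR_mul hμ hγ x t (((continuousOn_const (c := v)).mul
    (h1.mul h1)).add ((continuousOn_const (c := w / 2)).mul (h2.mul h1)) |>.add
    ((continuousOn_const (c := conj w / 2)).mul (h3.mul h1)))
  exact h4.congr h hγ.contour fun z _ _ _ => (dens_zero x t μ γ α y v w z).symm

/-- Integration by parts over the whole loop: there are no boundary terms, since those of the two
halves of the loop cancel. -/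
lemma IsLoop.loopInt_fPrime (hμ : 0 < μ) (h : IsLoop γ μ σ) (hγ : IsTameContour α μ γ) (x t : ℝ)
    (hy : y ∉ loopTrace σ) :
    loopInt σ (fun ζ => fPrime x t μ ζ / ((ζ - y) * radical γ α ζ)) =
      loopInt σ (dens x t μ γ α y 1 1 0) := by
  obtain ⟨ε₀, ε₁, hε₀, hε₁, hl0, hl1⟩ := h.exists_radical_limits hγ.contour
  have hfc := h.continuousOn_f hμ x t
  have hcs := h.nice.continuousOn
  have hreal : conj (f x t μ ((μ : ℂ) / 2)) = f x t μ ((μ : ℂ) / 2) := by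
    rw [f_eq_fUpper (by simp), fUpper_half_conj x t hμ]
  obtain ⟨fp, hfp⟩ := conj_eq_iff_real.1 hreal
  have half : ∀ y, y ∉ loopTrace σ → curveInt σ (fun ζ => fPrime x t μ ζ / ((ζ - y) *
      radical γ α ζ)) - curveInt σ (dens x t μ γ α y 1 1 0) =
      ((fp * (ε₁⁻¹ - ε₀⁻¹) : ℝ) : ℂ) / ((μ : ℂ) / 2 - y) := by
    intro y hy
    have hy' := (ne_of_not_mem_loopTrace hy).1
    have hi1 := h.curveIntegrable_fPrime hμ hγ.contour x t hy'
    have hi2 := (h.loopIntegrable_dens_zero hμ hγ x t hy 1 1).1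
    have hi : CurveIntegrable σ (fun ζ => fPrime x t μ ζ / ((ζ - y) * radical γ α ζ) -
        dens x t μ γ α y 1 1 0 ζ) := by
      have := IntervalIntegrable.sub hi1 hi2
      unfold CurveIntegrable
      simpa only [sub_mul] using this
    have hd : ∀ s ∈ Ioo 0 1, HasDerivAt (fun ζ => f x t μ ζ / ((ζ - y) * radical γ α ζ))
        ((fun ζ => fPrime x t μ ζ / ((ζ - y) * radical γ α ζ) -
          dens x t μ γ α y 1 1 0 ζ) (σ s)) (σ s) := by
      intro s hs
      obtain ⟨-, g2, g3⟩ := h.2.2.2.2.1 s hs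
      have e1 := _root_.sub_ne_zero.2 (hy' s (Ioo_subset_Icc_self hs))
      have e2 := h.radical_ne_zero hγ.contour hs
      obtain ⟨e3, e4⟩ := mul_ne_zero_iff.1 (h.sub_ne_zero hγ.contour (Ioo_subset_Icc_self hs))
      have d1 := hasDerivAt_f x t hμ g2
      have d2 := ((hasDerivAt_id (σ s)).sub_const y).mul (hγ.contour.hasDerivAt_radical g3)
      refine (d1.div d2 (mul_ne_zero e1 e2)).congr_deriv ?_
      simp only [dens, Pi.mul_apply, id, map_one, ofReal_zero, mul_zero, zero_add]
      field_simp
      ring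
    have hne : (μ : ℂ) / 2 - y ≠ 0 := by
      rw [_root_.sub_ne_zero, ← h.2.1]
      exact hy' 0 (by simp)
    have lim : ∀ {l : Filter ℝ} {s₀ ε : ℝ}, ε ≠ 0 → l ≤ 𝓝[Icc 0 1] s₀ → s₀ ∈ Icc 0 1 →
        σ s₀ = (μ : ℂ) / 2 → Tendsto (fun s => radical γ α (σ s)) l (𝓝 (ε : ℂ)) →
        Tendsto (fun s => f x t μ (σ s) / ((σ s - y) * radical γ α (σ s))) l
          (𝓝 ((fp : ℂ) / (((μ : ℂ) / 2 - y) * ε))) := by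
      intro l s₀ ε hε hl hs₀ e hR
      have l1 : Tendsto (fun s => f x t μ (σ s)) l (𝓝 (fp : ℂ)) := by
        rw [← hfp, ← e]
        exact (hfc s₀ hs₀).mono_left hl
      have l2 : Tendsto (fun s => σ s - y) l (𝓝 ((μ : ℂ) / 2 - y)) := by
        rw [← e]
        exact ((hcs s₀ hs₀).mono_left hl).sub_const y
      exact l1.div (l2.mul hR) (mul_ne_zero hne (by exact_mod_cast hε))
    have le0 : 𝓝[>] (0 : ℝ) ≤ 𝓝[Icc 0 1] 0 := by
      rw [← nhdsWithin_Ioo_eq_nhdsGT (zero_lt_one (α := ℝ))]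
      exact nhdsWithin_mono _ Ioo_subset_Icc_self
    have le1 : 𝓝[<] (1 : ℝ) ≤ 𝓝[Icc 0 1] 1 := by
      rw [← nhdsWithin_Ioo_eq_nhdsLT (zero_lt_one (α := ℝ))]
      exact nhdsWithin_mono _ Ioo_subset_Icc_self
    have h1 := h.nice.curveInt_eq_sub_of_tendsto
      (P := fun ζ => f x t μ ζ / ((ζ - y) * radical γ α ζ)) hd hi
      (lim hε₀ le0 (by simp) h.2.1 hl0) (lim hε₁ le1 (by simp) h.2.2.1 hl1)
    have h2 : curveInt σ (fun ζ => fPrime x t μ ζ / ((ζ - y) * radical γ α ζ) -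
        dens x t μ γ α y 1 1 0 ζ) = curveInt σ (fun ζ => fPrime x t μ ζ / ((ζ - y) *
      radical γ α ζ)) - curveInt σ (dens x t μ γ α y 1 1 0) := by
      unfold curveInt
      rw [← intervalIntegral.integral_sub hi1 hi2]
      simp only [sub_mul]
    rw [← h2, h1]
    have e5 : (ε₀ : ℂ) ≠ 0 := by simp_all
    have e6 : (ε₁ : ℂ) ≠ 0 := by simp_all
    push_cast
    field_simp
  have hyc : conj y ∉ loopTrace σ := fun h' => hy (mem_loopTrace_conj.1 h')
  have m1 : curveInt (mirror σ) (fun ζ => fPrime x t μ ζ / ((ζ - y) * radical γ α ζ)) =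
      -conj (curveInt σ (fun ζ => fPrime x t μ ζ / ((ζ - conj y) * radical γ α ζ))) := by
    rw [curveInt_mirror]
    congr 2
    refine curveInt_congr fun s hs => ?_
    obtain ⟨g1, g2, g3⟩ := h.2.2.2.2.1 s hs
    rw [fPrime_conj g1.ne', hγ.radical_conj g3]
    simp only [map_div₀, map_mul, map_sub, conj_conj]
  have m2 : curveInt (mirror σ) (dens x t μ γ α y 1 1 0) =
      -conj (curveInt σ (dens x t μ γ α (conj y) 1 1 0)) := by
    rw [curveInt_mirror]
    congr 2
    refine curveInt_congr fun s hs => ?_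
    obtain ⟨g1, g2, g3⟩ := h.2.2.2.2.1 s hs
    rw [dens_conj hγ x t _ _ _ _ g1.ne' g3, map_one]
  have k1 := half y hy
  have k2 := congrArg (conj) (half _ hyc)
  rw [map_sub, map_div₀, conj_ofReal, map_sub, map_div₀, conj_ofReal,
    conj_ofNat, conj_conj, ← k1] at k2
  rw [loopInt, loopInt, m1, m2]
  linear_combination -k2

/-- Variation of the end point of the contour, when the Cauchy integral vanishes there. -/
lemma IsLoop.loopInt_dens_end (hμ : 0 < μ) (h : IsLoop γ μ σ) (hγ : IsTameContour α μ γ) (x t : ℝ)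
    (h0 : cauchyE x t μ γ α σ α = 0) (v : ℂ) :
    loopInt σ (dens x t μ γ α α v v 0) = 3 / 2 * v * loopInt σ (dens x t μ γ α α 1 0 0) := by
  obtain ⟨ha, hac⟩ := h.end_not_mem hγ.contour
  have h1 := continuousOn_inv_sub ha
  have h3 := continuousOn_inv_sub hac
  have hne := _root_.sub_ne_zero.2 hγ.contour.ne_conj
  have hEc : cauchyE x t μ γ α σ (conj α) = 0 := by rw [h.cauchyE_conj hγ, h0, map_zero]
  have z1 : loopInt σ (fun ζ => f x t μ ζ / radical γ α ζ * (ζ - α)⁻¹) = 0 := by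
    have e := (mul_eq_zero.1 h0).resolve_left (inv_ne_zero two_pi_I_ne_zero)
    rw [← e]
    refine h.loopInt_congr hγ.contour fun z _ _ _ => ?_
    rw [div_eq_mul_inv, div_eq_mul_inv, mul_inv]
    ring
  have z2 : loopInt σ (fun ζ => f x t μ ζ / radical γ α ζ * (ζ - conj α)⁻¹) = 0 := by
    have e := (mul_eq_zero.1 hEc).resolve_left (inv_ne_zero two_pi_I_ne_zero)
    rw [← e]
    refine h.loopInt_congr hγ.contour fun z _ _ _ => ?_
    rw [div_eq_mul_inv, div_eq_mul_inv, mul_inv]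
    ring
  have i0 := h.loopIntegrable_dens_zero hμ hγ x t ha 1 0
  have i1 := h.loopIntegrable_fR_mul hμ hγ x t h1
  have i2 := h.loopIntegrable_fR_mul hμ hγ x t h3
  set κ : ℂ := conj v / (2 * (α - conj α)) with hκ
  have key : loopInt σ (dens x t μ γ α α v v 0) = loopInt σ (fun ζ =>
      3 / 2 * v * dens x t μ γ α α 1 0 0 ζ + (κ * (f x t μ ζ / radical γ α ζ * (ζ - α)⁻¹) +
        -κ * (f x t μ ζ / radical γ α ζ * (ζ - conj α)⁻¹))) := by
    refine h.loopInt_congr hγ.contour fun z hz _ _ => ?_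
    have e1 : z - α ≠ 0 := _root_.sub_ne_zero.2 fun e => ha (e ▸ hz)
    have e2 : z - conj α ≠ 0 := _root_.sub_ne_zero.2 fun e => hac (e ▸ hz)
    rw [dens_zero, dens_zero, map_zero, zero_div, zero_mul, zero_mul, hκ]
    field_simp
    ring
  rw [key, loopInt_add (i0.const_mul _) ((i1.const_mul _).add (i2.const_mul _)),
    loopInt_add (i1.const_mul _) (i2.const_mul _), loopInt_const_mul, loopInt_const_mul,
    loopInt_const_mul, z1, z2]
  ring

/-- The effect on the Cauchy integral at a point off the contour of a variation of the end point,
when the Cauchy integral vanishes at the end point. -/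
lemma IsLoop.loopInt_dens_off (hμ : 0 < μ) (h : IsLoop γ μ σ) (hγ : IsTameContour α μ γ) (x t : ℝ)
    (h0 : cauchyE x t μ γ α σ α = 0) (hy : y ∉ loopTrace σ) (hyγ : y ∉ γ) (w : ℂ) :
    (2 * π * I)⁻¹ * loopInt σ (dens x t μ γ α y 0 w 0) = cauchyE x t μ γ α σ y *
        (w / (2 * (y - α)) + conj w / (2 * (y - conj α))) := by
  obtain ⟨ha, hac⟩ := h.end_not_mem hγ.contour
  have h1 := continuousOn_inv_sub ha
  have h2 := continuousOn_inv_sub hy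
  have h3 := continuousOn_inv_sub hac
  have hEc : cauchyE x t μ γ α σ (conj α) = 0 := by rw [h.cauchyE_conj hγ, h0, map_zero]
  have e3 : y - α ≠ 0 := _root_.sub_ne_zero.2 fun e => hyγ (e ▸ hγ.contour.left_mem)
  have e4 : y - conj α ≠ 0 := _root_.sub_ne_zero.2 fun e =>
    hyγ (e ▸ hγ.contour.conj_mem.2 hγ.contour.left_mem)
  have hE : ∀ z, loopInt σ (fun ζ => f x t μ ζ / radical γ α ζ * (ζ - z)⁻¹) =
      (2 * π * I) * cauchyE x t μ γ α σ z := by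
    intro z
    rw [cauchyE, mul_inv_cancel_left₀ two_pi_I_ne_zero]
    refine h.loopInt_congr hγ.contour fun z _ _ _ => ?_
    rw [div_eq_mul_inv, div_eq_mul_inv, mul_inv]
    ring
  have i1 := h.loopIntegrable_fR_mul hμ hγ x t h1
  have i2 := h.loopIntegrable_fR_mul hμ hγ x t h2
  have i3 := h.loopIntegrable_fR_mul hμ hγ x t h3
  set κ : ℂ := w / (2 * (y - α)) with hκ
  set κ' : ℂ := conj w / (2 * (y - conj α)) with hκ'
  have key : loopInt σ (dens x t μ γ α y 0 w 0) = loopInt σ (fun ζ =>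
      (κ + κ') * (f x t μ ζ / radical γ α ζ * (ζ - y)⁻¹) +
        (-κ * (f x t μ ζ / radical γ α ζ * (ζ - α)⁻¹) +
        -κ' * (f x t μ ζ / radical γ α ζ * (ζ - conj α)⁻¹))) := by
    refine h.loopInt_congr hγ.contour fun z hz _ _ => ?_
    have e1 : z - α ≠ 0 := _root_.sub_ne_zero.2 fun e => ha (e ▸ hz)
    have e2 : z - conj α ≠ 0 := _root_.sub_ne_zero.2 fun e => hac (e ▸ hz)
    have e5 : z - y ≠ 0 := _root_.sub_ne_zero.2 fun e => hy (e ▸ hz)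
    rw [dens_zero, hκ, hκ']
    field_simp
    ring
  rw [key, loopInt_add (i2.const_mul _) ((i1.const_mul _).add (i3.const_mul _)),
    loopInt_add (i1.const_mul _) (i3.const_mul _), loopInt_const_mul, loopInt_const_mul,
    loopInt_const_mul, hE, hE, hE, h0, hEc, mul_zero, mul_zero, mul_zero, add_zero, add_zero,
    ← mul_assoc, mul_comm _ (κ + κ'), mul_assoc, inv_mul_cancel_left₀ two_pi_I_ne_zero,
    mul_comm]

lemma cauchyE_hasDerivAt_of_real {a d : ℂ} (hg : DifferentiableAt ℂ g a)
    (hd : HasDerivAt (fun s : ℝ => g (a + s)) d 0) : HasDerivAt g d a := by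
  have h1 : HasDerivAt (fun s : ℝ => g (a + s)) (deriv g a) 0 := by
    have e1 : HasDerivAt (fun s : ℝ => a + (s : ℂ)) 1 0 := by
      simpa using (ofRealCLM.hasDerivAt (x := (0 : ℝ))).const_add a
    have e2 : HasDerivAt g (deriv g a) (a + ((0 : ℝ) : ℂ)) := by simp_all
    have e3 := HasDerivAt.scomp (0 : ℝ) e2 e1
    rw [one_smul] at e3
    exact e3
  rw [h1.unique hd |>.symm]
  exact hg.hasDerivAt

namespace BaseContour

variable {D : BaseContour}

/-- The derivative of the Cauchy integral with respect to `μ` at fixed pole and end point. -/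
lemma Adm.fderiv_relE_mu (h : D.Adm b m)
    (hσ : IsLoop (D.fam (b + m / 2) m) m (fun s => m / 2 + c s)) (x t : ℝ)
    (hy : m / 2 + y ∉ loopTrace (fun s => m / 2 + c s)) :
    fderiv ℝ (D.relE x t c) (y, b, m) (-(1 / 2), -(1 / 2), 1) =
      (2 * π * I)⁻¹ * loopInt (fun s => m / 2 + c s) (fun ζ => fMu x t m ζ /
        ((ζ - (m / 2 + y)) * radical (D.fam (b + m / 2) m) (b + m / 2) ζ)) := by
  have hT := h.isTameContour
  obtain ⟨-, e⟩ := h.relE_contDiffAt hσ x t hy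
  have hi1 := hσ.loopIntegrable_fPrime h.pos hT x t hy
  have hi2 := hσ.loopIntegrable_fMu h.pos hT x t hy
  have e1 : ((-(1 / 2), -(1 / 2), 1) : ℂ × ℂ × ℝ) =
      (-(1 / 2) : ℝ) • ((1, 1, 0) : ℂ × ℂ × ℝ) + (0, 0, 1) := by
    ext <;> simp
  rw [e1, map_add, map_smul, e, e, ← hσ.loopInt_fPrime h.pos hT x t hy]
  have e2 : loopInt (fun s => m / 2 + c s) (dens x t m (D.fam (b + m / 2) m)
      (b + m / 2) (m / 2 + y) 0 0 1) = loopInt (fun s => m / 2 + c s) (fun ζ =>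
        (1 / 2) * (fPrime x t m ζ / ((ζ - (m / 2 + y)) *
          radical (D.fam (b + m / 2) m) (b + m / 2) ζ)) + fMu x t m ζ /
        ((ζ - (m / 2 + y)) * radical (D.fam (b + m / 2) m) (b + m / 2) ζ)) := by
    congr 1
    funext ζ
    simp only [dens, map_zero, zero_div, add_zero, mul_zero, ofReal_one, mul_one]
    push_cast
    ring
  rw [e2, loopInt_add (hi1.const_mul _) hi2, loopInt_const_mul, real_smul]
  push_cast
  ring

/-- The derivative of `K` with respect to the end point, where `K = 0`: it is complex linear. -/
lemma Adm.fderiv_relE_end (h : D.Adm b m)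
    (hσ : IsLoop (D.fam (b + m / 2) m) m (fun s => m / 2 + c s)) (x t : ℝ) (h0 : cauchyE x t m
    (D.fam (b + m / 2) m) (b + m / 2) (fun s => m / 2 + c s) (b + m / 2) = 0) (v : ℂ) :
    fderiv ℝ (D.relE x t c) (b, b, m) (v, v, 0) = v * ((2 * π * I)⁻¹ *
      loopInt (fun s => m / 2 + c s) (fun ζ => fPrime x t m ζ /
        ((ζ - (b + m / 2)) * radical (D.fam (b + m / 2) m) (b + m / 2) ζ))) := by
  have hT := h.isTameContour
  have ha := (hσ.end_not_mem hT.contour).1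
  have hc : m / 2 + b = b + m / 2 := add_comm _ _
  obtain ⟨-, e⟩ := h.relE_contDiffAt hσ x t (y₁ := b) (by rwa [hc])
  rw [e, hc, hσ.loopInt_fPrime h.pos hT x t ha, hσ.loopInt_dens_end h.pos hT x t h0,
    hσ.loopInt_dens_end h.pos hT x t h0 1]
  ring

/-- If `K = 0`, the derivative of the Cauchy integral at the end point is `2/3` of that of `K`. -/
lemma Adm.hasDerivAt_cauchyE (h : D.Adm b m)
    (hσ : IsLoop (D.fam (b + m / 2) m) m (fun s => m / 2 + c s)) (x t : ℝ) (h0 : cauchyE x t m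
    (D.fam (b + m / 2) m) (b + m / 2) (fun s => m / 2 + c s) (b + m / 2) = 0) :
    HasDerivAt (cauchyE x t m (D.fam (b + m / 2) m) (b + m / 2)
      (fun s => m / 2 + c s)) (2 / 3 * ((2 * π * I)⁻¹ *
      loopInt (fun s => m / 2 + c s) (fun ζ => fPrime x t m ζ /
        ((ζ - (b + m / 2)) * radical (D.fam (b + m / 2) m) (b + m / 2) ζ)))) (b + m / 2) := by
  have hT := h.isTameContour
  have ha := (hσ.end_not_mem hT.contour).1
  have hc : m / 2 + b = b + m / 2 := add_comm _ _
  obtain ⟨d, e⟩ := h.relE_contDiffAt hσ x t (y₁ := b) (by rwa [hc])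
  refine cauchyE_hasDerivAt_of_real (hσ.continuousAt_cauchyE h.pos hT x t ha) ?_
  have d1 := (d.differentiableAt one_ne_zero).hasFDerivAt
  have d2 : HasDerivAt (fun s : ℝ => ((b + s, b, m) : ℂ × ℂ × ℝ)) (1, 0, 0) 0 := by
    have e1 : HasDerivAt (fun s : ℝ => b + (s : ℂ)) 1 0 := by
      simpa using (ofRealCLM.hasDerivAt (x := (0 : ℝ))).const_add b
    exact e1.prodMk (hasDerivAt_const _ _)
  have d3 : HasDerivAt (fun s : ℝ => D.relE x t c (b + s, b, m)) _ 0 :=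
    HasFDerivAt.comp_hasDerivAt_of_eq (l := D.relE x t c) 0 d1 d2 (by simp)
  rw [e, hc] at d3
  rw [hσ.loopInt_fPrime h.pos hT x t ha, hσ.loopInt_dens_end h.pos hT x t h0 1]
  refine (d3.congr_deriv (by ring)).congr_of_eventuallyEq (Eventually.of_forall fun s => ?_)
  simp only [relE]
  rw [← add_assoc, hc]

/-- If `K = 0`, moving the end points changes the Cauchy integral off the contour only by the factor
coming from `R`, so that `R` times the Cauchy integral does not change. -/
lemma Adm.fderiv_relE_off (h : D.Adm b m)
    (hσ : IsLoop (D.fam (b + m / 2) m) m (fun s => m / 2 + c s)) (x t : ℝ) (h0 : cauchyE x t m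
    (D.fam (b + m / 2) m) (b + m / 2) (fun s => m / 2 + c s) (b + m / 2) = 0)
    (hy : m / 2 + y ∉ loopTrace (fun s => m / 2 + c s)) (hyγ : m / 2 + y ∉ D.fam (b + m / 2) m)
    (w : ℂ) :
    fderiv ℝ (D.relE x t c) (y, b, m) (0, w, 0) = D.relE x t c (y, b, m) *
      (w / (2 * (y - b)) + conj w / (2 * (y - conj b))) := by
  have hT := h.isTameContour
  obtain ⟨-, e⟩ := h.relE_contDiffAt hσ x t hy
  rw [e, hσ.loopInt_dens_off h.pos hT x t h0 hy hyγ]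
  have e1 : m / 2 + y - (b + m / 2) = y - b := by ring
  have e2 : m / 2 + y - conj (b + m / 2) = y - conj b := by
    simp only [map_add, map_div₀, conj_ofReal, conj_ofNat]
    ring
  rw [e1, e2]
  rfl

end BaseContour

/-! ### Moving a loop off a point -/

/-- Two curves have the same winding about `w` if their ratio about `w` stays in the slit plane. -/
lemma NiceCurve.curveInt_inv_eq_of_ratio {c d : ℝ → ℂ} (hc : NiceCurve c) (hd : NiceCurve d)
    (h0 : c 0 = d 0) (h1 : c 1 = d 1) (hcw : w ∉ c '' Icc 0 1) (hdw : w ∉ d '' Icc 0 1)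
    (hr : ∀ s ∈ Icc 0 1, (c s - w) / (d s - w) ∈ slitPlane) :
    curveInt c (fun ζ => (ζ - w)⁻¹) = curveInt d (fun ζ => (ζ - w)⁻¹) := by
  have hcn : ∀ s ∈ Icc 0 1, c s - w ≠ 0 := fun s hs h => hcw ⟨s, hs, sub_eq_zero.1 h⟩
  have hdn : ∀ s ∈ Icc 0 1, d s - w ≠ 0 := fun s hs h => hdw ⟨s, hs, sub_eq_zero.1 h⟩
  obtain ⟨S, hS, hcd⟩ := hc.diff
  obtain ⟨T, hT, hdd⟩ := hd.diff
  have i1 := hc.curveIntegrable_inv hcw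
  have i2 := hd.curveIntegrable_inv hdw
  unfold CurveIntegrable at i1 i2
  have key := integral_eq_of_hasDerivAt_off_countable
    (fun s => log ((c s - w) / (d s - w)))
    (fun s => (c s - w)⁻¹ * deriv c s - (d s - w)⁻¹ * deriv d s) (hS.union hT)
    (a := 0) (b := 1) ?_ ?_ (i1.sub i2)
  · rw [intervalIntegral.integral_sub i1 i2] at key
    rw [h0, h1, div_self (hdn 0 (by simp)), div_self (hdn 1 (by simp)), sub_self] at key
    exact sub_eq_zero.1 key
  · rw [uIcc_of_le zero_le_one]
    exact ContinuousOn.clog ((hc.continuousOn.sub continuousOn_const).div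
      (hd.continuousOn.sub continuousOn_const) hdn) hr
  · intro s hs
    rw [min_eq_left zero_le_one, max_eq_right zero_le_one] at hs
    have hs' := Ioo_subset_Icc_self hs.1
    have e1 := ((hcd s ⟨hs.1, fun h => hs.2 (Or.inl h)⟩).hasDerivAt).sub_const w
    have e2 := ((hdd s ⟨hs.1, fun h => hs.2 (Or.inr h)⟩).hasDerivAt).sub_const w
    refine ((e1.div e2 (hdn s hs')).clog_real (hr s hs')).congr_deriv ?_
    have := hcn s hs'
    have := hdn s hs'
    simp only [Pi.div_apply]
    field_simp

/-- A loop through a point off the contour can be pushed off that point by a small diffeomorphism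
of the plane supported near the point. -/
lemma IsLoop.exists_not_mem_loopTrace (h : IsLoop γ μ σ) (hγ : IsContour α μ γ) (hz : z ∈ Dom μ)
    (hzγ : z ∉ γ) : ∃ σ', IsLoop γ μ σ' ∧ z ∉ loopTrace σ' := by
  -- by symmetry it suffices to treat points of the upper half plane
  wlog hp : 0 < z.im generalizing z with H
  · obtain ⟨σ', h1, h2⟩ := H (conj_mem_Dom.2 hz) (fun h' => hzγ (hγ.conj_mem.1 h'))
      (by simpa using lt_of_le_of_ne (not_lt.1 hp) hz.1)
    exact ⟨σ', h1, fun h' => h2 (mem_loopTrace_conj.2 h')⟩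
  have hop : IsOpen ((Dom μ ∩ {w : ℂ | 0 < w.im}) ∩ γᶜ) :=
    ((isOpen_Dom μ).inter (isOpen_lt continuous_const continuous_im)).inter hγ.isOpen_compl
  obtain ⟨R, hR, hball⟩ := isOpen_iff.1 hop z ⟨⟨hz, hp⟩, hzγ⟩
  set r := R / 2 with hr
  have hr0 : 0 < r := by positivity
  let β : ContDiffBump z := ⟨r / 2, r, by positivity, by linarith⟩
  have hβs : ∀ w, β w ≠ 0 → dist w z < r := fun w hw => by
    have : w ∈ Function.support β := hw
    rw [β.support_eq] at this
    exact this
  have hβ1 : ∀ w, ‖(β w : ℂ)‖ ≤ 1 := fun w => by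
    rw [Complex.norm_real, Real.norm_of_nonneg β.nonneg]
    exact β.le_one
  have hβc : ContDiff ℝ 1 β := β.contDiff
  obtain ⟨L, hL⟩ := hβc.lipschitzWith_of_hasCompactSupport β.hasCompactSupport one_ne_zero
  -- the displacement is small and such that the point `z - ε` is not on the loop
  obtain ⟨Λ, hΛ⟩ := h.nice.lip
  have hden := dense_compl_of_volume_eq_zero (volume_image_eq_zero hΛ)
  set δ := min (r / 2) (1 / (2 * ((L : ℝ) + 1))) with hδ
  have hδ0 : 0 < δ := by positivity
  obtain ⟨y, hy, hyz⟩ := hden.exists_mem_open isOpen_ball ⟨z, mem_ball_self hδ0⟩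
  set ε : ℂ := z - y with hε
  have hεδ : ‖ε‖ < δ := by
    rw [mem_ball, dist_comm, Complex.dist_eq] at hyz
    exact hyz
  have hεr : ‖ε‖ < r / 2 := by simp_all
  have hεL : ‖ε‖ * L ≤ 1 / 2 := by
    have h1 : ‖ε‖ ≤ 1 / (2 * ((L : ℝ) + 1)) := hεδ.le.trans (min_le_right _ _)
    rw [le_div_iff₀ (by positivity)] at h1
    nlinarith [norm_nonneg ε]
  set θ : ℂ → ℂ := fun w => w + ε * (β w : ℂ) with hθ
  have hθm : ∀ w, ‖θ w - w‖ < r / 2 := fun w => by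
    simp only [hθ, add_sub_cancel_left, norm_mul]
    exact lt_of_le_of_lt (mul_le_of_le_one_right (norm_nonneg _) (hβ1 w)) hεr
  have hθo : ∀ w, θ w = w ∨ dist w z < r := fun w => by
    by_cases hw : β w = 0
    · simp_all
    · simp_all
  have hθi : Function.Injective θ := by
    intro v w hvw
    have h1 : v - w = ε * ((β w : ℂ) - β v) := by
      simp only [hθ] at hvw
      linear_combination hvw
    have h2 : ‖v - w‖ ≤ ‖ε‖ * (L * ‖v - w‖) := by
      conv_lhs => rw [h1]
      rw [norm_mul, ← ofReal_sub, Complex.norm_real, ← norm_sub_rev (β v)]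
      gcongr
      exact hL.norm_sub_le v w
    have h3 : ‖v - w‖ ≤ 1 / 2 * ‖v - w‖ := h2.trans (by rw [← mul_assoc]; gcongr)
    have h4 : ‖v - w‖ = 0 := le_antisymm (by linarith) (norm_nonneg _)
    exact sub_eq_zero.1 (norm_eq_zero.1 h4)
  have hθc : ContDiff ℝ 1 θ := contDiff_id.add (contDiff_const.mul (ofRealCLM.contDiff.comp hβc))
  have hθd : ∀ w v : ℂ, v ≠ 0 → fderiv ℝ θ w v ≠ 0 := by
    intro w v hv e
    have h1 := ((hβc.differentiable one_ne_zero) w).hasFDerivAt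
    have h2 : HasFDerivAt θ (ContinuousLinearMap.id ℝ ℂ + ε • (ofRealCLM.comp (fderiv ℝ β w))) w :=
      (hasFDerivAt_id w).add ((ofRealCLM.hasFDerivAt.comp w h1).const_mul ε)
    rw [h2.fderiv] at e
    simp only [add_apply, ContinuousLinearMap.id_apply, smul_apply,
      ContinuousLinearMap.comp_apply, ofRealCLM_apply, smul_eq_mul] at e
    have h3 : ‖v‖ ≤ ‖ε‖ * (L * ‖v‖) := by
      conv_lhs => rw [eq_neg_of_add_eq_zero_left e]
      rw [norm_neg, norm_mul, Complex.norm_real]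
      gcongr
      exact (fderiv ℝ β w).le_of_opNorm_le (norm_fderiv_le_of_lipschitz ℝ hL) v
    have h4 : ‖v‖ ≤ 1 / 2 * ‖v‖ := h3.trans (by rw [← mul_assoc]; gcongr)
    exact hv (norm_eq_zero.1 (le_antisymm (by linarith) (norm_nonneg _)))
  have hfar : ∀ w, w ∉ ((Dom μ ∩ {w : ℂ | 0 < w.im}) ∩ γᶜ) → R ≤ dist w z := fun w hw => by
    by_contra hcon
    exact hw (hball (not_le.1 hcon))
  have hhalf : θ ((μ : ℂ) / 2) = (μ : ℂ) / 2 := by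
    refine (hθo _).resolve_right fun h' => ?_
    have := hfar ((μ : ℂ) / 2) (fun h'' => by simpa using h''.1.2)
    linarith
  have hmem : ∀ w ∈ ((Dom μ ∩ {w : ℂ | 0 < w.im}) ∩ γᶜ),
      θ w ∈ ((Dom μ ∩ {w : ℂ | 0 < w.im}) ∩ γᶜ) := by
    intro w hw
    rcases hθo w with e | e
    · rwa [e]
    · refine hball ?_
      have h1 := hθm w
      rw [← Complex.dist_eq] at h1
      exact mem_ball.2 (lt_of_le_of_lt (dist_triangle _ w _) (by linarith))
  have hmemσ : ∀ s ∈ Ioo 0 1, σ s ∈ ((Dom μ ∩ {w : ℂ | 0 < w.im}) ∩ γᶜ) := fun s hs =>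
    ⟨⟨(h.2.2.2.2.1 s hs).2.1, (h.2.2.2.2.1 s hs).1⟩, (h.2.2.2.2.1 s hs).2.2⟩
  have hreg : IsPiecewiseRegular (fun s => θ (σ s)) := by
    obtain ⟨n, p, h0, h1, hp⟩ := h.1
    refine ⟨n, p, h0, h1, fun i hi => ⟨(hp i hi).1, hθc.comp_contDiffOn (hp i hi).2.1,
      fun s hs => ?_⟩⟩
    have e1 := (((hp i hi).2.1.differentiableOn one_ne_zero) s hs).hasDerivWithinAt
    have e2 := ((hθc.differentiable one_ne_zero) (σ s)).hasFDerivAt.comp_hasDerivWithinAt s e1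
    have e3 := e2.derivWithin (uniqueDiffOn_Icc (hp i hi).1 s hs)
    have e4 : derivWithin (fun s => θ (σ s)) (Icc (p i) (p (i + 1))) s = _ := e3
    rw [e4]
    exact hθd _ _ ((hp i hi).2.2 s hs)
  refine ⟨fun s => θ (σ s), ⟨hreg, ?_, ?_, ?_, ?_, ?_⟩, ?_⟩
  · simp only [h.2.1, hhalf]
  · simp only [h.2.2.1, hhalf]
  · intro s hs u hu hsu
    exact h.2.2.2.1 hs hu (hθi hsu)
  · simp_all
  · intro w hw hwp
    have hwR : R ≤ dist w z := by simp_all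
    have hwn : ∀ s ∈ Icc 0 1, σ s ≠ w ∧ θ (σ s) ≠ w := by
      intro s hs
      rcases h.mem_Icc hs with e | ⟨g1, g2, g3⟩
      · have : (μ : ℂ) / 2 ≠ w := by
          rintro rfl
          simp at hwp
        rw [e, hhalf]
        exact ⟨this, this⟩
      · exact ⟨fun e => g3 (e ▸ hw), fun e => (hmem _ ⟨⟨g2, g1⟩, g3⟩).2 (e ▸ hw)⟩
    rw [← h.2.2.2.2.2 w hw hwp]
    congr 1
    refine hreg.niceCurve.curveInt_inv_eq_of_ratio h.nice ?_ ?_ ?_ ?_ ?_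
    · simp only [h.2.1, hhalf]
    · simp only [h.2.2.1, hhalf]
    · simp_all
    · simp_all
    · intro s hs
      have hn : σ s - w ≠ 0 := _root_.sub_ne_zero.2 (hwn s hs).1
      have e : (θ (σ s) - w) / (σ s - w) = 1 + (θ (σ s) - σ s) / (σ s - w) := by
        field_simp
        ring
      rw [e]
      refine mem_slitPlane_of_norm_lt_one ?_
      rw [norm_div, div_lt_one (norm_pos_iff.2 hn)]
      rcases hθo (σ s) with e' | e'
      · rw [e', sub_self, norm_zero]
        exact norm_pos_iff.2 hn
      · have h1 := hθm (σ s)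
        have h2 := dist_triangle w (σ s) z
        rw [dist_comm w (σ s), Complex.dist_eq (σ s) w] at h2
        linarith
  · have hzn : ∀ s ∈ Icc 0 1, θ (σ s) ≠ z := by
      intro s hs e
      have hyβ : β y = 1 := β.one_of_mem_closedBall (by
        rw [mem_closedBall, dist_comm, Complex.dist_eq]
        exact hεr.le)
      have h1 : θ y = z := by simp_all
      exact hy ⟨s, hs, hθi (e.trans h1.symm)⟩
    rintro (⟨s, hs, e⟩ | ⟨s, hs, e⟩)
    · simp_all
    · have hs' : 1 - s ∈ Icc 0 1 := ⟨by linarith [hs.2], by linarith [hs.1]⟩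
      have e1 := congrArg Complex.im e
      simp only [mirror, conj_im] at e1
      have h2 : 0 ≤ (θ (σ (1 - s))).im := by
        rcases h.mem_Icc hs' with g | ⟨g1, g2, g3⟩
        · rw [g, hhalf]; simp
        · exact (hmem _ ⟨⟨g2, g1⟩, g3⟩).1.2.le
      linarith

/-! ### The modulation equation -/

/-- Some loop around `γ`. -/
def loopOf (γ : Set ℂ) (μ : ℝ) : ℝ → ℂ := Classical.epsilon (IsLoop γ μ)

lemma IsLoop.loopOf (h : IsLoop γ μ σ) : IsLoop γ μ (loopOf γ μ) := Classical.epsilon_spec ⟨σ, h⟩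

namespace BaseContour

/-- The admissible parameters `(m, a)` for which there is a loop around the contour. -/
def good (D : BaseContour) : Set (ℝ × ℂ) :=
  {q | D.Adm (q.2 - q.1 / 2) q.1 ∧ ∃ σ, IsLoop (D.fam q.2 q.1) q.1 σ}

/-- The function `K` as a function of the pair `(m, a)`. -/
def modulus (D : BaseContour) (x t : ℝ) (q : ℝ × ℂ) : ℂ :=
  modK x t q.1 (D.fam q.2 q.1) q.2 (loopOf (D.fam q.2 q.1) q.1)

variable {D : BaseContour}

lemma isTameContour_of_mem_good {a : ℂ} (h : (m, a) ∈ D.good) : IsTameContour a m (D.fam a m) := by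
  have := h.1.isTameContour
  rwa [sub_add_cancel] at this

lemma pos_of_mem_good {a : ℂ} (h : (m, a) ∈ D.good) : 0 < m := h.1.pos

lemma modulus_eq {a : ℂ} (h : (m, a) ∈ D.good) (x t : ℝ) (hσ : IsLoop (D.fam a m) m σ) :
    modK x t m (D.fam a m) a σ = D.modulus x t (m, a) :=
  hσ.modK_eq (pos_of_mem_good h) hσ.loopOf (isTameContour_of_mem_good h) x t

/-- A loop for one parameter, moved with the point `m/2`, is a loop for all nearby parameters. -/
lemma eventually_isLoop_translate {m₁ : ℝ} {a₁ : ℂ} (h : (m₁, a₁) ∈ D.good)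
    (hσ : IsLoop (D.fam a₁ m₁) m₁ (fun s => m₁ / 2 + c s)) :
    ∀ᶠ q : ℝ × ℂ in 𝓝 (m₁, a₁), q ∈ D.good ∧
      IsLoop (D.fam q.2 q.1) q.1 (fun s => q.1 / 2 + c s) := by
  have hc : ContinuousAt (fun q : ℝ × ℂ => (q.2 - q.1 / 2, q.1)) (m₁, a₁) := by fun_prop
  have h1 : D.Adm (a₁ - m₁ / 2) m₁ := h.1
  filter_upwards [hc.eventually h1.eventually,
    hc.eventually (h1.loop_eventually (c := c) (by rwa [sub_add_cancel]))] with q e1 e2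
  simp only [sub_add_cancel] at e2
  exact ⟨⟨e1, _, e2⟩, e2⟩

lemma exists_translate (σ : ℝ → ℂ) (m : ℝ) : ∃ c : ℝ → ℂ, σ = fun s => m / 2 + c s :=
  ⟨fun s => σ s - m / 2, by simp⟩

lemma isOpen_good : IsOpen D.good := by
  refine isOpen_iff_mem_nhds.2 fun ⟨m, a⟩ h => ?_
  obtain ⟨σ, hσ⟩ := h.2
  obtain ⟨c, rfl⟩ := exists_translate σ m
  filter_upwards [eventually_isLoop_translate h hσ] with q hq using hq.1

/-- The function `K` is `C¹` in both parameters, and its derivatives are integrals over an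
arbitrary loop. -/
lemma contDiffAt_modulus {a : ℂ} (h : (m, a) ∈ D.good) (x t : ℝ) (hσ : IsLoop (D.fam a m) m σ) :
    ContDiffAt ℝ 1 (D.modulus x t) (m, a) ∧ fderiv ℝ (D.modulus x t) (m, a) (1, 0) = (2 * π * I)⁻¹ *
        loopInt σ (fun ζ => fMu x t m ζ / ((ζ - a) * radical (D.fam a m) a ζ)) ∧
      (D.modulus x t (m, a) = 0 → ∀ v, fderiv ℝ (D.modulus x t) (m, a) (0, v) =
        v * ((2 * π * I)⁻¹ * loopInt σ (fun ζ => fPrime x t m ζ /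
          ((ζ - a) * radical (D.fam a m) a ζ)))) := by
  obtain ⟨c, rfl⟩ := exists_translate σ m
  have hev := eventually_isLoop_translate h hσ
  have hK := modulus_eq h x t hσ
  rw [modK_eq_cauchyE] at hK
  have hT := isTameContour_of_mem_good h
  have ha := (hσ.end_not_mem hT.contour).1
  have hA := h.1
  simp only at hA
  obtain ⟨b, rfl⟩ : ∃ b, a = b + m / 2 := ⟨a - m / 2, by ring⟩
  rw [add_sub_cancel_right] at hA
  have hc : m / 2 + b = b + m / 2 := add_comm _ _
  have hb : m / 2 + b ∉ loopTrace (fun s => m / 2 + c s) := by rwa [hc]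
  obtain ⟨d, -⟩ := hA.relE_contDiffAt hσ x t hb
  set Λ₀ : ℝ × ℂ →L[ℝ] ℂ := ContinuousLinearMap.snd ℝ ℝ ℂ -
    (1 / 2 : ℝ) • ofRealCLM.comp (ContinuousLinearMap.fst ℝ ℝ ℂ) with hΛ₀
  have hΛ₀a : ∀ q : ℝ × ℂ, Λ₀ q = q.2 - q.1 / 2 := by
    intro q
    change q.2 - (1 / 2 : ℝ) • (q.1 : ℂ) = _
    rw [real_smul]
    push_cast
    ring
  set Λ : ℝ × ℂ →L[ℝ] ℂ × ℂ × ℝ := Λ₀.prod (Λ₀.prod (ContinuousLinearMap.fst ℝ ℝ ℂ)) with hΛ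
  have hΛa : ∀ q : ℝ × ℂ, Λ q = (q.2 - q.1 / 2, q.2 - q.1 / 2, q.1) := by simp_all
  have hΛb : Λ (m, b + m / 2) = (b, b, m) := by simp_all
  have heq : D.modulus x t =ᶠ[𝓝 (m, b + m / 2)] fun q => D.relE x t c (Λ q) := by
    filter_upwards [hev] with q hq
    rw [← modulus_eq hq.1 x t hq.2, modK_eq_cauchyE, hΛa, relE]
    simp only [sub_add_cancel, add_sub_cancel]
  have d1 : ContDiffAt ℝ 1 (fun q => D.relE x t c (Λ q)) (m, b + m / 2) :=
    ContDiffAt.comp (g := D.relE x t c) (f := Λ) _ (by rwa [hΛb]) Λ.contDiff.contDiffAt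
  have d2 : HasFDerivAt (D.relE x t c) (fderiv ℝ (D.relE x t c) (b, b, m))
      (Λ (m, b + m / 2)) := by
    rw [hΛb]
    exact (d.differentiableAt one_ne_zero).hasFDerivAt
  have d3 : ∀ v, fderiv ℝ (D.modulus x t) (m, b + m / 2) v =
      fderiv ℝ (D.relE x t c) (b, b, m) (Λ v) := by
    intro v
    have e : fderiv ℝ (fun q => D.relE x t c (Λ q)) (m, b + m / 2) = _ :=
      (d2.comp (m, b + m / 2) Λ.hasFDerivAt).fderiv
    rw [heq.fderiv_eq, e]
    rfl
  refine ⟨d1.congr_of_eventuallyEq heq, ?_, fun h0 v => ?_⟩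
  · have := hA.fderiv_relE_mu hσ x t hb
    rw [hc] at this
    rw [d3, hΛa, ← this]
    congr 1
    ext <;> simp
  · rw [h0] at hK
    rw [d3, hΛa, ← hA.fderiv_relE_end hσ x t hK]
    simp

/-- If `K = 0`, the limit of `h' / R` at the end point is the derivative of `K` with respect to the
end point: near it `h = R E` with the Cauchy integral `E`, where `E(a) = K = 0` and `E'(a)` is two
thirds of that derivative. -/
lemma tendsto_deriv_div_radical {a : ℂ} (hg : (m, a) ∈ D.good) {x t : ℝ}
    (hσ : IsLoop (D.fam a m) m σ) (h0 : D.modulus x t (m, a) = 0) {h : ℂ → ℂ}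
    (hh : SolvesRHP x t m (D.fam a m) a h) :
    Tendsto (fun z => deriv h z / radical (D.fam a m) a z) (𝓝[Dom m \ D.fam a m] a)
      (𝓝 ((2 * π * I)⁻¹ * loopInt σ (fun ζ => fPrime x t m ζ /
          ((ζ - a) * radical (D.fam a m) a ζ)))) := by
  obtain ⟨c, rfl⟩ := exists_translate σ m
  have hT := isTameContour_of_mem_good hg
  have hm := pos_of_mem_good hg
  have ha := (hσ.end_not_mem hT.contour).1
  have hK := modulus_eq hg x t hσ
  rw [modK_eq_cauchyE, h0] at hK
  have hE : HasDerivAt (cauchyE x t m (D.fam a m) a (fun s => m / 2 + c s))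
      (2 / 3 * ((2 * π * I)⁻¹ * loopInt (fun s => m / 2 + c s)
        (fun ζ => fPrime x t m ζ / ((ζ - a) * radical (D.fam a m) a ζ)))) a := by
    have h1 : D.Adm (a - m / 2) m := hg.1
    have := h1.hasDerivAt_cauchyE (c := c) (by rwa [sub_add_cancel]) x t (by rwa [sub_add_cancel])
    rwa [sub_add_cancel] at this
  set σ := fun s => m / 2 + c s with hσdef
  set J := (2 * π * I)⁻¹ * loopInt σ (fun ζ => fPrime x t m ζ /
    ((ζ - a) * radical (D.fam a m) a ζ)) with hJ
  set E := cauchyE x t m (D.fam a m) a σ with hEdef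
  set R := radical (D.fam a m) a with hR
  have hP := hT.contour.1
  have hop := hT.contour.isOpen_Dom_diff
  have haγ := hT.contour.left_mem
  have hap : a ≠ m / 2 := by
    rintro rfl
    simp at hP
  -- near the end point `h = R E`
  have e1 : ∀ᶠ z in 𝓝 a, z ∉ D.fam a m → solH x t m (D.fam a m) a σ z = R z * E z :=
    hσ.solH_eventually hm hT x t haγ hap
  have hu := SolvesRHP.unique hT.contour (hσ.solvesRHP hm hT x t) hh
  have e2 : ∀ᶠ z in 𝓝 a, z ∉ loopTrace σ :=
    hσ.nice.isCompact_loopTrace.isClosed.isOpen_compl.mem_nhds ha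
  have hac : a - conj a ≠ 0 := by
    intro e
    have := congrArg Complex.im e
    simp at this
    linarith
  have e3 : ∀ᶠ z in 𝓝 a, z - conj a ≠ 0 := by
    have : ContinuousAt (fun z => z - conj a) a := by fun_prop
    exact this.eventually_ne hac
  have hform : ∀ᶠ z in 𝓝[Dom m \ D.fam a m] a, deriv h z / R z =
      E z / (z - a) / 2 + E z * (1 / (2 * (z - conj a))) + deriv E z := by
    filter_upwards [mem_nhdsWithin_of_mem_nhds e1.eventually_nhds, mem_nhdsWithin_of_mem_nhds e2,
      mem_nhdsWithin_of_mem_nhds e3, self_mem_nhdsWithin] with z g1 g2 g3 g4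
    have g5 : h =ᶠ[𝓝 z] fun z => R z * E z := by
      filter_upwards [g1, hop.mem_nhds g4] with w hw hw'
      rw [hu hw', hw hw'.2]
    have g6 := (hT.contour.hasDerivAt_radical g4.2).mul
      (hσ.continuousAt_cauchyE hm hT x t g2).hasDerivAt
    have g7 : deriv h z = _ := g5.deriv_eq.trans g6.deriv
    have hRz := hT.contour.isRadical.ne_zero hT.contour g4.2
    have hza : z - a ≠ 0 := fun e => g4.2 (by rwa [sub_eq_zero.1 e])
    rw [g7]
    simp only [hR, hEdef]
    field_simp
  have hslope : Tendsto (fun z => E z / (z - a)) (𝓝[Dom m \ D.fam a m] a) (𝓝 (2 / 3 * J)) := by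
    have h1 := hasDerivAt_iff_tendsto_slope.1 hE
    have h2 : 𝓝[Dom m \ D.fam a m] a ≤ 𝓝[≠] a := nhdsWithin_mono _ fun z hz e => hz.2 (by
      rw [mem_singleton_iff.1 e]; exact haγ)
    refine (h1.mono_left h2).congr fun z => ?_
    rw [slope_def_field, hK, sub_zero]
  have hd : DifferentiableOn ℂ E (loopTrace σ)ᶜ := hσ.differentiableOn_cauchyE hm hT x t
  have hE' : Tendsto (deriv E) (𝓝[Dom m \ D.fam a m] a) (𝓝 (2 / 3 * J)) := by
    have h1 := ((hd.deriv hσ.nice.isCompact_loopTrace.isClosed.isOpen_compl).differentiableAt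
      e2).continuousAt.tendsto
    rw [hE.deriv] at h1
    exact h1.mono_left nhdsWithin_le_nhds
  have hmid : Tendsto (fun z => E z * (1 / (2 * (z - conj a))))
      (𝓝[Dom m \ D.fam a m] a) (𝓝 0) := by
    have h1 : ContinuousAt (fun z => E z * (1 / (2 * (z - conj a)))) a := by
      refine hE.continuousAt.mul (ContinuousAt.div (by fun_prop) (by fun_prop) ?_)
      exact mul_ne_zero two_ne_zero hac
    have h2 := h1.tendsto
    simp only [hK, zero_mul] at h2
    exact h2.mono_left nhdsWithin_le_nhds
  have := ((hslope.div_const 2).add hmid).add hE'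
  rw [show 2 / 3 * J / 2 + 0 + 2 / 3 * J = J by ring] at this
  exact this.congr' (hform.mono fun z hz => hz.symm)

end BaseContour

/-! ### Solving the modulation equation -/

/-- The implicit function theorem for one complex equation, with a real parameter. -/
lemma exists_implicit {F : ℝ × ℂ → ℂ} {m₀ : ℝ} {a₀ J : ℂ} (hF : ContDiffAt ℝ 1 F (m₀, a₀))
    (h0 : F (m₀, a₀) = 0) (hJ : ∀ v, fderiv ℝ F (m₀, a₀) (0, v) = v * J) (hJ0 : J ≠ 0)
    {N : Set (ℝ × ℂ)} (hN : N ∈ 𝓝 (m₀, a₀)) :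
    ∃ (I : Set ℝ) (U : Set ℂ) (α : ℝ → ℂ), IsOpen I ∧ m₀ ∈ I ∧ IsOpen U ∧ a₀ ∈ U ∧
      I ×ˢ U ⊆ N ∧ α m₀ = a₀ ∧ (∀ m ∈ I, α m ∈ U ∧ ∀ a ∈ U, F (m, a) = 0 ↔ a = α m) ∧
      ContDiffOn ℝ 1 α I ∧ ∀ m ∈ I, fderiv ℝ F (m, α m) (0, 1) ≠ 0 := by
  have hinv : (fderiv ℝ F (m₀, a₀) ∘L .inr ℝ ℝ ℂ).IsInvertible := by
    refine ⟨(ContinuousLinearEquiv.unitsEquivAut ℂ (Units.mk0 J hJ0)).restrictScalars ℝ, ?_⟩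
    refine ContinuousLinearMap.ext fun v => ?_
    simp [hJ]
  have h1 := hF.eventually_apply_eq_iff_implicitFunction one_ne_zero hinv
  have h2 := hF.contDiffAt_implicitFunction one_ne_zero hinv
  have h3 := hF.implicitFunction_apply_self one_ne_zero hinv
  set α := hF.implicitFunction one_ne_zero hinv with hα
  rw [h0] at h1
  simp only at h2 h3
  have h4 : ∀ᶠ m in 𝓝 m₀, ContDiffAt ℝ 1 α m := h2.eventually (by simp)
  have hF' : ContinuousAt (fun q => fderiv ℝ F q (0, 1)) (m₀, a₀) :=
    (hF.continuousAt_fderiv one_ne_zero).clm_apply continuousAt_const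
  have h5 : ∀ᶠ q in 𝓝 (m₀, a₀), fderiv ℝ F q (0, 1) ≠ 0 :=
    hF'.eventually_ne (by rw [hJ, one_mul]; exact hJ0)
  obtain ⟨A, hA, U, hU, hAU⟩ := mem_nhds_prod_iff.1 (Filter.inter_mem hN (h1.and h5))
  have hU' := interior_mem_nhds.2 hU
  have h6 : ∀ᶠ m in 𝓝 m₀, α m ∈ interior U := h2.continuousAt (by rwa [h3])
  obtain ⟨I, hI, hIo, hmI⟩ := _root_.eventually_nhds_iff.1 ((h4.and h6).and hA)
  have hsub : ∀ m ∈ I, ∀ a ∈ interior U, (m, a) ∈ N ∩ {q | (F q = 0 ↔ α q.1 = q.2) ∧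
      fderiv ℝ F q (0, 1) ≠ 0} := fun m hm a ha => hAU ⟨(hI m hm).2, interior_subset ha⟩
  refine ⟨I, interior U, α, hIo, hmI, isOpen_interior, mem_of_mem_nhds hU', ?_, h3, ?_, ?_, ?_⟩
  · grind
  · grind
  · exact fun m hm => (hI m hm).1.1.contDiffWithinAt
  · simp_all

/-- The derivative of an implicit function. -/
lemma hasDerivAt_implicit {F : ℝ × ℂ → ℂ} {α : ℝ → ℂ} {J : ℂ} (hF : DifferentiableAt ℝ F (m, α m))
    (hα : DifferentiableAt ℝ α m) (h0 : ∀ᶠ s in 𝓝 m, F (s, α s) = 0)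
    (hJ : ∀ v, fderiv ℝ F (m, α m) (0, v) = v * J) (hJ0 : J ≠ 0) :
    HasDerivAt α (-fderiv ℝ F (m, α m) (1, 0) / J) m := by
  have h1 : HasDerivAt (fun s => F (s, α s)) (fderiv ℝ F (m, α m) (1, deriv α m)) m :=
    hF.hasFDerivAt.comp_hasDerivAt_of_eq m ((hasDerivAt_id m).prodMk hα.hasDerivAt) rfl
  have h2 : HasDerivAt (fun s => F (s, α s)) 0 m :=
    (hasDerivAt_const m (0 : ℂ)).congr_of_eventuallyEq h0
  have h3 := h1.unique h2
  have e : ((1, deriv α m) : ℝ × ℂ) = (1, 0) + (0, deriv α m) := by simp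
  rw [e, map_add, hJ] at h3
  refine hα.hasDerivAt.congr_deriv ?_
  rw [eq_div_iff hJ0]
  linear_combination h3

/-! ### The dependence of the solution on the parameter -/

lemma continuousAt_fMu_param (x t : ℝ) (hm : 0 < m) (h : z ∈ Dom m) :
    ContinuousAt (fun m : ℝ => fMu x t m z) m := by
  have key : ∀ z : ℂ, 0 < z.im → z ∈ Dom m → ContinuousAt (fun m : ℝ => fMu x t m z) m := by
    intro z hz h
    have hU : UpperReg m z := ⟨h.2, Or.inl hz⟩
    have e : (fun m : ℝ => fMu x t m z) =ᶠ[𝓝 m] fun m : ℝ =>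
        log (I * (m / 2 - z)) / 2 + fMuReg m z := by
      have hc : ContinuousAt (fun m : ℝ => (z, m)) m := by fun_prop
      filter_upwards [lt_mem_nhds hm, hc.eventually (isOpen_setOf_mem_Dom.mem_nhds h)]
        with m' h1 h2 using fMu_upper x t h1 hz h2
    refine ContinuousAt.congr ?_ e.symm
    refine ContinuousAt.add (ContinuousAt.div_const (ContinuousAt.clog (by fun_prop) ?_) _) ?_
    · exact Or.inl (by simpa using hz)
    · exact ContinuousAt.comp (g := fun q : ℂ × ℝ => fMuReg q.2 q.1) (f := fun m : ℝ => (z, m))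
        (continuousAt_fMuReg hm hU) (by fun_prop)
  rcases h.1.lt_or_gt with h1 | h1
  · have := key (conj z) (by simpa using h1) (conj_mem_Dom.2 h)
    simp only [fMu_conj h.1] at this
    simpa [Function.comp_def] using continuous_conj.continuousAt.comp this
  · simp_all

lemma contDiffAt_f_param (x t : ℝ) (hm : 0 < m) (h : z ∈ Dom m) :
    ContDiffAt ℝ 1 (fun m : ℝ => f x t m z) m ∧
      HasDerivAt (fun m : ℝ => f x t m z) (fMu x t m z) m := by
  have hd : ∀ m : ℝ, 0 < m → z ∈ Dom m → HasDerivAt (fun m : ℝ => f x t m z) (fMu x t m z) m := by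
    intro m hm h
    simpa using hasDerivAt_f_param x t hm h 0 0 z (by simp)
  refine ⟨?_, hd m hm h⟩
  have hc : ContinuousAt (fun m : ℝ => (z, m)) m := by fun_prop
  obtain ⟨V, hV, hVo, hmV⟩ := _root_.eventually_nhds_iff.1
    ((lt_mem_nhds hm).and (hc.eventually (isOpen_setOf_mem_Dom.mem_nhds h)))
  refine ContDiffOn.contDiffAt (s := V) ?_ (hVo.mem_nhds hmV)
  refine (contDiffOn_one_iff_derivWithin hVo.uniqueDiffOn).2 ⟨fun s hs =>
    (hd s (hV s hs).1 (hV s hs).2).differentiableAt.differentiableWithinAt, ?_⟩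
  refine ContinuousOn.congr (f := fun m => fMu x t m z) (fun s hs => ?_) fun s hs =>
    derivWithin_of_isOpen hVo hs
  exact (continuousAt_fMu_param x t (hV s hs).1 (hV s hs).2).continuousWithinAt

lemma mirror_const_add (σ : ℝ → ℂ) (d : ℝ) :
    mirror (fun s => (d : ℂ) + σ s) = fun s => (d : ℂ) + mirror σ s := by
  funext s
  simp [mirror]

lemma mem_loopTrace_const_add {d : ℝ} :
    z ∈ loopTrace (fun s => (d : ℂ) + σ s) ↔ z - d ∈ loopTrace σ := by
  have e : ∀ c : ℝ → ℂ, ∀ s, (d : ℂ) + c s = z ↔ c s = z - d := by grind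
  unfold loopTrace
  rw [mirror_const_add]
  simp only [mem_union, mem_image, e]

lemma loopWind_const_add (σ : ℝ → ℂ) (d : ℝ) (z : ℂ) :
    loopWind (fun s => (d : ℂ) + σ s) z = loopWind σ (z - d) := by
  unfold loopWind loopInt
  rw [mirror_const_add, curveInt_const_add, curveInt_const_add]
  simp only [show ∀ ζ : ℂ, (d : ℂ) + ζ - z = ζ - (z - d) from fun ζ => by ring]

/-- Winding numbers are unchanged when the loop is translated by a small amount. -/
lemma IsLoop.loopWind_translate (hσ : IsLoop γ m (fun s => m / 2 + c s))
    (hz : z ∉ loopTrace (fun s => m / 2 + c s)) :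
    ∀ᶠ m' : ℝ in 𝓝 m, z ∉ loopTrace (fun s => m' / 2 + c s) ∧
      loopWind (fun s => m' / 2 + c s) z = loopWind (fun s => m / 2 + c s) z := by
  have hc : ContinuousAt (fun m' : ℝ => z - (((m' - m) / 2 : ℝ) : ℂ)) m := by fun_prop
  have h1 := hσ.nice.loopWind_eventuallyEq hσ.closed (z := z - (((m - m) / 2 : ℝ) : ℂ)) (by simpa)
  filter_upwards [hc.eventually h1] with m' hm'
  have e : (fun s => m' / 2 + c s) = fun s => (((m' - m) / 2 : ℝ) : ℂ) + (m / 2 + c s) := by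
    funext s
    push_cast
    ring
  rw [e, mem_loopTrace_const_add, loopWind_const_add]
  exact ⟨hm'.1, by simpa using hm'.2⟩

namespace BaseContour

/-- The solution of the Riemann-Hilbert problem for the end points `α(m)`. -/
def sol (D : BaseContour) (x t : ℝ) (α : ℝ → ℂ) (z : ℂ) (m : ℝ) : ℂ :=
  solH x t m (D.fam (α m) m) (α m) (loopOf (D.fam (α m) m) m) z

variable {D : BaseContour}

lemma solvesRHP_sol {α : ℝ → ℂ} (hg : (m, α m) ∈ D.good) (x t : ℝ) :
    SolvesRHP x t m (D.fam (α m) m) (α m) (fun z => D.sol x t α z m) := by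
  obtain ⟨σ, hσ⟩ := hg.2
  exact hσ.loopOf.solvesRHP (pos_of_mem_good hg) (isTameContour_of_mem_good hg) x t

lemma sol_eq {α : ℝ → ℂ} (hg : (m, α m) ∈ D.good) (x t : ℝ) (hσ : IsLoop (D.fam (α m) m) m σ)
    (hz : z ∈ Dom m \ D.fam (α m) m) : D.sol x t α z m = solH x t m (D.fam (α m) m) (α m) σ z :=
  SolvesRHP.unique (isTameContour_of_mem_good hg).contour
    (hσ.solvesRHP (pos_of_mem_good hg) (isTameContour_of_mem_good hg) x t)
    (solvesRHP_sol hg x t) hz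

lemma eventually_mem_Dom_diff_fam {a : ℂ} (hg : (m, a) ∈ D.good) (hz : z ∈ Dom m \ D.fam a m) :
    ∀ᶠ q : ℂ × ℝ × ℂ in 𝓝 (z, m, a), q.1 ∈ Dom q.2.1 \ D.fam q.2.2 q.2.1 := by
  have h1 : ContinuousAt (fun q : ℂ × ℝ × ℂ => (q.1, q.2.1)) (z, m, a) := by fun_prop
  have h2 : ContinuousAt (fun q : ℂ × ℝ × ℂ =>
      (q.2.2 - q.2.1 / 2, q.1 - q.2.1 / 2)) (z, m, a) := by fun_prop
  filter_upwards [h1.eventually (isOpen_setOf_mem_Dom.mem_nhds hz.1),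
    h2.eventually (undo_not_mem_eventually hg.1.near hz.2)] with q e1 e2 using ⟨e1, e2⟩

/-- The solution is `C¹` in the parameter.  In its derivative the terms which come from the motion
of the end points cancel, since the singular parts of the derivatives of the radical and of the
Cauchy integral do. -/
lemma sol_contDiffAt {α : ℝ → ℂ} (hα : ContDiffAt ℝ 1 α m) (hg : (m, α m) ∈ D.good) {x t : ℝ}
    (hK : D.modulus x t (m, α m) = 0) (hz : z ∈ Dom m \ D.fam (α m) m)
    (hσ : IsLoop (D.fam (α m) m) m σ) (hzσ : z ∉ loopTrace σ) :
    ContDiffAt ℝ 1 (D.sol x t α z) m ∧ HasDerivAt (D.sol x t α z)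
      (radical (D.fam (α m) m) (α m) z * ((2 * π * I)⁻¹ *
        loopInt σ (fun ζ => fMu x t m ζ / ((ζ - z) * radical (D.fam (α m) m) (α m) ζ))) -
        (loopWind σ z + 1) * fMu x t m z) m := by
  obtain ⟨c, rfl⟩ := exists_translate σ m
  have hm := pos_of_mem_good hg
  have hA : D.Adm (α m - m / 2) m := hg.1
  have hT := isTameContour_of_mem_good hg
  have hun : D.undo (α m - m / 2) (z - m / 2) ∉ D.S := hz.2
  set n := loopWind (fun s => m / 2 + c s) z with hn
  set b : ℝ → ℂ := fun s => α s - s / 2 with hb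
  set u : ℝ → ℂ := fun s => D.rad (b s) (z - s / 2) with hu
  set κ : ℝ → ℂ × ℂ × ℝ := fun s => (z - s / 2, b s, s) with hκ
  have hbm : b m + m / 2 = α m := sub_add_cancel _ _
  have hzm : ∀ s : ℝ, s / 2 + (z - s / 2) = z := fun s => by ring
  have hid : ContDiffAt ℝ 1 (fun s : ℝ => (s : ℂ) / 2) m :=
    ofRealCLM.contDiff.contDiffAt.div_const 2
  have hidd : HasDerivAt (fun s : ℝ => (s : ℂ) / 2) (1 / 2) m :=
    (ofRealCLM.hasDerivAt (x := m)).div_const 2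
  have hbc : ContDiffAt ℝ 1 b m := hα.sub hid
  have hαd := (hα.differentiableAt one_ne_zero).hasDerivAt
  have hαc := hα.continuousAt
  -- the representation of the solution by the loop `c`, for all nearby parameters
  have hpair : ContinuousAt (fun s : ℝ => (s, α s)) m := by fun_prop
  have htrip : ContinuousAt (fun s : ℝ => (z, s, α s)) m := by fun_prop
  have heq : D.sol x t α z =ᶠ[𝓝 m] fun s =>
      u s * D.relE x t c (κ s) - (n + 1) * f x t s z := by
    filter_upwards [hpair.eventually (eventually_isLoop_translate hg hσ),
      htrip.eventually (eventually_mem_Dom_diff_fam hg hz), hσ.loopWind_translate hzσ]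
      with s h1 h2 h3
    have hAs : D.Adm (α s - s / 2) s := h1.1.1
    have hr := hAs.radical_fam (y := z - s / 2) h2.2
    rw [sub_add_cancel, hzm] at hr
    rw [sol_eq h1.1 x t h1.2 h2, h1.2.solH_eq (pos_of_mem_good h1.1)
      (isTameContour_of_mem_good h1.1) x t h3.1 h2.2, h3.2, hr]
    simp only [hn, hu, hκ, hb, relE, sub_add_cancel, hzm]
  -- the radical
  have hP : ∀ s : ℝ, z - s / 2 - b s = z - α s := by simp_all
  have hP' : ∀ s : ℝ, z - s / 2 - conj (b s) = z - conj (α s) := by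
    intro s
    simp only [hb, map_sub, map_div₀, conj_ofReal, conj_ofNat]
    ring
  have hpc : ContinuousAt (fun s : ℝ => (b s, z - s / 2)) m := by fun_prop
  have hun' : D.undo (b m) (z - m / 2) ∉ D.S := hun
  have huc : ContinuousAt u m := ContinuousAt.comp_of_eq (g := fun q : ℂ × ℂ => D.rad q.1 q.2)
      (f := fun s : ℝ => (b s, z - s / 2)) (continuousAt_rad hA.near hun') hpc rfl
  have husq : ∀ᶠ s in 𝓝 m, u s ^ 2 = (z - α s) * (z - conj (α s)) := by
    filter_upwards [hbc.continuousAt.eventually (near_eventually (D := D) (b := b m) hA.near),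
      hpc.eventually (undo_not_mem_eventually (D := D) (b := b m) hA.near hun')] with s h1 h2
    simp only [hu]
    rw [rad_sq h1 h2, hP, hP']
  have hu0 : u m ≠ 0 := rad_ne_zero hun'
  have hcj : ContDiff ℝ 1 (conj) := conjCLE.contDiff
  have hPc : ContDiffAt ℝ 1 (fun s => (z - α s) * (z - conj (α s))) m := by fun_prop
  have hPd : HasDerivAt (fun s => (z - α s) * (z - conj (α s)))
      (-deriv α m * (z - conj (α m)) + (z - α m) * -conj (deriv α m)) m :=
    (hαd.const_sub z).mul (HasDerivAt.const_sub z hαd.star)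
  have hud := (hasFDerivAt_of_sq_eq huc hPd.hasFDerivAt hu0 husq).hasDerivAt
  have hucd := contDiffAt_of_sq_eq huc hPc hu0 husq
  -- the Cauchy integral
  have hσ' : IsLoop (D.fam (b m + m / 2) m) m (fun s => m / 2 + c s) := by rwa [hbm]
  have hzσ' : m / 2 + (z - m / 2) ∉ loopTrace (fun s => m / 2 + c s) := by rwa [hzm]
  have hzγ' : m / 2 + (z - m / 2) ∉ D.fam (b m + m / 2) m := by simp_all
  have hA' : D.Adm (b m) m := hA
  obtain ⟨hE, -⟩ := hA'.relE_contDiffAt hσ' x t hzσ'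
  have hκc : ContDiffAt ℝ 1 κ m := by fun_prop
  have hκd : HasDerivAt κ (-(1 / 2), deriv α m - 1 / 2, 1) m :=
    (hidd.const_sub z).prodMk ((hαd.sub hidd).prodMk (hasDerivAt_id m))
  have hEc : ContDiffAt ℝ 1 (fun s => D.relE x t c (κ s)) m := by fun_prop
  have hEd : HasDerivAt (fun s => D.relE x t c (κ s)) _ m :=
    (hE.differentiableAt one_ne_zero).hasFDerivAt.comp_hasDerivAt_of_eq m hκd rfl
  have hK' : cauchyE x t m (D.fam (b m + m / 2) m) (b m + m / 2)
      (fun s => m / 2 + c s) (b m + m / 2) = 0 := by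
    rw [hbm, ← modK_eq_cauchyE, modulus_eq hg x t hσ, hK]
  have e : ((-(1 / 2), deriv α m - 1 / 2, 1) : ℂ × ℂ × ℝ) =
      (-(1 / 2), -(1 / 2), 1) + (0, deriv α m, 0) := by
    ext <;> simp; ring
  rw [e, map_add, hA'.fderiv_relE_mu hσ' x t hzσ', hA'.fderiv_relE_off hσ' x t hK' hzσ' hzγ',
    hbm, hzm, hP, hP'] at hEd
  obtain ⟨hfc, hfd⟩ := contDiffAt_f_param x t hm hz.1
  refine ⟨((hucd.mul hEc).sub (contDiffAt_const.mul hfc)).congr_of_eventuallyEq heq, ?_⟩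
  refine (((hud.mul hEd).sub (hfd.const_mul (n + 1))).congr_of_eventuallyEq heq).congr_deriv ?_
  have hR : radical (D.fam (α m) m) (α m) z = u m := by
    have hr := hA.radical_fam hun
    rwa [sub_add_cancel, hzm] at hr
  rw [hR]
  have hsq := husq.self_of_nhds
  have hne : (z - α m) * (z - conj (α m)) ≠ 0 := by grind
  have hne1 := left_ne_zero_of_mul hne
  have hne2 := right_ne_zero_of_mul hne
  generalize loopInt _ _ = M
  generalize D.relE x t c (κ m) = E
  have e2 : ((2 * u m)⁻¹ • ContinuousLinearMap.toSpanSingleton ℝ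
      (-deriv α m * (z - conj (α m)) + (z - α m) * -conj (deriv α m)) :
        ℝ →L[ℝ] ℂ) 1 = -(u m * (deriv α m / (2 * (z - α m)) +
        conj (deriv α m) / (2 * (z - conj (α m))))) := by
    simp only [smul_apply, ContinuousLinearMap.toSpanSingleton_apply, one_smul, smul_eq_mul]
    field_simp
    rw [hsq]
    ring
  rw [e2]
  ring

end BaseContour

end GenusZero

end

open Complex GenusZero GenusZero.BaseContour
open scoped Real

theorem mainTheorem9 (x t μ₀ : ℝ) (hμ₀ : 0 < μ₀) (α₀ : ℂ) (γ₀ : Set ℂ)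
    (hγ₀ : GenusZero.IsContour α₀ μ₀ γ₀)
    (σ₀ : ℝ → ℂ) (hσ₀ : GenusZero.IsLoop γ₀ μ₀ σ₀)
    (hK₀ : GenusZero.modK x t μ₀ γ₀ α₀ σ₀ = 0)
    (h₀ : ℂ → ℂ) (hh₀ : GenusZero.SolvesRHP x t μ₀ γ₀ α₀ h₀)
    -- `h'/R ≠ 0` at every point of `γ₀`, where `h'/R` is understood through its limits
    (hne : ∀ w ∈ γ₀, ¬ Tendsto (fun z => deriv h₀ z / GenusZero.radical γ₀ α₀ z)
      (𝓝[GenusZero.Dom μ₀ \ γ₀] w) (𝓝 0)) :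
    ∃ (I : Set ℝ) (U : Set ℂ) (γ : ℂ → ℝ → Set ℂ) (K : ℂ → ℝ → ℂ) (α : ℝ → ℂ) (h : ℂ → ℝ → ℂ),
      -- open neighbourhoods of `μ₀` and `α₀`, and contours for all parameters in them
      IsOpen I ∧ μ₀ ∈ I ∧ I ⊆ Ioi 0 ∧ IsOpen U ∧ α₀ ∈ U ∧ γ α₀ μ₀ = γ₀ ∧
      (∀ a ∈ U, ∀ μ ∈ I, GenusZero.IsContour a μ (γ a μ) ∧
        (∃ σ, GenusZero.IsLoop (γ a μ) μ σ) ∧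
        ∀ σ, GenusZero.IsLoop (γ a μ) μ σ → GenusZero.modK x t μ (γ a μ) a σ = K a μ) ∧
      -- the equation `K(α, μ) = 0` has the unique solution `α(μ)`, which is `C¹`
      α μ₀ = α₀ ∧ (∀ μ ∈ I, α μ ∈ U ∧ ∀ a ∈ U, K a μ = 0 ↔ a = α μ) ∧ ContDiffOn ℝ 1 α I ∧
      -- `h(z, μ)` is the unique solution of the Riemann-Hilbert problem, and it is `C¹` in `μ`
      (∀ μ ∈ I, GenusZero.SolvesRHP x t μ (γ (α μ) μ) (α μ) (fun z => h z μ) ∧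
        ∀ k : ℂ → ℂ, GenusZero.SolvesRHP x t μ (γ (α μ) μ) (α μ) k →
          EqOn k (fun z => h z μ) (GenusZero.Dom μ \ γ (α μ) μ)) ∧
      IsOpen {q : ℂ × ℝ | q.2 ∈ I ∧ q.1 ∈ GenusZero.Dom q.2 \ γ (α q.2) q.2} ∧
      (∀ z : ℂ, ContDiffOn ℝ 1 (fun μ => h z μ)
        {μ : ℝ | μ ∈ I ∧ z ∈ GenusZero.Dom μ \ γ (α μ) μ}) ∧
      -- the formulas for the derivatives, for every loop `γ̂` around `γ(α(μ), μ)`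
      ∀ μ ∈ I, ∀ σ, GenusZero.IsLoop (γ (α μ) μ) μ σ →
        GenusZero.LoopIntegrable σ (fun ζ => GenusZero.fMu x t μ ζ /
          ((ζ - α μ) * GenusZero.radical (γ (α μ) μ) (α μ) ζ)) ∧
        HasDerivAt (fun m : ℝ => K (α μ) m)
          ((2 * Real.pi * Complex.I)⁻¹ * GenusZero.loopInt σ (fun ζ => GenusZero.fMu x t μ ζ /
            ((ζ - α μ) * GenusZero.radical (γ (α μ) μ) (α μ) ζ))) μ ∧
        GenusZero.LoopIntegrable σ (fun ζ => GenusZero.fPrime x t μ ζ /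
          ((ζ - α μ) * GenusZero.radical (γ (α μ) μ) (α μ) ζ)) ∧
        GenusZero.loopInt σ (fun ζ => GenusZero.fPrime x t μ ζ /
          ((ζ - α μ) * GenusZero.radical (γ (α μ) μ) (α μ) ζ)) ≠ 0 ∧
        HasDerivAt α
          (-(2 * Real.pi * Complex.I * deriv (fun m : ℝ => K (α μ) m) μ) /
            GenusZero.loopInt σ (fun ζ => GenusZero.fPrime x t μ ζ /
              ((ζ - α μ) * GenusZero.radical (γ (α μ) μ) (α μ) ζ))) μ ∧
        ∀ z ∈ GenusZero.inside σ \ γ (α μ) μ,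
          z ∈ GenusZero.Dom μ ∧
          GenusZero.LoopIntegrable σ (fun ζ => GenusZero.fMu x t μ ζ /
            ((ζ - z) * GenusZero.radical (γ (α μ) μ) (α μ) ζ)) ∧
          HasDerivAt (fun m : ℝ => h z m)
            (GenusZero.radical (γ (α μ) μ) (α μ) z * ((2 * Real.pi * Complex.I)⁻¹ *
              GenusZero.loopInt σ (fun ζ => GenusZero.fMu x t μ ζ /
                ((ζ - z) * GenusZero.radical (γ (α μ) μ) (α μ) ζ)))) μ := by
  obtain ⟨⟨hp, hm, ⟨Φ, hΦ, -⟩, -⟩, -⟩ := id hh₀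
  have hT₀ : IsTameContour α₀ μ₀ γ₀ := ⟨hγ₀, Φ, hΦ⟩
  set D : BaseContour := ⟨α₀, μ₀, γ₀, hμ₀, hT₀⟩ with hD
  have hfam : D.fam α₀ μ₀ = γ₀ := D.fam_base
  have hgood : (μ₀, α₀) ∈ D.good := by
    refine ⟨adm_base, σ₀, ?_⟩
    simp only [hfam]
    exact hσ₀
  rw [← hfam] at hσ₀ hK₀ hh₀ hne
  have hγα : α₀ ∈ γ₀ := hγ₀.left_mem
  have hK : D.modulus x t (μ₀, α₀) = 0 := by
    rw [← modulus_eq hgood x t hσ₀, hK₀]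
  obtain ⟨hc, -, hv⟩ := contDiffAt_modulus hgood x t hσ₀
  have hlim := tendsto_deriv_div_radical hgood hσ₀ hK hh₀
  -- the derivative of `K` with respect to `α` is the limit of `h'/R` at the end point
  have hJ : (2 * π * I)⁻¹ * loopInt σ₀ (fun ζ => fPrime x t μ₀ ζ /
      ((ζ - α₀) * radical (D.fam α₀ μ₀) α₀ ζ)) ≠ 0 := fun e =>
    hne α₀ (by rwa [hfam]) (by rwa [e] at hlim)
  obtain ⟨I, U, α, hI, hμI, hU, hαU, hIU, hα₀, hα, hαc, hnz⟩ :=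
    exists_implicit hc hK (hv hK) hJ (isOpen_good.mem_nhds hgood)
  have hg : ∀ μ ∈ I, (μ, α μ) ∈ D.good := fun μ hμ => hIU ⟨hμ, (hα μ hμ).1⟩
  have hK0 : ∀ μ ∈ I, D.modulus x t (μ, α μ) = 0 := fun μ hμ =>
    ((hα μ hμ).2 _ (hα μ hμ).1).2 rfl
  have hαat : ∀ μ ∈ I, ContDiffAt ℝ 1 α μ := fun μ hμ => hαc.contDiffAt (hI.mem_nhds hμ)
  have hTα : ∀ μ ∈ I, IsTameContour (α μ) μ (D.fam (α μ) μ) := fun μ hμ =>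
    isTameContour_of_mem_good (hg μ hμ)
  refine ⟨I, U, D.fam, fun a μ => D.modulus x t (μ, a), α, fun z μ => D.sol x t α z μ, hI, hμI,
    fun μ hμ => pos_of_mem_good (hg μ hμ), hU, hαU, hfam, ?_, hα₀, hα, hαc,
    ?_, ?_, ?_, ?_⟩
  · intro a ha μ hμ
    have h1 : (μ, a) ∈ D.good := hIU ⟨hμ, ha⟩
    exact ⟨(isTameContour_of_mem_good h1).contour, h1.2,
      fun σ hσ => modulus_eq h1 x t hσ⟩
  · intro μ hμ
    have h1 := solvesRHP_sol (hg μ hμ) x t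
    exact ⟨h1, fun k hk => SolvesRHP.unique (hTα μ hμ).contour h1 hk⟩
  · refine isOpen_iff_mem_nhds.2 fun ⟨z, μ⟩ ⟨hμ, hz⟩ => ?_
    have h1 : ContinuousAt (fun q : ℂ × ℝ => (q.1, q.2, α q.2)) (z, μ) :=
      continuousAt_fst.prodMk (continuousAt_snd.prodMk
        (ContinuousAt.comp_of_eq (hαat μ hμ).continuousAt continuousAt_snd rfl))
    filter_upwards [(continuous_snd.tendsto (z, μ)).eventually (hI.mem_nhds hμ),
      h1.eventually (eventually_mem_Dom_diff_fam (hg μ hμ) hz)]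
      with q e1 e2 using ⟨e1, e2⟩
  · rintro z μ ⟨hμ, hz⟩
    obtain ⟨σ, hσ⟩ := (hg μ hμ).2
    obtain ⟨σ', h1, h2⟩ := hσ.exists_not_mem_loopTrace (hTα μ hμ).contour hz.1 hz.2
    exact (sol_contDiffAt (hαat μ hμ) (hg μ hμ) (hK0 μ hμ) hz h1
      h2).1.contDiffWithinAt
  · intro μ hμ σ hσ
    have hpos := pos_of_mem_good (hg μ hμ)
    have hend := (hσ.end_not_mem (hTα μ hμ).contour).1
    obtain ⟨d, e1, e2⟩ := contDiffAt_modulus (hg μ hμ) x t hσ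
    have e3 := e2 (hK0 μ hμ)
    have hnz' := hnz μ hμ
    rw [e3, one_mul] at hnz'
    have hd := d.differentiableAt one_ne_zero
    have hKμ : HasDerivAt (fun m : ℝ => D.modulus x t (m, α μ)) _ μ :=
      hd.hasFDerivAt.comp_hasDerivAt_of_eq μ ((hasDerivAt_id μ).prodMk (hasDerivAt_const μ _)) rfl
    rw [e1] at hKμ
    refine ⟨hσ.loopIntegrable_fMu hpos (hTα μ hμ) x t hend, hKμ,
      hσ.loopIntegrable_fPrime hpos (hTα μ hμ) x t hend, right_ne_zero_of_mul hnz', ?_, ?_⟩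
    · have h0 : ∀ᶠ s in 𝓝 μ, D.modulus x t (s, α s) = 0 := by
        filter_upwards [hI.mem_nhds hμ] with s hs using hK0 s hs
      refine (hasDerivAt_implicit hd ((hαat μ hμ).differentiableAt one_ne_zero) h0 e3
        hnz').congr_deriv ?_
      rw [hKμ.deriv, e1]
      have h2 := two_pi_I_ne_zero
      have h3 := right_ne_zero_of_mul hnz'
      field_simp
    · rintro z ⟨hz, hzγ⟩
      obtain ⟨hzD, hzσ, hzn⟩ := hσ.inside_subset hpos hz
      refine ⟨hzD, hσ.loopIntegrable_fMu hpos (hTα μ hμ) x t hzσ, ?_⟩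
      refine (sol_contDiffAt (hαat μ hμ) (hg μ hμ) (hK0 μ hμ) ⟨hzD, hzγ⟩ hσ
        hzσ).2.congr_deriv ?_
      rw [hzn]
      ring
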